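/- **Setting.** Let $T>0$, $\mathbf f\in L^2((0,T)\times\mathbb R^3;\mathbb R^3)$, and let the initial data satisfy $\rho_0\ge 0$ a.e., $\rho_0\in L^\infty(\mathbb R^3)$, $\mathbf m_0\in L^2(\mathbb R^3;\mathbb R^3)$, $\mathbf m_0=0$ a.e. on $\{\rho_0=0\}$, $|\mathbf m_0|^2/\rho_0\in L^1(\mathbb R^3)$ (with $0/0=0$), and $\rho_0^{-1/2}\,1_{\{0<\rho_0<\delta_0\}}\in L^2(\mathbb R^3)$ for some $\delta_0>0$. For $\mu>0$, a *weak solution* on $[0,T]$ of $$\rho_t+\operatorname{div}(\rho\mathbf u)=0,\quad (\rho\mathbf u)_t+\operatorname{div}(\rho\mathbf u\otimes\mathbf u)+\nabla p-\mu\Delta\mathbf u=\rho\mathbf f,\quad \operatorname{div}\mathbf u=0,\quad (\rho,\rho\mathbf u)|_{t=0}=(\rho_0,\mathbf m_0),\quad \mathbf u\to0\ (|\mathbf x|\to\infty)$$ is a pair of measurable $(\rho,\mathbf u)$ with $\rho\ge0$ such that * $\rho\in C([0,T];L^p(\mathbb R^3))$ for all $1\le p<\infty$, $\sqrt\rho\,\mathbf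 u\in L^\infty(0,T;L^2(\mathbb R^3))$, $\mathbf u\in L^2(0,T;L^6(\mathbb R^3))$ with weak gradient $\nabla\mathbf u\in L^2((0,T)\times\mathbb R^3)$ (this expresses $\mathbf u\to0$ at infinity), and $\operatorname{div}\mathbf u=0$; * $\int_0^T\!\int(\rho\phi_t+\rho\mathbf u\cdot\nabla\phi)\,d\mathbf x\,dt+\int\rho_0\phi(0)\,d\mathbf x=0$ for all $\phi\in C_c^\infty([0,T)\times\mathbb R^3)$; * $\int_0^T\!\int(\rho\mathbf u\cdot\boldsymbol\phi_t+\rho\mathbf u\otimes\mathbf u:\nabla\boldsymbol\phi+\rho\mathbf f\cdot\boldsymbol\phi)\,d\mathbf x\,dt+\int\mathbf m_0\cdot\boldsymbol\phi(0)\,d\mathbf x=\mu\int_0^T\!\int\nabla\mathbf u:\nabla\boldsymbol\phi\,d\mathbf x\,dt$ for all $\boldsymbol\phi\in C_c^\infty([0,T)\times\mathbb R^3;\mathbb R^3)$ with $\operatorname{div}\boldsymbol\phi=0$; * for a.e. $t\in(0,T)$, $\int\tfrac12\rho|\mathbf u|^2(t)\,d\mathbf x+\mu\int_0^t\!\int|\nabla\mathbf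 u|^2\,d\mathbf x\,ds\le\int\tfrac{|\mathbf m_0|^2}{2\rho_0}\,d\mathbf x+\int_0^t\!\int\rho\mathbf u\cdot\mathbf f\,d\mathbf x\,ds$. **Proposition.** Let $\mu_n>0$, $\mu_n\to0$, and for each $n$ let $(\rho^{\mu_n},\mathbf u^{\mu_n})$ be a weak solution with viscosity $\mu_n$ and the same $\mathbf f,\rho_0,\mathbf m_0$. Write $\widehat{g}(\mathbf k)=(2\pi)^{-3}\int g(\mathbf x)e^{-i\mathbf k\cdot\mathbf x}\,d\mathbf x$ and assume (RICKHw): there are $\beta>0$, $C_T>0$ and $k_*>0$, independent of $n$, with $$\sup_{k\ge k_*}\ k^{3+\beta}\int_0^T\!\int_{S^2}\bigl|\widehat{\sqrt{\rho^{\mu_n}}\mathbf u^{\mu_n}}(t,k\sigma)\bigr|^2\,k^2\,d\sigma\,dt\le C_T\qquad\text{for all }n .$$ Then there are a subsequence (not relabelled) and $\rho\ge0$, $\mathbf u$ on $(0,T)\times\mathbb R^3$ such that $\rho\in L^p((0,T)\times\mathbb R^3)$ and $\rho^{\mu_n}\rightharpoonup\rho$ weakly in $L^p((0,T)\times\mathbb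 R^3)$ for all $1<p<\infty$, $\sqrt\rho\,\mathbf u\in L^2((0,T)\times\mathbb R^3)$, and $$\sqrt{\rho^{\mu_n}}\,\mathbf u^{\mu_n}\to\sqrt\rho\,\mathbf u\quad\text{strongly in }L^2((0,T)\times\mathbb R^3)\text{ as }\mu_n\to0 .$$ -/

import Mathlib

open MeasureTheory Set Filter Topology
open scoped ENNReal NNReal ContDiff

namespace InhomNS

noncomputable section

/-- Physical space `ℝ³` with its Euclidean norm. -/
abbrev E3 : Type := EuclideanSpace ℝ (Fin 3)

/-- The `j`-th standard basis vector. -/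
def basisVec (j : Fin 3) : E3 := EuclideanSpace.single j (1 : ℝ)

/-- Lebesgue measure on `(0,T) × ℝ³`. -/
def slab (T : ℝ) : Measure (ℝ × E3) :=
  (volume.restrict (Ioo (0 : ℝ) T)).prod volume

/-- The weighted velocity `√ρ u`. -/
def weightedVel (ρ : ℝ → E3 → ℝ) (u : ℝ → E3 → E3) (t : ℝ) (x : E3) : E3 :=
  Real.sqrt (ρ t x) • u t x

/-- The divergence in space of a smooth vector field `v`. -/
def divx (v : E3 → E3) (x : E3) : ℝ :=
  ∑ i, fderiv ℝ v x (basisVec i) i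

/-- The partial derivative `∂_j v` of a smooth vector field `v`. -/
def partialx (v : E3 → E3) (j : Fin 3) (x : E3) : E3 :=
  fderiv ℝ v x (basisVec j)

/-- `φ` is a smooth function on space-time with compact support inside `I × ℝ³`.
For `I = (-∞, T)` the restrictions to `t ≥ 0` are the elements of `C_c^∞([0,T) × ℝ³)`;
for `I = (0, T)` one gets `C_c^∞((0,T) × ℝ³)`. -/
structure IsTest {F : Type*} [NormedAddCommGroup F] [NormedSpace ℝ F]
    (I : Set ℝ) (φ : ℝ → E3 → F) : Prop where
  smooth : ContDiff ℝ ∞ (Function.uncurry φ)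
  compact : HasCompactSupport (Function.uncurry φ)
  supp : tsupport (Function.uncurry φ) ⊆ I ×ˢ univ

/-- `G` is the weak gradient in space of `u` on `(0,T) × ℝ³`: `G j = ∂_j u`. -/
def IsWeakGrad (T : ℝ) (u : ℝ → E3 → E3) (G : Fin 3 → ℝ → E3 → E3) : Prop :=
  ∀ ψ : ℝ → E3 → ℝ, IsTest (Ioo 0 T) ψ → ∀ i j : Fin 3,
    ∫ z, u z.1 z.2 i * fderiv ℝ (ψ z.1) z.2 (basisVec j) ∂(slab T)
      = - ∫ z, G j z.1 z.2 i * ψ z.1 z.2 ∂(slab T)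

/-- The conditions on the initial density and momentum.  The quotient in `energy` is `0 / 0 = 0`
on the vacuum set, where `m₀` vanishes; the function `1/√ρ₀` in `nondeg` is looked at on
`{0 < ρ₀ < δ₀}` only. -/
structure InitialData (ρ₀ : E3 → ℝ) (m₀ : E3 → E3) : Prop where
  nonneg : ∀ᵐ x, 0 ≤ ρ₀ x
  bounded : MemLp ρ₀ ⊤ volume
  momentum : MemLp m₀ 2 volume
  vacuum : ∀ᵐ x, ρ₀ x = 0 → m₀ x = 0
  energy : Integrable (fun x => ‖m₀ x‖ ^ 2 / ρ₀ x) volume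
  nondeg : ∃ δ₀ : ℝ, 0 < δ₀ ∧
    MemLp ({x | 0 < ρ₀ x ∧ ρ₀ x < δ₀}.indicator fun x => 1 / Real.sqrt (ρ₀ x)) 2 volume

/-- Weak solutions `(ρ,u)` on `[0,T]` of the inhomogeneous incompressible Navier-Stokes equations
with viscosity `μ`, force `f`, initial data `(ρ₀, m₀)` and `u → 0` at infinity. -/
structure IsWeakSolution (T μ : ℝ) (f : ℝ → E3 → E3) (ρ₀ : E3 → ℝ) (m₀ : E3 → E3)
    (ρ : ℝ → E3 → ℝ) (u : ℝ → E3 → E3) : Prop where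
  density_meas : AEStronglyMeasurable (Function.uncurry ρ) (slab T)
  velocity_meas : AEStronglyMeasurable (Function.uncurry u) (slab T)
  density_nonneg : ∀ᵐ z ∂(slab T), 0 ≤ ρ z.1 z.2
  /-- `ρ ∈ C([0,T]; L^p(ℝ³))` for all `1 ≤ p < ∞`. -/
  density_cont : ∀ p : ENNReal, 1 ≤ p → p ≠ ⊤ →
    (∀ t ∈ Icc 0 T, MemLp (ρ t) p volume) ∧
    ∀ s ∈ Icc 0 T,
      Tendsto (fun t => eLpNorm (ρ t - ρ s) p volume) (𝓝[Icc 0 T] s) (𝓝 0)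
  /-- `√ρ u ∈ L^∞(0,T; L²(ℝ³))`. -/
  weighted_bound : ∃ C : ℝ≥0, ∀ᵐ t ∂(volume.restrict (Ioo 0 T)),
    eLpNorm (weightedVel ρ u t) 2 volume ≤ C
  /-- `u ∈ L²(0,T; L⁶(ℝ³))`: with `∇u ∈ L²` this is `u ∈ L²(0,T; D^{1,2}(ℝ³))`, the standard
  weak form of the condition `u → 0` at infinity. -/
  velocity_decay : ∫⁻ t in Ioo 0 T, eLpNorm (u t) 6 volume ^ 2 < ⊤
  /-- The equation of mass. -/
  mass : ∀ φ : ℝ → E3 → ℝ, IsTest (Iio T) φ →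
    (∫ z, (ρ z.1 z.2 * deriv (fun s => φ s z.2) z.1
        + ρ z.1 z.2 * fderiv ℝ (φ z.1) z.2 (u z.1 z.2)) ∂(slab T))
      + (∫ x, ρ₀ x * φ 0 x) = 0
  /-- The weak gradient `G = ∇u ∈ L²((0,T) × ℝ³)`, the condition `div u = 0`, the equation of
  momentum and the energy inequality. -/
  momentum_energy : ∃ G : Fin 3 → ℝ → E3 → E3,
    (∀ j, MemLp (Function.uncurry (G j)) 2 (slab T)) ∧
    IsWeakGrad T u G ∧
    (∀ᵐ z ∂(slab T), ∑ i, G i z.1 z.2 i = 0) ∧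
    (∀ φ : ℝ → E3 → E3, IsTest (Iio T) φ → (∀ t x, divx (φ t) x = 0) →
      (∫ z, (ρ z.1 z.2 * inner ℝ (u z.1 z.2) (deriv (fun s => φ s z.2) z.1)
          + ρ z.1 z.2 * inner ℝ (u z.1 z.2) (fderiv ℝ (φ z.1) z.2 (u z.1 z.2))
          + ρ z.1 z.2 * inner ℝ (f z.1 z.2) (φ z.1 z.2)) ∂(slab T))
        + (∫ x, inner ℝ (m₀ x) (φ 0 x))
        = ∫ z, μ * ∑ j, inner ℝ (G j z.1 z.2) (partialx (φ z.1) j z.2) ∂(slab T)) ∧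
    (∀ᵐ t ∂(volume.restrict (Ioo 0 T)),
      (∫ x, ρ t x * ‖u t x‖ ^ 2 / 2)
        + (∫ z, μ * ∑ j, ‖G j z.1 z.2‖ ^ 2 ∂(slab t))
        ≤ (∫ x, ‖m₀ x‖ ^ 2 / (2 * ρ₀ x))
          + (∫ z, ρ z.1 z.2 * inner ℝ (u z.1 z.2) (f z.1 z.2) ∂(slab t)))

/-- The `i`-th component of the Fourier transform
`ĝ(k) = (2π)⁻³ ∫ g(x) e^{-i k·x} dx` of a vector field `g`. -/
def fourierComp (g : E3 → E3) (k : E3) (i : Fin 3) : ℂ :=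
  ((1 / (2 * Real.pi) ^ 3 : ℝ) : ℂ) *
    ∫ x, (g x i : ℂ) * Complex.exp (-(Complex.I * ((inner ℝ k x : ℝ) : ℂ)))

/-- `∫₀ᵀ ∫_{S²} |ŵ(t, kσ)|² k² dσ dt`, where `dσ = sin φ dθ dφ` is the surface measure of the unit
sphere. -/
def shellEnergy (T : ℝ) (w : ℝ → E3 → E3) (k : ℝ) : ℝ≥0∞ :=
  ∫⁻ t in Ioo 0 T, ∫⁻ σ : Metric.sphere (0 : E3) 1,
    (∑ i, ‖fourierComp (w t) (k • (σ : E3)) i‖ₑ ^ 2) * ENNReal.ofReal (k ^ 2)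
      ∂(volume : Measure E3).toSphere

/-- Assumption (RICKHw) on `(0,T)` for a sequence of weighted velocities: the constants `β`, `C`
and `kstar` do not depend on the index, that is, on the viscosity. -/
def RICKHw (T : ℝ) (w : ℕ → ℝ → E3 → E3) : Prop :=
  ∃ β C kstar : ℝ, 0 < β ∧ 0 < C ∧ 0 < kstar ∧ ∀ n : ℕ, ∀ k : ℝ, kstar ≤ k →
    ENNReal.ofReal (k ^ (3 + β)) * shellEnergy T (w n) k ≤ ENNReal.ofReal C

/-- `a n` converges weakly to `b` in `L^p((0,T) × ℝ³)` for every `1 < p < ∞`. -/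
def WeakLpConv (T : ℝ) (a : ℕ → ℝ → E3 → ℝ) (b : ℝ → E3 → ℝ) : Prop :=
  ∀ p q : ℝ, p.HolderConjugate q →
    MemLp (Function.uncurry b) (ENNReal.ofReal p) (slab T) ∧
    ∀ g : ℝ × E3 → ℝ, MemLp g (ENNReal.ofReal q) (slab T) →
      Tendsto (fun n => ∫ z, a n z.1 z.2 * g z ∂(slab T)) atTop
        (𝓝 (∫ z, b z.1 z.2 * g z ∂(slab T)))

end

end InhomNS

open MeasureTheory Set Filter Topology
open scoped ENNReal NNReal ContDiff FourierTransform

namespace InhomNS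

noncomputable section

/-! ### One-dimensional tools -/

lemma ContDiff.absCont {f : ℝ → ℝ} (hf : ContDiff ℝ 1 f) (a b : ℝ) :
    AbsolutelyContinuousOnInterval f a b :=
  hf.contDiffOn.absolutelyContinuousOnInterval

/-- A `C¹` function of an absolutely continuous function is absolutely continuous. -/
lemma AbsCont.comp_contDiff {β g : ℝ → ℝ} (hβ : ContDiff ℝ 1 β) {a b : ℝ}
    (hg : AbsolutelyContinuousOnInterval g a b) :
    AbsolutelyContinuousOnInterval (fun t => β (g t)) a b := by
  obtain ⟨C, hC⟩ := hg.exists_bound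
  have hlip : ∃ K : ℝ≥0, LipschitzOnWith K β (Icc (-C) C) := by
    have hcpt : IsCompact (Icc (-C) C) := isCompact_Icc
    obtain ⟨K, hK⟩ := hcpt.exists_bound_of_continuousOn
      (f := deriv β) (hβ.continuous_deriv le_rfl).continuousOn
    refine ⟨Real.toNNReal K, ?_⟩
    refine (convex_Icc _ _).lipschitzOnWith_of_nnnorm_deriv_le
      (fun x _ => (hβ.differentiable one_ne_zero) x) (fun x hx => ?_)
    rw [← NNReal.coe_le_coe]
    exact (hK x hx).trans (Real.le_coe_toNNReal K)
  obtain ⟨K, hK⟩ := hlip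
  rw [absolutelyContinuousOnInterval_iff] at hg ⊢
  intro ε hε
  obtain ⟨δ, hδ, h⟩ := hg (ε / (K + 1)) (by positivity)
  refine ⟨δ, hδ, fun E hE hsum => ?_⟩
  have h1 := h E hE hsum
  have hmem : ∀ x ∈ uIcc a b, g x ∈ Icc (-C) C := fun x hx => abs_le.1 (hC x hx)
  have h2 : ∑ i ∈ Finset.range E.1, dist (β (g (E.2 i).1)) (β (g (E.2 i).2))
      ≤ ∑ i ∈ Finset.range E.1, K * dist (g (E.2 i).1) (g (E.2 i).2) := by
    refine Finset.sum_le_sum fun i hi => ?_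
    have := hE.1 i (by simpa using hi)
    exact hK.dist_le_mul _ (hmem _ this.1) _ (hmem _ this.2)
  rw [← Finset.mul_sum] at h2
  have h3 : (0:ℝ) ≤ ∑ i ∈ Finset.range E.1, dist (g (E.2 i).1) (g (E.2 i).2) :=
    Finset.sum_nonneg fun _ _ => dist_nonneg
  rw [lt_div_iff₀ (by positivity)] at h1
  nlinarith [K.coe_nonneg]

lemma chain_rule_integral {β g a : ℝ → ℝ} (hβ : ContDiff ℝ 1 β) {T t : ℝ}
    (ht : t ∈ Icc 0 T) (ha : IntervalIntegrable a volume 0 T)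
    (hg : ∀ t ∈ Icc 0 T, g t = g 0 + ∫ τ in (0:ℝ)..t, a τ) :
    β (g t) - β (g 0) = ∫ τ in (0:ℝ)..t, deriv β (g τ) * a τ := by
  have h0T : (0:ℝ) ≤ T := ht.1.trans ht.2
  set G : ℝ → ℝ := fun t => g 0 + ∫ τ in (0:ℝ)..t, a τ with hG
  have hat : IntervalIntegrable a volume 0 t := ha.mono_set (by
    rw [uIcc_of_le ht.1, uIcc_of_le h0T]; exact Icc_subset_Icc le_rfl ht.2)
  have hGac : AbsolutelyContinuousOnInterval G 0 t := by
    have := hat.absolutelyContinuousOnInterval_intervalIntegral (c := 0) (by simp)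
    have h2 := (ContDiff.absCont (f := fun _ => g 0) contDiff_const 0 t).add this
    exact h2
  have hcomp := (AbsCont.comp_contDiff hβ hGac).integral_deriv_eq_sub
  have hsub : uIcc 0 t ⊆ Icc 0 T := by
    rw [uIcc_of_le ht.1]; exact Icc_subset_Icc le_rfl ht.2
  rw [hg t ht]
  have : G 0 = g 0 := by simp [hG]
  have e : β (G t) - β (G 0) = β (g 0 + ∫ τ in (0:ℝ)..t, a τ) - β (g 0) := by
    rw [this]
  rw [← e, ← hcomp]
  refine intervalIntegral.integral_congr_ae ?_
  filter_upwards [hat.ae_hasDerivAt_integral] with x hx hxm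
  have hx' := uIoc_subset_uIcc hxm
  have hd : HasDerivAt G (a x) x := (hx hx' 0 (by simp)).const_add (g 0)
  have := ((hβ.differentiable one_ne_zero (G x)).hasDerivAt).comp x hd
  rw [hg x (hsub hx')]
  exact this.deriv

lemma exists_cutoff (a b : ℝ) : ∃ χ : ℝ → ℝ, ContDiff ℝ ∞ χ ∧ HasCompactSupport χ ∧
    ∀ t ∈ Icc a b, χ t = 1 := by
  let c : ContDiffBump (0:ℝ) := ⟨|a| + |b| + 1, |a| + |b| + 2, by positivity, by linarith⟩
  refine ⟨c, c.contDiff, c.hasCompactSupport, fun t ht => c.one_of_mem_closedBall ?_⟩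
  simp only [Metric.mem_closedBall, dist_zero_right, Real.norm_eq_abs, c]
  rw [abs_le]
  have := neg_abs_le a; have := le_abs_self b; have := abs_nonneg a; have := abs_nonneg b
  constructor <;> linarith [ht.1, ht.2]

/-- A weak time derivative on `[0,T)` with initial value is a primitive. -/
lemma ae_eq_primitive {T : ℝ} (hT : 0 < T) {M g : ℝ → ℝ}
    (hM : IntegrableOn M (Ioo 0 T)) (hg : IntegrableOn g (Ioo 0 T)) (M0 : ℝ)
    (h : ∀ θ : ℝ → ℝ, ContDiff ℝ ∞ θ → HasCompactSupport θ → tsupport θ ⊆ Iio T →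
      (∫ t in Ioo 0 T, deriv θ t * M t) + (∫ t in Ioo 0 T, θ t * g t) + θ 0 * M0 = 0) :
    ∀ᵐ t ∂(volume.restrict (Ioo 0 T)), M t = M0 + ∫ τ in (0:ℝ)..t, g τ := by
  have hgI : IntervalIntegrable g volume 0 T := by
    rw [intervalIntegrable_iff_integrableOn_Ioo_of_le hT.le]; exact hg
  set G : ℝ → ℝ := fun t => M0 + ∫ τ in (0:ℝ)..t, g τ with hG
  have hGac : AbsolutelyContinuousOnInterval G 0 T := by
    have := hgI.absolutelyContinuousOnInterval_intervalIntegral (c := 0) (by simp)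
    exact (ContDiff.absCont (f := fun _ => M0) contDiff_const 0 T).add this
  have hGc : ContinuousOn G (Icc 0 T) := by simpa [uIcc_of_le hT.le] using hGac.continuousOn
  have hGint : IntegrableOn G (Ioo 0 T) :=
    (hGc.integrableOn_compact isCompact_Icc).mono_set Ioo_subset_Icc_self
  have hGd : ∀ᵐ t ∂volume, t ∈ uIoc 0 T → deriv G t = g t := by
    filter_upwards [hgI.ae_hasDerivAt_integral] with x hx hxm
    exact ((hx (uIoc_subset_uIcc hxm) 0 (by simp)).const_add M0).deriv
  have key := isOpen_Ioo.ae_eq_zero_of_integral_contDiff_smul_eq_zero (μ := volume)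
    (U := Ioo 0 T) (f := fun t => M t - G t) ((hM.sub hGint).locallyIntegrableOn) ?_
  · rw [ae_restrict_iff' measurableSet_Ioo]
    filter_upwards [key] with t ht htm
    have := ht htm
    simp only [hG] at this
    linarith
  intro ψ hψ hψc hψs
  set θ0 : ℝ → ℝ := fun t => ∫ τ in T..t, ψ τ with hθ0
  have hθ0d : ∀ t, HasDerivAt θ0 (ψ t) t := fun t =>
    (hψ.continuous).integral_hasStrictDerivAt T t |>.hasDerivAt
  have hθ0s : ContDiff ℝ ∞ θ0 := by
    have hd : deriv θ0 = ψ := funext fun t => (hθ0d t).deriv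
    rw [contDiff_infty_iff_deriv]
    exact ⟨fun t => (hθ0d t).differentiableAt, by rw [hd]; exact hψ⟩
  obtain ⟨χ, hχs, hχc, hχ1⟩ := exists_cutoff (-1) (T+1)
  have hχ1' : ∀ t ∈ Ioo (-1) (T+1), χ t = 1 := fun t ht => hχ1 t (Ioo_subset_Icc_self ht)
  set θ : ℝ → ℝ := fun t => χ t * θ0 t with hθ
  have hKc : IsCompact (tsupport ψ) := hψc
  obtain ⟨b, hb0, hbT, hb⟩ : ∃ b, 0 < b ∧ b < T ∧ ∀ t, b < t → ψ t = 0 := by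
    rcases (tsupport ψ).eq_empty_or_nonempty with he | hne
    · refine ⟨T/2, by linarith, by linarith, fun t _ => ?_⟩
      apply image_eq_zero_of_notMem_tsupport; rw [he]; simp
    · obtain ⟨b, hbm, hbmax⟩ := hKc.exists_isMaxOn hne continuous_id.continuousOn
      refine ⟨b, (hψs hbm).1, (hψs hbm).2, fun t ht => ?_⟩
      apply image_eq_zero_of_notMem_tsupport
      intro hm
      exact absurd (hbmax hm) (by simpa using ht)
  have hθ0z : ∀ t, b ≤ t → θ0 t = 0 := by
    intro t ht
    simp only [hθ0]
    apply intervalIntegral.integral_zero_ae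
    refine Eventually.of_forall fun x hx => hb x ?_
    rcases mem_uIoc.1 hx with h | h <;> linarith [h.1]
  have hθsupp : tsupport θ ⊆ Iio T := by
    have : Function.support θ ⊆ Iic b := by
      intro t ht
      by_contra hcon
      exact ht (by simp [hθ, hθ0z t (not_le.1 hcon).le])
    exact (closure_minimal this isClosed_Iic).trans fun t ht => lt_of_le_of_lt ht hbT
  have hθcs : HasCompactSupport θ := hχc.mul_right
  have hθsm : ContDiff ℝ ∞ θ := hχs.mul hθ0s
  have hθeq : ∀ t ∈ Ioo (-1:ℝ) (T+1), θ t = θ0 t := fun t ht => by simp [hθ, hχ1' t ht]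
  have hθd : ∀ t ∈ Ioo (0:ℝ) T, deriv θ t = ψ t := by
    intro t ht
    have : θ =ᶠ[𝓝 t] θ0 := by
      filter_upwards [Ioo_mem_nhds (show (-1:ℝ) < t by linarith [ht.1])
        (show t < T + 1 by linarith [ht.2])] with y hy using hθeq y hy
    rw [this.deriv_eq, (hθ0d t).deriv]
  have hmain := h θ hθsm hθcs hθsupp
  have e1 : ∫ t in Ioo 0 T, deriv θ t * M t = ∫ t in Ioo 0 T, ψ t * M t :=
    setIntegral_congr_fun measurableSet_Ioo fun t ht => by simp only [hθd t ht]
  have ibp := AbsolutelyContinuousOnInterval.integral_mul_deriv_eq_deriv_mul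
    (ContDiff.absCont (hθ0s.of_le (by exact_mod_cast le_top)) 0 T) hGac
  have e2 : ∫ x in (0:ℝ)..T, θ0 x * deriv G x = ∫ t in Ioo 0 T, θ t * g t := by
    rw [← integral_Ioc_eq_integral_Ioo, ← intervalIntegral.integral_of_le hT.le]
    refine intervalIntegral.integral_congr_ae ?_
    filter_upwards [hGd] with t ht htm
    rw [ht htm, hθeq t]
    rw [uIoc_of_le hT.le] at htm
    exact ⟨by linarith [htm.1], by linarith [htm.2]⟩
  have e3 : ∫ x in (0:ℝ)..T, deriv θ0 x * G x = ∫ t in Ioo 0 T, ψ t * G t := by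
    rw [intervalIntegral.integral_of_le hT.le, integral_Ioc_eq_integral_Ioo]
    exact setIntegral_congr_fun measurableSet_Ioo fun t ht => by
      simp only [(hθ0d t).deriv]
  have i1 : IntegrableOn (fun t => ψ t * M t) (Ioo 0 T) := by
    obtain ⟨C, hC⟩ := hψ.continuous.bounded_above_of_compact_support hψc
    exact hM.bdd_mul hψ.continuous.aestronglyMeasurable (Eventually.of_forall hC)
  have i2 : IntegrableOn (fun t => ψ t * G t) (Ioo 0 T) := by
    obtain ⟨C, hC⟩ := hψ.continuous.bounded_above_of_compact_support hψc
    exact hGint.bdd_mul hψ.continuous.aestronglyMeasurable (Eventually.of_forall hC)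
  have e4 : ∫ x, ψ x • (M x - G x) = ∫ t in Ioo 0 T, ψ t * (M t - G t) := by
    rw [setIntegral_eq_integral_of_forall_compl_eq_zero]
    · rfl
    · intro x hx
      rw [image_eq_zero_of_notMem_tsupport (fun hm => hx (hψs hm)), zero_mul]
  rw [e4]
  have e5 : ∫ t in Ioo 0 T, ψ t * (M t - G t)
      = (∫ t in Ioo 0 T, ψ t * M t) - ∫ t in Ioo 0 T, ψ t * G t := by
    rw [← integral_sub i1 i2]
    exact integral_congr_ae (Eventually.of_forall fun t => by simp only []; ring)
  have hG0 : G 0 = M0 := by simp [hG]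
  have hθ00 : θ 0 = θ0 0 := hθeq 0 ⟨by norm_num, by linarith⟩
  rw [e2, e3, hG0, hθ0z T hbT.le] at ibp
  rw [e5]
  rw [e1, hθ00] at hmain
  linarith

/-! ### Cauchy–Schwarz and weighted Jensen for lower integrals -/

lemma half_pow_two (a : ℝ≥0∞) : (a ^ (1 / 2 : ℝ)) ^ 2 = a := by
  rw [← ENNReal.rpow_natCast, ← ENNReal.rpow_mul]; norm_num

lemma enorm_add_sq_le {F : Type*} [NormedAddCommGroup F] (a b : F) :
    ‖a + b‖ₑ ^ 2 ≤ 2 * (‖a‖ₑ ^ 2 + ‖b‖ₑ ^ 2) := by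
  refine (pow_le_pow_left' (enorm_add_le a b) 2).trans ?_
  have h := ENNReal.rpow_add_le_mul_rpow_add_rpow ‖a‖ₑ ‖b‖ₑ (p := 2) (by norm_num)
  norm_num at h
  exact h

lemma enorm_sub_sq_le {F : Type*} [NormedAddCommGroup F] (a b : F) :
    ‖a - b‖ₑ ^ 2 ≤ 2 * (‖a‖ₑ ^ 2 + ‖b‖ₑ ^ 2) := by
  simpa [sub_eq_add_neg] using enorm_add_sq_le a (-b)

lemma aesm_clm_apply {α F : Type*} [MeasurableSpace α] [NormedAddCommGroup F] [NormedSpace ℝ F]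
    {ν : Measure α} {A : α → E3 →L[ℝ] F} {v : α → E3} (hA : AEStronglyMeasurable A ν)
    (hv : AEStronglyMeasurable v ν) : AEStronglyMeasurable (fun z => A z (v z)) ν :=
  (ContinuousLinearMap.apply ℝ F : E3 →L[ℝ] (E3 →L[ℝ] F) →L[ℝ] F).flip.aestronglyMeasurable_comp₂
    hA hv

lemma fderiv_comp_const_sub {g : E3 → ℝ} (hg : ContDiff ℝ ∞ g) (x y e : E3) :
    fderiv ℝ (fun y => g (x - y)) y e = - fderiv ℝ g (x - y) e := by
  have h := ((hg.differentiable (by simp)) (x - y)).hasFDerivAt.comp y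
    ((hasFDerivAt_id (𝕜 := ℝ) y).const_sub x)
  rw [Function.comp_def] at h
  rw [h.fderiv]
  simp

lemma lintegral_mul_sq_le {α : Type*} [MeasurableSpace α] (ν : Measure α) {f g : α → ℝ≥0∞}
    (hf : AEMeasurable f ν) (hg : AEMeasurable g ν) :
    (∫⁻ x, f x * g x ∂ν) ^ 2 ≤ (∫⁻ x, f x ^ 2 ∂ν) * ∫⁻ x, g x ^ 2 ∂ν := by
  have h := ENNReal.lintegral_mul_le_Lp_mul_Lq ν Real.HolderConjugate.two_two hf hg
  calc (∫⁻ x, f x * g x ∂ν) ^ 2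
      ≤ ((∫⁻ x, f x ^ (2:ℝ) ∂ν) ^ (1 / (2:ℝ)) * (∫⁻ x, g x ^ (2:ℝ) ∂ν) ^ (1 / (2:ℝ))) ^ 2 :=
        pow_le_pow_left' h 2
    _ = _ := by
        rw [mul_pow, half_pow_two, half_pow_two]
        simp only [← ENNReal.rpow_natCast]
        norm_num

lemma lintegral_mul_sq_le_weight {α : Type*} [MeasurableSpace α] (ν : Measure α)
    {f k : α → ℝ≥0∞} (hf : AEMeasurable f ν) (hk : AEMeasurable k ν) :
    (∫⁻ x, f x * k x ∂ν) ^ 2 ≤ (∫⁻ x, k x ∂ν) * ∫⁻ x, f x ^ 2 * k x ∂ν := by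
  have h := lintegral_mul_sq_le ν (f := fun x => k x ^ (1 / (2:ℝ)))
    (g := fun x => f x * k x ^ (1 / (2:ℝ))) (hk.pow_const _) (hf.mul (hk.pow_const _))
  simp only [mul_pow, half_pow_two] at h
  refine le_trans (le_of_eq ?_) h
  congr 1
  refine lintegral_congr fun x => ?_
  have := half_pow_two (k x)
  rw [sq] at this
  calc f x * k x = f x * (k x ^ (1 / (2:ℝ)) * k x ^ (1 / (2:ℝ))) := by rw [this]
    _ = _ := by ring

lemma lintegral_mul_le_sqrt {α : Type*} [MeasurableSpace α] (ν : Measure α) {f g : α → ℝ≥0∞}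
    (hf : AEMeasurable f ν) (hg : AEMeasurable g ν) {a b : ℝ≥0∞}
    (ha : ∫⁻ x, f x ^ 2 ∂ν ≤ a ^ 2) (hb : ∫⁻ x, g x ^ 2 ∂ν ≤ b ^ 2) :
    ∫⁻ x, f x * g x ∂ν ≤ a * b := by
  have h := (lintegral_mul_sq_le ν hf hg).trans (mul_le_mul' ha hb)
  rw [← mul_pow] at h
  exact (ENNReal.pow_le_pow_left_iff two_ne_zero).1 h

/-! ### Mollification -/

/-- Convolution of a scalar function with a kernel. -/
def mol (g K : E3 → ℝ) (x : E3) : ℝ := ∫ y, g y * K (x - y)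

lemma mol_eq_convolution (g K : E3 → ℝ) :
    mol g K = convolution g K (ContinuousLinearMap.mul ℝ ℝ) volume := rfl

lemma mol_contDiff {g K : E3 → ℝ} (hg : LocallyIntegrable g) (hK : ContDiff ℝ ∞ K)
    (hKc : HasCompactSupport K) : ContDiff ℝ ∞ (mol g K) :=
  hKc.contDiff_convolution_right (n := ⊤) (ContinuousLinearMap.mul ℝ ℝ) hg hK

lemma mol_continuous {g K : E3 → ℝ} (hg : LocallyIntegrable g) (hK : Continuous K)
    (hKc : HasCompactSupport K) : Continuous (mol g K) :=
  hKc.continuous_convolution_right (ContinuousLinearMap.mul ℝ ℝ) hg hK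

lemma mol_fderiv {g K : E3 → ℝ} (hg : LocallyIntegrable g) (hK : ContDiff ℝ ∞ K)
    (hKc : HasCompactSupport K) (x e : E3) :
    fderiv ℝ (mol g K) x e = mol g (fun z => fderiv ℝ K z e) x := by
  have hK1 : ContDiff ℝ 1 K := hK.of_le (by exact_mod_cast le_top)
  have h := hKc.hasFDerivAt_convolution_right (ContinuousLinearMap.mul ℝ ℝ) hg hK1 x
  rw [mol_eq_convolution, h.fderiv, convolution_precompR_apply _ hg (hKc.fderiv ℝ)
    (hK1.continuous_fderiv one_ne_zero)]
  rfl

lemma integrable_mul_kernel {g K : E3 → ℝ} (hg : LocallyIntegrable g) (hK : Continuous K)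
    (hKc : HasCompactSupport K) (x : E3) : Integrable fun y => g y * K (x - y) := by
  have h := hg.integrable_smul_left_of_hasCompactSupport (g := fun y => K (x - y))
    (by fun_prop) (hKc.comp_homeomorph (Homeomorph.subLeft x))
  simpa [mul_comm] using h

/-- The standard mollifying bump of radius `2 / (k+1)`. -/
def bumpSeq (k : ℕ) : ContDiffBump (0 : E3) :=
  ⟨1 / ((k : ℝ) + 1), 2 / ((k : ℝ) + 1), by positivity, by gcongr; norm_num⟩

/-- The standard mollifiers. -/
def eta (k : ℕ) : E3 → ℝ := (bumpSeq k).normed volume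

lemma eta_smooth (k : ℕ) : ContDiff ℝ ∞ (eta k) := (bumpSeq k).contDiff_normed
lemma eta_cs (k : ℕ) : HasCompactSupport (eta k) := (bumpSeq k).hasCompactSupport_normed
lemma eta_nonneg (k : ℕ) (x : E3) : 0 ≤ eta k x := (bumpSeq k).nonneg_normed x
lemma eta_integral (k : ℕ) : ∫ x, eta k x = 1 := (bumpSeq k).integral_normed
lemma eta_support (k : ℕ) {x : E3} (hx : 2 / ((k : ℝ) + 1) ≤ ‖x‖) : eta k x = 0 := by
  have := (bumpSeq k).support_normed_eq (μ := (volume : Measure E3))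
  by_contra h
  have h2 : x ∈ Function.support (eta k) := h
  rw [eta, this] at h2
  simp [bumpSeq] at h2
  linarith
lemma eta_integrable (k : ℕ) : Integrable (eta k) :=
  (eta_smooth k).continuous.integrable_of_hasCompactSupport (eta_cs k)
lemma eta_lintegral (k : ℕ) : ∫⁻ x, ‖eta k x‖ₑ = 1 := by
  have h := ofReal_integral_norm_eq_lintegral_enorm (eta_integrable k)
  simp only [Real.norm_of_nonneg (eta_nonneg k _), eta_integral] at h
  rw [← h]; simp

lemma bumpSeq_scale (k : ℕ) (x : E3) : bumpSeq k x = bumpSeq 0 (((k : ℝ) + 1) • x) := by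
  simp only [ContDiffBump.apply, bumpSeq]
  congr 1
  · field_simp
  · simp

lemma eta_scale (k : ℕ) (x : E3) :
    eta k x = ((k : ℝ) + 1) ^ 3 * eta 0 (((k : ℝ) + 1) • x) := by
  simp only [eta, ContDiffBump.normed_def]
  have : ∫ x, bumpSeq k x = (((k : ℝ) + 1) ^ 3)⁻¹ * ∫ x, bumpSeq 0 x := by
    simp_rw [bumpSeq_scale k]
    rw [Measure.integral_comp_smul]
    simp [abs_of_pos (show (0:ℝ) < ((k:ℝ) + 1) by positivity)]
  rw [this, bumpSeq_scale k]
  field_simp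

lemma eta_fderiv_scale (k : ℕ) (x : E3) :
    fderiv ℝ (eta k) x = ((k : ℝ) + 1) ^ 4 • fderiv ℝ (eta 0) (((k : ℝ) + 1) • x) := by
  have h : eta k = fun x => ((k : ℝ) + 1) ^ 3 * eta 0 (((k : ℝ) + 1) • x) :=
    funext (eta_scale k)
  have hd : Differentiable ℝ (eta 0) := (eta_smooth 0).differentiable (by simp)
  rw [h]
  have hd' : DifferentiableAt ℝ (fun y => eta 0 (((k : ℝ) + 1) • y)) x :=
    (hd _).comp x (by fun_prop)
  rw [fderiv_const_mul hd']
  have : fderiv ℝ (fun y => eta 0 (((k : ℝ) + 1) • y)) x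
      = ((k : ℝ) + 1) • fderiv ℝ (eta 0) (((k : ℝ) + 1) • x) := by
    exact fderiv_comp_smul _
  rw [this, smul_smul]
  congr 1

/-- The scale-invariant first moment of the gradient of the mollifiers. -/
def etaMoment : ℝ≥0∞ := ∫⁻ z, ‖z‖ₑ * ‖fderiv ℝ (eta 0) z‖ₑ

lemma etaMoment_lt_top : etaMoment < ⊤ := by
  have hc : Continuous fun z : E3 => ‖z‖ * ‖fderiv ℝ (eta 0) z‖ :=
    continuous_norm.mul ((eta_smooth 0).continuous_fderiv (by simp)).norm
  have hi : Integrable fun z : E3 => ‖z‖ * ‖fderiv ℝ (eta 0) z‖ :=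
    hc.integrable_of_hasCompactSupport ((eta_cs 0).fderiv ℝ).norm.mul_left
  have := hi.2
  simpa [HasFiniteIntegral, etaMoment, enorm_mul] using this

lemma eta_moment (k : ℕ) : ∫⁻ z, ‖z‖ₑ * ‖fderiv ℝ (eta k) z‖ₑ = etaMoment := by
  have hpos : (0:ℝ) < (k : ℝ) + 1 := by positivity
  set F : E3 → ℝ≥0∞ := fun z => ‖z‖ₑ * ‖fderiv ℝ (eta 0) z‖ₑ with hF
  have hFm : Measurable F := by
    have h1 : Measurable fun z : E3 => fderiv ℝ (eta 0) z :=
      ((eta_smooth 0).continuous_fderiv (by simp)).measurable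
    exact measurable_enorm.mul h1.enorm
  have h1 : ∀ z, ‖z‖ₑ * ‖fderiv ℝ (eta k) z‖ₑ
      = ENNReal.ofReal (((k : ℝ) + 1) ^ 3) * F (((k : ℝ) + 1) • z) := by
    intro z
    rw [eta_fderiv_scale]
    simp only [hF, enorm_smul]
    have e1 : ‖((k : ℝ) + 1) ^ 4‖ₑ = ENNReal.ofReal (((k : ℝ) + 1) ^ 3) * ‖(k : ℝ) + 1‖ₑ := by
      rw [Real.enorm_of_nonneg hpos.le, ← ENNReal.ofReal_mul (by positivity),
        Real.enorm_of_nonneg (by positivity)]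
      ring_nf
    rw [e1]; ring
  simp_rw [h1]
  have hFm' : Measurable fun z => F (((k : ℝ) + 1) • z) := hFm.comp (measurable_const_smul _)
  rw [lintegral_const_mul _ hFm']
  have h2 := lintegral_map (μ := (volume : Measure E3)) hFm
    (measurable_const_smul ((k : ℝ) + 1))
  rw [← h2, Measure.map_addHaar_smul _ hpos.ne', lintegral_smul_measure]
  simp only [finrank_euclideanSpace, Fintype.card_fin, smul_eq_mul]
  rw [← mul_assoc, ← ENNReal.ofReal_mul (by positivity), abs_of_pos (by positivity),
    mul_inv_cancel₀ (by positivity)]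
  simp [etaMoment, hF]

lemma mol_sq_le {h : E3 → ℝ} (hh : AEStronglyMeasurable h) (k : ℕ) :
    ∫⁻ x, ‖mol h (eta k) x‖ₑ ^ 2 ≤ ∫⁻ x, ‖h x‖ₑ ^ 2 := by
  have hm : AEMeasurable (fun y => ‖h y‖ₑ) := hh.enorm
  have hkm : Measurable fun z => ‖eta k z‖ₑ := (eta_smooth k).continuous.measurable.enorm
  have h1 : ∀ x, ‖mol h (eta k) x‖ₑ ^ 2 ≤ ∫⁻ y, ‖h y‖ₑ ^ 2 * ‖eta k (x - y)‖ₑ := by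
    intro x
    have hk' : AEMeasurable (fun y => ‖eta k (x - y)‖ₑ) :=
      (hkm.comp (measurable_const.sub measurable_id)).aemeasurable
    calc ‖mol h (eta k) x‖ₑ ^ 2 ≤ (∫⁻ y, ‖h y‖ₑ * ‖eta k (x - y)‖ₑ) ^ 2 := by
          gcongr
          refine (enorm_integral_le_lintegral_enorm _).trans (le_of_eq ?_)
          simp [enorm_mul]
      _ ≤ _ := lintegral_mul_sq_le_weight _ hm hk'
      _ = _ := by
          rw [lintegral_sub_left_eq_self (fun z => ‖eta k z‖ₑ) x, eta_lintegral, one_mul]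
  calc ∫⁻ x, ‖mol h (eta k) x‖ₑ ^ 2 ≤ ∫⁻ x, ∫⁻ y, ‖h y‖ₑ ^ 2 * ‖eta k (x - y)‖ₑ :=
        lintegral_mono h1
    _ = ∫⁻ y, ∫⁻ x, ‖h y‖ₑ ^ 2 * ‖eta k (x - y)‖ₑ := by
        rw [lintegral_lintegral_swap]
        have m1 : AEMeasurable (fun p : E3 × E3 => ‖h p.2‖ₑ ^ 2) (volume.prod volume) :=
          (hm.pow_const 2).comp_quasiMeasurePreserving Measure.quasiMeasurePreserving_snd
        have m2 : AEMeasurable (fun p : E3 × E3 => ‖eta k (p.1 - p.2)‖ₑ) (volume.prod volume) :=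
          (hkm.comp (measurable_fst.sub measurable_snd)).aemeasurable
        exact m1.mul m2
    _ = ∫⁻ y, ‖h y‖ₑ ^ 2 := by
        refine lintegral_congr fun y => ?_
        have m3 : Measurable fun x => ‖eta k (x - y)‖ₑ :=
          hkm.comp (measurable_id.sub measurable_const)
        rw [lintegral_const_mul _ m3, lintegral_sub_right_eq_self (fun z => ‖eta k z‖ₑ) y, eta_lintegral, mul_one]

lemma mol_eta_tendsto {f : E3 → ℝ} (hf : LocallyIntegrable f) :
    ∀ᵐ x, Tendsto (fun k => mol f (eta k) x) atTop (𝓝 (f x)) := by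
  have h := ContDiffBump.ae_convolution_tendsto_right_of_locallyIntegrable
    (μ := (volume : Measure E3)) (φ := bumpSeq) (l := atTop) (K := 2) (g := f) ?_ ?_ hf
  · filter_upwards [h] with x hx
    refine hx.congr fun k => ?_
    rw [convolution_eq_swap]
    simp only [mol, eta, ContinuousLinearMap.lsmul_apply, smul_eq_mul]
    exact integral_congr_ae (Eventually.of_forall fun y => mul_comm _ _)
  · show Tendsto (fun k : ℕ => 2 / ((k : ℝ) + 1)) atTop (𝓝 0)
    exact tendsto_const_nhds.div_atTop
      (tendsto_atTop_add_const_right _ _ tendsto_natCast_atTop_atTop)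
  · refine Eventually.of_forall fun k => ?_
    simp only [bumpSeq]
    rw [mul_one_div]

lemma basisVec_sum (z : E3) : z = ∑ j, z j • basisVec j := by
  ext i
  fin_cases i <;> simp [basisVec, Fin.sum_univ_three]

lemma enorm_sq_eq_sum (z : E3) : ‖z‖ₑ ^ 2 = ∑ j, ‖z j‖ₑ ^ 2 := by
  have h : ‖z‖ ^ 2 = ∑ j, ‖z j‖ ^ 2 := EuclideanSpace.norm_sq_eq z
  simp only [← ofReal_norm, ← ENNReal.ofReal_pow (norm_nonneg _)]
  rw [h, ENNReal.ofReal_sum_of_nonneg fun _ _ => by positivity]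

/-- A function whose mollifications have gradient `h ∈ L²` has `L²` difference quotients. -/
lemma translate_sq_le {f : E3 → ℝ} {h : Fin 3 → E3 → ℝ} (hf : LocallyIntegrable f)
    (hh : ∀ j, LocallyIntegrable (h j))
    (hgrad : ∀ k x j, mol f (fun z => fderiv ℝ (eta k) z (basisVec j)) x = mol (h j) (eta k) x)
    (z : E3) :
    ∫⁻ x, ‖f (x + z) - f x‖ₑ ^ 2 ≤ ‖z‖ₑ ^ 2 * ∑ j, ∫⁻ x, ‖h j x‖ₑ ^ 2 := by
  have hsm : ∀ k, ContDiff ℝ ∞ (mol f (eta k)) := fun k =>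
    mol_contDiff hf (eta_smooth k) (eta_cs k)
  have hhc : ∀ k j, Continuous (mol (h j) (eta k)) := fun k j =>
    mol_continuous (hh j) (eta_smooth k).continuous (eta_cs k)
  have hpt : ∀ k x, ‖mol f (eta k) (x + z) - mol f (eta k) x‖ₑ ^ 2
      ≤ ∫⁻ s in Icc (0:ℝ) 1, ‖z‖ₑ ^ 2 * ∑ j, ‖mol (h j) (eta k) (x + s • z)‖ₑ ^ 2 := by
    intro k x
    set F := mol f (eta k) with hF
    have hd : ∀ s : ℝ, HasDerivAt (fun s : ℝ => F (x + s • z)) (fderiv ℝ F (x + s • z) z) s := by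
      intro s
      have h1 : HasDerivAt (fun s : ℝ => x + s • z) z s := by
        simpa using ((hasDerivAt_id s).smul_const z).const_add x
      exact (((hsm k).differentiable (by simp)) _).hasFDerivAt.comp_hasDerivAt s h1
    have hcont : Continuous fun s : ℝ => fderiv ℝ F (x + s • z) z :=
      (((hsm k).continuous_fderiv (by simp)).comp (by fun_prop)).clm_apply continuous_const
    have hint : F (x + z) - F x = ∫ s in (0:ℝ)..1, fderiv ℝ F (x + s • z) z := by
      rw [intervalIntegral.integral_eq_sub_of_hasDerivAt (fun s _ => hd s)
        (hcont.intervalIntegrable _ _)]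
      simp
    have hgz : ∀ y, fderiv ℝ F y z = ∑ j, z j * mol (h j) (eta k) y := by
      intro y
      conv_lhs => rw [basisVec_sum z]
      rw [map_sum]
      refine Finset.sum_congr rfl fun j _ => ?_
      rw [map_smul, smul_eq_mul, hF, mol_fderiv hf (eta_smooth k) (eta_cs k), hgrad]
    rw [hint, intervalIntegral.integral_of_le zero_le_one, ← integral_Icc_eq_integral_Ioc]
    have hmeas : Measurable fun s : ℝ => ‖fderiv ℝ F (x + s • z) z‖ₑ := hcont.measurable.enorm
    calc ‖∫ s in Icc (0:ℝ) 1, fderiv ℝ F (x + s • z) z‖ₑ ^ 2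
        ≤ (∫⁻ s in Icc (0:ℝ) 1, ‖fderiv ℝ F (x + s • z) z‖ₑ * 1) ^ 2 := by
          gcongr; simpa using enorm_integral_le_lintegral_enorm _
      _ ≤ _ := lintegral_mul_sq_le_weight _ hmeas.aemeasurable aemeasurable_const
      _ ≤ _ := by
          simp only [lintegral_const, MeasurableSet.univ, Measure.restrict_apply, univ_inter,
            Real.volume_Icc, sub_zero, ENNReal.ofReal_one, mul_one, one_mul]
          refine lintegral_mono fun s => ?_
          simp only []
          rw [hgz]
          have cs : (∑ j, z j * mol (h j) (eta k) (x + s • z)) ^ 2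
              ≤ (∑ j, z j ^ 2) * ∑ j, (mol (h j) (eta k) (x + s • z)) ^ 2 :=
            Finset.sum_mul_sq_le_sq_mul_sq _ _ _
          rw [enorm_sq_eq_sum z]
          have e : ∀ a : ℝ, ‖a‖ₑ ^ 2 = ENNReal.ofReal (a ^ 2) := fun a => by
            rw [← ofReal_norm, ← ENNReal.ofReal_pow (norm_nonneg _), Real.norm_eq_abs,
              sq_abs]
          simp only [e]
          rw [← ENNReal.ofReal_sum_of_nonneg fun _ _ => sq_nonneg _,
            ← ENNReal.ofReal_sum_of_nonneg fun _ _ => sq_nonneg _,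
            ← ENNReal.ofReal_mul (Finset.sum_nonneg fun _ _ => sq_nonneg _)]
          exact ENNReal.ofReal_le_ofReal cs
  have hbound : ∀ k, ∫⁻ x, ‖mol f (eta k) (x + z) - mol f (eta k) x‖ₑ ^ 2
      ≤ ‖z‖ₑ ^ 2 * ∑ j, ∫⁻ x, ‖h j x‖ₑ ^ 2 := by
    intro k
    have hm2 : ∀ j, Measurable fun y => ‖mol (h j) (eta k) y‖ₑ ^ 2 := fun j =>
      (hhc k j).measurable.enorm.pow_const 2
    calc ∫⁻ x, ‖mol f (eta k) (x + z) - mol f (eta k) x‖ₑ ^ 2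
        ≤ ∫⁻ x, ∫⁻ s in Icc (0:ℝ) 1, ‖z‖ₑ ^ 2 * ∑ j, ‖mol (h j) (eta k) (x + s • z)‖ₑ ^ 2 :=
          lintegral_mono (hpt k)
      _ = ∫⁻ s in Icc (0:ℝ) 1, ∫⁻ x, ‖z‖ₑ ^ 2 * ∑ j, ‖mol (h j) (eta k) (x + s • z)‖ₑ ^ 2 := by
          rw [lintegral_lintegral_swap]
          refine Measurable.aemeasurable ?_
          refine Measurable.const_mul (Finset.measurable_sum _ fun j _ => ?_) _
          exact (hm2 j).comp (measurable_fst.add (measurable_snd.smul_const z))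
      _ ≤ ∫⁻ s in Icc (0:ℝ) 1, ‖z‖ₑ ^ 2 * ∑ j, ∫⁻ x, ‖h j x‖ₑ ^ 2 := by
          refine lintegral_mono fun s => ?_
          simp only []
          have m3 : ∀ j, Measurable fun x => ‖mol (h j) (eta k) (x + s • z)‖ₑ ^ 2 := fun j =>
            (hm2 j).comp (measurable_id.add measurable_const)
          rw [lintegral_const_mul _ (Finset.measurable_fun_sum _ fun j _ => m3 j),
            lintegral_finsetSum _ fun j _ => m3 j]
          refine mul_le_mul' le_rfl (Finset.sum_le_sum fun j _ => ?_)
          rw [lintegral_add_right_eq_self (fun y => ‖mol (h j) (eta k) y‖ₑ ^ 2) (s • z)]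
          exact mol_sq_le (hh j).aestronglyMeasurable k
      _ = _ := by simp
  have hconv := mol_eta_tendsto hf
  have hconv' : ∀ᵐ x, Tendsto (fun k => mol f (eta k) (x + z)) atTop (𝓝 (f (x + z))) :=
    (measurePreserving_add_right (volume : Measure E3) z).quasiMeasurePreserving.ae hconv
  calc ∫⁻ x, ‖f (x + z) - f x‖ₑ ^ 2
      = ∫⁻ x, liminf (fun k => ‖mol f (eta k) (x + z) - mol f (eta k) x‖ₑ ^ 2) atTop := by
        refine lintegral_congr_ae ?_
        filter_upwards [hconv, hconv'] with x h1 h2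
        exact ((ENNReal.Tendsto.pow (h2.sub h1).enorm).liminf_eq).symm
    _ ≤ liminf (fun k => ∫⁻ x, ‖mol f (eta k) (x + z) - mol f (eta k) x‖ₑ ^ 2) atTop := by
        refine lintegral_liminf_le fun k => ?_
        have := (hsm k).continuous
        exact (((this.comp (continuous_id.add continuous_const)).sub this).measurable.enorm).pow_const 2
    _ ≤ _ := by
        refine liminf_le_of_le (by isBoundedDefault) fun b hb => ?_
        obtain ⟨k, hk⟩ := hb.exists
        exact hk.trans (hbound k)

/-! ### Velocity slices and the transport commutator -/

lemma locallyIntegrable_smul_of_memLp {ρ : E3 → ℝ} {v : E3 → E3} (hρ : MemLp ρ 2)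
    (hv : MemLp v 6) : LocallyIntegrable fun y => ρ y • v y := by
  have : ENNReal.HolderTriple 2 6 ((2:ℝ≥0∞)⁻¹ + 6⁻¹)⁻¹ := ⟨by simp⟩
  have h := hv.smul (r := ((2:ℝ≥0∞)⁻¹ + 6⁻¹)⁻¹) hρ
  refine h.locallyIntegrable ?_
  rw [ENNReal.one_le_inv]
  calc (2:ℝ≥0∞)⁻¹ + 6⁻¹ ≤ 2⁻¹ + 2⁻¹ := by gcongr; norm_num
    _ = 1 := ENNReal.inv_two_add_inv_two

lemma aesm_sub {F : Type*} [TopologicalSpace F] {f : E3 → F}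
    (hf : AEStronglyMeasurable f) :
    AEStronglyMeasurable (fun p : E3 × E3 => f (p.1 - p.2)) (volume.prod volume) :=
  hf.comp_quasiMeasurePreserving
    (quasiMeasurePreserving_sub_of_right_invariant (volume : Measure E3) volume)

lemma LocallyIntegrable.comp_apply {v : E3 → E3} (hv : LocallyIntegrable v) (i : Fin 3) :
    LocallyIntegrable fun y => v y i := by
  intro x
  obtain ⟨s, hs, h⟩ := hv x
  exact ⟨s, hs, (EuclideanSpace.proj (𝕜 := ℝ) i).integrable_comp h⟩

lemma aesm_apply {α : Type*} [MeasurableSpace α] {ν : Measure α} {v : α → E3}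
    (hv : AEStronglyMeasurable v ν) (i : Fin 3) :
    AEStronglyMeasurable (fun y => v y i) ν :=
  (PiLp.continuous_apply 2 (fun _ : Fin 3 => ℝ) i).comp_aestronglyMeasurable hv

lemma mol_sub_sq_le {f : E3 → ℝ} (hf : LocallyIntegrable f) (k : ℕ) {om : ℝ≥0∞}
    (hom : ∀ z : E3, ‖z‖ ≤ 2 / ((k : ℝ) + 1) → ∫⁻ x, ‖f (x - z) - f x‖ₑ ^ 2 ≤ om ^ 2) :
    ∫⁻ x, ‖mol f (eta k) x - f x‖ₑ ^ 2 ≤ om ^ 2 := by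
  have hfm := hf.aestronglyMeasurable
  have hkm : Measurable fun z => ‖eta k z‖ₑ := (eta_smooth k).continuous.measurable.enorm
  have h1 : ∀ x, ‖mol f (eta k) x - f x‖ₑ ^ 2
      ≤ ∫⁻ z, ‖f (x - z) - f x‖ₑ ^ 2 * ‖eta k z‖ₑ := by
    intro x
    have hi := integrable_mul_kernel hf (eta_smooth k).continuous (eta_cs k) x
    have e1 : mol f (eta k) x - f x = ∫ y, (f y - f x) * eta k (x - y) := by
      simp only [sub_mul]
      rw [integral_sub hi, integral_const_mul,
        integral_sub_left_eq_self (fun z => eta k z) volume x, eta_integral, mul_one]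
      · rfl
      · exact ((eta_integrable k).comp_sub_left x).const_mul _
    have e2 : ∫ y, (f y - f x) * eta k (x - y) = ∫ z, (f (x - z) - f x) * eta k z := by
      rw [← integral_sub_left_eq_self (fun z => (f (x - z) - f x) * eta k z) volume x]
      simp
    rw [e1, e2]
    have hm : AEMeasurable fun z => ‖f (x - z) - f x‖ₑ :=
      ((hfm.comp_quasiMeasurePreserving
        (quasiMeasurePreserving_sub_left_of_right_invariant volume x)).sub
          aestronglyMeasurable_const).enorm
    calc ‖∫ z, (f (x - z) - f x) * eta k z‖ₑ ^ 2
        ≤ (∫⁻ z, ‖f (x - z) - f x‖ₑ * ‖eta k z‖ₑ) ^ 2 := by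
          gcongr
          refine (enorm_integral_le_lintegral_enorm _).trans (le_of_eq ?_)
          simp [enorm_mul]
      _ ≤ _ := lintegral_mul_sq_le_weight _ hm hkm.aemeasurable
      _ = _ := by rw [eta_lintegral, one_mul]
  calc ∫⁻ x, ‖mol f (eta k) x - f x‖ₑ ^ 2
      ≤ ∫⁻ x, ∫⁻ z, ‖f (x - z) - f x‖ₑ ^ 2 * ‖eta k z‖ₑ := lintegral_mono h1
    _ = ∫⁻ z, ∫⁻ x, ‖f (x - z) - f x‖ₑ ^ 2 * ‖eta k z‖ₑ := by
        rw [lintegral_lintegral_swap]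
        have m1 : AEMeasurable (fun p : E3 × E3 => ‖f (p.1 - p.2) - f p.1‖ₑ ^ 2)
            (volume.prod volume) :=
          (((aesm_sub hfm).sub hfm.comp_fst).enorm).pow_const 2
        exact m1.mul (hkm.comp measurable_snd).aemeasurable
    _ ≤ ∫⁻ z, om ^ 2 * ‖eta k z‖ₑ := by
        refine lintegral_mono fun z => ?_
        rw [lintegral_mul_const' _ _ enorm_ne_top]
        by_cases hz : ‖z‖ ≤ 2 / ((k : ℝ) + 1)
        · exact mul_le_mul' (hom z hz) le_rfl
        · simp [eta_support k (not_le.1 hz).le]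
    _ = om ^ 2 := by rw [lintegral_const_mul _ hkm, eta_lintegral, mul_one]

/-- A velocity slice `v ∈ L⁶` with gradient `H ∈ L²` and zero divergence. -/
structure GoodSlice (v : E3 → E3) (H : Fin 3 → E3 → E3) : Prop where
  mem6 : MemLp v 6
  memH : ∀ j, MemLp (H j) 2
  grad : ∀ k x i j, mol (fun y => v y i) (fun z => fderiv ℝ (eta k) z (basisVec j)) x
    = mol (fun y => H j y i) (eta k) x
  trace : ∀ᵐ x, ∑ i, H i x i = 0

/-- The squared `L²` norm of a gradient. -/
def gradSq (H : Fin 3 → E3 → E3) : ℝ≥0∞ := ∑ j, ∫⁻ x, ‖H j x‖ₑ ^ 2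

lemma fderiv_apply_sum (K : E3 → ℝ) (x e : E3) :
    fderiv ℝ K x e = ∑ i, e i * fderiv ℝ K x (basisVec i) := by
  conv_lhs => rw [basisVec_sum e]
  simp [map_sum]

lemma one_le_six : (1:ℝ≥0∞) ≤ 6 := by norm_num

namespace GoodSlice

variable {v : E3 → E3} {H : Fin 3 → E3 → E3}

lemma locInt (h : GoodSlice v H) : LocallyIntegrable v := h.mem6.locallyIntegrable one_le_six

lemma translate (h : GoodSlice v H) (z : E3) :
    ∫⁻ x, ‖v (x + z) - v x‖ₑ ^ 2 ≤ ‖z‖ₑ ^ 2 * gradSq H := by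
  have hli := fun i => LocallyIntegrable.comp_apply h.locInt i
  have hHi := fun j i => LocallyIntegrable.comp_apply
    ((h.memH j).locallyIntegrable one_le_two) i
  have h1 := fun i => translate_sq_le (hli i) (fun j => hHi j i)
    (fun k x j => h.grad k x i j) z
  have hmv : ∀ i, AEMeasurable fun x => ‖v (x + z) i - v x i‖ₑ ^ 2 := fun i => by
    have := (hli i).aestronglyMeasurable
    exact (((this.comp_quasiMeasurePreserving
      (measurePreserving_add_right volume z).quasiMeasurePreserving).sub this).enorm).pow_const 2
  calc ∫⁻ x, ‖v (x + z) - v x‖ₑ ^ 2 = ∫⁻ x, ∑ i, ‖v (x + z) i - v x i‖ₑ ^ 2 := by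
        refine lintegral_congr fun x => ?_
        rw [enorm_sq_eq_sum]; rfl
    _ = ∑ i, ∫⁻ x, ‖v (x + z) i - v x i‖ₑ ^ 2 := lintegral_finsetSum' _ fun i _ => hmv i
    _ ≤ ∑ i, ‖z‖ₑ ^ 2 * ∑ j, ∫⁻ x, ‖H j x i‖ₑ ^ 2 := Finset.sum_le_sum fun i _ => h1 i
    _ = ‖z‖ₑ ^ 2 * gradSq H := by
        rw [← Finset.mul_sum, Finset.sum_comm]
        congr 1
        refine Finset.sum_congr rfl fun j _ => ?_
        rw [← lintegral_finsetSum' _ fun i _ =>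
          ((hHi j i).aestronglyMeasurable.enorm).pow_const 2]
        exact lintegral_congr fun x => (enorm_sq_eq_sum _).symm

lemma translate_sub (h : GoodSlice v H) (z : E3) :
    ∫⁻ x, ‖v (x - z) - v x‖ₑ ^ 2 ≤ ‖z‖ₑ ^ 2 * gradSq H := by
  simpa [sub_eq_add_neg] using h.translate (-z)

lemma mol_div (h : GoodSlice v H) (k : ℕ) (x : E3) :
    ∑ i, mol (fun y => v y i) (fun z => fderiv ℝ (eta k) z (basisVec i)) x = 0 := by
  have hHi := fun i => LocallyIntegrable.comp_apply
    ((h.memH i).locallyIntegrable one_le_two) i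
  simp_rw [h.grad]
  simp only [mol]
  rw [← integral_finsetSum _ fun i _ =>
    integrable_mul_kernel (hHi i) (eta_smooth k).continuous (eta_cs k) x]
  refine integral_eq_zero_of_ae ?_
  filter_upwards [h.trace] with y hy
  rw [← Finset.sum_mul, hy, zero_mul]; rfl

end GoodSlice

lemma deta_cont (k : ℕ) (e : E3) : Continuous fun z => fderiv ℝ (eta k) z e :=
  ((eta_smooth k).continuous_fderiv (by simp)).clm_apply continuous_const
lemma deta_cs (k : ℕ) (e : E3) : HasCompactSupport fun z => fderiv ℝ (eta k) z e :=
  ((eta_cs k).fderiv ℝ).comp_left (g := fun L : E3 →L[ℝ] ℝ => L e) rfl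
lemma deta_support (k : ℕ) {z : E3} (hz : 2 / ((k : ℝ) + 1) < ‖z‖) : fderiv ℝ (eta k) z = 0 := by
  have : eta k =ᶠ[𝓝 z] fun _ => 0 := by
    filter_upwards [continuous_norm.continuousAt.eventually (lt_mem_nhds hz)] with y hy
    exact eta_support k (le_of_lt hy)
  rw [this.fderiv_eq]; simp
lemma deta_integral (k : ℕ) (e : E3) : ∫ z, fderiv ℝ (eta k) z e = 0 := by
  have h := integral_mul_fderiv_eq_neg_fderiv_mul_of_integrable (μ := (volume : Measure E3))
    (f := fun _ : E3 => (1:ℝ)) (g := eta k) (v := e) (by simp) (by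
      simpa using (deta_cont k e).integrable_of_hasCompactSupport (deta_cs k e))
      (by simpa using eta_integrable k) (by simp)
      (fun x _ => (eta_smooth k).differentiable (by simp) x)
  simpa using h

/-- The commutator of transport by `v` and mollification. -/
def comm (ρ : E3 → ℝ) (v : E3 → E3) (k : ℕ) (x : E3) : ℝ :=
  (∫ y, ρ y * fderiv ℝ (eta k) (x - y) (v y)) - fderiv ℝ (mol ρ (eta k)) x (v x)

lemma integrable_rho_deta {ρ : E3 → ℝ} {v : E3 → E3}
    (hρv : LocallyIntegrable fun y => ρ y • v y) (k : ℕ) (x : E3) :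
    Integrable fun y => ρ y * fderiv ℝ (eta k) (x - y) (v y) := by
  have : (fun y => ρ y * fderiv ℝ (eta k) (x - y) (v y))
      = fun y => ∑ i, (ρ y • v y) i * fderiv ℝ (eta k) (x - y) (basisVec i) := by
    funext y
    rw [fderiv_apply_sum, Finset.mul_sum]
    refine Finset.sum_congr rfl fun i _ => ?_
    simp; ring
  rw [this]
  exact integrable_finsetSum _ fun i _ => integrable_mul_kernel
    (LocallyIntegrable.comp_apply hρv i) (deta_cont k _) (deta_cs k _) x

lemma comm_eq {ρ : E3 → ℝ} {v : E3 → E3} {H : Fin 3 → E3 → E3} (h : GoodSlice v H)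
    (hρ : LocallyIntegrable ρ) (hρv : LocallyIntegrable fun y => ρ y • v y) (k : ℕ) (x : E3) :
    comm ρ v k x = ∫ y, (ρ y - ρ x) * fderiv ℝ (eta k) (x - y) (v y - v x) := by
  have i1 := integrable_rho_deta hρv k x
  have i2 : Integrable fun y => ρ y * fderiv ℝ (eta k) (x - y) (v x) :=
    integrable_mul_kernel hρ (deta_cont k _) (deta_cs k _) x
  have i3a := fun i => integrable_mul_kernel (LocallyIntegrable.comp_apply h.locInt i)
    (deta_cont k (basisVec i)) (deta_cs k (basisVec i)) x
  have i3 : Integrable fun y => fderiv ℝ (eta k) (x - y) (v y) := by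
    simp_rw [fderiv_apply_sum (eta k) _ (v _)]
    exact integrable_finsetSum _ fun i _ => i3a i
  have i4 : Integrable fun y => fderiv ℝ (eta k) (x - y) (v x) :=
    ((deta_cont k (v x)).integrable_of_hasCompactSupport (deta_cs k (v x))).comp_sub_left x
  have z3 : ∫ y, fderiv ℝ (eta k) (x - y) (v y) = 0 := by
    simp_rw [fderiv_apply_sum (eta k) _ (v _)]
    rw [integral_finsetSum _ fun i _ => i3a i]
    exact h.mol_div k x
  have z4 : ∫ y, fderiv ℝ (eta k) (x - y) (v x) = 0 := by
    rw [integral_sub_left_eq_self (fun z => fderiv ℝ (eta k) z (v x)) volume x, deta_integral]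
  have e : ∀ y, (ρ y - ρ x) * fderiv ℝ (eta k) (x - y) (v y - v x)
      = (ρ y * fderiv ℝ (eta k) (x - y) (v y) - ρ y * fderiv ℝ (eta k) (x - y) (v x))
        - (ρ x * fderiv ℝ (eta k) (x - y) (v y) - ρ x * fderiv ℝ (eta k) (x - y) (v x)) := by
    intro y; rw [map_sub]; ring
  simp_rw [e]
  have i12 : Integrable fun y => ρ y * fderiv ℝ (eta k) (x - y) (v y)
    - ρ y * fderiv ℝ (eta k) (x - y) (v x) := i1.sub i2
  have i34 : Integrable fun y => ρ x * fderiv ℝ (eta k) (x - y) (v y)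
    - ρ x * fderiv ℝ (eta k) (x - y) (v x) := (i3.const_mul _).sub (i4.const_mul _)
  rw [integral_sub i12 i34, integral_sub i1 i2,
    integral_sub (i3.const_mul _) (i4.const_mul _), integral_const_mul, integral_const_mul,
    z3, z4, comm, mol_fderiv hρ (eta_smooth k) (eta_cs k)]
  simp [mol]

lemma comm_bound {ρ : E3 → ℝ} {v : E3 → E3} {H : Fin 3 → E3 → E3} (h : GoodSlice v H)
    (hρ : LocallyIntegrable ρ) (hρv : LocallyIntegrable fun y => ρ y • v y) (k : ℕ)
    {om γ : ℝ≥0∞}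
    (hom : ∀ z : E3, ‖z‖ ≤ 2 / ((k : ℝ) + 1) → ∫⁻ x, ‖ρ (x - z) - ρ x‖ₑ ^ 2 ≤ om ^ 2)
    (hγ : gradSq H ≤ γ ^ 2) :
    ∫⁻ x, ‖comm ρ v k x‖ₑ ≤ etaMoment * om * γ := by
  have hρm := hρ.aestronglyMeasurable
  have hvm := h.mem6.1
  have hdm : Measurable fun z => ‖fderiv ℝ (eta k) z‖ₑ :=
    ((eta_smooth k).continuous_fderiv (by simp)).measurable.enorm
  have h1 : ∀ x, ‖comm ρ v k x‖ₑ
      ≤ ∫⁻ z, ‖fderiv ℝ (eta k) z‖ₑ * (‖ρ (x - z) - ρ x‖ₑ * ‖v (x - z) - v x‖ₑ) := by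
    intro x
    rw [comm_eq h hρ hρv]
    have e2 : ∫ y, (ρ y - ρ x) * fderiv ℝ (eta k) (x - y) (v y - v x)
        = ∫ z, (ρ (x - z) - ρ x) * fderiv ℝ (eta k) z (v (x - z) - v x) := by
      rw [← integral_sub_left_eq_self
        (fun z => (ρ (x - z) - ρ x) * fderiv ℝ (eta k) z (v (x - z) - v x)) volume x]
      simp
    rw [e2]
    refine (enorm_integral_le_lintegral_enorm _).trans (lintegral_mono fun z => ?_)
    simp only [enorm_mul]
    calc _ ≤ ‖ρ (x - z) - ρ x‖ₑ * (‖fderiv ℝ (eta k) z‖ₑ * ‖v (x - z) - v x‖ₑ) := by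
          gcongr; exact ContinuousLinearMap.le_opENorm _ _
      _ = _ := by ring
  have m1 : AEMeasurable (fun p : E3 × E3 => ‖ρ (p.1 - p.2) - ρ p.1‖ₑ) (volume.prod volume) :=
    ((aesm_sub hρm).sub hρm.comp_fst).enorm
  have m2 : AEMeasurable (fun p : E3 × E3 => ‖v (p.1 - p.2) - v p.1‖ₑ) (volume.prod volume) :=
    ((aesm_sub hvm).sub hvm.comp_fst).enorm
  calc ∫⁻ x, ‖comm ρ v k x‖ₑ
      ≤ ∫⁻ x, ∫⁻ z, ‖fderiv ℝ (eta k) z‖ₑ * (‖ρ (x - z) - ρ x‖ₑ * ‖v (x - z) - v x‖ₑ) :=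
        lintegral_mono h1
    _ = ∫⁻ z, ∫⁻ x, ‖fderiv ℝ (eta k) z‖ₑ * (‖ρ (x - z) - ρ x‖ₑ * ‖v (x - z) - v x‖ₑ) := by
        rw [lintegral_lintegral_swap]
        exact (hdm.comp measurable_snd).aemeasurable.mul (m1.mul m2)
    _ ≤ ∫⁻ z, (om * γ) * (‖z‖ₑ * ‖fderiv ℝ (eta k) z‖ₑ) := by
        refine lintegral_mono fun z => ?_
        rw [lintegral_const_mul' _ _ enorm_ne_top]
        by_cases hz : ‖z‖ ≤ 2 / ((k : ℝ) + 1)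
        · have q := quasiMeasurePreserving_sub_of_right_invariant (volume : Measure E3) volume
          have n1 : AEMeasurable fun x => ‖ρ (x - z) - ρ x‖ₑ :=
            ((hρm.comp_quasiMeasurePreserving
              (measurePreserving_sub_right volume z).quasiMeasurePreserving).sub hρm).enorm
          have n2 : AEMeasurable fun x => ‖v (x - z) - v x‖ₑ :=
            ((hvm.comp_quasiMeasurePreserving
              (measurePreserving_sub_right volume z).quasiMeasurePreserving).sub hvm).enorm
          have hb : ∫⁻ x, ‖v (x - z) - v x‖ₑ ^ 2 ≤ (‖z‖ₑ * γ) ^ 2 := by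
            rw [mul_pow]; exact (h.translate_sub z).trans (mul_le_mul' le_rfl hγ)
          calc _ ≤ ‖fderiv ℝ (eta k) z‖ₑ * (om * (‖z‖ₑ * γ)) :=
                mul_le_mul' le_rfl (lintegral_mul_le_sqrt _ n1 n2 (hom z hz) hb)
            _ = _ := by ring
        · have hz0 : ‖fderiv ℝ (eta k) z‖ₑ = 0 := by
            rw [← ofReal_norm, deta_support k (not_le.1 hz), norm_zero, ENNReal.ofReal_zero]
          rw [hz0, zero_mul]; exact zero_le
    _ = etaMoment * om * γ := by
        have m3 : Measurable fun z : E3 => ‖z‖ₑ * ‖fderiv ℝ (eta k) z‖ₑ := measurable_enorm.mul hdm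
        rw [lintegral_const_mul _ m3, eta_moment]; ring

lemma exists_sq_eq (b : ℝ≥0∞) : ∃ a : ℝ≥0∞, a ^ 2 = b ∧ (b ≠ ⊤ → a ≠ ⊤) := by
  refine ⟨b ^ (1 / (2:ℝ)), ?_, fun h => ENNReal.rpow_ne_top_of_nonneg (by norm_num) h⟩
  rw [← ENNReal.rpow_natCast, ← ENNReal.rpow_mul]; norm_num

lemma lintegral_enorm_sq_lt_top {ψ : E3 → ℝ} (hψ : Continuous ψ) (hψc : HasCompactSupport ψ) :
    ∫⁻ x, ‖ψ x‖ₑ ^ 2 ≠ ⊤ := by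
  have hs : HasCompactSupport fun x => ψ x ^ 2 :=
    hψc.comp_left (g := fun t : ℝ => t ^ 2) (zero_pow two_ne_zero)
  have hi2 : Integrable fun x => ψ x ^ 2 :=
    Continuous.integrable_of_hasCompactSupport (by fun_prop) hs
  have := hi2.2
  simp only [HasFiniteIntegral, enorm_pow] at this
  exact this.ne

lemma tendsto_two_div : Tendsto (fun k : ℕ => ENNReal.ofReal (2 / ((k:ℝ) + 1))) atTop (𝓝 0) := by
  have t0 : Tendsto (fun k : ℕ => 2 / ((k : ℝ) + 1)) atTop (𝓝 0) :=
    tendsto_const_nhds.div_atTop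
      (tendsto_atTop_add_const_right _ _ tendsto_natCast_atTop_atTop)
  have t1 := (ENNReal.continuous_ofReal.tendsto 0).comp t0
  rw [ENNReal.ofReal_zero] at t1
  exact t1

lemma integral_mol_tendsto {f ψ : E3 → ℝ} (hf : LocallyIntegrable f) {C : ℝ≥0∞} (hC : C ≠ ⊤)
    (hfC : ∀ z : E3, ∫⁻ x, ‖f (x - z) - f x‖ₑ ^ 2 ≤ ‖z‖ₑ ^ 2 * C)
    (hψ : Continuous ψ) (hψc : HasCompactSupport ψ) :
    Tendsto (fun k : ℕ => ∫ x, mol f (eta k) x * ψ x) atTop (𝓝 (∫ x, f x * ψ x)) := by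
  obtain ⟨γ, hγ2, hγf⟩ := exists_sq_eq C
  obtain ⟨c, hc2, hcf⟩ := exists_sq_eq (∫⁻ x, ‖ψ x‖ₑ ^ 2)
  have hcf := hcf (lintegral_enorm_sq_lt_top hψ hψc)
  have hγf := hγf hC
  have hint : Integrable fun x => f x * ψ x := by
    simpa [mul_comm] using hf.integrable_smul_left_of_hasCompactSupport hψ hψc
  have hcont : ∀ k, Continuous (mol f (eta k)) := fun k =>
    mol_continuous hf (eta_smooth k).continuous (eta_cs k)
  have hintk : ∀ k, Integrable fun x => mol f (eta k) x * ψ x := fun k =>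
    ((hcont k).mul hψ).integrable_of_hasCompactSupport hψc.mul_left
  rw [tendsto_iff_edist_tendsto_0]
  have hb : ∀ k : ℕ, edist (∫ x, mol f (eta k) x * ψ x) (∫ x, f x * ψ x)
      ≤ (ENNReal.ofReal (2 / ((k:ℝ) + 1)) * γ) * c := by
    intro k
    rw [edist_eq_enorm_sub, ← integral_sub (hintk k) hint]
    refine (enorm_integral_le_lintegral_enorm _).trans ?_
    simp_rw [← sub_mul, enorm_mul]
    refine lintegral_mul_le_sqrt _ ?_ hψ.measurable.enorm.aemeasurable ?_ hc2.ge
    · exact ((hcont k).aestronglyMeasurable.sub hf.aestronglyMeasurable).enorm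
    · refine mol_sub_sq_le hf k fun z hz => (hfC z).trans ?_
      rw [mul_pow, hγ2]
      gcongr
      rw [← ofReal_norm]
      exact ENNReal.ofReal_le_ofReal hz
  refine tendsto_of_tendsto_of_tendsto_of_le_of_le tendsto_const_nhds ?_ (fun _ => zero_le) hb
  have t2 := ENNReal.Tendsto.mul_const (ENNReal.Tendsto.mul_const tendsto_two_div
    (Or.inr hγf)) (Or.inr hcf)
  simpa using t2

lemma enorm_apply_sq_le (z : E3) (i : Fin 3) : ‖z i‖ₑ ^ 2 ≤ ‖z‖ₑ ^ 2 := by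
  rw [enorm_sq_eq_sum z]
  exact Finset.single_le_sum (f := fun i => ‖z i‖ₑ ^ 2) (fun _ _ => zero_le) (Finset.mem_univ i)

/-- The weak form of `div v = 0` tested with a `C¹` function. -/
lemma GoodSlice.weak_div {v : E3 → E3} {H : Fin 3 → E3 → E3} (h : GoodSlice v H)
    (hfin : gradSq H ≠ ⊤) {φ : E3 → ℝ} (hφ : ContDiff ℝ 1 φ) (hφc : HasCompactSupport φ) :
    ∫ x, fderiv ℝ φ x (v x) = 0 := by
  have hli := fun i => LocallyIntegrable.comp_apply h.locInt i
  have hdc : ∀ i, Continuous fun x => fderiv ℝ φ x (basisVec i) := fun i =>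
    (hφ.continuous_fderiv one_ne_zero).clm_apply continuous_const
  have hds : ∀ i, HasCompactSupport fun x => fderiv ℝ φ x (basisVec i) := fun i =>
    (hφc.fderiv ℝ).comp_left (g := fun L : E3 →L[ℝ] ℝ => L (basisVec i)) rfl
  have hint : ∀ i, Integrable fun x => v x i * fderiv ℝ φ x (basisVec i) := fun i => by
    simpa [mul_comm] using (hli i).integrable_smul_left_of_hasCompactSupport (hdc i) (hds i)
  have hsm : ∀ i k, ContDiff ℝ ∞ (mol (fun y => v y i) (eta k)) := fun i k =>
    mol_contDiff (hli i) (eta_smooth k) (eta_cs k)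
  have hintk : ∀ k i, Integrable fun x =>
      mol (fun y => v y i) (eta k) x * fderiv ℝ φ x (basisVec i) := fun k i =>
    ((hsm i k).continuous.mul (hdc i)).integrable_of_hasCompactSupport (hds i).mul_left
  have hzero : ∀ k, ∑ i, ∫ x, mol (fun y => v y i) (eta k) x * fderiv ℝ φ x (basisVec i) = 0 := by
    intro k
    have hsm1 : ∀ i, ContDiff ℝ 1 (mol (fun y => v y i) (eta k)) := fun i =>
      (hsm i k).of_le (by exact_mod_cast le_top)
    have c1 : ∀ i, Integrable fun x =>
        fderiv ℝ (mol (fun y => v y i) (eta k)) x (basisVec i) * φ x := fun i =>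
      ((((hsm1 i).continuous_fderiv one_ne_zero).clm_apply continuous_const).mul
        hφ.continuous).integrable_of_hasCompactSupport hφc.mul_left
    have : ∀ i, ∫ x, mol (fun y => v y i) (eta k) x * fderiv ℝ φ x (basisVec i)
        = - ∫ x, fderiv ℝ (mol (fun y => v y i) (eta k)) x (basisVec i) * φ x := fun i => by
      refine integral_mul_fderiv_eq_neg_fderiv_mul_of_integrable (c1 i) (hintk k i) ?_
        (fun x _ => (hsm1 i).differentiable one_ne_zero x)
        (fun x _ => hφ.differentiable one_ne_zero x)
      exact ((hsm i k).continuous.mul hφ.continuous).integrable_of_hasCompactSupport hφc.mul_left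
    simp_rw [this]
    rw [Finset.sum_neg_distrib, ← integral_finsetSum _ fun i _ => c1 i]
    simp only [neg_eq_zero]
    refine integral_eq_zero_of_ae (Eventually.of_forall fun x => ?_)
    simp only [Pi.zero_apply]
    rw [← Finset.sum_mul]
    have : ∑ i, fderiv ℝ (mol (fun y => v y i) (eta k)) x (basisVec i) = 0 := by
      rw [← h.mol_div k x]
      exact Finset.sum_congr rfl fun i _ => mol_fderiv (hli i) (eta_smooth k) (eta_cs k) _ _
    rw [this, zero_mul]
  have hlim : ∀ i, Tendsto (fun k : ℕ => ∫ x, mol (fun y => v y i) (eta k) x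
      * fderiv ℝ φ x (basisVec i)) atTop (𝓝 (∫ x, v x i * fderiv ℝ φ x (basisVec i))) := by
    intro i
    refine integral_mol_tendsto (hli i) hfin (fun z => ?_) (hdc i) (hds i)
    refine le_trans (lintegral_mono fun x => ?_) (h.translate_sub z)
    exact enorm_apply_sq_le (v (x - z) - v x) i
  have hsum := tendsto_finsetSum Finset.univ fun i _ => hlim i
  simp_rw [hzero] at hsum
  have := tendsto_nhds_unique hsum tendsto_const_nhds
  simp_rw [fderiv_apply_sum φ _ (v _)]
  rw [integral_finsetSum _ fun i _ => hint i, this]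

/-! ### Slices of space-time functions -/

lemma eLpNorm_two_sq {α F : Type*} [MeasurableSpace α] [NormedAddCommGroup F] (ν : Measure α)
    (f : α → F) : eLpNorm f 2 ν ^ 2 = ∫⁻ x, ‖f x‖ₑ ^ 2 ∂ν := by
  have := eLpNorm_nnreal_pow_eq_lintegral (f := f) (μ := ν) (p := 2) two_ne_zero
  simpa using this

/-- Continuity in time of a family of `L^p` functions. -/
def TimeCont (T : ℝ) (ρ : ℝ → E3 → ℝ) (p : ℝ≥0∞) : Prop :=
  (∀ t ∈ Icc 0 T, MemLp (ρ t) p volume) ∧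
    ∀ s ∈ Icc 0 T, Tendsto (fun t => eLpNorm (ρ t - ρ s) p volume) (𝓝[Icc 0 T] s) (𝓝 0)

lemma TimeCont.continuous {T : ℝ} {ρ : ℝ → E3 → ℝ} {p : ℝ≥0∞} [Fact (1 ≤ p)]
    (h : TimeCont T ρ p) :
    Continuous fun t : Icc (0:ℝ) T => (h.1 t t.2).toLp (ρ t) := by
  rw [continuous_iff_continuousAt]
  intro s
  rw [ContinuousAt, tendsto_iff_edist_tendsto_0]
  have := h.2 s s.2
  rw [nhdsWithin_eq_map_subtype_coe s.2, tendsto_map'_iff] at this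
  refine this.congr fun t => ?_
  rw [Lp.edist_toLp_toLp]; rfl

lemma TimeCont.bounded {T : ℝ} {ρ : ℝ → E3 → ℝ} {p : ℝ≥0∞} (hp : 1 ≤ p)
    (h : TimeCont T ρ p) :
    ∃ C : ℝ≥0, ∀ t ∈ Icc 0 T, eLpNorm (ρ t) p ≤ C := by
  have : Fact (1 ≤ p) := ⟨hp⟩
  have hc := isCompact_univ.image h.continuous.nnnorm
  obtain ⟨C, hC⟩ := hc.bddAbove
  refine ⟨C, fun t ht => ?_⟩
  have := hC ⟨⟨t, ht⟩, mem_univ _, rfl⟩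
  have e := Lp.enorm_toLp (h.1 t ht)
  rw [← e, enorm_eq_nnnorm]
  exact_mod_cast this

lemma TimeCont.modulus {T : ℝ} {ρ : ℝ → E3 → ℝ} (h : TimeCont T ρ 2) {ε : ℝ≥0∞} (hε : 0 < ε) :
    ∃ δ : ℝ, 0 < δ ∧ ∀ t ∈ Icc 0 T, ∀ z : E3, ‖z‖ < δ →
      ∫⁻ x, ‖ρ t (x - z) - ρ t x‖ₑ ^ 2 ≤ ε ^ 2 := by
  have : Fact ((1:ℝ≥0∞) ≤ 2) := ⟨one_le_two⟩
  have : Fact ((2:ℝ≥0∞) ≠ ⊤) := ⟨by norm_num⟩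
  set F : Icc (0:ℝ) T → Lp ℝ 2 (volume : Measure E3) := fun t => (h.1 t t.2).toLp (ρ t) with hF
  have hFc : Continuous F := h.continuous
  set Φ : E3 × Icc (0:ℝ) T → ℝ≥0∞ := fun p =>
    edist (DomAddAct.mk (-p.1) +ᵥ F p.2) (F p.2) with hΦ
  have hΦc : Continuous Φ := by
    refine Continuous.edist ?_ (hFc.comp continuous_snd)
    have h1 : Continuous fun p : E3 × Icc (0:ℝ) T => DomAddAct.mk (-p.1) :=
      DomAddAct.continuous_mk.comp continuous_fst.neg
    exact h1.vadd (hFc.comp continuous_snd)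
  have hev : ∀ᶠ z in 𝓝 (0:E3), ∀ t ∈ (univ : Set (Icc (0:ℝ) T)), Φ (z, t) < ε := by
    refine isCompact_univ.eventually_forall_of_forall_eventually fun t _ => ?_
    have h0 : Φ (0, t) < ε := by simp [hΦ, hε]
    exact (hΦc.continuousAt.eventually (gt_mem_nhds h0))
  obtain ⟨δ, hδ, hb⟩ := Metric.eventually_nhds_iff.1 hev
  refine ⟨δ, hδ, fun t ht z hz => ?_⟩
  have h1 := hb (y := z) (by simpa using hz) ⟨t, ht⟩ (mem_univ _)
  simp only [hΦ, hF] at h1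
  rw [DomAddAct.mk_vadd_toLp, Lp.edist_toLp_toLp] at h1
  have h2 := pow_le_pow_left' h1.le 2
  rw [eLpNorm_two_sq] at h2
  refine le_trans (le_of_eq ?_) h2
  refine lintegral_congr fun x => ?_
  simp [sub_eq_add_neg, add_comm]

lemma ae_slice {T : ℝ} {F : ℝ × E3 → ℝ} (hF : Integrable F (slab T))
    (h : ∀ θ : ℝ → ℝ, ContDiff ℝ ∞ θ → HasCompactSupport θ → tsupport θ ⊆ Ioo 0 T →
      ∫ z, θ z.1 * F z ∂(slab T) = 0) :
    ∀ᵐ t ∂(volume.restrict (Ioo 0 T)), ∫ x, F (t, x) = 0 := by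
  have hm : IntegrableOn (fun t => ∫ x, F (t, x)) (Ioo 0 T) := hF.integral_prod_left
  have key := isOpen_Ioo.ae_eq_zero_of_integral_contDiff_smul_eq_zero (μ := volume)
    (U := Ioo 0 T) hm.locallyIntegrableOn ?_
  · rw [ae_restrict_iff' measurableSet_Ioo]; exact key
  intro θ hθ hθc hθs
  obtain ⟨C, hC⟩ := hθ.continuous.bounded_above_of_compact_support hθc
  have hi : Integrable (fun z : ℝ × E3 => θ z.1 * F z) (slab T) :=
    hF.bdd_mul (hθ.continuous.comp continuous_fst).aestronglyMeasurable
      (Eventually.of_forall fun z => hC z.1)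
  have h1 := h θ hθ hθc hθs
  rw [slab, integral_prod _ hi] at h1
  simp only [integral_const_mul] at h1
  rw [← h1, eq_comm]
  refine setIntegral_eq_integral_of_forall_compl_eq_zero fun x hx => ?_
  rw [image_eq_zero_of_notMem_tsupport (fun hm => hx (hθs hm)), zero_mul]

lemma isTest_smul {F : Type*} [NormedAddCommGroup F] [NormedSpace ℝ F] {I : Set ℝ}
    {θ : ℝ → ℝ} {φ : E3 → F} (hθ : ContDiff ℝ ∞ θ) (hθc : HasCompactSupport θ)
    (hθs : tsupport θ ⊆ I) (hφ : ContDiff ℝ ∞ φ) (hφc : HasCompactSupport φ) :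
    IsTest I fun t x => θ t • φ x := by
  have hsub : tsupport (Function.uncurry fun t x => θ t • φ x) ⊆ tsupport θ ×ˢ tsupport φ := by
    refine closure_minimal ?_ ((isClosed_tsupport _).prod (isClosed_tsupport _))
    rintro ⟨t, x⟩ hz
    simp only [Function.mem_support, Function.uncurry_apply_pair] at hz
    exact ⟨subset_tsupport _ fun h => hz (by simp [h]), subset_tsupport _ fun h => hz (by simp [h])⟩
  refine ⟨?_, ?_, hsub.trans (prod_mono hθs (subset_univ _))⟩
  · exact (hθ.comp contDiff_fst).smul (hφ.comp contDiff_snd)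
  · exact (hθc.isCompact.prod hφc.isCompact).of_isClosed_subset (isClosed_tsupport _) hsub

instance holderTriple_six : ENNReal.HolderTriple (6 / 5) 6 1 := ⟨by
  rw [ENNReal.inv_div (by simp) (by simp), inv_one]
  rw [div_eq_mul_inv, ← add_one_mul]
  norm_num
  exact ENNReal.mul_inv_cancel (by norm_num) (by norm_num)⟩

lemma one_le_six_fifths : (1:ℝ≥0∞) ≤ 6 / 5 := by
  rw [ENNReal.le_div_iff_mul_le (by simp) (by simp)]; norm_num

lemma velocity_decay_one {T : ℝ} {u : ℝ → E3 → E3}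
    (hdec : ∫⁻ t in Ioo 0 T, eLpNorm (u t) 6 volume ^ 2 < ⊤) :
    ∫⁻ t in Ioo 0 T, eLpNorm (u t) 6 volume < ⊤ := by
  have h1 : ∀ a : ℝ≥0∞, a ≤ 1 + a ^ 2 := fun a => by
    rcases le_total a 1 with h | h
    · exact h.trans le_self_add
    · calc a = a * 1 := (mul_one a).symm
        _ ≤ a * a := by gcongr
        _ = a ^ 2 := (sq a).symm
        _ ≤ _ := le_add_self
  refine (lintegral_mono fun t => h1 _).trans_lt ?_
  rw [lintegral_add_left measurable_const]
  refine ENNReal.add_lt_top.2 ⟨?_, hdec⟩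
  simp [ENNReal.ofReal_lt_top]

lemma lintegral_smul_le_six {v : E3 → E3} {a : E3 → ℝ} (hv : AEStronglyMeasurable v)
    (ha : AEStronglyMeasurable a) :
    ∫⁻ x, ‖a x • v x‖ₑ ≤ eLpNorm a (6 / 5) * eLpNorm v 6 := by
  have h : eLpNorm (a • v) 1 volume ≤ _ := eLpNorm_smul_le_mul_eLpNorm (p := 6 / 5) (q := 6) hv ha
  rw [eLpNorm_one_eq_lintegral_enorm] at h
  exact h

/-- Products of the velocity with functions bounded in `L^{6/5}` are integrable. -/
lemma integrable_smul_velocity {T : ℝ} {u : ℝ → E3 → E3} {a : ℝ → E3 → ℝ}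
    (hu : AEStronglyMeasurable (Function.uncurry u) (slab T))
    (hdec : ∫⁻ t in Ioo 0 T, eLpNorm (u t) 6 volume ^ 2 < ⊤)
    (ha : AEStronglyMeasurable (Function.uncurry a) (slab T)) (C : ℝ≥0)
    (haC : ∀ t ∈ Ioo 0 T, eLpNorm (a t) (6 / 5) ≤ C) :
    Integrable (fun z : ℝ × E3 => a z.1 z.2 • u z.1 z.2) (slab T) := by
  have hm : AEStronglyMeasurable (fun z : ℝ × E3 => a z.1 z.2 • u z.1 z.2) (slab T) := ha.smul hu
  refine ⟨hm, ?_⟩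
  rw [HasFiniteIntegral, slab, lintegral_prod _ hm.enorm]
  have hus := hu.prodMk_left
  have has := ha.prodMk_left
  have h1 : ∫⁻ t in Ioo 0 T, ∫⁻ x, ‖a t x • u t x‖ₑ
      ≤ ∫⁻ t in Ioo 0 T, C * eLpNorm (u t) 6 volume := by
    refine lintegral_mono_ae ?_
    filter_upwards [hus, has, ae_restrict_mem measurableSet_Ioo] with t h1 h2 ht
    exact (lintegral_smul_le_six h1 h2).trans (mul_le_mul' (haC t ht) le_rfl)
  rw [lintegral_const_mul' _ _ ENNReal.coe_ne_top] at h1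
  exact h1.trans_lt (ENNReal.mul_lt_top ENNReal.coe_lt_top (velocity_decay_one hdec))

lemma integrable_test_velocity {T : ℝ} {u : ℝ → E3 → E3}
    (hu : AEStronglyMeasurable (Function.uncurry u) (slab T))
    (hdec : ∫⁻ t in Ioo 0 T, eLpNorm (u t) 6 volume ^ 2 < ⊤)
    {ψ : E3 → ℝ} (hψ : Continuous ψ) (hψc : HasCompactSupport ψ) :
    Integrable (fun z : ℝ × E3 => ψ z.2 • u z.1 z.2) (slab T) := by
  have hmem : MemLp ψ (6 / 5) := hψ.memLp_of_hasCompactSupport hψc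
  refine integrable_smul_velocity hu hdec (a := fun _ => ψ)
    (hψ.comp continuous_snd).aestronglyMeasurable (eLpNorm ψ (6 / 5)).toNNReal fun t _ => ?_
  rw [ENNReal.coe_toNNReal hmem.2.ne]

/-- The velocity of a weak solution has good slices at almost every time. -/
lemma ae_goodSlice {T : ℝ} {u : ℝ → E3 → E3} {G : Fin 3 → ℝ → E3 → E3}
    (hu : AEStronglyMeasurable (Function.uncurry u) (slab T))
    (hdec : ∫⁻ t in Ioo 0 T, eLpNorm (u t) 6 volume ^ 2 < ⊤)
    (hG : ∀ j, MemLp (Function.uncurry (G j)) 2 (slab T))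
    (hgrad : IsWeakGrad T u G) (htr : ∀ᵐ z ∂(slab T), ∑ i, G i z.1 z.2 i = 0) :
    ∀ᵐ t ∂(volume.restrict (Ioo 0 T)), GoodSlice (u t) fun j => G j t := by
  have hus := hu.prodMk_left
  have hfin : ∀ᵐ t ∂(volume.restrict (Ioo 0 T)), eLpNorm (u t) 6 volume < ⊤ := by
    have hm : ∀ᵐ t ∂(volume.restrict (Ioo 0 T)), ∫⁻ x, ‖u t x‖ₑ ^ (6:ℝ) < ⊤ := by
      have hmeas : AEMeasurable (fun t => ∫⁻ x, ‖u t x‖ₑ ^ (6:ℝ)) (volume.restrict (Ioo 0 T)) :=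
        (hu.enorm.pow_const (6:ℝ)).lintegral_prod_right'
      have e : ∀ t, eLpNorm (u t) 6 volume ^ 2 = (∫⁻ x, ‖u t x‖ₑ ^ (6:ℝ)) ^ (1 / 3 : ℝ) := by
        intro t
        rw [eLpNorm_eq_lintegral_rpow_enorm_toReal (by norm_num) (by norm_num),
          ← ENNReal.rpow_natCast, ← ENNReal.rpow_mul]
        norm_num
      simp_rw [e] at hdec
      filter_upwards [ae_lt_top' (hmeas.pow_const _) hdec.ne] with t ht
      exact (ENNReal.rpow_lt_top_iff_of_pos (by norm_num)).1 ht
    filter_upwards [hm] with t ht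
    rw [eLpNorm_eq_lintegral_rpow_enorm_toReal (by norm_num) (by norm_num)]
    refine ENNReal.rpow_lt_top_of_nonneg (by norm_num) ?_
    simpa using ht.ne
  have hGs : ∀ᵐ t ∂(volume.restrict (Ioo 0 T)), ∀ j, MemLp (G j t) 2 := by
    rw [ae_all_iff]
    intro j
    have hm := (hG j).1.prodMk_left
    have h2 : ∫⁻ z, ‖Function.uncurry (G j) z‖ₑ ^ 2 ∂(slab T) < ⊤ := by
      rw [← eLpNorm_two_sq]; exact ENNReal.pow_lt_top (hG j).2
    rw [slab, lintegral_prod _ ((hG j).1.enorm.pow_const 2)] at h2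
    filter_upwards [hm, ae_lt_top' ((hG j).1.enorm.pow_const 2).lintegral_prod_right' h2.ne]
      with t h1 h3
    refine ⟨h1, ?_⟩
    have : eLpNorm (G j t) 2 volume ^ 2 < ⊤ := by rw [eLpNorm_two_sq]; exact h3
    exact (ENNReal.pow_lt_top_iff (n := 2)).1 this |>.resolve_right (by norm_num)
  have htr' := Measure.ae_ae_of_ae_prod htr
  have hgr : ∀ᵐ t ∂(volume.restrict (Ioo 0 T)), ∀ k n : ℕ, ∀ i j : Fin 3,
      mol (fun y => u t y i) (fun z => fderiv ℝ (eta k) z (basisVec j))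
        (TopologicalSpace.denseSeq E3 n)
      = mol (fun y => G j t y i) (eta k) (TopologicalSpace.denseSeq E3 n) := by
    simp only [ae_all_iff]
    intro k n i j
    set y := TopologicalSpace.denseSeq E3 n
    set φ : E3 → ℝ := fun x => eta k (y - x) with hφ
    have hφs : ContDiff ℝ ∞ φ := (eta_smooth k).comp (contDiff_const.sub contDiff_id)
    have hφc : HasCompactSupport φ := (eta_cs k).comp_homeomorph (Homeomorph.subLeft y)
    have hφd : ∀ x, fderiv ℝ φ x (basisVec j) = - fderiv ℝ (eta k) (y - x) (basisVec j) :=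
      fun x => fderiv_comp_const_sub (eta_smooth k) y x _
    have hdc : Continuous fun x => fderiv ℝ φ x (basisVec j) :=
      (hφs.continuous_fderiv (by simp)).clm_apply continuous_const
    have hds : HasCompactSupport fun x => fderiv ℝ φ x (basisVec j) :=
      (hφc.fderiv ℝ).comp_left (g := fun L : E3 →L[ℝ] ℝ => L (basisVec j)) rfl
    have i1 : Integrable (fun z : ℝ × E3 => u z.1 z.2 i * fderiv ℝ φ z.2 (basisVec j))
        (slab T) := by
      have := (EuclideanSpace.proj (𝕜 := ℝ) i).integrable_comp
        (integrable_test_velocity hu hdec hdc hds)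
      refine this.congr (Eventually.of_forall fun z => ?_)
      simp [mul_comm]
    have i2 : Integrable (fun z : ℝ × E3 => G j z.1 z.2 i * φ z.2) (slab T) := by
      have hφ2 : MemLp (fun z : ℝ × E3 => φ z.2) 2 (slab T) := by
        refine ⟨(hφs.continuous.comp continuous_snd).aestronglyMeasurable, ?_⟩
        have : eLpNorm (fun z : ℝ × E3 => φ z.2) 2 (slab T) ^ 2 < ⊤ := by
          have hm : Measurable fun z : ℝ × E3 => ‖φ z.2‖ₑ ^ 2 :=
            (hφs.continuous.comp continuous_snd).measurable.enorm.pow_const 2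
          rw [eLpNorm_two_sq, slab, lintegral_prod _ hm.aemeasurable]
          simp only [lintegral_const]
          refine ENNReal.mul_lt_top (lintegral_enorm_sq_lt_top hφs.continuous hφc).lt_top ?_
          simp
        exact (ENNReal.pow_lt_top_iff (n := 2)).1 this |>.resolve_right (by norm_num)
      have hGi : MemLp (fun z : ℝ × E3 => G j z.1 z.2 i) 2 (slab T) :=
        (hG j).of_le (aesm_apply (hG j).1 i)
          (Eventually.of_forall fun z => PiLp.norm_apply_le _ _)
      exact hGi.integrable_mul hφ2
    have hsl := ae_slice (i1.add i2) ?_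
    · have s1 := i1.prod_right_ae
      have s2 := i2.prod_right_ae
      filter_upwards [hsl, s1, s2] with t ht h1 h2
      simp only [Pi.add_apply] at ht
      rw [integral_add h1 h2] at ht
      simp only [hφd, mul_neg, integral_neg] at ht
      simp only [mol]
      simp only [hφ] at ht
      linarith
    · intro θ hθ hθc hθs
      have h1 := hgrad (fun t x => θ t • φ x) (isTest_smul hθ hθc hθs hφs hφc) i j
      have hd : ∀ z : ℝ × E3, fderiv ℝ (fun x => θ z.1 * φ x) z.2 (basisVec j)
          = θ z.1 * fderiv ℝ φ z.2 (basisVec j) := by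
        intro z
        have hh : DifferentiableAt ℝ φ z.2 := hφs.differentiable (by simp) z.2
        rw [fderiv_const_mul hh]; simp
      simp only [smul_eq_mul, hd] at h1
      obtain ⟨C, hC⟩ := hθ.continuous.bounded_above_of_compact_support hθc
      have hθm : AEStronglyMeasurable (fun z : ℝ × E3 => θ z.1) (slab T) :=
        (hθ.continuous.comp continuous_fst).aestronglyMeasurable
      have j1 := i1.bdd_mul hθm (Eventually.of_forall fun z => hC z.1)
      have j2 := i2.bdd_mul hθm (Eventually.of_forall fun z => hC z.1)
      have e : ∀ z : ℝ × E3, θ z.1 * (((fun z : ℝ × E3 => u z.1 z.2 i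
            * fderiv ℝ φ z.2 (basisVec j)) + fun z : ℝ × E3 => G j z.1 z.2 i * φ z.2) z)
          = θ z.1 * (u z.1 z.2 i * fderiv ℝ φ z.2 (basisVec j))
            + θ z.1 * (G j z.1 z.2 i * φ z.2) := fun z => by
        simp only [Pi.add_apply]; ring
      simp_rw [e]
      rw [integral_add j1 j2]
      have e1 : ∫ z, u z.1 z.2 i * (θ z.1 * fderiv ℝ φ z.2 (basisVec j)) ∂(slab T)
          = ∫ z, θ z.1 * (u z.1 z.2 i * fderiv ℝ φ z.2 (basisVec j)) ∂(slab T) :=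
        integral_congr_ae (Eventually.of_forall fun z => by ring)
      have e2 : ∫ z, G j z.1 z.2 i * (θ z.1 * φ z.2) ∂(slab T)
          = ∫ z, θ z.1 * (G j z.1 z.2 i * φ z.2) ∂(slab T) :=
        integral_congr_ae (Eventually.of_forall fun z => by ring)
      rw [e1, e2] at h1
      linarith
  filter_upwards [hus, hfin, hGs, htr', hgr] with t h1 h2 h3 h4 h5
  refine ⟨⟨h1, h2⟩, h3, fun k x i j => ?_, h4⟩
  have hul : LocallyIntegrable (u t) := MemLp.locallyIntegrable ⟨h1, h2⟩ one_le_six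
  have c1 : Continuous (mol (fun y => u t y i) (fun z => fderiv ℝ (eta k) z (basisVec j))) :=
    mol_continuous (LocallyIntegrable.comp_apply hul i) (deta_cont k _) (deta_cs k _)
  have c2 : Continuous (mol (fun y => G j t y i) (eta k)) :=
    mol_continuous (LocallyIntegrable.comp_apply ((h3 j).locallyIntegrable one_le_two) i)
      (eta_smooth k).continuous (eta_cs k)
  have := c1.ext_on (TopologicalSpace.denseRange_denseSeq E3) c2 (by
    rintro _ ⟨n, rfl⟩; exact h5 k n i j)
  exact congrFun this x

/-! ### Transport by a divergence-free Sobolev velocity -/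

/-- A density transported by a divergence-free velocity with square integrable gradient. -/
structure Transport (T : ℝ) (ρ₀ : E3 → ℝ) (ρ : ℝ → E3 → ℝ) (u : ℝ → E3 → E3)
    (G : Fin 3 → ℝ → E3 → E3) : Prop where
  pos : 0 < T
  rho0 : LocallyIntegrable ρ₀
  ρm : AEStronglyMeasurable (Function.uncurry ρ) (slab T)
  um : AEStronglyMeasurable (Function.uncurry u) (slab T)
  cont : ∀ p : ℝ≥0∞, 1 ≤ p → p ≠ ⊤ → TimeCont T ρ p
  decay : ∫⁻ t in Ioo 0 T, eLpNorm (u t) 6 volume ^ 2 < ⊤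
  gradMem : ∀ j, MemLp (Function.uncurry (G j)) 2 (slab T)
  grad : IsWeakGrad T u G
  trace : ∀ᵐ z ∂(slab T), ∑ i, G i z.1 z.2 i = 0
  mass : ∀ φ : ℝ → E3 → ℝ, IsTest (Iio T) φ →
    (∫ z, (ρ z.1 z.2 * deriv (fun s => φ s z.2) z.1
        + ρ z.1 z.2 * fderiv ℝ (φ z.1) z.2 (u z.1 z.2)) ∂(slab T))
      + (∫ x, ρ₀ x * φ 0 x) = 0

lemma TimeCont.continuousOn_integral {T : ℝ} {ρ : ℝ → E3 → ℝ} (h : TimeCont T ρ 1)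
    {φ : E3 → ℝ} (hφ : AEStronglyMeasurable φ) {C : ℝ} (hC : ∀ x, ‖φ x‖ ≤ C) :
    ContinuousOn (fun t => ∫ x, ρ t x * φ x) (Icc 0 T) := by
  intro s hs
  have hint : ∀ t ∈ Icc 0 T, Integrable fun x => ρ t x * φ x := fun t ht => by
    have := ((memLp_one_iff_integrable.1 (h.1 t ht)).bdd_mul hφ (Eventually.of_forall hC))
    simpa [mul_comm] using this
  rw [ContinuousWithinAt, tendsto_iff_edist_tendsto_0]
  have hb : ∀ t ∈ Icc 0 T, edist (∫ x, ρ t x * φ x) (∫ x, ρ s x * φ x)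
      ≤ eLpNorm (ρ t - ρ s) 1 volume * ENNReal.ofReal C := by
    intro t ht
    rw [edist_eq_enorm_sub, ← integral_sub (hint t ht) (hint s hs),
      eLpNorm_one_eq_lintegral_enorm, ← lintegral_mul_const' _ _ ENNReal.ofReal_ne_top]
    refine (enorm_integral_le_lintegral_enorm _).trans (lintegral_mono fun x => ?_)
    rw [← sub_mul, enorm_mul]
    gcongr
    · rfl
    · rw [← ofReal_norm]; exact ENNReal.ofReal_le_ofReal (hC x)
  have hlim := ENNReal.Tendsto.mul_const (b := ENNReal.ofReal C) (h.2 s hs)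
    (Or.inr ENNReal.ofReal_ne_top)
  rw [zero_mul] at hlim
  refine tendsto_of_tendsto_of_tendsto_of_le_of_le' tendsto_const_nhds hlim
    (Eventually.of_forall fun _ => zero_le) ?_
  filter_upwards [self_mem_nhdsWithin] with t ht using hb t ht

lemma lintegral_slab {T : ℝ} {F : ℝ × E3 → ℝ≥0∞} (hF : AEMeasurable F (slab T)) :
    ∫⁻ z, F z ∂(slab T) = ∫⁻ t in Ioo 0 T, ∫⁻ x, F (t, x) :=
  lintegral_prod _ hF

lemma slab_ae_fst {T : ℝ} {P : ℝ → Prop} (h : ∀ᵐ t ∂(volume.restrict (Ioo 0 T)), P t) :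
    ∀ᵐ z ∂(slab T), P z.1 :=
  (Measure.quasiMeasurePreserving_fst (ν := (volume : Measure E3))).ae h

lemma slab_mono {s T : ℝ} (h : s ≤ T) : slab s ≤ slab T :=
  Measure.prod_mono (Measure.restrict_mono (Ioo_subset_Ioo le_rfl h) le_rfl) le_rfl

lemma qmp_drop {α : Type*} [MeasurableSpace α] (ν : Measure α) [SFinite ν] :
    Measure.QuasiMeasurePreserving (fun p : (α × E3) × E3 => (p.1.1, p.2))
      ((ν.prod volume).prod volume) (ν.prod volume) := by
  refine ⟨by fun_prop, Measure.AbsolutelyContinuous.mk fun s hs h0 => ?_⟩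
  have hm : Measurable fun p : (α × E3) × E3 => (p.1.1, p.2) := by fun_prop
  rw [Measure.map_apply hm hs, Measure.measure_prod_null (hm hs)]
  have h1 := (Measure.measure_prod_null hs).1 h0
  have h2 := Measure.quasiMeasurePreserving_fst (μ := ν) (ν := (volume : Measure E3)) |>.ae h1
  filter_upwards [h2] with p hp
  exact hp

namespace Transport

variable {T : ℝ} {ρ₀ : E3 → ℝ} {ρ : ℝ → E3 → ℝ} {u : ℝ → E3 → E3} {G : Fin 3 → ℝ → E3 → E3}

lemma cont1 (h : Transport T ρ₀ ρ u G) : TimeCont T ρ 1 := h.cont 1 le_rfl (by simp)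
lemma cont2 (h : Transport T ρ₀ ρ u G) : TimeCont T ρ 2 := h.cont 2 one_le_two (by simp)

lemma integrable_slice (h : Transport T ρ₀ ρ u G) {t : ℝ} (ht : t ∈ Icc 0 T) :
    Integrable (ρ t) := memLp_one_iff_integrable.1 (h.cont1.1 t ht)

lemma flux_integrable (h : Transport T ρ₀ ρ u G) :
    Integrable (fun z : ℝ × E3 => ρ z.1 z.2 • u z.1 z.2) (slab T) := by
  obtain ⟨C, hC⟩ := (h.cont (6 / 5) one_le_six_fifths
    (ENNReal.div_ne_top (by simp) (by simp))).bounded one_le_six_fifths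
  exact integrable_smul_velocity h.um h.decay h.ρm C fun t ht => hC t (Ioo_subset_Icc_self ht)

lemma flux_test_integrable (h : Transport T ρ₀ ρ u G) {φ : E3 → ℝ} (hφ : ContDiff ℝ 1 φ)
    (hφc : HasCompactSupport φ) :
    Integrable (fun z : ℝ × E3 => ρ z.1 z.2 * fderiv ℝ φ z.2 (u z.1 z.2)) (slab T) := by
  obtain ⟨C, hC⟩ := (hφ.continuous_fderiv one_ne_zero).bounded_above_of_compact_support
    (hφc.fderiv ℝ)
  have hm : AEStronglyMeasurable (fun z : ℝ × E3 => fderiv ℝ φ z.2 (ρ z.1 z.2 • u z.1 z.2))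
      (slab T) :=
    aesm_clm_apply
      ((hφ.continuous_fderiv one_ne_zero).comp continuous_snd).aestronglyMeasurable
      h.flux_integrable.1
  refine (h.flux_integrable.norm.const_mul C).mono' ?_ ?_
  · refine hm.congr (Eventually.of_forall fun z => by simp)
  · refine Eventually.of_forall fun z => ?_
    have := (fderiv ℝ φ z.2).le_opNorm (ρ z.1 z.2 • u z.1 z.2)
    rw [map_smul, smul_eq_mul] at this
    exact this.trans (by gcongr; exact hC _)

lemma mass_slice (h : Transport T ρ₀ ρ u G) {φ : E3 → ℝ} (hφ : ContDiff ℝ ∞ φ)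
    (hφc : HasCompactSupport φ) {t : ℝ} (ht : t ∈ Icc 0 T) :
    ∫ x, ρ t x * φ x = (∫ x, ρ₀ x * φ x)
      + ∫ τ in (0:ℝ)..t, ∫ x, ρ τ x * fderiv ℝ φ x (u τ x) := by
  have hφ1 : ContDiff ℝ 1 φ := hφ.of_le (by exact_mod_cast le_top)
  have hT := h.pos
  obtain ⟨C, hC⟩ := hφ.continuous.bounded_above_of_compact_support hφc
  have hMc := h.cont1.continuousOn_integral hφ.continuous.aestronglyMeasurable hC
  have hMi : IntegrableOn (fun t => ∫ x, ρ t x * φ x) (Ioo 0 T) :=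
    (hMc.integrableOn_compact isCompact_Icc).mono_set Ioo_subset_Icc_self
  have hF := h.flux_test_integrable hφ1 hφc
  have hg : IntegrableOn (fun τ => ∫ x, ρ τ x * fderiv ℝ φ x (u τ x)) (Ioo 0 T) :=
    hF.integral_prod_left
  obtain ⟨C1, hC1⟩ := h.cont1.bounded le_rfl
  have hρi : Integrable (fun z : ℝ × E3 => ρ z.1 z.2) (slab T) := by
    refine ⟨h.ρm, ?_⟩
    have hm : AEMeasurable (fun z : ℝ × E3 => ‖ρ z.1 z.2‖ₑ) (slab T) := h.ρm.enorm
    rw [HasFiniteIntegral, lintegral_slab hm]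
    calc ∫⁻ t in Ioo 0 T, ∫⁻ x, ‖ρ t x‖ₑ ≤ ∫⁻ t in Ioo 0 T, (C1 : ℝ≥0∞) := by
          refine setLIntegral_mono measurable_const fun t ht => ?_
          rw [← eLpNorm_one_eq_lintegral_enorm]
          exact hC1 t (Ioo_subset_Icc_self ht)
      _ < ⊤ := by simp [ENNReal.mul_lt_top_iff]
  have hρφ : Integrable (fun z : ℝ × E3 => ρ z.1 z.2 * φ z.2) (slab T) := by
    have := hρi.bdd_mul (hφ.continuous.comp continuous_snd).aestronglyMeasurable
      (Eventually.of_forall fun z => hC z.2)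
    simpa [mul_comm] using this
  have key := ae_eq_primitive hT hMi hg (∫ x, ρ₀ x * φ x) ?_
  · have hac : ContinuousOn (fun t => (∫ x, ρ₀ x * φ x)
        + ∫ τ in (0:ℝ)..t, ∫ x, ρ τ x * fderiv ℝ φ x (u τ x)) (Icc 0 T) := by
      refine continuousOn_const.add ?_
      have := intervalIntegral.continuousOn_primitive_interval (μ := volume)
        (f := fun τ => ∫ x, ρ τ x * fderiv ℝ φ x (u τ x)) (a := 0) (b := T)
        (by rw [uIcc_of_le hT.le, integrableOn_Icc_iff_integrableOn_Ioo]; exact hg)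
      rwa [uIcc_of_le hT.le] at this
    have key' : (fun t => ∫ x, ρ t x * φ x) =ᵐ[volume.restrict (Icc 0 T)] fun t =>
        (∫ x, ρ₀ x * φ x) + ∫ τ in (0:ℝ)..t, ∫ x, ρ τ x * fderiv ℝ φ x (u τ x) := by
      rw [Measure.restrict_congr_set Ioo_ae_eq_Icc.symm]; exact key
    exact Measure.eqOn_Icc_of_ae_eq volume hT.ne key' hMc hac ht
  · intro θ hθ hθc hθs
    have hm := h.mass (fun t x => θ t • φ x) (isTest_smul hθ hθc hθs hφ hφc)
    have hd1 : ∀ z : ℝ × E3, deriv (fun s => θ s * φ z.2) z.1 = deriv θ z.1 * φ z.2 := fun z =>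
      deriv_mul_const ((hθ.differentiable (by simp)) _) _
    have hd2 : ∀ z : ℝ × E3, fderiv ℝ (fun x => θ z.1 * φ x) z.2 (u z.1 z.2)
        = θ z.1 * fderiv ℝ φ z.2 (u z.1 z.2) := fun z => by
      have hh : DifferentiableAt ℝ φ z.2 := hφ.differentiable (by simp) z.2
      rw [fderiv_const_mul hh]; simp
    simp only [smul_eq_mul, hd1, hd2] at hm
    obtain ⟨Cθ, hCθ⟩ := hθ.continuous.bounded_above_of_compact_support hθc
    have hθ' : Continuous (deriv θ) := hθ.continuous_deriv (by simp)
    obtain ⟨Cθ', hCθ'⟩ := hθ'.bounded_above_of_compact_support hθc.deriv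
    have j1 : Integrable (fun z : ℝ × E3 => deriv θ z.1 * (ρ z.1 z.2 * φ z.2)) (slab T) :=
      hρφ.bdd_mul (hθ'.comp continuous_fst).aestronglyMeasurable
        (Eventually.of_forall fun z => hCθ' z.1)
    have j2 : Integrable (fun z : ℝ × E3 => θ z.1 * (ρ z.1 z.2 * fderiv ℝ φ z.2 (u z.1 z.2)))
        (slab T) :=
      hF.bdd_mul (hθ.continuous.comp continuous_fst).aestronglyMeasurable
        (Eventually.of_forall fun z => hCθ z.1)
    have e : ∀ z : ℝ × E3, ρ z.1 z.2 * (deriv θ z.1 * φ z.2)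
        + ρ z.1 z.2 * (θ z.1 * fderiv ℝ φ z.2 (u z.1 z.2))
        = deriv θ z.1 * (ρ z.1 z.2 * φ z.2)
          + θ z.1 * (ρ z.1 z.2 * fderiv ℝ φ z.2 (u z.1 z.2)) := fun z => by ring
    simp_rw [e] at hm
    rw [integral_add j1 j2, slab, integral_prod _ j1, integral_prod _ j2] at hm
    simp only [integral_const_mul] at hm
    have e3 : ∫ x, ρ₀ x * (θ 0 * φ x) = θ 0 * ∫ x, ρ₀ x * φ x := by
      rw [← integral_const_mul]
      exact integral_congr_ae (Eventually.of_forall fun x => by ring)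
    rw [e3] at hm
    exact hm

lemma initial (h : Transport T ρ₀ ρ u G) : ρ 0 =ᵐ[volume] ρ₀ := by
  have h0 : (0:ℝ) ∈ Icc 0 T := ⟨le_rfl, h.pos.le⟩
  refine ae_eq_of_integral_contDiff_smul_eq (h.integrable_slice h0).locallyIntegrable h.rho0
    fun g hg hgc => ?_
  have := h.mass_slice hg hgc h0
  simp only [intervalIntegral.integral_same, add_zero] at this
  simpa [mul_comm] using this

lemma ae_slices (h : Transport T ρ₀ ρ u G) :
    ∀ᵐ t ∂(volume.restrict (Ioo 0 T)), GoodSlice (u t) fun j => G j t :=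
  ae_goodSlice h.um h.decay h.gradMem h.grad h.trace

lemma lintegral_gradSq (h : Transport T ρ₀ ρ u G) :
    ∫⁻ t in Ioo 0 T, gradSq (fun j => G j t) = ∑ j, ∫⁻ z, ‖G j z.1 z.2‖ₑ ^ 2 ∂(slab T) := by
  have hm : ∀ j, AEMeasurable (fun z : ℝ × E3 => ‖G j z.1 z.2‖ₑ ^ 2) (slab T) := fun j =>
    (h.gradMem j).1.enorm.pow_const 2
  have hm' : ∀ j, AEMeasurable (fun t => ∫⁻ x, ‖G j t x‖ₑ ^ 2) (volume.restrict (Ioo 0 T)) :=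
    fun j => (hm j).lintegral_prod_right'
  simp only [gradSq]
  rw [lintegral_finsetSum' _ fun j _ => hm' j]
  exact Finset.sum_congr rfl fun j _ => (lintegral_slab (hm j)).symm

lemma lintegral_gradSq_lt_top (h : Transport T ρ₀ ρ u G) :
    ∫⁻ t in Ioo 0 T, gradSq (fun j => G j t) < ⊤ := by
  rw [h.lintegral_gradSq]
  refine ENNReal.sum_lt_top.2 fun j _ => ?_
  have := eLpNorm_two_sq (slab T) (Function.uncurry (G j))
  simp only [Function.uncurry] at this
  rw [← this]
  exact ENNReal.pow_lt_top (h.gradMem j).2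

lemma gradSq_aemeas (h : Transport T ρ₀ ρ u G) :
    AEMeasurable (fun t => gradSq fun j => G j t) (volume.restrict (Ioo 0 T)) :=
  Finset.aemeasurable_fun_sum _ fun j _ =>
    ((h.gradMem j).1.enorm.pow_const 2).lintegral_prod_right'

end Transport

/-! ### Renormalisation -/

lemma integral_slab {T : ℝ} {F : ℝ × E3 → ℝ} (hF : Integrable F (slab T)) :
    ∫ z, F z ∂(slab T) = ∫ t in Ioo 0 T, ∫ x, F (t, x) :=
  integral_prod _ hF

lemma ENNReal_le_one_add_sq (a : ℝ≥0∞) : a ≤ 1 + a ^ 2 := by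
  rcases le_total a 1 with h | h
  · exact h.trans le_self_add
  · calc a = a * 1 := (mul_one a).symm
      _ ≤ a * a := by gcongr
      _ = a ^ 2 := (sq a).symm
      _ ≤ _ := le_add_self

lemma sqrt_le_one_add {a b : ℝ≥0∞} (h : a ^ 2 = b) : a ≤ 1 + b := h ▸ ENNReal_le_one_add_sq a

namespace Transport

variable {T : ℝ} {ρ₀ : E3 → ℝ} {ρ : ℝ → E3 → ℝ} {u : ℝ → E3 → E3} {G : Fin 3 → ℝ → E3 → E3}

/-- The mollified flux `div (ρ u) ⋆ η_k`. -/
def mflux (ρ : ℝ → E3 → ℝ) (u : ℝ → E3 → E3) (k : ℕ) (τ : ℝ) (x : E3) : ℝ :=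
  ∫ y, ρ τ y * fderiv ℝ (eta k) (x - y) (u τ y)

lemma mol_evolution (h : Transport T ρ₀ ρ u G) (k : ℕ) (x : E3) {t : ℝ} (ht : t ∈ Icc 0 T) :
    mol (ρ t) (eta k) x = mol (ρ 0) (eta k) x + ∫ τ in (0:ℝ)..t, - mflux ρ u k τ x := by
  set φ : E3 → ℝ := fun y => eta k (x - y) with hφ
  have hφs : ContDiff ℝ ∞ φ := (eta_smooth k).comp (contDiff_const.sub contDiff_id)
  have hφc : HasCompactSupport φ := (eta_cs k).comp_homeomorph (Homeomorph.subLeft x)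
  have hφd : ∀ y e, fderiv ℝ φ y e = - fderiv ℝ (eta k) (x - y) e :=
    fderiv_comp_const_sub (eta_smooth k) x
  have h1 := h.mass_slice hφs hφc ht
  have h0 := h.mass_slice hφs hφc (t := 0) ⟨le_rfl, h.pos.le⟩
  simp only [intervalIntegral.integral_same, add_zero] at h0
  rw [← h0] at h1
  simp only [hφd, mul_neg, integral_neg] at h1
  exact h1

lemma mflux_aesm (h : Transport T ρ₀ ρ u G) (k : ℕ) :
    AEStronglyMeasurable (fun z : ℝ × E3 => mflux ρ u k z.1 z.2) (slab T) := by
  have q : Measure.QuasiMeasurePreserving (fun p : (ℝ × E3) × E3 => (p.1.1, p.2))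
      ((slab T).prod volume) (slab T) := qmp_drop _
  have h1 : AEStronglyMeasurable (fun p : (ℝ × E3) × E3 => ρ p.1.1 p.2) ((slab T).prod volume) :=
    h.ρm.comp_quasiMeasurePreserving q
  have h2 : AEStronglyMeasurable (fun p : (ℝ × E3) × E3 => u p.1.1 p.2) ((slab T).prod volume) :=
    h.um.comp_quasiMeasurePreserving q
  have h3 : AEStronglyMeasurable (fun p : (ℝ × E3) × E3 => fderiv ℝ (eta k) (p.1.2 - p.2))
      ((slab T).prod volume) :=
    (((eta_smooth k).continuous_fderiv (by simp)).comp (by fun_prop)).aestronglyMeasurable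
  have h4 : AEStronglyMeasurable (fun p : (ℝ × E3) × E3 =>
      ρ p.1.1 p.2 * fderiv ℝ (eta k) (p.1.2 - p.2) (u p.1.1 p.2)) ((slab T).prod volume) :=
    h1.mul (aesm_clm_apply h3 h2)
  exact h4.integral_prod_right'

lemma mol_aesm (h : Transport T ρ₀ ρ u G) (k : ℕ) :
    AEStronglyMeasurable (fun z : ℝ × E3 => mol (ρ z.1) (eta k) z.2) (slab T) := by
  have q : Measure.QuasiMeasurePreserving (fun p : (ℝ × E3) × E3 => (p.1.1, p.2))
      ((slab T).prod volume) (slab T) := qmp_drop _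
  have h1 : AEStronglyMeasurable (fun p : (ℝ × E3) × E3 => ρ p.1.1 p.2) ((slab T).prod volume) :=
    h.ρm.comp_quasiMeasurePreserving q
  have h3 : AEStronglyMeasurable (fun p : (ℝ × E3) × E3 => eta k (p.1.2 - p.2))
      ((slab T).prod volume) :=
    ((eta_smooth k).continuous.comp (by fun_prop)).aestronglyMeasurable
  exact (h1.mul h3).integral_prod_right'

lemma eta_bound (k : ℕ) : ∃ C : ℝ, 0 ≤ C ∧ (∀ z, ‖eta k z‖ ≤ C) ∧ ∀ z, ‖fderiv ℝ (eta k) z‖ ≤ C := by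
  obtain ⟨C1, h1⟩ := (eta_smooth k).continuous.bounded_above_of_compact_support (eta_cs k)
  obtain ⟨C2, h2⟩ := ((eta_smooth k).continuous_fderiv (by simp)).bounded_above_of_compact_support
    ((eta_cs k).fderiv ℝ)
  exact ⟨max C1 C2, le_max_of_le_left ((norm_nonneg _).trans (h1 0)),
    fun z => (h1 z).trans (le_max_left _ _), fun z => (h2 z).trans (le_max_right _ _)⟩

lemma mflux_le (h : Transport T ρ₀ ρ u G) (k : ℕ) : ∃ N : ℝ → ℝ, IntegrableOn N (Ioo 0 T) ∧
    ∀ᵐ τ ∂(volume.restrict (Ioo 0 T)), ∀ x, ‖mflux ρ u k τ x‖ ≤ N τ := by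
  obtain ⟨C, hC0, -, hC⟩ := eta_bound k
  refine ⟨fun τ => C * ∫ y, ‖ρ τ y • u τ y‖, ?_, ?_⟩
  · exact (h.flux_integrable.norm.integral_prod_left).const_mul C
  · filter_upwards [h.flux_integrable.prod_right_ae] with τ hτ x
    rw [← integral_const_mul]
    refine norm_integral_le_of_norm_le (hτ.norm.const_mul C) (Eventually.of_forall fun y => ?_)
    have := (fderiv ℝ (eta k) (x - y)).le_opNorm (ρ τ y • u τ y)
    rw [map_smul, smul_eq_mul] at this
    exact this.trans (by gcongr; exact hC _)

lemma mol_bound (h : Transport T ρ₀ ρ u G) (k : ℕ) :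
    ∃ C : ℝ, 0 ≤ C ∧ ∀ t ∈ Icc 0 T, ∀ x, ‖mol (ρ t) (eta k) x‖ ≤ C := by
  obtain ⟨C, hC0, hC, -⟩ := eta_bound k
  obtain ⟨C1, hC1⟩ := h.cont1.bounded le_rfl
  refine ⟨C1 * C, by positivity, fun t ht x => ?_⟩
  have hi := h.integrable_slice ht
  have hb : ∫ y, ‖ρ t y‖ ≤ C1 := by
    have h1 := hC1 t ht
    rw [eLpNorm_one_eq_lintegral_enorm, ← ofReal_integral_norm_eq_lintegral_enorm hi] at h1
    exact (ENNReal.ofReal_le_coe).1 h1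
  calc ‖mol (ρ t) (eta k) x‖ ≤ ∫ y, ‖ρ t y‖ * C := by
        refine norm_integral_le_of_norm_le (hi.norm.mul_const C) (Eventually.of_forall fun y => ?_)
        rw [norm_mul]; gcongr; exact hC _
    _ ≤ _ := by rw [integral_mul_const]; gcongr

/-- The mollified renormalised equation, with the error controlled by the commutator. -/
lemma renorm_mollified (h : Transport T ρ₀ ρ u G) {β : ℝ → ℝ} (hβ : ContDiff ℝ 1 β)
    {M : ℝ≥0} (hM : ∀ r, ‖deriv β r‖₊ ≤ M) {ζ : E3 → ℝ} (hζ : ContDiff ℝ ∞ ζ)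
    (hζc : HasCompactSupport ζ) {Z : ℝ≥0} (hZ : ∀ x, ‖ζ x‖₊ ≤ Z) (k : ℕ) {ε : ℝ≥0∞}
    (hε : ∀ t ∈ Icc 0 T, ∀ z : E3, ‖z‖ ≤ 2 / ((k : ℝ) + 1) →
      ∫⁻ x, ‖ρ t (x - z) - ρ t x‖ₑ ^ 2 ≤ ε ^ 2) {t : ℝ} (ht : t ∈ Icc 0 T) :
    ‖(∫ x, β (mol (ρ t) (eta k) x) * ζ x) - (∫ x, β (mol (ρ 0) (eta k) x) * ζ x)
      - ∫ z, β (mol (ρ z.1) (eta k) z.2) * fderiv ℝ ζ z.2 (u z.1 z.2) ∂(slab t)‖ₑ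
      ≤ (Z * M * etaMoment * ∫⁻ τ in Ioo 0 T, (1 + gradSq fun j => G j τ)) * ε := by
  have hT := h.pos
  have h0T : (0:ℝ) ∈ Icc 0 T := ⟨le_rfl, hT.le⟩
  have hli : ∀ τ ∈ Icc 0 T, LocallyIntegrable (ρ τ) := fun τ hτ =>
    (h.integrable_slice hτ).locallyIntegrable
  have hqs : ∀ τ ∈ Icc 0 T, ContDiff ℝ ∞ (mol (ρ τ) (eta k)) := fun τ hτ =>
    mol_contDiff (hli τ hτ) (eta_smooth k) (eta_cs k)
  obtain ⟨N, hN, hNb⟩ := h.mflux_le k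
  obtain ⟨Cq, hCq0, hCq⟩ := h.mol_bound k
  have hβ' : Continuous (deriv β) := hβ.continuous_deriv le_rfl
  have hζ1 : ContDiff ℝ 1 ζ := hζ.of_le (by exact_mod_cast le_top)
  have hsub : Ioo 0 t ⊆ Ioo 0 T := Ioo_subset_Ioo le_rfl ht.2
  have hζi : Integrable ζ := hζ.continuous.integrable_of_hasCompactSupport hζc
  have hqm := h.mol_aesm k
  -- the flux term
  set Φ : ℝ × E3 → ℝ := fun z =>
    ζ z.2 * (deriv β (mol (ρ z.1) (eta k) z.2) * (- mflux ρ u k z.1 z.2)) with hΦ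
  have hΦT : Integrable Φ (slab T) := by
    have hb : Integrable (fun z : ℝ × E3 => (M * N z.1) * ‖ζ z.2‖) (slab T) :=
      (hN.const_mul (M:ℝ)).mul_prod hζi.norm
    refine hb.mono' ?_ ?_
    · exact (hζ.continuous.comp continuous_snd).aestronglyMeasurable.mul
        ((hβ'.comp_aestronglyMeasurable hqm).mul (h.mflux_aesm k).neg)
    · filter_upwards [slab_ae_fst hNb] with z hz
      simp only [hΦ, norm_mul, norm_neg]
      rw [mul_comm ‖ζ z.2‖]
      gcongr
      · exact_mod_cast hM _
      · exact hz _
  have hΦt := hΦT.mono_measure (slab_mono ht.2)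
  -- the transport term
  set Ψ : ℝ × E3 → ℝ := fun z =>
    β (mol (ρ z.1) (eta k) z.2) * fderiv ℝ ζ z.2 (u z.1 z.2) with hΨ
  have hΨT : Integrable Ψ (slab T) := by
    obtain ⟨Cβ, hCβ⟩ := (isCompact_Icc (a := -Cq) (b := Cq)).exists_bound_of_continuousOn
      hβ.continuous.continuousOn
    have h1 : Integrable (fun z : ℝ × E3 => fderiv ℝ ζ z.2 (u z.1 z.2)) (slab T) := by
      have : ∀ i : Fin 3, Integrable (fun z : ℝ × E3 => u z.1 z.2 i * fderiv ℝ ζ z.2 (basisVec i))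
          (slab T) := fun i => by
        have := (EuclideanSpace.proj (𝕜 := ℝ) i).integrable_comp
          (integrable_test_velocity h.um h.decay
            ((hζ1.continuous_fderiv one_ne_zero).clm_apply
              (continuous_const (y := basisVec i)))
            ((hζc.fderiv ℝ).comp_left (g := fun L : E3 →L[ℝ] ℝ => L (basisVec i)) rfl))
        refine this.congr (Eventually.of_forall fun z => ?_)
        simp [mul_comm]
      simp_rw [fderiv_apply_sum ζ _ (u _ _)]
      exact integrable_finsetSum _ fun i _ => this i
    refine h1.bdd_mul (c := Cβ) (hβ.continuous.comp_aestronglyMeasurable hqm) ?_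
    filter_upwards [slab_ae_fst (ae_restrict_mem measurableSet_Ioo)] with z hz
    exact hCβ _ (abs_le.1 (hCq z.1 (Ioo_subset_Icc_self hz) z.2))
  have hΨt := hΨT.mono_measure (slab_mono ht.2)
  -- time evolution
  have hevol : (∫ x, β (mol (ρ t) (eta k) x) * ζ x) - (∫ x, β (mol (ρ 0) (eta k) x) * ζ x)
      = ∫ z, Φ z ∂(slab t) := by
    have hci : ∀ τ ∈ Icc 0 T, Integrable fun x => β (mol (ρ τ) (eta k) x) * ζ x := fun τ hτ =>
      ((hβ.continuous.comp (hqs τ hτ).continuous).mul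
        hζ.continuous).integrable_of_hasCompactSupport hζc.mul_left
    rw [← integral_sub (hci t ht) (hci 0 h0T), slab, integral_prod_symm _ hΦt]
    have hNx : ∀ᵐ x ∂(volume : Measure E3), Integrable (fun τ => mflux ρ u k τ x)
        (volume.restrict (Ioo 0 T)) := by
      have hms := (h.mflux_aesm k)
      have : ∀ᵐ x ∂(volume : Measure E3), AEStronglyMeasurable (fun τ => mflux ρ u k τ x)
          (volume.restrict (Ioo 0 T)) := by
        have := hms.prod_swap.prodMk_left
        exact this
      filter_upwards [this] with x hx
      exact hN.mono' hx (hNb.mono fun τ hτ => hτ x)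
    refine integral_congr_ae ?_
    filter_upwards [hNx] with x hx
    have hii : IntervalIntegrable (fun τ => - mflux ρ u k τ x) volume 0 T := by
      rw [intervalIntegrable_iff_integrableOn_Ioo_of_le hT.le]; exact hx.neg
    have := chain_rule_integral hβ ht hii (g := fun τ => mol (ρ τ) (eta k) x)
      (fun τ hτ => h.mol_evolution k x hτ)
    rw [← sub_mul, this, intervalIntegral.integral_of_le ht.1, integral_Ioc_eq_integral_Ioo,
      mul_comm, ← integral_const_mul]
  have hslice : ∀ᵐ τ ∂(volume.restrict (Ioo 0 t)),
      ‖(∫ x, Φ (τ, x)) - ∫ x, Ψ (τ, x)‖ₑ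
        ≤ (Z * M * etaMoment * ε) * (1 + gradSq fun j => G j τ) := by
    have hae : ∀ᵐ τ ∂(volume.restrict (Ioo 0 T)), ‖(∫ x, Φ (τ, x)) - ∫ x, Ψ (τ, x)‖ₑ
        ≤ (Z * M * etaMoment * ε) * (1 + gradSq fun j => G j τ) := by
      filter_upwards [h.ae_slices, hΦT.prod_right_ae, hΨT.prod_right_ae,
        ae_restrict_mem measurableSet_Ioo, ae_lt_top' h.gradSq_aemeas h.lintegral_gradSq_lt_top.ne]
        with τ hgs hΦτ hΨτ hτ' hfin
      have hτ := Ioo_subset_Icc_self hτ'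
      set q := mol (ρ τ) (eta k) with hq
      have hq1 : ContDiff ℝ 1 q := (hqs τ hτ).of_le (by exact_mod_cast le_top)
      have hφ1 : ContDiff ℝ 1 fun x => ζ x * β (q x) := hζ1.mul (hβ.comp hq1)
      have hφc : HasCompactSupport fun x => ζ x * β (q x) := hζc.mul_right
      have hdiv := hgs.weak_div hfin.ne hφ1 hφc
      have hd : ∀ x, fderiv ℝ (fun x => ζ x * β (q x)) x (u τ x)
          = ζ x * (deriv β (q x) * fderiv ℝ q x (u τ x)) + Ψ (τ, x) := by
        intro x
        have d1 : HasFDerivAt ζ (fderiv ℝ ζ x) x := (hζ1.differentiable one_ne_zero x).hasFDerivAt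
        have d2 : HasFDerivAt q (fderiv ℝ q x) x := (hq1.differentiable one_ne_zero x).hasFDerivAt
        have d3 : HasDerivAt β (deriv β (q x)) (q x) :=
          (hβ.differentiable one_ne_zero (q x)).hasDerivAt
        have d4 := d1.mul (d3.comp_hasFDerivAt x d2)
        have : fderiv ℝ (fun x => ζ x * β (q x)) x = _ := d4.fderiv
        rw [this]
        simp [hΨ, hq]
      simp_rw [hd] at hdiv
      have hI : Integrable fun x => ζ x * (deriv β (q x) * fderiv ℝ q x (u τ x)) := by
        have : Integrable fun x => fderiv ℝ (fun x => ζ x * β (q x)) x (u τ x) := by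
          simp_rw [fderiv_apply_sum _ _ (u _ _)]
          refine integrable_finsetSum _ fun i _ => ?_
          have := (LocallyIntegrable.comp_apply hgs.locInt i).integrable_smul_left_of_hasCompactSupport
            (g := fun x => fderiv ℝ (fun x => ζ x * β (q x)) x (basisVec i))
            ((hφ1.continuous_fderiv one_ne_zero).clm_apply continuous_const)
            ((hφc.fderiv ℝ).comp_left (g := fun L : E3 →L[ℝ] ℝ => L (basisVec i)) rfl)
          simpa [mul_comm] using this
        have h2 := this.sub hΨτ
        refine h2.congr (Eventually.of_forall fun x => ?_)
        simp only [Pi.sub_apply, hd]; ring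
      rw [integral_add hI hΨτ] at hdiv
      have e1 : (∫ x, Φ (τ, x)) - ∫ x, Ψ (τ, x)
          = - ∫ x, ζ x * (deriv β (q x) * comm (ρ τ) (u τ) k x) := by
        have : ∫ x, Ψ (τ, x) = - ∫ x, ζ x * (deriv β (q x) * fderiv ℝ q x (u τ x)) := by
          linarith
        rw [this, sub_neg_eq_add, ← integral_add hΦτ hI, ← integral_neg]
        refine integral_congr_ae (Eventually.of_forall fun x => ?_)
        simp only [hΦ, comm, mflux, ← hq]
        ring
      rw [e1, enorm_neg]
      have hρv : LocallyIntegrable fun y => ρ τ y • u τ y :=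
        locallyIntegrable_smul_of_memLp (h.cont2.1 τ hτ) hgs.mem6
      obtain ⟨γ, hγ, -⟩ := exists_sq_eq (gradSq fun j => G j τ)
      calc ‖∫ x, ζ x * (deriv β (q x) * comm (ρ τ) (u τ) k x)‖ₑ
          ≤ ∫⁻ x, (Z * M) * ‖comm (ρ τ) (u τ) k x‖ₑ := by
            refine (enorm_integral_le_lintegral_enorm _).trans (lintegral_mono fun x => ?_)
            rw [enorm_mul, enorm_mul, mul_assoc]
            gcongr
            · exact enorm_le_coe.2 (hZ x)
            · exact enorm_le_coe.2 (hM _)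
        _ = (Z * M) * ∫⁻ x, ‖comm (ρ τ) (u τ) k x‖ₑ :=
            lintegral_const_mul' _ _ (ENNReal.mul_ne_top ENNReal.coe_ne_top ENNReal.coe_ne_top)
        _ ≤ (Z * M) * (etaMoment * ε * γ) := by
            gcongr
            exact comm_bound hgs (hli τ hτ) hρv k (hε τ hτ) hγ.ge
        _ ≤ (Z * M) * (etaMoment * ε * (1 + gradSq fun j => G j τ)) := by
            gcongr; exact sqrt_le_one_add hγ
        _ = _ := by ring
    exact ae_restrict_of_ae_restrict_of_subset hsub hae
  rw [hevol, integral_slab hΦt, integral_slab hΨt,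
    ← integral_sub hΦt.integral_prod_left hΨt.integral_prod_left]
  calc _ ≤ ∫⁻ τ in Ioo 0 t, (Z * M * etaMoment * ε) * (1 + gradSq fun j => G j τ) :=
        (enorm_integral_le_lintegral_enorm _).trans (lintegral_mono_ae hslice)
    _ ≤ ∫⁻ τ in Ioo 0 T, (Z * M * etaMoment * ε) * (1 + gradSq fun j => G j τ) :=
        lintegral_mono_set hsub
    _ = _ := by
        have hm : AEMeasurable (fun τ => 1 + gradSq fun j => G j τ) (volume.restrict (Ioo 0 T)) :=
          aemeasurable_const.add h.gradSq_aemeas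
        rw [lintegral_const_mul'' _ hm]
        ring

end Transport

lemma ENNReal_eq_zero_of_le_mul {a C : ℝ≥0∞} (hC : C ≠ ⊤) (h : ∀ ε : ℝ≥0∞, 0 < ε → a ≤ C * ε) :
    a = 0 := by
  have h1 : Tendsto (fun n : ℕ => C * ((n:ℝ≥0∞))⁻¹) atTop (𝓝 (C * 0)) :=
    ENNReal.Tendsto.const_mul ENNReal.tendsto_inv_nat_nhds_zero (Or.inr hC)
  rw [mul_zero] at h1
  refine le_antisymm (ge_of_tendsto' h1 fun n => h _ ?_) zero_le
  exact ENNReal.inv_pos.2 (ENNReal.natCast_ne_top n)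

/-- An inequality holding in almost every time slice holds almost everywhere. -/
lemma slab_ae_le {T : ℝ} {f g : ℝ × E3 → ℝ} (hf : AEStronglyMeasurable f (slab T))
    (hg : AEStronglyMeasurable g (slab T))
    (h : ∀ᵐ t ∂(volume.restrict (Ioo 0 T)), ∀ᵐ x, f (t, x) ≤ g (t, x)) :
    ∀ᵐ z ∂(slab T), f z ≤ g z := by
  set F := hf.mk f
  set G := hg.mk g
  have hFm : Measurable F := hf.stronglyMeasurable_mk.measurable
  have hGm : Measurable G := hg.stronglyMeasurable_mk.measurable
  have hF : f =ᵐ[slab T] F := hf.ae_eq_mk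
  have hG : g =ᵐ[slab T] G := hg.ae_eq_mk
  have hF' := Measure.ae_ae_of_ae_prod hF
  have hG' := Measure.ae_ae_of_ae_prod hG
  have hm : MeasurableSet {z | F z ≤ G z} := measurableSet_le hFm hGm
  have : ∀ᵐ z ∂(slab T), F z ≤ G z := by
    refine (Measure.ae_prod_iff_ae_ae hm).2 ?_
    filter_upwards [hF', hG', h] with t h1 h2 h3
    filter_upwards [h1, h2, h3] with x k1 k2 k3
    rw [← k1, ← k2]; exact k3
  filter_upwards [this, hF, hG] with z h1 h2 h3
  rw [h2, h3]; exact h1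

/-- Smooth cutoff functions exhausting the space. -/
lemma exists_cutoff_seq : ∃ (ζ : ℕ → E3 → ℝ) (C : ℝ), (∀ R, ContDiff ℝ ∞ (ζ R)) ∧
    (∀ R, HasCompactSupport (ζ R)) ∧ (∀ R x, ‖ζ R x‖ ≤ 1) ∧
    (∀ x, Tendsto (fun R => ζ R x) atTop (𝓝 1)) ∧
    ∀ (R : ℕ) (x : E3), ‖fderiv ℝ (ζ R) x‖ ≤ C * ((R:ℝ) + 1)⁻¹ := by
  let c : ContDiffBump (0:E3) := ⟨1, 2, by norm_num, by norm_num⟩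
  let ζ : ℕ → E3 → ℝ := fun R x => c (((R:ℝ) + 1)⁻¹ • x)
  have hζ : ∀ R, ContDiff ℝ ∞ (ζ R) := fun R => c.contDiff.comp (contDiff_const_smul _)
  have hζc : ∀ R, HasCompactSupport (ζ R) := fun R =>
    c.hasCompactSupport.comp_homeomorph
      (Homeomorph.smulOfNeZero ((R:ℝ) + 1)⁻¹ (by positivity))
  have hζ1 : ∀ R x, ‖ζ R x‖ ≤ 1 := fun R x => by
    rw [Real.norm_of_nonneg c.nonneg]; exact c.le_one
  have hζlim : ∀ x, Tendsto (fun R => ζ R x) atTop (𝓝 1) := by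
    intro x
    have t0 : Tendsto (fun R : ℕ => ((R:ℝ) + 1)⁻¹ • x) atTop (𝓝 ((0:ℝ) • x)) :=
      (tendsto_inv_atTop_zero.comp
        (tendsto_atTop_add_const_right _ _ tendsto_natCast_atTop_atTop)).smul_const x
    rw [zero_smul] at t0
    have := (c.continuous.tendsto 0).comp t0
    rwa [c.one_of_mem_closedBall (by simp [c])] at this
  obtain ⟨C, hC⟩ := (c.contDiff (n := 1).continuous_fderiv one_ne_zero).bounded_above_of_compact_support
    (c.hasCompactSupport.fderiv ℝ)
  have hd : ∀ (R : ℕ) (x : E3), ‖fderiv ℝ (ζ R) x‖ ≤ C * ((R:ℝ) + 1)⁻¹ := by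
    intro R x
    have hL : HasFDerivAt (fun x : E3 => ((R:ℝ) + 1)⁻¹ • x)
        (((R:ℝ) + 1)⁻¹ • ContinuousLinearMap.id ℝ E3) x :=
      HasFDerivAt.fun_const_smul (hasFDerivAt_id x) _
    have h2 : HasFDerivAt (ζ R) _ x :=
      ((c.contDiff (n := 1).differentiable one_ne_zero _).hasFDerivAt).comp x hL
    rw [h2.fderiv, ContinuousLinearMap.comp_smul, norm_smul, ContinuousLinearMap.comp_id, mul_comm,
      Real.norm_of_nonneg (by positivity)]
    gcongr
    exact hC _
  exact ⟨ζ, C, hζ, hζc, hζ1, hζlim, hd⟩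

namespace Transport

variable {T : ℝ} {ρ₀ : E3 → ℝ} {ρ : ℝ → E3 → ℝ} {u : ℝ → E3 → E3} {G : Fin 3 → ℝ → E3 → E3}

lemma test_velocity_integrable (h : Transport T ρ₀ ρ u G) {ζ : E3 → ℝ} (hζ : ContDiff ℝ 1 ζ)
    (hζc : HasCompactSupport ζ) :
    Integrable (fun z : ℝ × E3 => fderiv ℝ ζ z.2 (u z.1 z.2)) (slab T) := by
  have : ∀ i : Fin 3, Integrable (fun z : ℝ × E3 => u z.1 z.2 i * fderiv ℝ ζ z.2 (basisVec i))
      (slab T) := fun i => by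
    have := (EuclideanSpace.proj (𝕜 := ℝ) i).integrable_comp
      (integrable_test_velocity h.um h.decay
        ((hζ.continuous_fderiv one_ne_zero).clm_apply (continuous_const (y := basisVec i)))
        ((hζc.fderiv ℝ).comp_left (g := fun L : E3 →L[ℝ] ℝ => L (basisVec i)) rfl))
    refine this.congr (Eventually.of_forall fun z => ?_)
    simp [mul_comm]
  simp_rw [fderiv_apply_sum ζ _ (u _ _)]
  exact integrable_finsetSum _ fun i _ => this i

/-- The renormalised equation for bounded nonlinearities. -/
lemma renorm_bdd (h : Transport T ρ₀ ρ u G) {β : ℝ → ℝ} (hβ : ContDiff ℝ 1 β)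
    {M : ℝ≥0} (hM : ∀ r, ‖deriv β r‖₊ ≤ M) {B : ℝ} (hB : ∀ r, ‖β r‖ ≤ B) {ζ : E3 → ℝ}
    (hζ : ContDiff ℝ ∞ ζ) (hζc : HasCompactSupport ζ) {t : ℝ} (ht : t ∈ Icc 0 T) :
    ∫ x, β (ρ t x) * ζ x = (∫ x, β (ρ₀ x) * ζ x)
      + ∫ z, β (ρ z.1 z.2) * fderiv ℝ ζ z.2 (u z.1 z.2) ∂(slab t) := by
  have h0T : (0:ℝ) ∈ Icc 0 T := ⟨le_rfl, h.pos.le⟩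
  have hζ1 : ContDiff ℝ 1 ζ := hζ.of_le (by exact_mod_cast le_top)
  have hζi : Integrable ζ := hζ.continuous.integrable_of_hasCompactSupport hζc
  have hli : ∀ τ ∈ Icc 0 T, LocallyIntegrable (ρ τ) := fun τ hτ =>
    (h.integrable_slice hτ).locallyIntegrable
  have hV := (h.test_velocity_integrable hζ1 hζc).mono_measure (slab_mono ht.2)
  have hslice : ∀ τ ∈ Icc 0 T, Tendsto (fun k => ∫ x, β (mol (ρ τ) (eta k) x) * ζ x) atTop
      (𝓝 (∫ x, β (ρ τ x) * ζ x)) := by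
    intro τ hτ
    refine tendsto_integral_of_dominated_convergence (fun x => B * ‖ζ x‖) (fun k => ?_)
      (hζi.norm.const_mul B) (fun k => Eventually.of_forall fun x => ?_) ?_
    · exact ((hβ.continuous.comp (mol_contDiff (hli τ hτ) (eta_smooth k)
        (eta_cs k)).continuous).mul hζ.continuous).aestronglyMeasurable
    · rw [norm_mul]; gcongr; exact hB _
    · filter_upwards [mol_eta_tendsto (hli τ hτ)] with x hx
      exact ((hβ.continuous.tendsto _).comp hx).mul_const _
  have hmi : ∀ F : ℝ × E3 → ℝ, AEStronglyMeasurable F (slab T) →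
      Integrable (fun z : ℝ × E3 => β (F z) * fderiv ℝ ζ z.2 (u z.1 z.2)) (slab t) := by
    intro F hF
    exact hV.bdd_mul (c := B)
      ((hβ.continuous.comp_aestronglyMeasurable hF).mono_measure (slab_mono ht.2))
      (Eventually.of_forall fun z => hB _)
  have hflux : Tendsto (fun k => ∫ z, β (mol (ρ z.1) (eta k) z.2)
      * fderiv ℝ ζ z.2 (u z.1 z.2) ∂(slab t)) atTop
      (𝓝 (∫ z, β (ρ z.1 z.2) * fderiv ℝ ζ z.2 (u z.1 z.2) ∂(slab t))) := by
    have e1 := fun k => integral_slab (hmi _ (h.mol_aesm k))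
    simp only at e1
    simp_rw [e1]
    have e2 := integral_slab (hmi _ h.ρm)
    simp only [Function.uncurry] at e2
    rw [e2]
    have hVs := hV.prod_right_ae
    refine tendsto_integral_of_dominated_convergence
      (fun τ => B * ∫ x, ‖fderiv ℝ ζ x (u τ x)‖) (fun k => ?_)
      (hV.norm.integral_prod_left.const_mul B) (fun k => ?_) ?_
    · exact ((hmi _ (h.mol_aesm k)).integral_prod_left).1
    · filter_upwards [hVs] with τ hτ
      rw [← integral_const_mul]
      refine norm_integral_le_of_norm_le (hτ.norm.const_mul B) (Eventually.of_forall fun x => ?_)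
      rw [norm_mul]; gcongr; exact hB _
    · filter_upwards [hVs, ae_restrict_mem measurableSet_Ioo] with τ hτ hτt
      have hτT : τ ∈ Icc 0 T := ⟨hτt.1.le, hτt.2.le.trans ht.2⟩
      refine tendsto_integral_of_dominated_convergence (fun x => B * ‖fderiv ℝ ζ x (u τ x)‖)
        (fun k => ?_) (hτ.norm.const_mul B) (fun k => Eventually.of_forall fun x => ?_) ?_
      · exact (hβ.continuous.comp (mol_contDiff (hli τ hτT) (eta_smooth k)
          (eta_cs k)).continuous).aestronglyMeasurable.mul hτ.1
      · rw [norm_mul]; gcongr; exact hB _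
      · filter_upwards [mol_eta_tendsto (hli τ hτT)] with x hx
        exact ((hβ.continuous.tendsto _).comp hx).mul_const _
  have hlim := ((hslice t ht).sub (hslice 0 h0T)).sub hflux
  have e0 : ∫ x, β (ρ 0 x) * ζ x = ∫ x, β (ρ₀ x) * ζ x :=
    integral_congr_ae (h.initial.mono fun x hx => by simp only [hx])
  rw [e0] at hlim
  obtain ⟨Z, hZ⟩ := hζ.continuous.bounded_above_of_compact_support hζc
  have hZ' : ∀ x, ‖ζ x‖₊ ≤ Z.toNNReal := fun x => by
    rw [← NNReal.coe_le_coe, coe_nnnorm]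
    exact (hZ x).trans (Real.le_coe_toNNReal _)
  have hzero : ‖(∫ x, β (ρ t x) * ζ x) - (∫ x, β (ρ₀ x) * ζ x)
      - ∫ z, β (ρ z.1 z.2) * fderiv ℝ ζ z.2 (u z.1 z.2) ∂(slab t)‖ₑ = 0 := by
    refine ENNReal_eq_zero_of_le_mul (C := Z.toNNReal * M * etaMoment
      * ∫⁻ τ in Ioo 0 T, (1 + gradSq fun j => G j τ)) ?_ fun ε hε => ?_
    · refine ENNReal.mul_ne_top (ENNReal.mul_ne_top (by finiteness) etaMoment_lt_top.ne) ?_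
      rw [lintegral_add_left measurable_const]
      exact (ENNReal.add_lt_top.2 ⟨by simp, h.lintegral_gradSq_lt_top⟩).ne
    · obtain ⟨δ, hδ, hmod⟩ := h.cont2.modulus hε
      refine le_of_tendsto hlim.enorm ?_
      have hsmall : ∀ᶠ k : ℕ in atTop, 2 / ((k:ℝ) + 1) < δ := by
        have t0 : Tendsto (fun k : ℕ => 2 / ((k : ℝ) + 1)) atTop (𝓝 0) :=
          tendsto_const_nhds.div_atTop
            (tendsto_atTop_add_const_right _ _ tendsto_natCast_atTop_atTop)
        exact t0.eventually (gt_mem_nhds hδ)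
      filter_upwards [hsmall] with k hk
      exact h.renorm_mollified hβ hM hζ hζc hZ' k
        (fun τ hτ z hz => hmod τ hτ z (hz.trans_lt hk)) ht
  rw [enorm_eq_zero] at hzero
  linarith

/-- Integrals of nonlinear functions of the density are conserved. -/
lemma conserved (h : Transport T ρ₀ ρ u G) {β : ℝ → ℝ} (hβ : ContDiff ℝ 1 β)
    {M : ℝ≥0} (hM : ∀ r, ‖deriv β r‖₊ ≤ M) {B : ℝ} (hB : ∀ r, ‖β r‖ ≤ B)
    (hβ1 : ∀ r, ‖β r‖ ≤ ‖r‖) {t : ℝ} (ht : t ∈ Icc 0 T) :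
    ∫ x, β (ρ t x) = ∫ x, β (ρ₀ x) := by
  obtain ⟨ζ, C, hζ, hζc, hζ1, hζlim, hd⟩ := exists_cutoff_seq
  have hβi : ∀ {g : E3 → ℝ}, Integrable g → Integrable fun x => β (g x) := fun {g} hg =>
    hg.norm.mono' (hβ.continuous.comp_aestronglyMeasurable hg.1)
      (Eventually.of_forall fun x => hβ1 _)
  have hlim : ∀ {g : E3 → ℝ}, Integrable g → Tendsto (fun R => ∫ x, β (g x) * ζ R x) atTop
      (𝓝 (∫ x, β (g x))) := by
    intro g hg
    refine tendsto_integral_of_dominated_convergence (fun x => ‖β (g x)‖) (fun R => ?_)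
      (hβi hg).norm (fun R => Eventually.of_forall fun x => ?_) (Eventually.of_forall fun x => ?_)
    · exact (hβi hg).1.mul (hζ R).continuous.aestronglyMeasurable
    · rw [norm_mul]; exact mul_le_of_le_one_right (norm_nonneg _) (hζ1 R x)
    · simpa using (hζlim x).const_mul (β (g x))
  have hflux : Tendsto (fun R => ∫ z, β (ρ z.1 z.2) * fderiv ℝ (ζ R) z.2 (u z.1 z.2) ∂(slab t))
      atTop (𝓝 0) := by
    have hbi := h.flux_integrable.norm.mono_measure (slab_mono ht.2)
    have hb : ∀ R : ℕ, ‖∫ z, β (ρ z.1 z.2) * fderiv ℝ (ζ R) z.2 (u z.1 z.2) ∂(slab t)‖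
        ≤ (C * ∫ z, ‖ρ z.1 z.2 • u z.1 z.2‖ ∂(slab t)) * ((R:ℝ) + 1)⁻¹ := by
      intro R
      rw [mul_comm, ← mul_assoc, ← integral_const_mul]
      refine norm_integral_le_of_norm_le (hbi.const_mul _) (Eventually.of_forall fun z => ?_)
      rw [norm_mul, norm_smul]
      calc ‖β (ρ z.1 z.2)‖ * ‖fderiv ℝ (ζ R) z.2 (u z.1 z.2)‖
          ≤ ‖ρ z.1 z.2‖ * ((C * ((R:ℝ) + 1)⁻¹) * ‖u z.1 z.2‖) := by
            gcongr
            · exact hβ1 _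
            · exact ((fderiv ℝ (ζ R) z.2).le_opNorm _).trans (by gcongr; exact hd R _)
        _ = _ := by ring
    refine squeeze_zero_norm hb ?_
    have : Tendsto (fun R : ℕ => ((R:ℝ) + 1)⁻¹) atTop (𝓝 0) :=
      tendsto_inv_atTop_zero.comp
        (tendsto_atTop_add_const_right _ _ tendsto_natCast_atTop_atTop)
    simpa using this.const_mul (C * ∫ z, ‖ρ z.1 z.2 • u z.1 z.2‖ ∂(slab t))
  have h0i : Integrable ρ₀ :=
    (h.integrable_slice ⟨le_rfl, h.pos.le⟩).congr h.initial
  have l2 := (hlim h0i).add hflux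
  rw [add_zero] at l2
  refine tendsto_nhds_unique (hlim (h.integrable_slice ht)) (l2.congr fun R => ?_)
  exact (h.renorm_bdd hβ hM hB (hζ R) (hζc R) ht).symm

end Transport

/-! ### Equimeasurability of the density -/

/-- A bounded weight that vanishes exactly at the origin. -/
def wgt (r : ℝ) : ℝ := r ^ 2 / (1 + r ^ 2)

lemma wgt_nonneg (r : ℝ) : 0 ≤ wgt r := by unfold wgt; positivity

lemma wgt_le_one (r : ℝ) : wgt r ≤ 1 := by
  unfold wgt; rw [div_le_one (by positivity)]; linarith

lemma wgt_le_abs (r : ℝ) : wgt r ≤ |r| := by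
  unfold wgt
  rw [div_le_iff₀ (by positivity), ← sq_abs]
  nlinarith [abs_nonneg r, mul_nonneg (abs_nonneg r) (sq_nonneg (|r| - 1)),
    mul_nonneg (abs_nonneg r) (abs_nonneg r)]

lemma wgt_pos {r : ℝ} (h : r ≠ 0) : 0 < wgt r := by unfold wgt; positivity

lemma wgt_contDiff : ContDiff ℝ 1 wgt :=
  (contDiff_id.pow 2).div (contDiff_const.add (contDiff_id.pow 2)) fun x => by
    have : (0:ℝ) < 1 + x ^ 2 := by positivity
    exact this.ne'

lemma wgt_deriv_le (r : ℝ) : |deriv wgt r| ≤ 1 := by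
  have h : (0:ℝ) < 1 + r ^ 2 := by positivity
  have hd : HasDerivAt wgt (((2 * r) * (1 + r ^ 2) - r ^ 2 * (2 * r)) / (1 + r ^ 2) ^ 2) r := by
    have h1 : HasDerivAt (fun r : ℝ => r ^ 2) (2 * r) r := by simpa using hasDerivAt_pow 2 r
    exact h1.div (h1.const_add 1) h.ne'
  rw [hd.deriv, abs_div, abs_of_pos (by positivity : (0:ℝ) < (1 + r ^ 2) ^ 2),
    div_le_one (by positivity)]
  rw [show 2 * r * (1 + r ^ 2) - r ^ 2 * (2 * r) = 2 * r by ring]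
  rw [abs_le]
  constructor <;> nlinarith [sq_nonneg (r + 1), sq_nonneg (r - 1), sq_nonneg (r ^ 2)]

/-- The weighted law of a function. -/
def wlaw (g : E3 → ℝ) : Measure ℝ :=
  ((volume : Measure E3).withDensity fun x => ((wgt (g x)).toNNReal : ℝ≥0∞)).map g

lemma wgt_integrable {g : E3 → ℝ} (hg : Integrable g) : Integrable fun x => wgt (g x) :=
  hg.norm.mono' (wgt_contDiff.continuous.comp_aestronglyMeasurable hg.1)
    (Eventually.of_forall fun x => by
      rw [Real.norm_of_nonneg (wgt_nonneg _)]; exact wgt_le_abs _)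

lemma wlaw_finite {g : E3 → ℝ} (hg : Integrable g) : IsFiniteMeasure (wlaw g) := by
  have : IsFiniteMeasure ((volume : Measure E3).withDensity
      fun x => ((wgt (g x)).toNNReal : ℝ≥0∞)) := isFiniteMeasure_withDensity (by
    have := (wgt_integrable hg).2
    rw [HasFiniteIntegral] at this
    refine ne_of_lt (lt_of_le_of_lt (lintegral_mono fun x => ?_) this)
    rw [Real.enorm_of_nonneg (wgt_nonneg _)]; rfl)
  unfold wlaw
  infer_instance

lemma wlaw_charFun {g : E3 → ℝ} (hg : Integrable g) (ξ : ℝ) :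
    charFun (wlaw g) ξ = ((∫ x, wgt (g x) * Real.cos (ξ * g x) : ℝ) : ℂ)
      + ((∫ x, wgt (g x) * Real.sin (ξ * g x) : ℝ) : ℂ) * Complex.I := by
  have hac : (volume : Measure E3).withDensity (fun x => ((wgt (g x)).toNNReal : ℝ≥0∞))
      ≪ volume := withDensity_absolutelyContinuous _ _
  have hgm : AEMeasurable g volume := hg.1.aemeasurable
  have hc : Continuous fun r : ℝ => Complex.exp (ξ * r * Complex.I) := by fun_prop
  rw [charFun_apply_real, wlaw, integral_map (hgm.mono_ac hac) hc.aestronglyMeasurable,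
    integral_withDensity_eq_integral_smul₀
      (f := fun x => (wgt (g x)).toNNReal)
      ((wgt_contDiff.continuous.measurable.comp_aemeasurable hgm).real_toNNReal)]
  have i1 : Integrable fun x => wgt (g x) * Real.cos (ξ * g x) := by
    refine (wgt_integrable hg).mul_bdd (c := 1) ?_ (Eventually.of_forall fun x => ?_)
    · exact (by fun_prop : Continuous fun r : ℝ => Real.cos (ξ * r)).comp_aestronglyMeasurable hg.1
    · exact Real.abs_cos_le_one _
  have i2 : Integrable fun x => wgt (g x) * Real.sin (ξ * g x) := by
    refine (wgt_integrable hg).mul_bdd (c := 1) ?_ (Eventually.of_forall fun x => ?_)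
    · exact (by fun_prop : Continuous fun r : ℝ => Real.sin (ξ * r)).comp_aestronglyMeasurable hg.1
    · exact Real.abs_sin_le_one _
  rw [← integral_complex_ofReal, ← integral_complex_ofReal, ← integral_mul_const,
    ← integral_add i1.ofReal (i2.ofReal.mul_const _)]
  refine integral_congr_ae (Eventually.of_forall fun x => ?_)
  simp only [NNReal.smul_def, Real.coe_toNNReal _ (wgt_nonneg _), Complex.real_smul]
  rw [← Complex.ofReal_mul ξ, Complex.exp_mul_I, ← Complex.ofReal_cos, ← Complex.ofReal_sin]
  push_cast
  ring

lemma lintegral_wlaw {g : E3 → ℝ} (hg : AEStronglyMeasurable g) {F : ℝ → ℝ≥0∞}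
    (hF : Measurable F) (hF0 : F 0 = 0) :
    ∫⁻ r, F r / ENNReal.ofReal (wgt r) ∂(wlaw g) = ∫⁻ x, F (g x) := by
  have hgm : AEMeasurable g volume := hg.aemeasurable
  have hwm : Measurable fun r => ENNReal.ofReal (wgt r) :=
    wgt_contDiff.continuous.measurable.ennreal_ofReal
  have hac : (volume : Measure E3).withDensity (fun x => ((wgt (g x)).toNNReal : ℝ≥0∞))
      ≪ volume := withDensity_absolutelyContinuous _ _
  have hQ : Measurable fun r => F r / ENNReal.ofReal (wgt r) := hF.div hwm
  rw [wlaw, lintegral_map' hQ.aemeasurable (hgm.mono_ac hac)]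
  refine (lintegral_withDensity_eq_lintegral_mul₀ (hwm.comp_aemeasurable hgm)
      (hQ.comp_aemeasurable hgm)).trans ?_
  refine lintegral_congr fun x => ?_
  simp only [Pi.mul_apply, Function.comp_apply]
  by_cases h0 : g x = 0
  · simp [h0, hF0, wgt]
  · exact ENNReal.mul_div_cancel (by simpa using wgt_pos h0) ENNReal.ofReal_ne_top

namespace Transport

variable {T : ℝ} {ρ₀ : E3 → ℝ} {ρ : ℝ → E3 → ℝ} {u : ℝ → E3 → E3} {G : Fin 3 → ℝ → E3 → E3}

lemma conserved_wgt (h : Transport T ρ₀ ρ u G) {k : ℝ → ℝ} (hk : ContDiff ℝ 1 k)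
    (h1 : ∀ r, |k r| ≤ 1) {N : ℝ} (hN : ∀ r, |deriv k r| ≤ N) {t : ℝ} (ht : t ∈ Icc 0 T) :
    ∫ x, wgt (ρ t x) * k (ρ t x) = ∫ x, wgt (ρ₀ x) * k (ρ₀ x) := by
  have hN0 : 0 ≤ N := (abs_nonneg _).trans (hN 0)
  refine h.conserved (β := fun r => wgt r * k r) (wgt_contDiff.mul hk) (M := (1 + N).toNNReal)
    (fun r => ?_) (B := 1) (fun r => ?_) (fun r => ?_) ht
  · have d1 := (wgt_contDiff.differentiable one_ne_zero r).hasDerivAt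
    have d2 := (hk.differentiable one_ne_zero r).hasDerivAt
    have d3 : deriv (fun r => wgt r * k r) r = _ := (d1.mul d2).deriv
    rw [← NNReal.coe_le_coe, coe_nnnorm, Real.coe_toNNReal _ (by positivity), d3, Real.norm_eq_abs]
    refine (abs_add_le _ _).trans ?_
    rw [abs_mul, abs_mul, abs_of_nonneg (wgt_nonneg r)]
    gcongr
    · exact mul_le_one₀ (wgt_deriv_le r) (abs_nonneg _) (h1 r)
    · exact (mul_le_of_le_one_left (abs_nonneg _) (wgt_le_one r)).trans (hN r)
  · rw [norm_mul, Real.norm_eq_abs, Real.norm_eq_abs, abs_of_nonneg (wgt_nonneg r)]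
    exact mul_le_one₀ (wgt_le_one r) (abs_nonneg _) (h1 r)
  · rw [norm_mul, Real.norm_eq_abs, Real.norm_eq_abs, abs_of_nonneg (wgt_nonneg r)]
    exact (mul_le_of_le_one_right (wgt_nonneg r) (h1 r)).trans (wgt_le_abs r)

lemma integrable_initial (h : Transport T ρ₀ ρ u G) : Integrable ρ₀ :=
  (h.integrable_slice ⟨le_rfl, h.pos.le⟩).congr h.initial

/-- The density is equimeasurable with the initial density. -/
lemma lintegral_conserved (h : Transport T ρ₀ ρ u G) {F : ℝ → ℝ≥0∞} (hF : Measurable F)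
    (hF0 : F 0 = 0) {t : ℝ} (ht : t ∈ Icc 0 T) : ∫⁻ x, F (ρ t x) = ∫⁻ x, F (ρ₀ x) := by
  have i1 := h.integrable_slice ht
  have i2 := h.integrable_initial
  have := wlaw_finite i1
  have := wlaw_finite i2
  have hl : wlaw (ρ t) = wlaw ρ₀ := by
    refine Measure.ext_of_charFun (funext fun ξ => ?_)
    have hc : ContDiff ℝ 1 fun r : ℝ => Real.cos (ξ * r) :=
      Real.contDiff_cos.comp (contDiff_const.mul contDiff_id)
    have hs : ContDiff ℝ 1 fun r : ℝ => Real.sin (ξ * r) :=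
      Real.contDiff_sin.comp (contDiff_const.mul contDiff_id)
    have hl : ∀ r : ℝ, HasDerivAt (fun r : ℝ => ξ * r) ξ r := fun r => by
      simpa using (hasDerivAt_id r).const_mul ξ
    rw [wlaw_charFun i1, wlaw_charFun i2,
      h.conserved_wgt hc (fun r => Real.abs_cos_le_one _) (N := |ξ|) (fun r => ?_) ht,
      h.conserved_wgt hs (fun r => Real.abs_sin_le_one _) (N := |ξ|) (fun r => ?_) ht]
    · rw [((hl r).sin).deriv, abs_mul]
      exact mul_le_of_le_one_left (abs_nonneg _) (Real.abs_cos_le_one _)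
    · rw [((hl r).cos).deriv, abs_mul, abs_neg]
      exact mul_le_of_le_one_left (abs_nonneg _) (Real.abs_sin_le_one _)
  rw [← lintegral_wlaw i1.1 hF hF0, ← lintegral_wlaw i2.1 hF hF0, hl]

/-- A property of values that holds for the initial density (and at the vacuum) propagates. -/
lemma ae_conserved (h : Transport T ρ₀ ρ u G) {S : Set ℝ} (hS : MeasurableSet S) (h0 : 0 ∈ S)
    (hi : ∀ᵐ x, ρ₀ x ∈ S) {t : ℝ} (ht : t ∈ Icc 0 T) : ∀ᵐ x, ρ t x ∈ S := by
  have hm : Measurable (Sᶜ.indicator (1 : ℝ → ℝ≥0∞)) := measurable_one.indicator hS.compl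
  have h1 := h.lintegral_conserved hm (by simp [h0]) ht
  have h2 : ∫⁻ x, Sᶜ.indicator (1 : ℝ → ℝ≥0∞) (ρ₀ x) = 0 := by
    have hm0 : AEMeasurable (fun x => Sᶜ.indicator (1 : ℝ → ℝ≥0∞) (ρ₀ x)) volume :=
      hm.comp_aemeasurable h.integrable_initial.1.aemeasurable
    rw [lintegral_eq_zero_iff' hm0]
    filter_upwards [hi] with x hx
    simp [hx]
  have hmt : AEMeasurable (fun x => Sᶜ.indicator (1 : ℝ → ℝ≥0∞) (ρ t x)) volume :=
    hm.comp_aemeasurable (h.integrable_slice ht).1.aemeasurable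
  rw [h2, lintegral_eq_zero_iff' hmt] at h1
  filter_upwards [h1] with x hx
  by_contra hc
  simp [hc] at hx

end Transport

/-! ### Functions with square integrable difference quotients -/

lemma lintegral_le_of_tendsto {α : Type*} [MeasurableSpace α] {ν : Measure α}
    {F : ℕ → α → ℝ≥0∞} (hm : ∀ n, AEMeasurable (F n) ν) {g : α → ℝ≥0∞}
    (hlim : ∀ᵐ x ∂ν, Tendsto (fun n => F n x) atTop (𝓝 (g x))) {C : ℝ≥0∞}
    (hC : ∀ n, ∫⁻ x, F n x ∂ν ≤ C) : ∫⁻ x, g x ∂ν ≤ C := by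
  calc ∫⁻ x, g x ∂ν = ∫⁻ x, liminf (fun n => F n x) atTop ∂ν :=
        lintegral_congr_ae (hlim.mono fun x hx => hx.liminf_eq.symm)
    _ ≤ liminf (fun n => ∫⁻ x, F n x ∂ν) atTop := lintegral_liminf_le' hm
    _ ≤ C := liminf_le_of_le (h := fun b hb => by
        obtain ⟨n, hn⟩ := hb.exists
        exact hn.trans (hC n))

/-- `f` has difference quotients bounded in `L²`, with squared bound `D`. -/
def DiffQuot (f : E3 → ℝ) (D : ℝ≥0∞) : Prop :=
  ∀ z : E3, ∫⁻ x, ‖f (x - z) - f x‖ₑ ^ 2 ≤ ‖z‖ₑ ^ 2 * D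

lemma DiffQuot.fderiv_sq_le {f : E3 → ℝ} {D : ℝ≥0∞} (h : DiffQuot f D) (hf : ContDiff ℝ 1 f)
    (e : E3) : ∫⁻ x, ‖fderiv ℝ f x e‖ₑ ^ 2 ≤ ‖e‖ₑ ^ 2 * D := by
  set a : ℕ → ℝ := fun n => ((n:ℝ) + 1)⁻¹ with ha
  have hapos : ∀ n, 0 < a n := fun n => by positivity
  have hlim : Tendsto a atTop (𝓝 0) := tendsto_inv_atTop_zero.comp
    (tendsto_atTop_add_const_right _ _ tendsto_natCast_atTop_atTop)
  have hlim' : Tendsto a atTop (𝓝[≠] 0) :=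
    tendsto_nhdsWithin_iff.2 ⟨hlim, Eventually.of_forall fun n => (hapos n).ne'⟩
  refine lintegral_le_of_tendsto
    (F := fun n x => ‖(a n)⁻¹ • (f (x + a n • e) - f x)‖ₑ ^ 2) (fun n => ?_)
    (Eventually.of_forall fun x => ?_) fun n => ?_
  · have : Continuous fun x => (a n)⁻¹ • (f (x + a n • e) - f x) := by
      have := hf.continuous
      fun_prop
    exact (this.measurable.enorm.pow_const 2).aemeasurable
  · have hd := (hf.differentiable one_ne_zero x).hasFDerivAt.hasLineDerivAt e
    have := hd.tendsto_slope_zero.comp hlim'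
    exact ENNReal.Tendsto.pow this.enorm
  · have h1 := h (-(a n • e))
    simp only [sub_neg_eq_add, enorm_neg, enorm_smul] at h1
    simp only [enorm_smul, mul_pow]
    rw [lintegral_const_mul' _ _ (by finiteness)]
    calc ‖(a n)⁻¹‖ₑ ^ 2 * ∫⁻ x, ‖f (x + a n • e) - f x‖ₑ ^ 2
        ≤ ‖(a n)⁻¹‖ₑ ^ 2 * ((‖a n‖ₑ * ‖e‖ₑ) ^ 2 * D) := by gcongr
      _ = (‖(a n)⁻¹‖ₑ * ‖a n‖ₑ) ^ 2 * (‖e‖ₑ ^ 2 * D) := by ring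
      _ = ‖e‖ₑ ^ 2 * D := by
        rw [← enorm_mul, inv_mul_cancel₀ (hapos n).ne']; simp

lemma DiffQuot.mol {f : E3 → ℝ} {D : ℝ≥0∞} (h : DiffQuot f D) (hf : LocallyIntegrable f) (k : ℕ) :
    DiffQuot (mol f (eta k)) D := by
  intro z
  have hfz : LocallyIntegrable fun y => f (y - z) := by
    have hmp : MeasurePreserving (fun y : E3 => y - z) volume volume :=
      measurePreserving_sub_right volume z
    intro x
    obtain ⟨s, hs, hi⟩ := hf (x - z)
    refine ⟨(fun y => y - z) ⁻¹' s, (continuous_sub_right z).continuousAt.preimage_mem_nhds hs, ?_⟩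
    exact (hmp.integrableOn_comp_preimage (Homeomorph.subRight z).measurableEmbedding).2 hi
  have e : ∀ x, InhomNS.mol f (eta k) (x - z) - InhomNS.mol f (eta k) x
      = InhomNS.mol (fun y => f (y - z) - f y) (eta k) x := by
    intro x
    have e1 : InhomNS.mol f (eta k) (x - z) = InhomNS.mol (fun y => f (y - z)) (eta k) x := by
      simp only [InhomNS.mol]
      rw [← integral_sub_right_eq_self _ z]
      refine integral_congr_ae (Eventually.of_forall fun y => ?_)
      simp
    rw [e1]
    simp only [InhomNS.mol, sub_mul]
    exact (integral_sub (integrable_mul_kernel hfz (eta_smooth k).continuous (eta_cs k) x)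
      (integrable_mul_kernel hf (eta_smooth k).continuous (eta_cs k) x)).symm
  simp_rw [e]
  exact (mol_sq_le (hfz.sub hf).aestronglyMeasurable k).trans (h z)

lemma enorm_basisVec (j : Fin 3) : ‖basisVec j‖ₑ = 1 := by
  rw [← ofReal_norm]; simp [basisVec]

lemma opNorm_sq_le (L : E3 →L[ℝ] ℝ) : ‖L‖ₑ ^ 2 ≤ ∑ j, ‖L (basisVec j)‖ₑ ^ 2 := by
  have h : ‖L‖ ≤ Real.sqrt (∑ j, ‖L (basisVec j)‖ ^ 2) := by
    refine L.opNorm_le_bound (Real.sqrt_nonneg _) fun x => ?_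
    have e : L x = ∑ j, x j * L (basisVec j) := by
      conv_lhs => rw [basisVec_sum x]
      simp [map_sum]
    rw [e, EuclideanSpace.norm_eq, ← Real.sqrt_mul (by positivity)]
    refine Real.le_sqrt_of_sq_le ?_
    rw [Real.norm_eq_abs, sq_abs]
    refine (Finset.sum_mul_sq_le_sq_mul_sq _ _ _).trans ?_
    rw [mul_comm]
    simp
  have h2 : ‖L‖ ^ 2 ≤ ∑ j, ‖L (basisVec j)‖ ^ 2 := by
    calc ‖L‖ ^ 2 ≤ Real.sqrt (∑ j, ‖L (basisVec j)‖ ^ 2) ^ 2 := by gcongr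
      _ = _ := Real.sq_sqrt (by positivity)
  simp only [← ofReal_norm, ← ENNReal.ofReal_pow (norm_nonneg _)]
  rw [← ENNReal.ofReal_sum_of_nonneg fun _ _ => by positivity]
  exact ENNReal.ofReal_le_ofReal h2

lemma DiffQuot.lintegral_fderiv_sq_le {f : E3 → ℝ} {D : ℝ≥0∞} (h : DiffQuot f D)
    (hf : ContDiff ℝ 1 f) : ∫⁻ x, ‖fderiv ℝ f x‖ₑ ^ 2 ≤ 3 * D := by
  have hm : ∀ j, Measurable fun x => ‖fderiv ℝ f x (basisVec j)‖ₑ ^ 2 := fun j =>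
    ((hf.continuous_fderiv one_ne_zero).clm_apply continuous_const).measurable.enorm.pow_const 2
  calc ∫⁻ x, ‖fderiv ℝ f x‖ₑ ^ 2 ≤ ∫⁻ x, ∑ j, ‖fderiv ℝ f x (basisVec j)‖ₑ ^ 2 :=
        lintegral_mono fun x => opNorm_sq_le _
    _ = ∑ j, ∫⁻ x, ‖fderiv ℝ f x (basisVec j)‖ₑ ^ 2 := lintegral_finsetSum _ fun j _ => hm j
    _ ≤ ∑ j : Fin 3, D := Finset.sum_le_sum fun j _ => by
        have := h.fderiv_sq_le hf (basisVec j)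
        rwa [enorm_basisVec, one_pow, one_mul] at this
    _ = 3 * D := by simp

/-- The constant of the Sobolev inequality `‖f‖₆² ≤ C ‖∇f‖₂²`. -/
def sobConst : ℝ≥0∞ := (SNormLESNormFDerivOfEqConst ℝ (volume : Measure E3) 2 : ℝ≥0∞) ^ 2 * 3

lemma sobConst_ne_top : sobConst ≠ ⊤ := by unfold sobConst; finiteness

lemma sobolev_smooth {g : E3 → ℝ} (hg : ContDiff ℝ ∞ g) (hg2 : MemLp g 2) :
    eLpNorm g 6 volume ≤ SNormLESNormFDerivOfEqConst ℝ (volume : Measure E3) 2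
      * eLpNorm (fderiv ℝ g) 2 volume := by
  obtain ⟨ζ, C, hζ, hζc, hζ1, hζlim, hd⟩ := exists_cutoff_seq
  set S : ℝ≥0∞ := ((SNormLESNormFDerivOfEqConst ℝ (volume : Measure E3) 2 : ℝ≥0) : ℝ≥0∞) with hS
  have hg1 : ContDiff ℝ 1 g := hg.of_le (by exact_mod_cast le_top)
  have hgd : Continuous (fderiv ℝ g) := hg1.continuous_fderiv one_ne_zero
  have hR : ∀ R : ℕ, eLpNorm (fun x => ζ R x * g x) 6 volume
      ≤ S * (eLpNorm (fderiv ℝ g) 2 volume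
        + ENNReal.ofReal (C * ((R:ℝ) + 1)⁻¹) * eLpNorm g 2 volume) := by
    intro R
    have hζ1' : ContDiff ℝ 1 (ζ R) := (hζ R).of_le (by exact_mod_cast le_top)
    have h6 := eLpNorm_le_eLpNorm_fderiv_of_eq (F := ℝ) (volume : Measure E3)
      (u := fun x => ζ R x * g x) (hζ1'.mul hg1) (hζc R).mul_right (p := 2) (p' := 6)
      (by norm_num) (by simp) (by simp; norm_num)
    rw [ENNReal.coe_ofNat, ENNReal.coe_ofNat, NNReal.coe_ofNat, ← hS] at h6
    refine h6.trans (mul_le_mul' le_rfl ?_)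
    have hfd : ∀ x, fderiv ℝ (fun x => ζ R x * g x) x
        = ζ R x • fderiv ℝ g x + g x • fderiv ℝ (ζ R) x := fun x =>
      fderiv_fun_mul (hζ1'.differentiable one_ne_zero x) (hg1.differentiable one_ne_zero x)
    have hfe : fderiv ℝ (fun x => ζ R x * g x)
        = (fun x => ζ R x • fderiv ℝ g x) + fun x => g x • fderiv ℝ (ζ R) x := funext hfd
    rw [hfe]
    have m1 : AEStronglyMeasurable (fun x => ζ R x • fderiv ℝ g x) volume :=
      ((hζ R).continuous.smul hgd).aestronglyMeasurable
    have m2 : AEStronglyMeasurable (fun x => g x • fderiv ℝ (ζ R) x) volume :=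
      (hg.continuous.smul (hζ1'.continuous_fderiv one_ne_zero)).aestronglyMeasurable
    refine (eLpNorm_add_le m1 m2 one_le_two).trans (add_le_add ?_ ?_)
    · refine eLpNorm_mono fun x => ?_
      rw [norm_smul]; exact mul_le_of_le_one_left (norm_nonneg _) (hζ1 R x)
    · refine eLpNorm_le_mul_eLpNorm_of_ae_le_mul (Eventually.of_forall fun x => ?_) 2
      rw [norm_smul, mul_comm]
      gcongr
      exact hd R x
  have hC : Tendsto (fun R : ℕ => S * (eLpNorm (fderiv ℝ g) 2 volume
      + ENNReal.ofReal (C * ((R:ℝ) + 1)⁻¹) * eLpNorm g 2 volume)) atTop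
      (𝓝 (S * eLpNorm (fderiv ℝ g) 2 volume)) := by
    have t0 : Tendsto (fun R : ℕ => C * ((R:ℝ) + 1)⁻¹) atTop (𝓝 (C * 0)) :=
      (tendsto_inv_atTop_zero.comp
        (tendsto_atTop_add_const_right _ _ tendsto_natCast_atTop_atTop)).const_mul C
    rw [mul_zero] at t0
    have t1 := (ENNReal.continuous_ofReal.tendsto 0).comp t0
    rw [ENNReal.ofReal_zero] at t1
    have t2 := ENNReal.Tendsto.mul_const (b := eLpNorm g 2 volume) t1 (Or.inr hg2.2.ne)
    rw [zero_mul] at t2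
    have t3 := ENNReal.Tendsto.const_mul (a := S) (t2.const_add (eLpNorm (fderiv ℝ g) 2 volume))
      (Or.inr (by simp [hS]))
    rwa [add_zero] at t3
  have hF := Lp.eLpNorm_lim_le_liminf_eLpNorm (p := 6) (μ := (volume : Measure E3))
    (f := fun R x => ζ R x * g x)
    (fun R => ((hζ R).continuous.mul hg.continuous).aestronglyMeasurable) g
    (Eventually.of_forall fun x => by simpa using (hζlim x).mul_const (g x))
  refine hF.trans ((liminf_le_liminf (Eventually.of_forall hR)).trans ?_)
  exact hC.liminf_eq.le

lemma DiffQuot.sobolev {f : E3 → ℝ} {D : ℝ≥0∞} (h : DiffQuot f D) (hf : MemLp f 2) :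
    eLpNorm f 6 volume ^ 2 ≤ sobConst * D := by
  have hli := hf.locallyIntegrable one_le_two
  obtain ⟨d, hd, -⟩ := exists_sq_eq (3 * D)
  set S : ℝ≥0∞ := ((SNormLESNormFDerivOfEqConst ℝ (volume : Measure E3) 2 : ℝ≥0) : ℝ≥0∞) with hS
  have hk : ∀ k, eLpNorm (InhomNS.mol f (eta k)) 6 volume ≤ S * d := by
    intro k
    have hs := mol_contDiff hli (eta_smooth k) (eta_cs k)
    refine (sobolev_smooth hs ⟨hs.continuous.aestronglyMeasurable, ?_⟩).trans ?_
    · have := mol_sq_le hf.1 k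
      rw [← eLpNorm_two_sq, ← eLpNorm_two_sq] at this
      exact lt_of_le_of_lt ((ENNReal.pow_le_pow_left_iff two_ne_zero).1 this) hf.2
    · gcongr
      refine (ENNReal.pow_le_pow_left_iff two_ne_zero).1 ?_
      rw [eLpNorm_two_sq, hd]
      exact (h.mol hli k).lintegral_fderiv_sq_le (hs.of_le (by exact_mod_cast le_top))
  have hF := Lp.eLpNorm_lim_le_liminf_eLpNorm (p := 6) (μ := (volume : Measure E3))
    (f := fun k => InhomNS.mol f (eta k))
    (fun k => (mol_contDiff hli (eta_smooth k) (eta_cs k)).continuous.aestronglyMeasurable) f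
    (mol_eta_tendsto hli)
  have : eLpNorm f 6 volume ≤ S * d := hF.trans (liminf_le_of_le (h := fun b hb => by
        obtain ⟨n, hn⟩ := hb.exists
        exact hn.trans (hk n)))
  calc eLpNorm f 6 volume ^ 2 ≤ (S * d) ^ 2 := by gcongr
    _ = sobConst * D := by rw [mul_pow, hd, sobConst]; ring

/-- The weak derivative is controlled by the difference quotients. -/
lemma DiffQuot.integral_mul_fderiv_le {f : E3 → ℝ} {d : ℝ≥0∞} (h : DiffQuot f (d ^ 2))
    (hd : d ≠ ⊤) (hf : LocallyIntegrable f) {φ : E3 → ℝ} (hφ : ContDiff ℝ ∞ φ)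
    (hφc : HasCompactSupport φ) (j : Fin 3) :
    ‖∫ x, f x * fderiv ℝ φ x (basisVec j)‖ₑ ≤ d * eLpNorm φ 2 volume := by
  have hφ1 : ContDiff ℝ 1 φ := hφ.of_le (by exact_mod_cast le_top)
  have hdc : Continuous fun x => fderiv ℝ φ x (basisVec j) :=
    (hφ1.continuous_fderiv one_ne_zero).clm_apply continuous_const
  have hds : HasCompactSupport fun x => fderiv ℝ φ x (basisVec j) :=
    (hφc.fderiv ℝ).comp_left (g := fun L : E3 →L[ℝ] ℝ => L (basisVec j)) rfl
  have hlim := integral_mol_tendsto hf (C := d ^ 2) (by finiteness) h hdc hds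
  refine le_of_tendsto' hlim.enorm fun k => ?_
  have hs : ContDiff ℝ 1 (InhomNS.mol f (eta k)) :=
    (mol_contDiff hf (eta_smooth k) (eta_cs k)).of_le (by exact_mod_cast le_top)
  have hmd : Continuous fun x => fderiv ℝ (InhomNS.mol f (eta k)) x (basisVec j) :=
    (hs.continuous_fderiv one_ne_zero).clm_apply continuous_const
  have hparts := integral_mul_fderiv_eq_neg_fderiv_mul_of_integrable (μ := (volume : Measure E3))
    (f := InhomNS.mol f (eta k)) (g := φ) (v := basisVec j)
    ((hmd.mul hφ.continuous).integrable_of_hasCompactSupport hφc.mul_left)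
    ((hs.continuous.mul hdc).integrable_of_hasCompactSupport hds.mul_left)
    ((hs.continuous.mul hφ.continuous).integrable_of_hasCompactSupport hφc.mul_left)
    (fun x _ => hs.differentiable one_ne_zero x) (fun x _ => hφ1.differentiable one_ne_zero x)
  rw [hparts, enorm_neg]
  refine (enorm_integral_le_lintegral_enorm _).trans ?_
  simp_rw [enorm_mul]
  refine lintegral_mul_le_sqrt _ hmd.measurable.enorm.aemeasurable
    hφ.continuous.measurable.enorm.aemeasurable ?_ (eLpNorm_two_sq _ _).ge
  have := (h.mol hf k).fderiv_sq_le hs (basisVec j)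
  rwa [enorm_basisVec, one_pow, one_mul] at this

/-! ### Plancherel's identity for integrable functions -/

open SchwartzMap in
lemma fourier_toLp_ae_eq {f : E3 → ℂ} (h1 : Integrable f) (h2 : MemLp f 2) :
    (𝓕 (h2.toLp f) : Lp ℂ 2 (volume : Measure E3)) =ᵐ[volume] 𝓕 f := by
  have hfc : Continuous (𝓕 f) :=
    VectorFourier.fourierIntegral_continuous (L := innerₗ E3) Real.continuous_fourierChar
      continuous_inner h1
  refine ae_eq_of_integral_contDiff_smul_eq
    ((Lp.memLp _).locallyIntegrable one_le_two) hfc.locallyIntegrable fun g hg hgc => ?_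
  have hgc' : HasCompactSupport fun x => (g x : ℂ) :=
    hgc.comp_left (g := fun r : ℝ => (r : ℂ)) rfl
  have hg' : ContDiff ℝ ∞ fun x => (g x : ℂ) := Complex.ofRealCLM.contDiff.comp hg
  set γ : 𝓢(E3, ℂ) := hgc'.toSchwartzMap hg' with hγ
  have hγa : ∀ x, γ x = (g x : ℂ) := fun x => rfl
  have key := DFunLike.congr_fun (Lp.fourier_toTemperedDistribution_eq (h2.toLp f)) γ
  rw [TemperedDistribution.fourier_apply, Lp.toTemperedDistribution_apply,
    Lp.toTemperedDistribution_apply] at key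
  have e1 : ∫ x, g x • (𝓕 (h2.toLp f) : Lp ℂ 2 (volume : Measure E3)) x
      = ∫ x, γ x • (𝓕 (h2.toLp f) : Lp ℂ 2 (volume : Measure E3)) x :=
    integral_congr_ae (Eventually.of_forall fun x => by simp [hγa])
  have e2 : ∫ x, (𝓕 γ) x • (h2.toLp f) x = ∫ x, (𝓕 (γ : E3 → ℂ)) x • f x := by
    refine integral_congr_ae ?_
    filter_upwards [h2.coeFn_toLp] with x hx
    rw [hx, SchwartzMap.fourier_coe]
  have e3 := VectorFourier.integral_fourierIntegral_smul_eq_flip (μ := (volume : Measure E3))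
    (ν := (volume : Measure E3)) (e := Real.fourierChar) (L := innerₗ E3)
    (f := γ) (g := f) Real.continuous_fourierChar continuous_inner γ.integrable h1
  rw [e1, ← key, e2]
  refine e3.trans (integral_congr_ae (Eventually.of_forall fun x => ?_))
  simp only [hγa]
  rw [flip_innerₗ]
  simp only [Complex.real_smul, smul_eq_mul]
  rfl

lemma plancherel {f : E3 → ℂ} (h1 : Integrable f) (h2 : MemLp f 2) :
    ∫⁻ ξ, ‖𝓕 f ξ‖ₑ ^ 2 = ∫⁻ x, ‖f x‖ₑ ^ 2 := by
  rw [← eLpNorm_two_sq, ← eLpNorm_two_sq, ← eLpNorm_congr_ae (fourier_toLp_ae_eq h1 h2)]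
  congr 1
  have h := Lp.norm_fourier_eq (h2.toLp f)
  rw [Lp.norm_def, Lp.norm_toLp] at h
  exact (ENNReal.toReal_eq_toReal_iff' (Lp.memLp _).2.ne h2.2.ne).1 h

lemma fourier_translate {f : E3 → ℂ} (h1 : Integrable f) (z ξ : E3) :
    𝓕 (fun x => f (x - z) - f x) ξ = (Real.fourierChar (-(inner ℝ z ξ)) - 1 : ℂ) * 𝓕 f ξ := by
  have hz : Integrable fun x => f (x - z) := h1.comp_sub_right z
  have e1 : 𝓕 (fun x => f (x - z)) ξ = (Real.fourierChar (-(inner ℝ z ξ)) : ℂ) * 𝓕 f ξ := by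
    simp only [Real.fourier_eq]
    rw [← integral_add_right_eq_self _ z, ← integral_const_mul]
    refine integral_congr_ae (Eventually.of_forall fun x => ?_)
    simp only [add_sub_cancel_right, inner_add_left, neg_add, AddChar.map_add_eq_mul]
    simp only [Circle.smul_def, Circle.coe_mul, smul_eq_mul]
    ring
  rw [sub_mul, one_mul, ← e1]
  simp only [Real.fourier_eq, smul_sub]
  exact integral_sub ((Real.fourierIntegral_convergent_iff ξ).2 hz)
    ((Real.fourierIntegral_convergent_iff ξ).2 h1)

lemma enorm_fourierChar_sub_one_le (r : ℝ) :
    ‖((Real.fourierChar r : ℂ) - 1)‖ₑ ≤ ENNReal.ofReal (2 * Real.pi) * ‖r‖ₑ := by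
  have h : ‖((Real.fourierChar r : ℂ) - 1)‖ ≤ 2 * Real.pi * ‖r‖ := by
    rw [Real.fourierChar_apply, mul_comm _ Complex.I]
    refine (Real.norm_exp_I_mul_ofReal_sub_one_le).trans ?_
    rw [norm_mul, Real.norm_of_nonneg (by positivity)]
  rw [← ofReal_norm, ← ofReal_norm, ← ENNReal.ofReal_mul (by positivity)]
  exact ENNReal.ofReal_le_ofReal h

lemma diffQuot_of_fourier {f : E3 → ℝ} (h1 : Integrable f) (h2 : MemLp f 2) :
    DiffQuot f (ENNReal.ofReal (2 * Real.pi) ^ 2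
      * ∫⁻ ξ, ‖ξ‖ₑ ^ 2 * ‖𝓕 (fun x => (f x : ℂ)) ξ‖ₑ ^ 2) := by
  intro z
  have hc1 : Integrable fun x => (f x : ℂ) := h1.ofReal
  have hc2 : MemLp (fun x => (f x : ℂ)) 2 := h2.ofReal
  have hs2 : MemLp (fun x => (f (x - z) : ℂ)) 2 :=
    hc2.comp_measurePreserving (measurePreserving_sub_right volume z)
  have hp := plancherel (f := fun x => (f (x - z) : ℂ) - f x) ((hc1.comp_sub_right z).sub hc1)
    (hs2.sub hc2)
  have e : ∫⁻ x, ‖f (x - z) - f x‖ₑ ^ 2 = ∫⁻ x, ‖(f (x - z) : ℂ) - f x‖ₑ ^ 2 := by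
    refine lintegral_congr fun x => ?_
    rw [← Complex.ofReal_sub, ← ofReal_norm, ← ofReal_norm, Complex.norm_real]
  rw [e, ← hp]
  simp_rw [fourier_translate hc1 z, enorm_mul, mul_pow]
  rw [← mul_assoc, ← lintegral_const_mul' _ _ (by finiteness)]
  refine lintegral_mono fun ξ => ?_
  rw [← mul_assoc]
  gcongr
  rw [← mul_pow, ← mul_pow]
  gcongr
  refine (enorm_fourierChar_sub_one_le _).trans ?_
  rw [enorm_neg, mul_comm ‖z‖ₑ, mul_assoc]
  gcongr
  rw [← ofReal_norm, ← ofReal_norm, ← ofReal_norm, ← ENNReal.ofReal_mul (norm_nonneg _)]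
  exact ENNReal.ofReal_le_ofReal (norm_inner_le_norm z ξ)

/-! ### Shell bounds and difference quotients -/

lemma finrank_E3 : Module.finrank ℝ E3 = 3 := by simp

lemma lintegral_polar {F : E3 → ℝ≥0∞} (hF : Measurable F) :
    ∫⁻ x, F x = ∫⁻ r in Ioi (0:ℝ), ∫⁻ σ : Metric.sphere (0 : E3) 1, F (r • (σ : E3))
      * ENNReal.ofReal (r ^ 2) ∂(volume : Measure E3).toSphere := by
  have hmp := Measure.measurePreserving_homeomorphUnitSphereProd (volume : Measure E3)
  rw [finrank_E3] at hmp
  set Q : Metric.sphere (0 : E3) 1 × Ioi (0:ℝ) → ℝ≥0∞ := fun p => F ((p.2 : ℝ) • (p.1 : E3)) with hQ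
  have hQm : Measurable Q := hF.comp (by fun_prop)
  have h1 : ∫⁻ x, F x = ∫⁻ x : ({0}ᶜ : Set E3), F x ∂((volume : Measure E3).comap (↑)) := by
    rw [lintegral_subtype_comap (measurableSet_singleton (0:E3)).compl (fun x => F x)]
    rw [Measure.restrict_congr_set (t := univ), Measure.restrict_univ]
    rw [ae_eq_univ, compl_compl]; simp
  have h2 : ∀ x : ({0}ᶜ : Set E3), F x = Q (homeomorphUnitSphereProd E3 x) := by
    intro x
    have hx : (x : E3) ≠ 0 := x.2
    simp [hQ, smul_smul, norm_ne_zero_iff.2 hx]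
  rw [h1]
  simp_rw [h2]
  rw [hmp.lintegral_comp hQm, lintegral_prod_symm _ hQm.aemeasurable]
  have hin : Measurable fun r : ℝ => ∫⁻ σ : Metric.sphere (0 : E3) 1, F (r • (σ : E3))
      ∂(volume : Measure E3).toSphere := by
    have : Measurable fun p : ℝ × Metric.sphere (0 : E3) 1 => F (p.1 • (p.2 : E3)) :=
      hF.comp (by fun_prop)
    exact this.lintegral_prod_right'
  have hp : Measurable fun r : Ioi (0:ℝ) => ENNReal.ofReal (r.1 ^ (3 - 1)) := by fun_prop
  rw [Measure.volumeIoiPow, lintegral_withDensity_eq_lintegral_mul _ hp (by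
    exact hin.comp measurable_subtype_coe)]
  rw [← lintegral_subtype_comap (measurableSet_Ioi (a := (0:ℝ)))]
  refine lintegral_congr fun r => ?_
  simp only [Pi.mul_apply, hQ]
  rw [lintegral_mul_const' _ _ ENNReal.ofReal_ne_top, mul_comm]

lemma lintegral_scale {F : E3 → ℝ≥0∞} (hF : Measurable F) {c : ℝ} (hc : 0 < c) :
    ∫⁻ x, F (c • x) = ENNReal.ofReal ((c ^ 3)⁻¹) * ∫⁻ x, F x := by
  have h := Measure.map_addHaar_smul (volume : Measure E3) hc.ne'
  have h2 : ∫⁻ x, F x ∂(Measure.map (fun x => c • x) (volume : Measure E3)) = ∫⁻ x, F (c • x) :=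
    lintegral_map hF (measurable_const_smul c)
  rw [← h2]
  have h' : Measure.map (fun x => c • x) (volume : Measure E3) = _ := h
  rw [h', lintegral_smul_measure, finrank_E3, abs_of_pos (by positivity), smul_eq_mul]

/-- The energy density in Fourier space. -/
def specDens (g : E3 → E3) (k : E3) : ℝ≥0∞ := ∑ i, ‖fourierComp g k i‖ₑ ^ 2

lemma fourier_eq_fourierComp (g : E3 → E3) (i : Fin 3) (ξ : E3) :
    𝓕 (fun x => (g x i : ℂ)) ξ
      = (((2 * Real.pi) ^ 3 : ℝ) : ℂ) * fourierComp g ((2 * Real.pi) • ξ) i := by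
  have hpi : (2 * Real.pi) ^ 3 ≠ 0 := by positivity
  rw [fourierComp, ← mul_assoc, ← Complex.ofReal_mul, mul_one_div_cancel hpi, Complex.ofReal_one,
    one_mul, Real.fourier_eq]
  refine integral_congr_ae (Eventually.of_forall fun x => ?_)
  simp only [Circle.smul_def, smul_eq_mul, Real.fourierChar_apply]
  rw [mul_comm]
  congr 2
  rw [inner_smul_left, real_inner_comm]
  push_cast
  simp
  ring

lemma fourierComp_measurable {W : ℝ → E3 → E3} (hW : StronglyMeasurable (Function.uncurry W))
    (i : Fin 3) : Measurable fun p : ℝ × E3 => fourierComp (W p.1) p.2 i := by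
  have h1 : StronglyMeasurable fun p : (ℝ × E3) × E3 => (W p.1.1 p.2 i : ℂ)
      * Complex.exp (-(Complex.I * ((inner ℝ p.1.2 p.2 : ℝ) : ℂ))) := by
    refine StronglyMeasurable.mul ?_ ?_
    · have : StronglyMeasurable fun p : (ℝ × E3) × E3 => Function.uncurry W (p.1.1, p.2) :=
        hW.comp_measurable (by fun_prop)
      have h2 := (PiLp.continuous_apply 2 (fun _ : Fin 3 => ℝ) i).comp_stronglyMeasurable this
      exact Complex.continuous_ofReal.comp_stronglyMeasurable h2
    · exact (by fun_prop : Continuous fun p : (ℝ × E3) × E3 =>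
        Complex.exp (-(Complex.I * ((inner ℝ p.1.2 p.2 : ℝ) : ℂ)))).stronglyMeasurable
  exact (h1.integral_prod_right'.const_mul _).measurable

lemma specDens_measurable {W : ℝ → E3 → E3} (hW : StronglyMeasurable (Function.uncurry W)) :
    Measurable fun p : ℝ × E3 => specDens (W p.1) p.2 :=
  Finset.measurable_fun_sum _ fun i _ => (fourierComp_measurable hW i).enorm.pow_const 2

lemma specDens_measurable_slice {W : ℝ → E3 → E3} (hW : StronglyMeasurable (Function.uncurry W))
    (t : ℝ) : Measurable (specDens (W t)) := by
  have h2 := (specDens_measurable hW).comp (measurable_prodMk_left (x := t))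
  rw [Function.comp_def] at h2
  exact h2

/-- The bound on the high frequencies. -/
def tailConst (β C kstar : ℝ) : ℝ≥0∞ :=
  ∫⁻ r in Ioi kstar, ENNReal.ofReal (r ^ 2) * (ENNReal.ofReal C / ENNReal.ofReal (r ^ (3 + β)))

lemma tailConst_ne_top {β C kstar : ℝ} (hβ : 0 < β) (hC : 0 < C) (hk : 0 < kstar) :
    tailConst β C kstar ≠ ⊤ := by
  have hi : IntegrableOn (fun r : ℝ => C * r ^ (-1 - β)) (Ioi kstar) :=
    (integrableOn_Ioi_rpow_of_lt (by linarith) hk).const_mul C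
  have h := hi.2
  rw [HasFiniteIntegral] at h
  refine ((setLIntegral_mono' measurableSet_Ioi fun r hr => ?_).trans_lt h).ne
  have hr0 : 0 < r := hk.trans hr
  have hp : 0 < r ^ (3 + β) := Real.rpow_pos_of_pos hr0 _
  rw [← ENNReal.ofReal_div_of_pos hp, ← ENNReal.ofReal_mul (by positivity),
    Real.enorm_of_nonneg (by positivity)]
  refine ENNReal.ofReal_le_ofReal (le_of_eq ?_)
  have e : r ^ (-1 - β) = r ^ 2 / r ^ (3 + β) := by
    rw [← Real.rpow_natCast r 2, ← Real.rpow_sub hr0]; congr 1; push_cast; ring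
  rw [e]; ring

lemma high_freq_bound {T : ℝ} {W : ℝ → E3 → E3} (hW : StronglyMeasurable (Function.uncurry W))
    {β C kstar : ℝ}
    (hsh : ∀ k : ℝ, kstar ≤ k →
      ENNReal.ofReal (k ^ (3 + β)) * shellEnergy T W k ≤ ENNReal.ofReal C) :
    ∫⁻ t in Ioo 0 T, ∫⁻ k, ‖k‖ₑ ^ 2 * specDens (W t) k
      ≤ ENNReal.ofReal (kstar ^ 2) * (∫⁻ t in Ioo 0 T, ∫⁻ k, specDens (W t) k)
        + tailConst β C kstar := by
  have hm := specDens_measurable hW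
  have hmt : ∀ t, Measurable (specDens (W t)) := specDens_measurable_slice hW
  have hmI : Measurable fun t => ∫⁻ k, specDens (W t) k := hm.lintegral_prod_right'
  set H : E3 → ℝ≥0∞ := {k : E3 | kstar < ‖k‖}.indicator fun k => ‖k‖ₑ ^ 2 with hH
  have hHm : Measurable H := (by fun_prop : Measurable fun k : E3 => ‖k‖ₑ ^ 2).indicator
    (measurableSet_lt measurable_const measurable_norm)
  have hpt : ∀ (t : ℝ) (k : E3), ‖k‖ₑ ^ 2 * specDens (W t) k
      ≤ ENNReal.ofReal (kstar ^ 2) * specDens (W t) k + H k * specDens (W t) k := by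
    intro t k
    rw [← add_mul]
    gcongr
    by_cases h : kstar < ‖k‖
    · rw [hH, indicator_of_mem (show k ∈ {k : E3 | kstar < ‖k‖} from h)]; exact le_add_self
    · refine le_add_right ?_
      rw [← ofReal_norm, ← ENNReal.ofReal_pow (norm_nonneg _)]
      exact ENNReal.ofReal_le_ofReal (by gcongr; exact not_lt.1 h)
  have hsl : ∀ t, ∫⁻ k, ‖k‖ₑ ^ 2 * specDens (W t) k ≤ ENNReal.ofReal (kstar ^ 2)
      * (∫⁻ k, specDens (W t) k) + ∫⁻ k, H k * specDens (W t) k := by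
    intro t
    refine (lintegral_mono (hpt t)).trans ?_
    rw [lintegral_add_left ((hmt t).const_mul _), lintegral_const_mul _ (hmt t)]
  refine (lintegral_mono hsl).trans ?_
  rw [lintegral_add_left (hmI.const_mul _), lintegral_const_mul _ hmI]
  gcongr
  have hpol : ∀ t, ∫⁻ k, H k * specDens (W t) k = ∫⁻ r in Ioi (0:ℝ),
      ∫⁻ σ : Metric.sphere (0 : E3) 1, H (r • (σ : E3)) * specDens (W t) (r • (σ : E3))
        * ENNReal.ofReal (r ^ 2) ∂(volume : Measure E3).toSphere := fun t =>
    lintegral_polar (hHm.mul (hmt t))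
  simp_rw [hpol]
  have hj : Measurable fun q : (ℝ × ℝ) × Metric.sphere (0 : E3) 1 =>
      H (q.1.2 • (q.2 : E3)) * specDens (W q.1.1) (q.1.2 • (q.2 : E3))
        * ENNReal.ofReal (q.1.2 ^ 2) := by
    refine ((hHm.comp (by fun_prop)).mul ?_).mul (by fun_prop)
    exact hm.comp (f := fun q : (ℝ × ℝ) × Metric.sphere (0 : E3) 1 =>
      (q.1.1, q.1.2 • (q.2 : E3))) (by fun_prop)
  rw [lintegral_lintegral_swap hj.lintegral_prod_right'.aemeasurable]
  have hbd : ∀ r ∈ Ioi (0:ℝ), ∫⁻ t in Ioo 0 T,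
      ∫⁻ σ : Metric.sphere (0 : E3) 1, H (r • (σ : E3)) * specDens (W t) (r • (σ : E3))
        * ENNReal.ofReal (r ^ 2) ∂(volume : Measure E3).toSphere
      ≤ (Ioi kstar).indicator (fun r => ENNReal.ofReal (r ^ 2)
        * (ENNReal.ofReal C / ENNReal.ofReal (r ^ (3 + β)))) r := by
    intro r hr
    have hnorm : ∀ σ : Metric.sphere (0 : E3) 1, ‖r • (σ : E3)‖ = r := fun σ => by
      rw [norm_smul, norm_eq_of_mem_sphere, mul_one, Real.norm_of_nonneg (le_of_lt hr)]
    by_cases h : kstar < r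
    · rw [indicator_of_mem (show r ∈ Ioi kstar from h)]
      have hHr : ∀ σ : Metric.sphere (0 : E3) 1, H (r • (σ : E3)) = ENNReal.ofReal (r ^ 2) := by
        intro σ
        rw [hH, indicator_of_mem (show r • (σ : E3) ∈ {k : E3 | kstar < ‖k‖} by
          simp only [mem_ofPred_eq, hnorm, h]), ← ofReal_norm, hnorm,
          ← ENNReal.ofReal_pow (le_of_lt hr)]
      simp_rw [hHr, mul_assoc, lintegral_const_mul' _ _ ENNReal.ofReal_ne_top]
      gcongr
      have h3 := hsh r h.le
      have hp : 0 < r ^ (3 + β) := Real.rpow_pos_of_pos hr _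
      rw [ENNReal.le_div_iff_mul_le (Or.inl (by simpa using hp)) (Or.inl ENNReal.ofReal_ne_top),
        mul_comm]
      exact h3
    · have hHr : ∀ σ : Metric.sphere (0 : E3) 1, H (r • (σ : E3)) = 0 := by
        intro σ
        rw [hH, indicator_of_notMem (by simp only [mem_ofPred_eq, hnorm, h, not_false_iff])]
      simp [hHr]
  refine (setLIntegral_mono' measurableSet_Ioi hbd).trans ?_
  refine (lintegral_mono' Measure.restrict_le_self le_rfl).trans ?_
  rw [lintegral_indicator measurableSet_Ioi, tailConst]

/-- The bound on the difference quotients of a field with energy `E` and bounded shells. -/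
def dqConst (T : ℝ) (E : ℝ≥0∞) (β C kstar : ℝ) : ℝ≥0∞ :=
  ENNReal.ofReal (2 * Real.pi) ^ 8 * (ENNReal.ofReal (kstar ^ 2)
    * (ENNReal.ofReal (2 * Real.pi) ^ 3 * (ENNReal.ofReal T * (3 * E))) + tailConst β C kstar)

lemma dqConst_ne_top {T : ℝ} {E : ℝ≥0∞} (hE : E ≠ ⊤) {β C kstar : ℝ} (hβ : 0 < β) (hC : 0 < C)
    (hk : 0 < kstar) : dqConst T E β C kstar ≠ ⊤ := by
  have := tailConst_ne_top hβ hC hk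
  unfold dqConst
  finiteness

lemma specDens_scale_le (g : E3 → E3) (ξ : E3) (i : Fin 3) :
    ‖𝓕 (fun x => (g x i : ℂ)) ξ‖ₑ ^ 2
      ≤ ENNReal.ofReal (2 * Real.pi) ^ 6 * specDens g ((2 * Real.pi) • ξ) := by
  have h0 : (0:ℝ) ≤ 2 * Real.pi := by positivity
  rw [fourier_eq_fourierComp, enorm_mul, mul_pow]
  have e : ‖(((2 * Real.pi) ^ 3 : ℝ) : ℂ)‖ₑ ^ 2 = ENNReal.ofReal (2 * Real.pi) ^ 6 := by
    rw [← ofReal_norm, Complex.norm_real, Real.norm_of_nonneg (by positivity),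
      ENNReal.ofReal_pow h0, ← pow_mul]
  rw [e]
  gcongr
  exact Finset.single_le_sum (f := fun i => ‖fourierComp g ((2 * Real.pi) • ξ) i‖ₑ ^ 2)
    (fun _ _ => zero_le) (Finset.mem_univ i)

lemma specDens_scale_eq (g : E3 → E3) (ξ : E3) :
    specDens g ((2 * Real.pi) • ξ) ≤ ∑ i, ‖𝓕 (fun x => (g x i : ℂ)) ξ‖ₑ ^ 2 := by
  refine Finset.sum_le_sum fun i _ => ?_
  have hp := Real.pi_gt_three
  rw [fourier_eq_fourierComp, enorm_mul]
  gcongr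
  have : (1:ℝ≥0∞) ≤ ‖(((2 * Real.pi) ^ 3 : ℝ) : ℂ)‖ₑ := by
    rw [← ofReal_norm, Complex.norm_real, Real.norm_of_nonneg (by positivity), ENNReal.one_le_ofReal]
    exact one_le_pow₀ (by linarith)
  exact le_mul_of_one_le_left zero_le this

lemma exists_diffQuot_of_measurable {T : ℝ} {W : ℝ → E3 → E3}
    (hW : StronglyMeasurable (Function.uncurry W)) {E : ℝ≥0∞}
    (hE : ∀ᵐ t ∂(volume.restrict (Ioo 0 T)), Integrable (W t) ∧ MemLp (W t) 2 ∧
      ∫⁻ x, ‖W t x‖ₑ ^ 2 ≤ E) {β C kstar : ℝ}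
    (hsh : ∀ k : ℝ, kstar ≤ k →
      ENNReal.ofReal (k ^ (3 + β)) * shellEnergy T W k ≤ ENNReal.ofReal C) :
    ∃ D : ℝ → ℝ≥0∞, Measurable D ∧ (∀ᵐ t ∂(volume.restrict (Ioo 0 T)), ∀ i,
      DiffQuot (fun x => W t x i) (D t)) ∧ ∫⁻ t in Ioo 0 T, D t ≤ dqConst T E β C kstar := by
  have h2pi : (0:ℝ) < 2 * Real.pi := by positivity
  have hp := Real.pi_gt_three
  have hm := specDens_measurable hW
  have hmt : ∀ t, Measurable (specDens (W t)) := specDens_measurable_slice hW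
  have hmk : Measurable fun p : ℝ × E3 => ‖p.2‖ₑ ^ 2 * specDens (W p.1) p.2 :=
    (by fun_prop : Measurable fun p : ℝ × E3 => ‖p.2‖ₑ ^ 2).mul hm
  set c := ENNReal.ofReal (2 * Real.pi) with hc
  refine ⟨fun t => c ^ 8 * ∫⁻ k, ‖k‖ₑ ^ 2 * specDens (W t) k,
    hmk.lintegral_prod_right'.const_mul _, ?_, ?_⟩
  · filter_upwards [hE] with t ⟨h1, h2, _⟩ i z
    have hi1 : Integrable fun x => W t x i := (EuclideanSpace.proj (𝕜 := ℝ) i).integrable_comp h1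
    have hi2 : MemLp (fun x => W t x i) 2 :=
      h2.of_le (aesm_apply h2.1 i) (Eventually.of_forall fun x => PiLp.norm_apply_le _ _)
    refine (diffQuot_of_fourier hi1 hi2 z).trans (mul_le_mul' le_rfl ?_)
    have hms : Measurable fun k : E3 => ‖k‖ₑ ^ 2 * specDens (W t) k :=
      (by fun_prop : Measurable fun k : E3 => ‖k‖ₑ ^ 2).mul (hmt t)
    calc c ^ 2 * ∫⁻ ξ, ‖ξ‖ₑ ^ 2 * ‖𝓕 (fun x => (W t x i : ℂ)) ξ‖ₑ ^ 2
        ≤ c ^ 2 * ∫⁻ ξ, c ^ 6 * (‖(2 * Real.pi) • ξ‖ₑ ^ 2 * specDens (W t) ((2 * Real.pi) • ξ)) := by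
          gcongr c ^ 2 * ?_
          refine lintegral_mono fun ξ => ?_
          calc ‖ξ‖ₑ ^ 2 * ‖𝓕 (fun x => (W t x i : ℂ)) ξ‖ₑ ^ 2
              ≤ ‖(2 * Real.pi) • ξ‖ₑ ^ 2
                * (c ^ 6 * specDens (W t) ((2 * Real.pi) • ξ)) := by
                gcongr
                · rw [enorm_smul]
                  refine le_mul_of_one_le_left zero_le ?_
                  rw [Real.enorm_of_nonneg h2pi.le, ENNReal.one_le_ofReal]
                  linarith
                · exact specDens_scale_le _ _ _
            _ = _ := by ring
      _ = c ^ 2 * (c ^ 6 * (ENNReal.ofReal (((2 * Real.pi) ^ 3)⁻¹)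
            * ∫⁻ k, ‖k‖ₑ ^ 2 * specDens (W t) k)) := by
          rw [lintegral_const_mul' _ _ (by finiteness), lintegral_scale hms h2pi]
      _ ≤ c ^ 2 * (c ^ 6 * (1 * ∫⁻ k, ‖k‖ₑ ^ 2 * specDens (W t) k)) := by
          gcongr
          rw [ENNReal.ofReal_le_one]
          exact inv_le_one_of_one_le₀ (one_le_pow₀ (by linarith))
      _ = _ := by ring
  · rw [lintegral_const_mul _ hmk.lintegral_prod_right']
    unfold dqConst
    gcongr
    refine (high_freq_bound hW hsh).trans ?_
    gcongr
    have hsl : ∀ᵐ t ∂(volume.restrict (Ioo 0 T)), ∫⁻ k, specDens (W t) k ≤ c ^ 3 * (3 * E) := by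
      filter_upwards [hE] with t ⟨h1, h2, h3⟩
      have e : ∫⁻ k, specDens (W t) k = c ^ 3 * ∫⁻ ξ, specDens (W t) ((2 * Real.pi) • ξ) := by
        rw [lintegral_scale (hmt t) h2pi, ← mul_assoc, hc, ← ENNReal.ofReal_pow h2pi.le,
          ← ENNReal.ofReal_mul (by positivity), mul_inv_cancel₀ (by positivity)]
        simp
      rw [e]
      gcongr
      have hi1 : ∀ i, Integrable fun x => (W t x i : ℂ) := fun i =>
        Integrable.ofReal ((EuclideanSpace.proj (𝕜 := ℝ) i).integrable_comp h1)
      have hi2 : ∀ i, MemLp (fun x => (W t x i : ℂ)) 2 := fun i => MemLp.ofReal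
        (h2.of_le (aesm_apply h2.1 i) (Eventually.of_forall fun x => PiLp.norm_apply_le _ _))
      refine (lintegral_mono (specDens_scale_eq _)).trans ?_
      have hfm : ∀ i, Measurable fun ξ => ‖𝓕 (fun x => (W t x i : ℂ)) ξ‖ₑ ^ 2 := fun i =>
        ((VectorFourier.fourierIntegral_continuous (L := innerₗ E3) Real.continuous_fourierChar
          continuous_inner (hi1 i)).measurable.enorm.pow_const 2)
      rw [lintegral_finsetSum _ fun i _ => hfm i]
      simp_rw [fun i => plancherel (hi1 i) (hi2 i)]
      calc ∑ i, ∫⁻ x, ‖(W t x i : ℂ)‖ₑ ^ 2 ≤ ∑ i : Fin 3, E := by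
            refine Finset.sum_le_sum fun i _ => (lintegral_mono fun x => ?_).trans h3
            rw [← ofReal_norm, Complex.norm_real, ofReal_norm]
            exact enorm_apply_sq_le _ _
        _ = 3 * E := by simp
    refine (lintegral_mono_ae hsl).trans ?_
    rw [setLIntegral_const, Real.volume_Ioo, sub_zero]
    apply le_of_eq; ring

lemma fourierComp_congr {g g' : E3 → E3} (h : g =ᵐ[volume] g') : fourierComp g = fourierComp g' := by
  funext k i
  unfold fourierComp
  congr 1
  exact integral_congr_ae (h.mono fun x hx => by simp only [hx])

/-- A field with bounded Fourier shells has square integrable difference quotients. -/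
lemma exists_diffQuot {T : ℝ} {w : ℝ → E3 → E3}
    (hw : AEStronglyMeasurable (Function.uncurry w) (slab T)) {E : ℝ≥0∞}
    (hE : ∀ᵐ t ∂(volume.restrict (Ioo 0 T)), Integrable (w t) ∧ MemLp (w t) 2 ∧
      ∫⁻ x, ‖w t x‖ₑ ^ 2 ≤ E) {β C kstar : ℝ}
    (hsh : ∀ k : ℝ, kstar ≤ k →
      ENNReal.ofReal (k ^ (3 + β)) * shellEnergy T w k ≤ ENNReal.ofReal C) :
    ∃ D : ℝ → ℝ≥0∞, Measurable D ∧ (∀ᵐ t ∂(volume.restrict (Ioo 0 T)), ∀ i,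
      DiffQuot (fun x => w t x i) (D t)) ∧ ∫⁻ t in Ioo 0 T, D t ≤ dqConst T E β C kstar := by
  set W : ℝ → E3 → E3 := fun t x => hw.mk _ (t, x) with hWdef
  have hW : StronglyMeasurable (Function.uncurry W) := hw.stronglyMeasurable_mk
  have hae : ∀ᵐ t ∂(volume.restrict (Ioo 0 T)), w t =ᵐ[volume] W t :=
    Measure.ae_ae_of_ae_prod hw.ae_eq_mk
  have hshell : ∀ k, shellEnergy T W k = shellEnergy T w k := by
    intro k
    refine lintegral_congr_ae ?_
    filter_upwards [hae] with t ht
    rw [fourierComp_congr ht]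
  obtain ⟨D, hD, hdq, hb⟩ := exists_diffQuot_of_measurable hW (E := E) (T := T) (by
    filter_upwards [hE, hae] with t ⟨h1, h2, h3⟩ ht
    refine ⟨h1.congr ht, h2.ae_eq ht, ?_⟩
    rw [lintegral_congr_ae (ht.symm.mono fun x hx => by rw [hx])]
    exact h3) (fun k hk => by rw [hshell]; exact hsh k hk)
  refine ⟨D, hD, ?_, hb⟩
  filter_upwards [hdq, hae] with t h1 ht i z
  refine le_trans (le_of_eq ?_) (h1 i z)
  have ht' : ∀ᵐ x, w t (x - z) = W t (x - z) :=
    (measurePreserving_sub_right volume z).quasiMeasurePreserving.ae ht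
  refine lintegral_congr_ae ?_
  filter_upwards [ht, ht'] with x h2 h3
  rw [h2, h3]

/-! ### Bounded densities -/

lemma slab_interval {t : ℝ} (ht : 0 ≤ t) {F : ℝ × E3 → ℝ} (hF : Integrable F (slab t)) :
    ∫ z, F z ∂(slab t) = ∫ τ in (0:ℝ)..t, ∫ x, F (τ, x) := by
  rw [integral_slab hF, intervalIntegral.integral_of_le ht, integral_Ioc_eq_integral_Ioo]

lemma ae_zero_of_intervalIntegral_zero {T : ℝ} (hT : 0 < T) {f : ℝ → ℝ}
    (hf : IntegrableOn f (Ioo 0 T)) (h : ∀ t ∈ Icc 0 T, ∫ τ in (0:ℝ)..t, f τ = 0) :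
    ∀ᵐ t ∂(volume.restrict (Ioo 0 T)), f t = 0 := by
  have hi : IntervalIntegrable f volume 0 T := by
    rw [intervalIntegrable_iff_integrableOn_Ioo_of_le hT.le]; exact hf
  rw [ae_restrict_iff' measurableSet_Ioo]
  filter_upwards [hi.ae_hasDerivAt_integral] with x hx hxm
  have h1 := hx (by rw [uIcc_of_le hT.le]; exact Ioo_subset_Icc_self hxm) 0 left_mem_uIcc
  have h2 : HasDerivAt (fun t => ∫ τ in (0:ℝ)..t, f τ) 0 x := by
    refine (hasDerivAt_const x (0:ℝ)).congr_of_eventuallyEq ?_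
    filter_upwards [isOpen_Ioo.mem_nhds hxm] with t ht using h t (Ioo_subset_Icc_self ht)
  exact h1.unique h2

/-- Duality in `L²` with smooth functions. -/
lemma eLpNorm_le_of_dual {g : E3 → ℝ} (hg : MemLp g 2) {c : ℝ≥0∞} (hc : c ≠ ⊤)
    (h : ∀ φ : E3 → ℝ, ContDiff ℝ ∞ φ → HasCompactSupport φ →
      ‖∫ x, g x * φ x‖ₑ ≤ c * eLpNorm φ 2 volume) : eLpNorm g 2 volume ≤ c := by
  set N := eLpNorm g 2 volume with hN
  have hNt : N ≠ ⊤ := hg.2.ne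
  have key : ∀ n : ℕ, N ^ 2 ≤ c * (N + ENNReal.ofReal (((n:ℝ) + 1)⁻¹))
      + N * ENNReal.ofReal (((n:ℝ) + 1)⁻¹) := by
    intro n
    set e := ENNReal.ofReal (((n:ℝ) + 1)⁻¹)
    obtain ⟨φ, hφc, hφ, hφa⟩ := hg.exist_eLpNorm_sub_le (by simp) one_le_two
      (ε := ((n:ℝ) + 1)⁻¹) (by positivity)
    have hφm : MemLp φ 2 := hφ.continuous.memLp_of_hasCompactSupport hφc
    have i1 : Integrable fun x => g x * φ x := hg.integrable_mul hφm
    have i2 : Integrable fun x => g x * (g x - φ x) := hg.integrable_mul (hg.sub hφm)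
    have e1 : N ^ 2 = ‖(∫ x, g x * φ x) + ∫ x, g x * (g x - φ x)‖ₑ := by
      rw [← integral_add i1 i2, hN, eLpNorm_two_sq]
      have : ∀ x, g x * φ x + g x * (g x - φ x) = ‖g x‖ ^ 2 := fun x => by
        rw [Real.norm_eq_abs, sq_abs]; ring
      simp_rw [this]
      have hgi : Integrable fun x => ‖g x‖ ^ 2 := hg.integrable_norm_pow (by simp)
      rw [Real.enorm_of_nonneg (integral_nonneg fun _ => by positivity),
        ofReal_integral_eq_lintegral_ofReal hgi (Eventually.of_forall fun _ => by positivity)]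
      refine lintegral_congr fun x => ?_
      rw [ENNReal.ofReal_pow (norm_nonneg _), ofReal_norm]
    rw [e1]
    refine (enorm_add_le _ _).trans (add_le_add ((h φ hφ hφc).trans ?_) ?_)
    · gcongr
      calc eLpNorm φ 2 volume = eLpNorm (g - (g - φ)) 2 volume := by simp
        _ ≤ N + eLpNorm (g - φ) 2 volume := eLpNorm_sub_le hg.1 (hg.1.sub hφm.1) one_le_two
        _ ≤ N + e := by gcongr
    · refine (enorm_integral_le_lintegral_enorm _).trans ?_
      simp_rw [enorm_mul]
      refine lintegral_mul_le_sqrt _ hg.1.enorm (hg.1.sub hφm.1).enorm (eLpNorm_two_sq _ _).ge ?_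
      have := pow_le_pow_left' hφa 2
      rwa [eLpNorm_two_sq] at this
  have t0 : Tendsto (fun n : ℕ => ENNReal.ofReal (((n:ℝ) + 1)⁻¹)) atTop (𝓝 0) := by
    have t0 : Tendsto (fun n : ℕ => ((n:ℝ) + 1)⁻¹) atTop (𝓝 0) :=
      tendsto_inv_atTop_zero.comp
        (tendsto_atTop_add_const_right _ _ tendsto_natCast_atTop_atTop)
    have t1 := (ENNReal.continuous_ofReal.tendsto 0).comp t0
    rwa [ENNReal.ofReal_zero] at t1
  have t1 := (ENNReal.Tendsto.const_mul (a := c) (t0.const_add N) (Or.inr hc)).add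
    (ENNReal.Tendsto.const_mul (a := N) t0 (Or.inr hNt))
  simp only [add_zero, mul_zero] at t1
  have h2 := ge_of_tendsto' t1 key
  rcases eq_or_ne N 0 with h0 | h0
  · rw [h0]; exact zero_le
  · rw [sq] at h2
    exact (ENNReal.mul_le_mul_iff_left h0 hNt).1 h2

namespace Transport

variable {T : ℝ} {ρ₀ : E3 → ℝ} {ρ : ℝ → E3 → ℝ} {u : ℝ → E3 → E3} {G : Fin 3 → ℝ → E3 → E3}
  {M : ℝ}

lemma ae_mem (h : Transport T ρ₀ ρ u G) (hM0 : 0 ≤ M) (hM : ∀ᵐ x, ρ₀ x ∈ Icc 0 M) {t : ℝ}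
    (ht : t ∈ Icc 0 T) : ∀ᵐ x, ρ t x ∈ Icc 0 M :=
  h.ae_conserved measurableSet_Icc ⟨le_rfl, hM0⟩ hM ht

lemma ae_slab_mem (h : Transport T ρ₀ ρ u G) (hM0 : 0 ≤ M) (hM : ∀ᵐ x, ρ₀ x ∈ Icc 0 M) :
    ∀ᵐ z ∂(slab T), ρ z.1 z.2 ∈ Icc 0 M := by
  have hs : ∀ᵐ t ∂(volume.restrict (Ioo 0 T)), ∀ᵐ x, ρ t x ∈ Icc 0 M := by
    filter_upwards [ae_restrict_mem measurableSet_Ioo] with t ht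
    exact h.ae_mem hM0 hM (Ioo_subset_Icc_self ht)
  have h1 := slab_ae_le (f := fun _ => 0) (g := Function.uncurry ρ) aestronglyMeasurable_const h.ρm
    (hs.mono fun t ht => ht.mono fun x hx => hx.1)
  have h2 := slab_ae_le (f := Function.uncurry ρ) (g := fun _ => M) h.ρm aestronglyMeasurable_const
    (hs.mono fun t ht => ht.mono fun x hx => hx.2)
  filter_upwards [h1, h2] with z k1 k2 using ⟨k1, k2⟩

/-- The renormalised equation. -/
lemma renorm (h : Transport T ρ₀ ρ u G) (hM0 : 0 ≤ M) (hM : ∀ᵐ x, ρ₀ x ∈ Icc 0 M)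
    {β : ℝ → ℝ} (hβ : ContDiff ℝ 1 β) {ζ : E3 → ℝ}
    (hζ : ContDiff ℝ ∞ ζ) (hζc : HasCompactSupport ζ) {t : ℝ} (ht : t ∈ Icc 0 T) :
    ∫ x, β (ρ t x) * ζ x = (∫ x, β (ρ₀ x) * ζ x)
      + ∫ z, β (ρ z.1 z.2) * fderiv ℝ ζ z.2 (u z.1 z.2) ∂(slab t) := by
  obtain ⟨χ, hχ, hχc, hχ1⟩ := exists_cutoff 0 M
  set b : ℝ → ℝ := fun r => β r * χ r with hb
  have hb1 : ContDiff ℝ 1 b := hβ.mul (hχ.of_le (by exact_mod_cast le_top))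
  have hbc : HasCompactSupport b := hχc.mul_left
  obtain ⟨B, hB⟩ := hb1.continuous.bounded_above_of_compact_support hbc
  obtain ⟨N, hN⟩ := (hb1.continuous_deriv le_rfl).bounded_above_of_compact_support hbc.deriv
  have key := h.renorm_bdd hb1 (M := N.toNNReal) (fun r => by
    rw [← NNReal.coe_le_coe, coe_nnnorm]
    exact (hN r).trans (Real.le_coe_toNNReal _)) hB hζ hζc ht
  have he : ∀ r ∈ Icc 0 M, b r = β r := fun r hr => by rw [hb]; simp only [hχ1 r hr, mul_one]
  have e1 : ∫ x, b (ρ t x) * ζ x = ∫ x, β (ρ t x) * ζ x :=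
    integral_congr_ae ((h.ae_mem hM0 hM ht).mono fun x hx => by simp only [he _ hx])
  have e2 : ∫ x, b (ρ₀ x) * ζ x = ∫ x, β (ρ₀ x) * ζ x :=
    integral_congr_ae (hM.mono fun x hx => by simp only [he _ hx])
  have e3 : ∫ z, b (ρ z.1 z.2) * fderiv ℝ ζ z.2 (u z.1 z.2) ∂(slab t)
      = ∫ z, β (ρ z.1 z.2) * fderiv ℝ ζ z.2 (u z.1 z.2) ∂(slab t) :=
    integral_congr_ae (((h.ae_slab_mem hM0 hM).filter_mono
      (ae_mono (slab_mono ht.2))).mono fun z hz => by simp only [he _ hz])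
  rwa [e1, e2, e3] at key

/-- The renormalised equation for pointwise limits. -/
lemma renorm_limit (h : Transport T ρ₀ ρ u G) (hM0 : 0 ≤ M) (hM : ∀ᵐ x, ρ₀ x ∈ Icc 0 M)
    {β : ℕ → ℝ → ℝ} (hβ : ∀ n, ContDiff ℝ 1 (β n)) {B : ℝ} (hB : ∀ n, ∀ r ∈ Icc 0 M, ‖β n r‖ ≤ B)
    {γ : ℝ → ℝ} (hγ : ∀ r ∈ Icc 0 M, Tendsto (fun n => β n r) atTop (𝓝 (γ r))) {ζ : E3 → ℝ}
    (hζ : ContDiff ℝ ∞ ζ) (hζc : HasCompactSupport ζ) {t : ℝ} (ht : t ∈ Icc 0 T) :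
    ∫ x, γ (ρ t x) * ζ x = (∫ x, γ (ρ₀ x) * ζ x)
      + ∫ z, γ (ρ z.1 z.2) * fderiv ℝ ζ z.2 (u z.1 z.2) ∂(slab t) := by
  have hζ1 : ContDiff ℝ 1 ζ := hζ.of_le (by exact_mod_cast le_top)
  have hζi : Integrable ζ := hζ.continuous.integrable_of_hasCompactSupport hζc
  have hV := (h.test_velocity_integrable hζ1 hζc).mono_measure (slab_mono ht.2)
  have hsl : ∀ g : E3 → ℝ, AEStronglyMeasurable g volume → (∀ᵐ x, g x ∈ Icc 0 M) →
      Tendsto (fun n => ∫ x, β n (g x) * ζ x) atTop (𝓝 (∫ x, γ (g x) * ζ x)) := by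
    intro g hg hgM
    refine tendsto_integral_of_dominated_convergence (fun x => B * ‖ζ x‖) (fun n => ?_)
      (hζi.norm.const_mul B) (fun n => ?_) ?_
    · exact ((hβ n).continuous.comp_aestronglyMeasurable hg).mul hζ.continuous.aestronglyMeasurable
    · filter_upwards [hgM] with x hx
      rw [norm_mul]; gcongr; exact hB n _ hx
    · filter_upwards [hgM] with x hx
      exact (hγ _ hx).mul_const _
  have hfl : Tendsto (fun n => ∫ z, β n (ρ z.1 z.2) * fderiv ℝ ζ z.2 (u z.1 z.2) ∂(slab t)) atTop
      (𝓝 (∫ z, γ (ρ z.1 z.2) * fderiv ℝ ζ z.2 (u z.1 z.2) ∂(slab t))) := by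
    have hmem := (h.ae_slab_mem hM0 hM).filter_mono (ae_mono (slab_mono ht.2))
    refine tendsto_integral_of_dominated_convergence
      (fun z => B * ‖fderiv ℝ ζ z.2 (u z.1 z.2)‖) (fun n => ?_) (hV.norm.const_mul B)
      (fun n => ?_) ?_
    · exact ((hβ n).continuous.comp_aestronglyMeasurable
        (h.ρm.mono_measure (slab_mono ht.2))).mul hV.1
    · filter_upwards [hmem] with z hz
      rw [norm_mul]; gcongr; exact hB n _ hz
    · filter_upwards [hmem] with z hz
      exact (hγ _ hz).mul_const _
  have l1 := hsl _ (h.integrable_slice ht).1 (h.ae_mem hM0 hM ht)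
  have l2 := (hsl _ h.integrable_initial.1 hM).add hfl
  exact tendsto_nhds_unique l1 (l2.congr fun n => (h.renorm hM0 hM (hβ n) hζ hζc ht).symm)

lemma tendsto_inv_succ : Tendsto (fun n : ℕ => ((n:ℝ) + 1)⁻¹) atTop (𝓝 0) :=
  tendsto_inv_atTop_zero.comp
    (tendsto_atTop_add_const_right _ _ tendsto_natCast_atTop_atTop)

/-- The equation for the square root of the density. -/
lemma sqrt_weak (h : Transport T ρ₀ ρ u G) (hM0 : 0 ≤ M) (hM : ∀ᵐ x, ρ₀ x ∈ Icc 0 M) {ζ : E3 → ℝ}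
    (hζ : ContDiff ℝ ∞ ζ) (hζc : HasCompactSupport ζ) {t : ℝ} (ht : t ∈ Icc 0 T) :
    ∫ x, Real.sqrt (ρ t x) * ζ x = (∫ x, Real.sqrt (ρ₀ x) * ζ x)
      + ∫ z, fderiv ℝ ζ z.2 (weightedVel ρ u z.1 z.2) ∂(slab t) := by
  have hpos : ∀ (n : ℕ) (r : ℝ), 0 < r ^ 2 + ((n:ℝ) + 1)⁻¹ ^ 2 := fun n r => by positivity
  have key := h.renorm_limit hM0 hM
    (β := fun n r => Real.sqrt (Real.sqrt (r ^ 2 + ((n:ℝ) + 1)⁻¹ ^ 2)))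
    (fun n => ((contDiff_id.pow 2).add contDiff_const).sqrt (fun r => (hpos n r).ne') |>.sqrt
      fun r => (Real.sqrt_pos.2 (hpos n r)).ne')
    (B := Real.sqrt (Real.sqrt (M ^ 2 + 1))) (fun n r hr => ?_)
    (γ := fun r => Real.sqrt r) (fun r hr => ?_) hζ hζc ht
  · rw [key]
    congr 1
    refine integral_congr_ae (Eventually.of_forall fun z => ?_)
    simp [weightedVel]
  · rw [Real.norm_of_nonneg (Real.sqrt_nonneg _)]
    have : ((n:ℝ) + 1)⁻¹ ≤ 1 := inv_le_one_of_one_le₀ (by linarith [n.cast_nonneg (α := ℝ)])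
    gcongr
    · exact hr.1
    · exact hr.2
    · exact pow_le_one₀ (by positivity) this
  · have t1 : Tendsto (fun n : ℕ => Real.sqrt (Real.sqrt (r ^ 2 + ((n:ℝ) + 1)⁻¹ ^ 2))) atTop
        (𝓝 (Real.sqrt (Real.sqrt (r ^ 2 + 0 ^ 2)))) :=
      ((tendsto_const_nhds.add (tendsto_inv_succ.pow 2)).sqrt).sqrt
    have e : Real.sqrt (r ^ 2 + 0 ^ 2) = r := by
      rw [zero_pow two_ne_zero, add_zero, Real.sqrt_sq hr.1]
    rwa [e] at t1

/-- The equation for the indicator function of the support of the density. -/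
lemma support_weak (h : Transport T ρ₀ ρ u G) (hM0 : 0 ≤ M) (hM : ∀ᵐ x, ρ₀ x ∈ Icc 0 M)
    {ζ : E3 → ℝ} (hζ : ContDiff ℝ ∞ ζ) (hζc : HasCompactSupport ζ) {t : ℝ} (ht : t ∈ Icc 0 T) :
    ∫ x, (if ρ t x = 0 then 0 else 1) * ζ x = (∫ x, (if ρ₀ x = 0 then 0 else 1) * ζ x)
      + ∫ z, (if ρ z.1 z.2 = 0 then 0 else 1) * fderiv ℝ ζ z.2 (u z.1 z.2) ∂(slab t) := by
  have hpos : ∀ (n : ℕ) (r : ℝ), 0 < r ^ 2 + ((n:ℝ) + 1)⁻¹ ^ 2 := fun n r => by positivity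
  refine h.renorm_limit hM0 hM (β := fun n r => r ^ 2 / (r ^ 2 + ((n:ℝ) + 1)⁻¹ ^ 2))
    (fun n => (contDiff_id.pow 2).div ((contDiff_id.pow 2).add contDiff_const)
      fun r => (hpos n r).ne') (B := 1) (fun n r hr => ?_)
    (γ := fun r => if r = 0 then 0 else 1) (fun r hr => ?_) hζ hζc ht
  · rw [Real.norm_of_nonneg (by positivity), div_le_one (hpos n r)]
    linarith [sq_nonneg (((n:ℝ) + 1)⁻¹)]
  · by_cases h0 : r = 0
    · simp [h0]
    · have t1 : Tendsto (fun n : ℕ => r ^ 2 / (r ^ 2 + ((n:ℝ) + 1)⁻¹ ^ 2)) atTop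
          (𝓝 (r ^ 2 / (r ^ 2 + 0 ^ 2))) :=
        tendsto_const_nhds.div (tendsto_const_nhds.add (tendsto_inv_succ.pow 2)) (by
          rw [zero_pow two_ne_zero, add_zero]; positivity)
      rw [zero_pow two_ne_zero, add_zero, div_self (by positivity)] at t1
      simpa [h0] using t1

end Transport

/-! ### Time regularity of the square root of the density -/

/-- A transported bounded density with a weighted velocity having square integrable difference
quotients. -/
structure RegTransport (T M : ℝ) (ρ₀ : E3 → ℝ) (ρ : ℝ → E3 → ℝ) (u : ℝ → E3 → E3)
    (G : Fin 3 → ℝ → E3 → E3) (D : ℝ → ℝ≥0∞) : Prop extends Transport T ρ₀ ρ u G where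
  M0 : 0 ≤ M
  bdd : ∀ᵐ x, ρ₀ x ∈ Icc 0 M
  inv : ∫⁻ x, ENNReal.ofReal (ρ₀ x)⁻¹ ≠ ⊤
  Dm : Measurable D
  Dfin : ∫⁻ t in Ioo 0 T, D t ≠ ⊤
  dq : ∀ᵐ t ∂(volume.restrict (Ioo 0 T)), ∀ i, DiffQuot (fun x => weightedVel ρ u t x i) (D t)

lemma weightedVel_aesm {T : ℝ} {ρ : ℝ → E3 → ℝ} {u : ℝ → E3 → E3}
    (hρ : AEStronglyMeasurable (Function.uncurry ρ) (slab T))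
    (hu : AEStronglyMeasurable (Function.uncurry u) (slab T)) :
    AEStronglyMeasurable (Function.uncurry (weightedVel ρ u)) (slab T) :=
  (Real.continuous_sqrt.comp_aestronglyMeasurable hρ).smul hu

namespace RegTransport

variable {T M : ℝ} {ρ₀ : E3 → ℝ} {ρ : ℝ → E3 → ℝ} {u : ℝ → E3 → E3} {G : Fin 3 → ℝ → E3 → E3}
  {D : ℝ → ℝ≥0∞}

lemma mem (h : RegTransport T M ρ₀ ρ u G D) {t : ℝ} (ht : t ∈ Icc 0 T) :
    ∀ᵐ x, ρ t x ∈ Icc 0 M := h.ae_mem h.M0 h.bdd ht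

lemma slab_mem (h : RegTransport T M ρ₀ ρ u G D) : ∀ᵐ z ∂(slab T), ρ z.1 z.2 ∈ Icc 0 M :=
  h.ae_slab_mem h.M0 h.bdd

lemma sqrt_memLp (h : RegTransport T M ρ₀ ρ u G D) {t : ℝ} (ht : t ∈ Icc 0 T) :
    MemLp (fun x => Real.sqrt (ρ t x)) 2 := by
  have hi := h.integrable_slice ht
  rw [memLp_two_iff_integrable_sq (Real.continuous_sqrt.comp_aestronglyMeasurable hi.1)]
  exact hi.congr ((h.mem ht).mono fun x hx => (Real.sq_sqrt hx.1).symm)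

lemma memLp_six (h : RegTransport T M ρ₀ ρ u G D) :
    ∀ᵐ t ∂(volume.restrict (Ioo 0 T)), MemLp (weightedVel ρ u t) 6 := by
  filter_upwards [h.ae_slices, ae_restrict_mem measurableSet_Ioo] with t ht htT
  have hm := h.mem (Ioo_subset_Icc_self htT)
  have hi := h.integrable_slice (Ioo_subset_Icc_self htT)
  refine MemLp.of_le_mul (c := Real.sqrt M) ht.mem6
    ((Real.continuous_sqrt.comp_aestronglyMeasurable hi.1).smul ht.mem6.1) ?_
  filter_upwards [hm] with x hx
  rw [weightedVel, norm_smul, Real.norm_of_nonneg (Real.sqrt_nonneg _)]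
  gcongr
  exact hx.2

lemma test_integrable (h : RegTransport T M ρ₀ ρ u G D) {ζ : E3 → ℝ} (hζ : ContDiff ℝ 1 ζ)
    (hζc : HasCompactSupport ζ) :
    Integrable (fun z : ℝ × E3 => fderiv ℝ ζ z.2 (weightedVel ρ u z.1 z.2)) (slab T) := by
  have hV := h.test_velocity_integrable hζ hζc
  have := hV.bdd_mul (c := Real.sqrt M) (Real.continuous_sqrt.comp_aestronglyMeasurable h.ρm) (by
    filter_upwards [h.slab_mem] with z hz
    rw [Real.norm_of_nonneg (Real.sqrt_nonneg _)]
    exact Real.sqrt_le_sqrt hz.2)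
  refine this.congr (Eventually.of_forall fun z => ?_)
  simp [weightedVel, Function.uncurry]

lemma ae_D_lt_top (h : RegTransport T M ρ₀ ρ u G D) :
    ∀ᵐ t ∂(volume.restrict (Ioo 0 T)), D t < ⊤ := ae_lt_top h.Dm h.Dfin

/-- The square root of the density is absolutely continuous in time with values in `L²`. -/
lemma sqrt_diff (h : RegTransport T M ρ₀ ρ u G D) {t t' : ℝ} (ht : 0 ≤ t) (htt : t ≤ t')
    (ht' : t' ≤ T) :
    eLpNorm (fun x => Real.sqrt (ρ t' x) - Real.sqrt (ρ t x)) 2 volume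
      ≤ 3 * ∫⁻ τ in Ioo t t', D τ ^ (1 / 2 : ℝ) := by
  have htI : t ∈ Icc 0 T := ⟨ht, htt.trans ht'⟩
  have htI' : t' ∈ Icc 0 T := ⟨ht.trans htt, ht'⟩
  have hsub : Ioo t t' ⊆ Ioo 0 T := Ioo_subset_Ioo ht ht'
  have hdm : Measurable fun τ => D τ ^ (1 / 2 : ℝ) := h.Dm.pow_const _
  have hfin : ∫⁻ τ in Ioo t t', D τ ^ (1 / 2 : ℝ) ≠ ⊤ := by
    refine ((lintegral_mono_set hsub).trans_lt (lt_of_le_of_lt (lintegral_mono fun τ =>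
      sqrt_le_one_add (half_pow_two _)) ?_)).ne
    rw [lintegral_add_left measurable_const]
    exact ENNReal.add_lt_top.2 ⟨by simp, h.Dfin.lt_top⟩
  refine eLpNorm_le_of_dual ((h.sqrt_memLp htI').sub (h.sqrt_memLp htI)) (by finiteness)
    fun φ hφ hφc => ?_
  have hφm : MemLp φ 2 := hφ.continuous.memLp_of_hasCompactSupport hφc
  have hφ1 : ContDiff ℝ 1 φ := hφ.of_le (by exact_mod_cast le_top)
  have hF := h.test_integrable hφ1 hφc
  have e1 : ∫ x, (Real.sqrt (ρ t' x) - Real.sqrt (ρ t x)) * φ x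
      = ∫ τ in t..t', ∫ x, fderiv ℝ φ x (weightedVel ρ u τ x) := by
    have i1 : Integrable fun x => Real.sqrt (ρ t' x) * φ x := (h.sqrt_memLp htI').integrable_mul hφm
    have i2 : Integrable fun x => Real.sqrt (ρ t x) * φ x := (h.sqrt_memLp htI).integrable_mul hφm
    simp_rw [sub_mul]
    rw [integral_sub i1 i2, h.sqrt_weak h.M0 h.bdd hφ hφc htI', h.sqrt_weak h.M0 h.bdd hφ hφc htI,
      slab_interval (ht.trans htt) (hF.mono_measure (slab_mono ht')),
      slab_interval ht (hF.mono_measure (slab_mono (htt.trans ht'))), add_sub_add_left_eq_sub]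
    have hI : IntegrableOn (fun τ => ∫ x, fderiv ℝ φ x (weightedVel ρ u τ x)) (Ioo 0 T) :=
      hF.integral_prod_left
    have hII : IntervalIntegrable (fun τ => ∫ x, fderiv ℝ φ x (weightedVel ρ u τ x))
        volume 0 T := by
      rw [intervalIntegrable_iff_integrableOn_Ioo_of_le h.pos.le]; exact hI
    refine intervalIntegral.integral_interval_sub_left (hII.mono_set ?_) (hII.mono_set ?_)
    · rw [uIcc_of_le (ht.trans htt), uIcc_of_le h.pos.le]; exact Icc_subset_Icc le_rfl ht'
    · rw [uIcc_of_le ht, uIcc_of_le h.pos.le]; exact Icc_subset_Icc le_rfl (htt.trans ht')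
  change ‖∫ x, (Real.sqrt (ρ t' x) - Real.sqrt (ρ t x)) * φ x‖ₑ ≤ _
  rw [e1, intervalIntegral.integral_of_le htt, integral_Ioc_eq_integral_Ioo]
  refine (enorm_integral_le_lintegral_enorm _).trans ?_
  rw [mul_assoc, mul_comm (∫⁻ τ in Ioo t t', D τ ^ (1 / 2 : ℝ)), ← mul_assoc,
    ← lintegral_const_mul _ hdm]
  refine lintegral_mono_ae ?_
  have hall : ∀ᵐ τ ∂(volume.restrict (Ioo 0 T)),
      ‖∫ x, fderiv ℝ φ x (weightedVel ρ u τ x)‖ₑ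
        ≤ 3 * eLpNorm φ 2 volume * D τ ^ (1 / 2 : ℝ) := by
    filter_upwards [h.dq, h.ae_D_lt_top, h.memLp_six] with τ h1 h2 h3
    have hli := h3.locallyIntegrable one_le_six
    have hdc : ∀ j, Continuous fun x => fderiv ℝ φ x (basisVec j) := fun j =>
      (hφ1.continuous_fderiv one_ne_zero).clm_apply continuous_const
    have hds : ∀ j, HasCompactSupport fun x => fderiv ℝ φ x (basisVec j) := fun j =>
      (hφc.fderiv ℝ).comp_left (g := fun L : E3 →L[ℝ] ℝ => L (basisVec j)) rfl
    have hi : ∀ j, Integrable fun x => weightedVel ρ u τ x j * fderiv ℝ φ x (basisVec j) := by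
      intro j
      have := (LocallyIntegrable.comp_apply hli j).integrable_smul_left_of_hasCompactSupport
        (hdc j) (hds j)
      simpa [mul_comm] using this
    simp_rw [fderiv_apply_sum φ _ (weightedVel ρ u _ _)]
    rw [integral_finsetSum _ fun j _ => hi j]
    refine (enorm_sum_le _ _).trans ?_
    calc ∑ j, ‖∫ x, weightedVel ρ u τ x j * fderiv ℝ φ x (basisVec j)‖ₑ
        ≤ ∑ j : Fin 3, D τ ^ (1 / 2 : ℝ) * eLpNorm φ 2 volume := by
          refine Finset.sum_le_sum fun j _ => ?_
          refine DiffQuot.integral_mul_fderiv_le (by rw [half_pow_two]; exact h1 j)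
            (ENNReal.rpow_ne_top_of_nonneg (by norm_num) h2.ne)
            (LocallyIntegrable.comp_apply hli j) hφ hφc j
      _ = _ := by simp; ring
  exact ae_restrict_of_ae_restrict_of_subset hsub hall

lemma sqrt_diff_sq (h : RegTransport T M ρ₀ ρ u G D) {t t' : ℝ} (ht : 0 ≤ t) (htt : t ≤ t')
    (ht' : t' ≤ T) :
    ∫⁻ x, ‖Real.sqrt (ρ t' x) - Real.sqrt (ρ t x)‖ₑ ^ 2
      ≤ 9 * ENNReal.ofReal (t' - t) * ∫⁻ τ in Ioo t t', D τ := by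
  have hdm : Measurable fun τ => D τ ^ (1 / 2 : ℝ) := h.Dm.pow_const _
  rw [← eLpNorm_two_sq]
  refine (pow_le_pow_left' (h.sqrt_diff ht htt ht') 2).trans ?_
  rw [mul_pow, show (3:ℝ≥0∞) ^ 2 = 9 by norm_num, mul_assoc]
  gcongr
  have := lintegral_mul_sq_le (volume.restrict (Ioo t t')) (f := fun _ => 1)
    aemeasurable_const hdm.aemeasurable
  simp only [half_pow_two, one_mul, one_pow, lintegral_const, Measure.restrict_apply_univ, Real.volume_Ioo]
    at this
  exact this

end RegTransport

lemma vacuum_taylor {ε : ℝ} (hε : 0 < ε) {a c : ℝ} :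
    |a ^ 2 / (a ^ 2 + ε ^ 2) - c ^ 2 / (c ^ 2 + ε ^ 2)|
      ≤ |2 * ε ^ 2 * c / (c ^ 2 + ε ^ 2) ^ 2| * |a - c| + 3 / ε ^ 2 * |a - c| ^ 2 := by
  have ha : 0 < a ^ 2 + ε ^ 2 := by positivity
  have hc : 0 < c ^ 2 + ε ^ 2 := by positivity
  have e : a ^ 2 / (a ^ 2 + ε ^ 2) - c ^ 2 / (c ^ 2 + ε ^ 2)
      = 2 * ε ^ 2 * c / (c ^ 2 + ε ^ 2) ^ 2 * (a - c)
        + ε ^ 2 / (c ^ 2 + ε ^ 2) * ((ε ^ 2 - c * (c + 2 * a))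
          / ((a ^ 2 + ε ^ 2) * (c ^ 2 + ε ^ 2))) * (a - c) ^ 2 := by
    field_simp
    ring
  rw [e]
  refine (abs_add_le _ _).trans ?_
  rw [abs_mul, abs_mul (ε ^ 2 / (c ^ 2 + ε ^ 2) * _), abs_pow, sq_abs, ← sq_abs (a - c)]
  gcongr
  rw [abs_mul, abs_of_pos (by positivity : 0 < ε ^ 2 / (c ^ 2 + ε ^ 2))]
  have h1 : ε ^ 2 / (c ^ 2 + ε ^ 2) ≤ 1 := by
    rw [div_le_one hc]; linarith [sq_nonneg c]
  have h2 : |(ε ^ 2 - c * (c + 2 * a)) / ((a ^ 2 + ε ^ 2) * (c ^ 2 + ε ^ 2))| ≤ 3 / ε ^ 2 := by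
    rw [abs_div, abs_of_pos (by positivity : 0 < (a ^ 2 + ε ^ 2) * (c ^ 2 + ε ^ 2)),
      div_le_div_iff₀ (by positivity) (by positivity)]
    have h3 : |ε ^ 2 - c * (c + 2 * a)| ≤ ε ^ 2 + 2 * c ^ 2 + a ^ 2 := by
      rw [abs_le]
      constructor <;> nlinarith [sq_nonneg (a - c), sq_nonneg (a + c)]
    calc |ε ^ 2 - c * (c + 2 * a)| * ε ^ 2 ≤ (ε ^ 2 + 2 * c ^ 2 + a ^ 2) * ε ^ 2 := by gcongr
      _ ≤ 3 * ((a ^ 2 + ε ^ 2) * (c ^ 2 + ε ^ 2)) := by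
        nlinarith [mul_nonneg (sq_nonneg a) (sq_nonneg c), mul_nonneg (sq_nonneg ε) (sq_nonneg c),
          mul_nonneg (sq_nonneg ε) (sq_nonneg a), sq_nonneg (ε ^ 2)]
  calc _ ≤ 1 * (3 / ε ^ 2) := mul_le_mul h1 h2 (abs_nonneg _) zero_le_one
    _ = _ := one_mul _

/-! ### The vacuum does not move -/

lemma sum_lintegral_Ioo_le (f : ℝ → ℝ≥0∞) {t : ℕ → ℝ} (ht : Monotone t) (n : ℕ) :
    ∑ i ∈ Finset.range n, ∫⁻ τ in Ioo (t i) (t (i + 1)), f τ ≤ ∫⁻ τ in Ioo (t 0) (t n), f τ := by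
  induction n with
  | zero => simp
  | succ n ih =>
    rw [Finset.sum_range_succ]
    refine (add_le_add ih le_rfl).trans ?_
    rw [← lintegral_union measurableSet_Ioo]
    · refine lintegral_mono_set (union_subset ?_ ?_)
      · exact Ioo_subset_Ioo le_rfl (ht n.le_succ)
      · exact Ioo_subset_Ioo (ht n.zero_le) le_rfl
    · rw [Set.disjoint_left]
      rintro x ⟨-, h1⟩ ⟨h2, -⟩
      exact absurd h1 (not_lt.2 h2.le)

lemma lintegral_le_of_tendsto_of_tendsto {α : Type*} [MeasurableSpace α] {ν : Measure α}
    {F : ℕ → α → ℝ≥0∞} (hm : ∀ n, AEMeasurable (F n) ν) {g : α → ℝ≥0∞}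
    (hlim : ∀ᵐ x ∂ν, Tendsto (fun n => F n x) atTop (𝓝 (g x))) {C : ℕ → ℝ≥0∞} {c : ℝ≥0∞}
    (hC : ∀ n, ∫⁻ x, F n x ∂ν ≤ C n) (hc : Tendsto C atTop (𝓝 c)) : ∫⁻ x, g x ∂ν ≤ c := by
  calc ∫⁻ x, g x ∂ν = ∫⁻ x, liminf (fun n => F n x) atTop ∂ν :=
        lintegral_congr_ae (hlim.mono fun x hx => hx.liminf_eq.symm)
    _ ≤ liminf (fun n => ∫⁻ x, F n x ∂ν) atTop := lintegral_liminf_le' hm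
    _ ≤ liminf C atTop := liminf_le_liminf (Eventually.of_forall hC)
    _ = c := hc.liminf_eq

/-- The regularised indicator function of the complement of the vacuum. -/
def vb (ε s : ℝ) : ℝ := s ^ 2 / (s ^ 2 + ε ^ 2)

/-- The derivative of `vb`. -/
def vq (ε s : ℝ) : ℝ := 2 * ε ^ 2 * s / (s ^ 2 + ε ^ 2) ^ 2

lemma vb_measurable (ε : ℝ) : Measurable (vb ε) := by unfold vb; fun_prop

lemma vq_measurable (ε : ℝ) : Measurable (vq ε) := by unfold vq; fun_prop

lemma enorm_vb_sub_le {ε : ℝ} (hε : 0 < ε) (a c : ℝ) :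
    ‖vb ε a - vb ε c‖ₑ ≤ ‖vq ε c‖ₑ * ‖a - c‖ₑ + ENNReal.ofReal (3 / ε ^ 2) * ‖a - c‖ₑ ^ 2 := by
  have h := vacuum_taylor hε (a := a) (c := c)
  simp only [← ofReal_norm]
  rw [← ENNReal.ofReal_mul (norm_nonneg _), ← ENNReal.ofReal_pow (norm_nonneg _),
    ← ENNReal.ofReal_mul (by positivity), ← ENNReal.ofReal_add (by positivity) (by positivity)]
  exact ENNReal.ofReal_le_ofReal h

lemma enorm_vq_sq_le {ε r : ℝ} (hε : 0 < ε) (hr : 0 ≤ r) :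
    ‖vq ε (Real.sqrt r)‖ₑ ^ 2 ≤ 4 * ENNReal.ofReal r⁻¹ := by
  rcases hr.eq_or_lt with h0 | h0
  · simp [← h0, vq]
  have hs := Real.sqrt_pos.2 h0
  have h1 : |vq ε (Real.sqrt r)| ≤ 2 / Real.sqrt r := by
    have e := Real.sq_sqrt hr
    rw [vq, abs_of_nonneg (by positivity), div_le_div_iff₀ (by positivity) hs]
    nlinarith [sq_nonneg (Real.sqrt r ^ 2), sq_nonneg (ε ^ 2), sq_nonneg (Real.sqrt r * ε)]
  have h2 : ‖vq ε (Real.sqrt r)‖ ^ 2 ≤ 4 * r⁻¹ := by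
    calc ‖vq ε (Real.sqrt r)‖ ^ 2 ≤ (2 / Real.sqrt r) ^ 2 := by gcongr; exact h1
      _ = 4 * r⁻¹ := by rw [div_pow, Real.sq_sqrt hr]; ring
  rw [← ofReal_norm, ← ENNReal.ofReal_pow (norm_nonneg _), ← ENNReal.ofReal_ofNat,
    ← ENNReal.ofReal_mul (by norm_num)]
  exact ENNReal.ofReal_le_ofReal h2

lemma vq_tendsto {r : ℝ} (hr : 0 ≤ r) :
    Tendsto (fun n : ℕ => ‖vq (((n:ℝ) + 1)⁻¹) (Real.sqrt r)‖ₑ ^ 2) atTop (𝓝 0) := by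
  rcases hr.eq_or_lt with h0 | h0
  · simp [← h0, vq]
  have hs := Real.sqrt_pos.2 h0
  have t1 : Tendsto (fun n : ℕ => vq (((n:ℝ) + 1)⁻¹) (Real.sqrt r)) atTop
      (𝓝 (2 * 0 ^ 2 * Real.sqrt r / (Real.sqrt r ^ 2 + 0 ^ 2) ^ 2)) := by
    unfold vq
    refine Tendsto.div (((Transport.tendsto_inv_succ.pow 2).const_mul 2).mul_const _)
      ((tendsto_const_nhds.add (Transport.tendsto_inv_succ.pow 2)).pow 2) (by positivity)
  simp only [ne_eq, OfNat.ofNat_ne_zero, not_false_eq_true, zero_pow, mul_zero, zero_mul,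
    zero_div] at t1
  have := ENNReal.Tendsto.pow (n := 2) t1.enorm
  simpa using this

namespace RegTransport

variable {T M : ℝ} {ρ₀ : E3 → ℝ} {ρ : ℝ → E3 → ℝ} {u : ℝ → E3 → E3} {G : Fin 3 → ℝ → E3 → E3}
  {D : ℝ → ℝ≥0∞}

lemma slice_aemeas (h : RegTransport T M ρ₀ ρ u G D) {t : ℝ} (ht : t ∈ Icc 0 T) :
    AEMeasurable (ρ t) := (h.integrable_slice ht).1.aemeasurable

lemma vb_diff_le (h : RegTransport T M ρ₀ ρ u G D) {ε : ℝ} (hε : 0 < ε) {q X : ℝ≥0∞}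
    (hq : ∫⁻ x, ‖vq ε (Real.sqrt (ρ₀ x))‖ₑ ^ 2 ≤ q ^ 2)
    (hX : 3 * ∫⁻ τ in Ioo 0 T, D τ ^ (1 / 2 : ℝ) ≤ X) {t : ℝ} (ht : t ∈ Icc 0 T) :
    ∫⁻ x, ‖vb ε (Real.sqrt (ρ t x)) - vb ε (Real.sqrt (ρ 0 x))‖ₑ ≤ q * X := by
  set c := ENNReal.ofReal (3 / ε ^ 2)
  set Dt := ∫⁻ τ in Ioo 0 T, D τ with hDt
  have hDtf : Dt ≠ ⊤ := h.Dfin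
  have hN : ∀ N : ℕ, ∫⁻ x, ‖vb ε (Real.sqrt (ρ t x)) - vb ε (Real.sqrt (ρ 0 x))‖ₑ
      ≤ q * X + c * (9 * ENNReal.ofReal (t * ((N:ℝ) + 1)⁻¹) * Dt) := by
    intro N
    set τ : ℕ → ℝ := fun i => i * (t * ((N:ℝ) + 1)⁻¹) with hτ
    have hst : 0 ≤ t * ((N:ℝ) + 1)⁻¹ := mul_nonneg ht.1 (by positivity)
    have hmono : Monotone τ := fun i j hij => by
      simp only [hτ]; gcongr
    have h0 : τ 0 = 0 := by simp [hτ]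
    have hend : τ (N + 1) = t := by simp only [hτ]; push_cast; field_simp
    have hstep : ∀ i, τ (i + 1) - τ i = t * ((N:ℝ) + 1)⁻¹ := fun i => by
      simp only [hτ]; push_cast; ring
    have hmem : ∀ i ≤ N + 1, τ i ∈ Icc 0 T := fun i hi =>
      ⟨h0 ▸ hmono i.zero_le, ((hmono hi).trans hend.le).trans ht.2⟩
    have hpt : ∀ x, ‖vb ε (Real.sqrt (ρ t x)) - vb ε (Real.sqrt (ρ 0 x))‖ₑ
        ≤ ∑ i ∈ Finset.range (N + 1),
          ‖vb ε (Real.sqrt (ρ (τ (i + 1)) x)) - vb ε (Real.sqrt (ρ (τ i) x))‖ₑ := by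
      intro x
      have := Finset.sum_range_sub (fun i => vb ε (Real.sqrt (ρ (τ i) x))) (N + 1)
      simp only [hend, h0] at this
      rw [← this]
      exact enorm_sum_le _ _
    have hms : ∀ i ≤ N + 1, AEMeasurable (fun x => Real.sqrt (ρ (τ i) x)) := fun i hi =>
      Real.continuous_sqrt.measurable.comp_aemeasurable (h.slice_aemeas (hmem i hi))
    refine (lintegral_mono hpt).trans ?_
    rw [lintegral_finsetSum' _ fun i hi => by
      have hi' := Finset.mem_range.1 hi
      have m1 : AEMeasurable fun x => vb ε (Real.sqrt (ρ (τ (i + 1)) x)) :=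
        (vb_measurable ε).comp_aemeasurable (hms _ (by omega))
      have m2 : AEMeasurable fun x => vb ε (Real.sqrt (ρ (τ i) x)) :=
        (vb_measurable ε).comp_aemeasurable (hms _ (by omega))
      exact (m1.sub m2).enorm]
    have hterm : ∀ i ∈ Finset.range (N + 1),
        ∫⁻ x, ‖vb ε (Real.sqrt (ρ (τ (i + 1)) x)) - vb ε (Real.sqrt (ρ (τ i) x))‖ₑ
        ≤ q * (3 * ∫⁻ σ in Ioo (τ i) (τ (i + 1)), D σ ^ (1 / 2 : ℝ))
          + c * (9 * ENNReal.ofReal (t * ((N:ℝ) + 1)⁻¹) * ∫⁻ σ in Ioo (τ i) (τ (i + 1)), D σ) := by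
      intro i hi
      have hi' := Finset.mem_range.1 hi
      have hi1 := hmem i (by omega)
      have hi2 := hmem (i + 1) (by omega)
      have m1 := hms (i + 1) (by omega)
      have m2 := hms i (by omega)
      have md : AEMeasurable fun x => ‖Real.sqrt (ρ (τ (i + 1)) x) - Real.sqrt (ρ (τ i) x)‖ₑ :=
        (m1.sub m2).enorm
      have mq : AEMeasurable fun x => ‖vq ε (Real.sqrt (ρ (τ i) x))‖ₑ :=
        ((vq_measurable ε).comp_aemeasurable m2).enorm
      have mqd : AEMeasurable (fun x => ‖vq ε (Real.sqrt (ρ (τ i) x))‖ₑ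
          * ‖Real.sqrt (ρ (τ (i + 1)) x) - Real.sqrt (ρ (τ i) x)‖ₑ) volume := mq.mul md
      refine (lintegral_mono fun x => enorm_vb_sub_le hε _ _).trans ?_
      rw [lintegral_add_left' mqd, lintegral_const_mul' _ _ ENNReal.ofReal_ne_top]
      gcongr
      · refine lintegral_mul_le_sqrt _ mq md ?_ ?_
        · rw [h.lintegral_conserved (F := fun r => ‖vq ε (Real.sqrt r)‖ₑ ^ 2)
            (((vq_measurable ε).comp Real.continuous_sqrt.measurable).enorm.pow_const 2)
            (by simp [vq]) hi1]
          exact hq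
        · rw [← eLpNorm_two_sq]
          exact pow_le_pow_left' (h.sqrt_diff hi1.1 (hmono i.le_succ) hi2.2) 2
      · rw [← hstep i]
        exact h.sqrt_diff_sq hi1.1 (hmono i.le_succ) hi2.2
    refine (Finset.sum_le_sum hterm).trans ?_
    rw [Finset.sum_add_distrib, ← Finset.mul_sum, ← Finset.mul_sum, ← Finset.mul_sum,
      ← Finset.mul_sum]
    have hle : ∀ f : ℝ → ℝ≥0∞, ∑ i ∈ Finset.range (N + 1), ∫⁻ σ in Ioo (τ i) (τ (i + 1)), f σ
        ≤ ∫⁻ σ in Ioo 0 T, f σ := fun f => by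
      refine (sum_lintegral_Ioo_le f hmono (N + 1)).trans (lintegral_mono_set ?_)
      rw [h0, hend]; exact Ioo_subset_Ioo le_rfl ht.2
    gcongr
    · exact (mul_le_mul' le_rfl (hle _)).trans hX
    · exact hle D
  have t0 : Tendsto (fun N : ℕ => t * ((N:ℝ) + 1)⁻¹) atTop (𝓝 (t * 0)) :=
    Transport.tendsto_inv_succ.const_mul t
  rw [mul_zero] at t0
  have t1 := (ENNReal.continuous_ofReal.tendsto 0).comp t0
  rw [ENNReal.ofReal_zero] at t1
  have t2 := ENNReal.Tendsto.mul_const (b := Dt)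
    (ENNReal.Tendsto.const_mul (a := 9) t1 (Or.inr (by simp))) (Or.inr hDtf)
  have t3 := (ENNReal.Tendsto.const_mul (a := c) t2 (Or.inr ENNReal.ofReal_ne_top)).const_add (q * X)
  simp only [mul_zero, zero_mul, add_zero] at t3
  exact ge_of_tendsto' t3 hN

/-- The vacuum does not depend on time. -/
lemma vacuum (h : RegTransport T M ρ₀ ρ u G D) {t : ℝ} (ht : t ∈ Icc 0 T) :
    ∀ᵐ x, (ρ t x = 0 ↔ ρ₀ x = 0) := by
  have h0T : (0:ℝ) ∈ Icc 0 T := ⟨le_rfl, h.pos.le⟩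
  set X := 3 * ∫⁻ τ in Ioo 0 T, D τ ^ (1 / 2 : ℝ) with hX
  have hXf : X ≠ ⊤ := by
    refine ENNReal.mul_ne_top (by simp) ?_
    refine ((lintegral_mono fun τ => sqrt_le_one_add (half_pow_two _)).trans_lt ?_).ne
    rw [lintegral_add_left measurable_const]
    exact ENNReal.add_lt_top.2 ⟨by simp, h.Dfin.lt_top⟩
  set ε : ℕ → ℝ := fun n => ((n:ℝ) + 1)⁻¹ with hε
  have hεp : ∀ n, 0 < ε n := fun n => by positivity
  have hρm := h.integrable_initial.1.aemeasurable
  have hQ : Tendsto (fun n => ∫⁻ x, ‖vq (ε n) (Real.sqrt (ρ₀ x))‖ₑ ^ 2) atTop (𝓝 0) := by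
    have := tendsto_lintegral_of_dominated_convergence' (μ := (volume : Measure E3))
      (F := fun n x => ‖vq (ε n) (Real.sqrt (ρ₀ x))‖ₑ ^ 2) (f := fun _ => 0)
      (fun x => 4 * ENNReal.ofReal (ρ₀ x)⁻¹) (fun n => ?_) (fun n => ?_) ?_ ?_
    · simpa using this
    · exact (((vq_measurable _).comp Real.continuous_sqrt.measurable).enorm.pow_const
        2).comp_aemeasurable hρm
    · filter_upwards [h.bdd] with x hx using enorm_vq_sq_le (hεp n) hx.1
    · rw [lintegral_const_mul' _ _ (by simp)]
      exact ENNReal.mul_ne_top (by simp) h.inv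
    · filter_upwards [h.bdd] with x hx using vq_tendsto hx.1
  have hq : Tendsto (fun n => (∫⁻ x, ‖vq (ε n) (Real.sqrt (ρ₀ x))‖ₑ ^ 2) ^ (1 / 2 : ℝ) * X) atTop
      (𝓝 0) := by
    have t1 := hQ.ennrpow_const (1 / 2 : ℝ)
    rw [ENNReal.zero_rpow_of_pos (by norm_num)] at t1
    have t2 := ENNReal.Tendsto.mul_const (b := X) t1 (Or.inr hXf)
    rwa [zero_mul] at t2
  have hmb : ∀ s ∈ Icc 0 T, ∀ n, AEMeasurable fun x => vb (ε n) (Real.sqrt (ρ s x)) :=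
    fun s hs n => ((vb_measurable _).comp Real.continuous_sqrt.measurable).comp_aemeasurable
      (h.slice_aemeas hs)
  have hlimb : ∀ r : ℝ, 0 ≤ r → Tendsto (fun n => vb (ε n) (Real.sqrt r)) atTop
      (𝓝 (if r = 0 then 0 else 1)) := by
    intro r hr
    by_cases h0 : r = 0
    · simp [h0, vb]
    · have hr' : 0 < r := lt_of_le_of_ne hr (Ne.symm h0)
      have t1 : Tendsto (fun n : ℕ => vb (ε n) (Real.sqrt r)) atTop
          (𝓝 (Real.sqrt r ^ 2 / (Real.sqrt r ^ 2 + 0 ^ 2))) := by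
        unfold vb
        refine tendsto_const_nhds.div
          (tendsto_const_nhds.add (Transport.tendsto_inv_succ.pow 2)) ?_
        rw [Real.sq_sqrt hr, zero_pow two_ne_zero, add_zero]; exact h0
      rw [Real.sq_sqrt hr, zero_pow two_ne_zero, add_zero, div_self h0] at t1
      simpa [h0] using t1
  have key := lintegral_le_of_tendsto_of_tendsto (ν := (volume : Measure E3))
    (F := fun n x => ‖vb (ε n) (Real.sqrt (ρ t x)) - vb (ε n) (Real.sqrt (ρ 0 x))‖ₑ)
    (fun n => ((hmb t ht n).sub (hmb 0 h0T n)).enorm)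
    (g := fun x => ‖(if ρ t x = 0 then (0:ℝ) else 1) - (if ρ 0 x = 0 then 0 else 1)‖ₑ) (by
      filter_upwards [h.mem ht, h.mem h0T] with x h1 h2
      exact ((hlimb _ h1.1).sub (hlimb _ h2.1)).enorm)
    (fun n => h.vb_diff_le (hεp n) (q := (∫⁻ x, ‖vq (ε n) (Real.sqrt (ρ₀ x))‖ₑ ^ 2) ^ (1 / 2 : ℝ))
      (half_pow_two _).ge le_rfl ht) hq
  have hz : ∀ s ∈ Icc 0 T, AEMeasurable fun x => if ρ s x = 0 then (0:ℝ) else 1 := by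
    intro s hs
    have : Measurable fun r : ℝ => if r = 0 then (0:ℝ) else 1 :=
      Measurable.ite (measurableSet_singleton 0) measurable_const measurable_const
    exact this.comp_aemeasurable (h.slice_aemeas hs)
  have hzm : AEMeasurable (fun x => ‖(if ρ t x = 0 then (0:ℝ) else 1)
      - (if ρ 0 x = 0 then 0 else 1)‖ₑ) volume := ((hz t ht).sub (hz 0 h0T)).enorm
  rw [nonpos_iff_eq_zero, lintegral_eq_zero_iff' hzm] at key
  filter_upwards [key, h.initial] with x hx hi
  simp only [Pi.zero_apply, enorm_eq_zero] at hx
  rw [← hi]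
  by_cases h1 : ρ t x = 0 <;> by_cases h2 : ρ 0 x = 0 <;> simp [h1, h2] at hx ⊢

/-- The velocity outside the vacuum. -/
def _root_.InhomNS.innerVel (ρ : ℝ → E3 → ℝ) (u : ℝ → E3 → E3) (t : ℝ) (x : E3) : E3 :=
  (Real.sqrt (ρ t x))⁻¹ • weightedVel ρ u t x

lemma _root_.InhomNS.innerVel_eq {ρ : ℝ → E3 → ℝ} {u : ℝ → E3 → E3} {t : ℝ} {x : E3}
    (hx : 0 ≤ ρ t x) : innerVel ρ u t x = (if ρ t x = 0 then (0:ℝ) else 1) • u t x := by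
  rw [innerVel, weightedVel, smul_smul]
  by_cases h0 : ρ t x = 0
  · simp [h0]
  · have : 0 < ρ t x := lt_of_le_of_ne hx (Ne.symm h0)
    simp [h0, inv_mul_cancel₀ (Real.sqrt_pos.2 this).ne']

/-- The velocity outside the vacuum is divergence-free. -/
lemma innerVel_div (h : RegTransport T M ρ₀ ρ u G D) {ζ : E3 → ℝ} (hζ : ContDiff ℝ ∞ ζ)
    (hζc : HasCompactSupport ζ) :
    ∀ᵐ t ∂(volume.restrict (Ioo 0 T)), ∫ x, fderiv ℝ ζ x (innerVel ρ u t x) = 0 := by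
  have hζ1 : ContDiff ℝ 1 ζ := hζ.of_le (by exact_mod_cast le_top)
  have hV := h.test_velocity_integrable hζ1 hζc
  have hind : Measurable fun r : ℝ => if r = 0 then (0:ℝ) else 1 :=
    Measurable.ite (measurableSet_singleton 0) measurable_const measurable_const
  have hF : Integrable (fun z : ℝ × E3 => (if ρ z.1 z.2 = 0 then (0:ℝ) else 1)
      * fderiv ℝ ζ z.2 (u z.1 z.2)) (slab T) := by
    refine hV.bdd_mul (c := 1) (hind.comp_aemeasurable h.ρm.aemeasurable).aestronglyMeasurable
      (Eventually.of_forall fun z => ?_)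
    split_ifs <;> simp
  have hI : IntegrableOn (fun τ => ∫ x, (if ρ τ x = 0 then (0:ℝ) else 1)
      * fderiv ℝ ζ x (u τ x)) (Ioo 0 T) := hF.integral_prod_left
  have hz := ae_zero_of_intervalIntegral_zero h.pos hI fun t ht => by
    have h1 := h.support_weak h.M0 h.bdd hζ hζc ht
    rw [slab_interval ht.1 (hF.mono_measure (slab_mono ht.2))] at h1
    have e : ∫ x, (if ρ t x = 0 then (0:ℝ) else 1) * ζ x
        = ∫ x, (if ρ₀ x = 0 then (0:ℝ) else 1) * ζ x :=
      integral_congr_ae ((h.vacuum ht).mono fun x hx => by simp only [hx])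
    linarith
  filter_upwards [hz, ae_restrict_mem measurableSet_Ioo] with t ht htT
  rw [← ht]
  refine integral_congr_ae ((h.mem (Ioo_subset_Icc_self htT)).mono fun x hx => ?_)
  simp only
  rw [innerVel_eq hx.1, map_smul, smul_eq_mul]

end RegTransport

lemma InitialData.exists_bound {ρ₀ : E3 → ℝ} {m₀ : E3 → E3} (h : InitialData ρ₀ m₀) :
    ∃ M : ℝ, 0 ≤ M ∧ ∀ᵐ x, ρ₀ x ∈ Icc 0 M := by
  refine ⟨(eLpNormEssSup ρ₀ volume).toReal, ENNReal.toReal_nonneg, ?_⟩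
  have hb := h.bounded.2
  rw [eLpNorm_exponent_top] at hb
  filter_upwards [h.nonneg, ae_le_eLpNormEssSup (f := ρ₀) (μ := volume)] with x h0 h1
  refine ⟨h0, ?_⟩
  have := ENNReal.toReal_mono hb.ne h1
  rwa [toReal_enorm, Real.norm_of_nonneg h0] at this

lemma InitialData.lintegral_inv_ne_top {ρ₀ : E3 → ℝ} {m₀ : E3 → E3} (h : InitialData ρ₀ m₀)
    (hi : Integrable ρ₀) : ∫⁻ x, ENNReal.ofReal (ρ₀ x)⁻¹ ≠ ⊤ := by
  obtain ⟨δ, hδ, hn⟩ := h.nondeg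
  set I := {x | 0 < ρ₀ x ∧ ρ₀ x < δ}.indicator fun x => 1 / Real.sqrt (ρ₀ x) with hI
  have h1 : ∫⁻ x, ‖I x‖ₑ ^ 2 ≠ ⊤ := by
    rw [← eLpNorm_two_sq]
    exact (ENNReal.pow_lt_top hn.2).ne
  have h2 : ∫⁻ x, ENNReal.ofReal (ρ₀ x * (δ ^ 2)⁻¹) ≠ ⊤ := (hi.mul_const _).lintegral_lt_top.ne
  refine ne_top_of_le_ne_top (ENNReal.add_ne_top.2 ⟨h1, h2⟩) ?_
  rw [← lintegral_add_left' (f := fun x => ‖I x‖ₑ ^ 2) (hn.1.enorm.pow_const 2)]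
  refine lintegral_mono_ae ?_
  filter_upwards [h.nonneg] with x h0
  rcases h0.eq_or_lt with h00 | hpos
  · simp [← h00]
  · by_cases hx : ρ₀ x < δ
    · refine le_trans (le_of_eq ?_) le_self_add
      have : I x = 1 / Real.sqrt (ρ₀ x) := indicator_of_mem (s := {x | 0 < ρ₀ x ∧ ρ₀ x < δ})
        ⟨hpos, hx⟩ _
      rw [this, ← ofReal_norm, ← ENNReal.ofReal_pow (norm_nonneg _), Real.norm_eq_abs, sq_abs,
        div_pow, Real.sq_sqrt h0]
      simp
    · refine le_trans (ENNReal.ofReal_le_ofReal ?_) le_add_self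
      push Not at hx
      rw [inv_le_iff_one_le_mul₀ hpos, mul_assoc, mul_comm, mul_assoc, ← div_eq_inv_mul,
        one_le_div (by positivity)]
      nlinarith

lemma slab_ae_slices {T : ℝ} {P : ℝ × E3 → Prop} (h : ∀ᵐ z ∂(slab T), P z) :
    ∀ᵐ t ∂(volume.restrict (Ioo 0 T)), ∀ᵐ x, P (t, x) := Measure.ae_ae_of_ae_prod h

namespace IsWeakSolution

variable {T μ : ℝ} {f : ℝ → E3 → E3} {ρ₀ : E3 → ℝ} {m₀ : E3 → E3} {ρ : ℝ → E3 → ℝ}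
  {u : ℝ → E3 → E3}

lemma weightedVel_memLp (h : IsWeakSolution T μ f ρ₀ m₀ ρ u) :
    MemLp (Function.uncurry (weightedVel ρ u)) 2 (slab T) := by
  have hm := weightedVel_aesm h.density_meas h.velocity_meas
  refine ⟨hm, ?_⟩
  obtain ⟨C, hC⟩ := h.weighted_bound
  have h2 : eLpNorm (Function.uncurry (weightedVel ρ u)) 2 (slab T) ^ 2
      ≤ (C:ℝ≥0∞) ^ 2 * ENNReal.ofReal T := by
    rw [eLpNorm_two_sq, lintegral_slab (hm.enorm.pow_const 2)]
    calc ∫⁻ t in Ioo 0 T, ∫⁻ x, ‖Function.uncurry (weightedVel ρ u) (t, x)‖ₑ ^ 2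
        ≤ ∫⁻ t in Ioo 0 T, (C:ℝ≥0∞) ^ 2 := by
          refine lintegral_mono_ae (hC.mono fun t ht => ?_)
          have := eLpNorm_two_sq volume (weightedVel ρ u t)
          simp only [Function.uncurry_apply_pair]
          rw [← this]
          gcongr
      _ = _ := by simp
  by_contra hcon
  rw [not_lt_top_iff] at hcon
  rw [hcon] at h2
  have : (C:ℝ≥0∞) ^ 2 * ENNReal.ofReal T ≠ ⊤ := by finiteness
  exact this (top_unique (by simpa using h2))

/-- The energy bounds, uniform in the viscosity. -/
lemma energy_bound (h : IsWeakSolution T μ f ρ₀ m₀ ρ u) (hT : 0 < T) (hμ : 0 < μ)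
    (hf : MemLp (Function.uncurry f) 2 (slab T)) {M : ℝ}
    (hM : ∀ᵐ z ∂(slab T), ρ z.1 z.2 ∈ Icc 0 M) (hM0 : 0 ≤ M)
    {G : Fin 3 → ℝ → E3 → E3} (hG : ∀ j, MemLp (Function.uncurry (G j)) 2 (slab T))
    (hen : ∀ᵐ t ∂(volume.restrict (Ioo 0 T)),
      (∫ x, ρ t x * ‖u t x‖ ^ 2 / 2)
        + (∫ z, μ * ∑ j, ‖G j z.1 z.2‖ ^ 2 ∂(slab t))
        ≤ (∫ x, ‖m₀ x‖ ^ 2 / (2 * ρ₀ x))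
          + (∫ z, ρ z.1 z.2 * inner ℝ (u z.1 z.2) (f z.1 z.2) ∂(slab t))) {E : ℝ}
    (hE : E = 4 * (∫ x, ‖m₀ x‖ ^ 2 / (2 * ρ₀ x)) + 4 * T * M * ∫ z, ‖f z.1 z.2‖ ^ 2 ∂(slab T)) :
    (∀ᵐ t ∂(volume.restrict (Ioo 0 T)), ∫⁻ x, ‖weightedVel ρ u t x‖ₑ ^ 2 ≤ ENNReal.ofReal E) ∧
    ∀ᵐ t ∂(volume.restrict (Ioo 0 T)),
      ENNReal.ofReal μ * ∑ j, ∫⁻ z, ‖G j z.1 z.2‖ₑ ^ 2 ∂(slab t) ≤ ENNReal.ofReal E := by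
  have hw := h.weightedVel_memLp
  have hwi : Integrable (fun z : ℝ × E3 => ‖weightedVel ρ u z.1 z.2‖ ^ 2) (slab T) :=
    hw.integrable_norm_pow two_ne_zero
  have hfi : Integrable (fun z : ℝ × E3 => ‖f z.1 z.2‖ ^ 2) (slab T) :=
    hf.integrable_norm_pow two_ne_zero
  have hGi : Integrable (fun z : ℝ × E3 => μ * ∑ j, ‖G j z.1 z.2‖ ^ 2) (slab T) :=
    (integrable_finsetSum _ fun j _ => (hG j).integrable_norm_pow two_ne_zero).const_mul _
  set F := ∫ z, ‖f z.1 z.2‖ ^ 2 ∂(slab T) with hF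
  set E0 := ∫ x, ‖m₀ x‖ ^ 2 / (2 * ρ₀ x) with hE0
  set Y := ∫ z, ‖weightedVel ρ u z.1 z.2‖ ^ 2 ∂(slab T) with hY
  have hwsq : ∀ t x, 0 ≤ ρ t x → ‖weightedVel ρ u t x‖ ^ 2 = ρ t x * ‖u t x‖ ^ 2 := by
    intro t x hx
    rw [weightedVel, norm_smul, mul_pow, Real.norm_of_nonneg (Real.sqrt_nonneg _), Real.sq_sqrt hx]
  have hforce : ∀ t ≤ T, ∫ z, ρ z.1 z.2 * inner ℝ (u z.1 z.2) (f z.1 z.2) ∂(slab t)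
      ≤ Y / (4 * T) + T * M * F := by
    intro t ht
    have hb : Integrable (fun z : ℝ × E3 => ‖weightedVel ρ u z.1 z.2‖ ^ 2 / (4 * T)
        + T * M * ‖f z.1 z.2‖ ^ 2) (slab T) := (hwi.div_const _).add (hfi.const_mul _)
    calc ∫ z, ρ z.1 z.2 * inner ℝ (u z.1 z.2) (f z.1 z.2) ∂(slab t)
        ≤ ∫ z, (‖weightedVel ρ u z.1 z.2‖ ^ 2 / (4 * T) + T * M * ‖f z.1 z.2‖ ^ 2) ∂(slab t) := by
          by_cases hi : Integrable (fun z : ℝ × E3 =>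
            ρ z.1 z.2 * inner ℝ (u z.1 z.2) (f z.1 z.2)) (slab t)
          swap
          · rw [integral_undef hi]
            exact integral_nonneg fun z => by positivity
          · refine integral_mono_ae hi (hb.mono_measure (slab_mono ht)) ?_
            filter_upwards [ae_mono (slab_mono ht) hM] with z hz
            have h1 : inner ℝ (u z.1 z.2) (f z.1 z.2) ≤ ‖u z.1 z.2‖ * ‖f z.1 z.2‖ :=
              real_inner_le_norm _ _
            have h2 := hwsq z.1 z.2 hz.1
            have h3 : ρ z.1 z.2 * inner ℝ (u z.1 z.2) (f z.1 z.2)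
                ≤ ρ z.1 z.2 * (‖u z.1 z.2‖ * ‖f z.1 z.2‖) := mul_le_mul_of_nonneg_left h1 hz.1
            refine h3.trans ?_
            rw [h2]
            have h4 : ρ z.1 z.2 * (‖u z.1 z.2‖ * ‖f z.1 z.2‖)
                ≤ ρ z.1 z.2 * ‖u z.1 z.2‖ ^ 2 / (4 * T) + T * ρ z.1 z.2 * ‖f z.1 z.2‖ ^ 2 := by
              have h5 : ‖u z.1 z.2‖ * ‖f z.1 z.2‖
                  ≤ ‖u z.1 z.2‖ ^ 2 / (4 * T) + T * ‖f z.1 z.2‖ ^ 2 := by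
                rw [← sub_nonneg]
                have : ‖u z.1 z.2‖ ^ 2 / (4 * T) + T * ‖f z.1 z.2‖ ^ 2 - ‖u z.1 z.2‖ * ‖f z.1 z.2‖
                    = (‖u z.1 z.2‖ - 2 * T * ‖f z.1 z.2‖) ^ 2 / (4 * T) := by
                  field_simp
                  ring
                rw [this]
                positivity
              calc _ ≤ ρ z.1 z.2 * (‖u z.1 z.2‖ ^ 2 / (4 * T) + T * ‖f z.1 z.2‖ ^ 2) :=
                    mul_le_mul_of_nonneg_left h5 hz.1
                _ = _ := by ring
            refine h4.trans ?_
            gcongr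
            exact hz.2
      _ ≤ ∫ z, (‖weightedVel ρ u z.1 z.2‖ ^ 2 / (4 * T) + T * M * ‖f z.1 z.2‖ ^ 2) ∂(slab T) :=
          integral_mono_measure (slab_mono ht) (Eventually.of_forall fun z => by positivity) hb
      _ = Y / (4 * T) + T * M * F := by
          rw [integral_add (hwi.div_const _) (hfi.const_mul _), integral_div, integral_const_mul]
  have hkey : ∀ᵐ t ∂(volume.restrict (Ioo 0 T)),
      (∫ x, ‖weightedVel ρ u t x‖ ^ 2) / 2 + (∫ z, μ * ∑ j, ‖G j z.1 z.2‖ ^ 2 ∂(slab t))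
        ≤ E0 + (Y / (4 * T) + T * M * F) := by
    filter_upwards [hen, slab_ae_slices hM, ae_restrict_mem measurableSet_Ioo] with t h1 h2 htT
    have e : ∫ x, ρ t x * ‖u t x‖ ^ 2 / 2 = (∫ x, ‖weightedVel ρ u t x‖ ^ 2) / 2 := by
      rw [← integral_div]
      refine integral_congr_ae (h2.mono fun x hx => ?_)
      simp only [hwsq t x hx.1]
    rw [← e]
    linarith [hforce t htT.2.le]
  have hGpos : ∀ t, 0 ≤ ∫ z, μ * ∑ j, ‖G j z.1 z.2‖ ^ 2 ∂(slab t) := fun t =>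
    integral_nonneg fun z => by positivity
  have hYb : Y ≤ T * (2 * (E0 + (Y / (4 * T) + T * M * F))) := by
    calc Y = ∫ t in Ioo 0 T, ∫ x, ‖weightedVel ρ u t x‖ ^ 2 := by rw [hY, integral_slab hwi]
      _ ≤ ∫ t in Ioo 0 T, 2 * (E0 + (Y / (4 * T) + T * M * F)) := by
          refine integral_mono_ae hwi.integral_prod_left (integrable_const _) ?_
          filter_upwards [hkey] with t ht
          have := hGpos t
          linarith
      _ = _ := by simp [hT.le, mul_comm]
  have hY' : Y / (2 * T) ≤ 2 * E0 + 2 * T * M * F := by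
    rw [div_le_iff₀ (by positivity)]
    have : T * (2 * (E0 + (Y / (4 * T) + T * M * F))) = 2 * T * E0 + Y / 2 + 2 * T * T * M * F := by
      field_simp
      ring
    nlinarith
  have hb : 2 * (E0 + (Y / (4 * T) + T * M * F)) ≤ E := by
    have : 2 * (Y / (4 * T)) = Y / (2 * T) := by field_simp; ring
    rw [hE]
    linarith
  constructor
  · filter_upwards [hkey, hwi.prod_right_ae] with t h1 h2
    have h3 := ofReal_integral_eq_lintegral_ofReal h2 (Eventually.of_forall fun x => by positivity)
    have h4 : ∫⁻ x, ‖weightedVel ρ u t x‖ₑ ^ 2 = ENNReal.ofReal (∫ x, ‖weightedVel ρ u t x‖ ^ 2) := by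
      rw [h3]
      refine lintegral_congr fun x => ?_
      rw [← ofReal_norm, ENNReal.ofReal_pow (norm_nonneg _)]
    rw [h4]
    refine ENNReal.ofReal_le_ofReal ?_
    have := hGpos t
    linarith
  · filter_upwards [hkey, ae_restrict_mem measurableSet_Ioo] with t h1 htT
    have h2 := hGi.mono_measure (slab_mono htT.2.le)
    have h3 := ofReal_integral_eq_lintegral_ofReal h2 (Eventually.of_forall fun x => by positivity)
    have hGm : ∀ j, AEMeasurable (fun z : ℝ × E3 => ‖G j z.1 z.2‖ₑ ^ 2) (slab t) := fun j =>
      ((hG j).mono_measure (slab_mono htT.2.le)).1.enorm.pow_const 2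
    have h4 : ENNReal.ofReal μ * ∑ j, ∫⁻ z, ‖G j z.1 z.2‖ₑ ^ 2 ∂(slab t)
        = ENNReal.ofReal (∫ z, μ * ∑ j, ‖G j z.1 z.2‖ ^ 2 ∂(slab t)) := by
      rw [h3, ← lintegral_finsetSum' _ fun j _ => hGm j,
        ← lintegral_const_mul' _ _ ENNReal.ofReal_ne_top]
      refine lintegral_congr fun z => ?_
      rw [ENNReal.ofReal_mul hμ.le, ENNReal.ofReal_sum_of_nonneg fun j _ => by positivity]
      congr 1
      refine Finset.sum_congr rfl fun j _ => ?_
      rw [← ofReal_norm, ENNReal.ofReal_pow (norm_nonneg _)]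
    rw [h4]
    refine ENNReal.ofReal_le_ofReal ?_
    have h5 : 0 ≤ ∫ x, ‖weightedVel ρ u t x‖ ^ 2 := integral_nonneg fun x => by positivity
    have h6 := hGpos t
    linarith

end IsWeakSolution

/-- A weak solution together with the bounds that are uniform in the viscosity. -/
structure RegSol (T M : ℝ) (E Dt : ℝ≥0∞) (μ : ℝ) (f : ℝ → E3 → E3) (ρ₀ : E3 → ℝ) (m₀ : E3 → E3)
    (ρ : ℝ → E3 → ℝ) (u : ℝ → E3 → E3) (G : Fin 3 → ℝ → E3 → E3) (D : ℝ → ℝ≥0∞) : Prop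
    extends RegTransport T M ρ₀ ρ u G D where
  wmem : MemLp (Function.uncurry (weightedVel ρ u)) 2 (slab T)
  vel : ∀ᵐ t ∂(volume.restrict (Ioo 0 T)), ∫⁻ x, ‖weightedVel ρ u t x‖ₑ ^ 2 ≤ E
  visc : ∀ᵐ t ∂(volume.restrict (Ioo 0 T)),
    ENNReal.ofReal μ * ∑ j, ∫⁻ z, ‖G j z.1 z.2‖ₑ ^ 2 ∂(slab t) ≤ E
  Dle : ∫⁻ t in Ioo 0 T, D t ≤ Dt
  mom : ∀ φ : ℝ → E3 → E3, IsTest (Iio T) φ → (∀ t x, divx (φ t) x = 0) →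
      (∫ z, (ρ z.1 z.2 * inner ℝ (u z.1 z.2) (deriv (fun s => φ s z.2) z.1)
          + ρ z.1 z.2 * inner ℝ (u z.1 z.2) (fderiv ℝ (φ z.1) z.2 (u z.1 z.2))
          + ρ z.1 z.2 * inner ℝ (f z.1 z.2) (φ z.1 z.2)) ∂(slab T))
        + (∫ x, inner ℝ (m₀ x) (φ 0 x))
        = ∫ z, μ * ∑ j, inner ℝ (G j z.1 z.2) (partialx (φ z.1) j z.2) ∂(slab T)

lemma Transport.support_finite {T : ℝ} {ρ₀ : E3 → ℝ} {ρ : ℝ → E3 → ℝ} {u : ℝ → E3 → E3}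
    {G : Fin 3 → ℝ → E3 → E3} (h : Transport T ρ₀ ρ u G)
    (hinv : ∫⁻ x, ENNReal.ofReal (ρ₀ x)⁻¹ ≠ ⊤) (h0 : ∀ᵐ x, 0 ≤ ρ₀ x) {t : ℝ} (ht : t ∈ Icc 0 T) :
    ∫⁻ x, ({0}ᶜ : Set ℝ).indicator (1 : ℝ → ℝ≥0∞) (ρ t x) ≠ ⊤ := by
  rw [h.lintegral_conserved (F := ({0}ᶜ : Set ℝ).indicator (1 : ℝ → ℝ≥0∞))
    (measurable_one.indicator (measurableSet_singleton 0).compl) (by simp) ht]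
  refine ne_top_of_le_ne_top
    (ENNReal.add_ne_top.2 ⟨h.integrable_initial.lintegral_lt_top.ne, hinv⟩) ?_
  rw [← lintegral_add_left' (f := fun x => ENNReal.ofReal (ρ₀ x))
    h.integrable_initial.1.aemeasurable.ennreal_ofReal]
  refine lintegral_mono_ae (h0.mono fun x hx => ?_)
  rcases hx.eq_or_lt with h1 | h1
  · simp [← h1]
  · rw [indicator_of_mem (by simpa using h1.ne'), ← ENNReal.ofReal_add hx (by positivity)]
    simp only [Pi.one_apply, ENNReal.one_le_ofReal]
    rcases le_total 1 (ρ₀ x) with h2 | h2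
    · have := inv_pos.2 h1
      linarith
    · have := (one_le_inv₀ h1).2 h2
      linarith

/-- Weak solutions satisfying the spectral decay hypothesis have uniform bounds. -/
lemma exists_regSol {T : ℝ} (hT : 0 < T) {f : ℝ → E3 → E3}
    (hf : MemLp (Function.uncurry f) 2 (slab T)) {ρ₀ : E3 → ℝ} {m₀ : E3 → E3}
    (h₀ : InitialData ρ₀ m₀) {μ : ℕ → ℝ} (hμ : ∀ n, 0 < μ n) {ρ : ℕ → ℝ → E3 → ℝ}
    {u : ℕ → ℝ → E3 → E3} (hsol : ∀ n, IsWeakSolution T (μ n) f ρ₀ m₀ (ρ n) (u n))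
    (hK : RICKHw T fun n => weightedVel (ρ n) (u n)) :
    ∃ (M : ℝ) (E Dt : ℝ≥0∞), E ≠ ⊤ ∧ Dt ≠ ⊤ ∧
      ∀ n, ∃ G D, RegSol T M E Dt (μ n) f ρ₀ m₀ (ρ n) (u n) G D := by
  obtain ⟨M, hM0, hM⟩ := h₀.exists_bound
  obtain ⟨β, C, kstar, hβ, hC, hk, hsh⟩ := hK
  set E : ℝ := 4 * (∫ x, ‖m₀ x‖ ^ 2 / (2 * ρ₀ x))
    + 4 * T * M * ∫ z, ‖f z.1 z.2‖ ^ 2 ∂(slab T) with hE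
  refine ⟨M, ENNReal.ofReal E, dqConst T (ENNReal.ofReal E) β C kstar, ENNReal.ofReal_ne_top,
    dqConst_ne_top ENNReal.ofReal_ne_top hβ hC hk, fun n => ?_⟩
  obtain ⟨G, hG, hgrad, htr, hmom, hen⟩ := (hsol n).momentum_energy
  have htp : Transport T ρ₀ (ρ n) (u n) G :=
    { pos := hT
      rho0 := h₀.bounded.locallyIntegrable le_top
      ρm := (hsol n).density_meas
      um := (hsol n).velocity_meas
      cont := (hsol n).density_cont
      decay := (hsol n).velocity_decay
      gradMem := hG
      grad := hgrad
      trace := htr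
      mass := (hsol n).mass }
  have hinv := h₀.lintegral_inv_ne_top htp.integrable_initial
  obtain ⟨hb1, hb2⟩ := (hsol n).energy_bound hT (hμ n) hf (htp.ae_slab_mem hM0 hM) hM0 hG hen hE
  have hw := (hsol n).weightedVel_memLp
  obtain ⟨D, hDm, hdq, hDi⟩ := exists_diffQuot hw.1 (E := ENNReal.ofReal E) (by
    filter_upwards [hb1, hw.1.prodMk_left, ae_restrict_mem measurableSet_Ioo] with t h1 h2 htT
    have hm2 : MemLp (weightedVel (ρ n) (u n) t) 2 := by
      refine ⟨h2, ?_⟩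
      have := eLpNorm_two_sq volume (weightedVel (ρ n) (u n) t)
      by_contra hcon
      rw [not_lt_top_iff] at hcon
      rw [hcon] at this
      rw [← this] at h1
      simp at h1
    refine ⟨⟨h2, ?_⟩, hm2, h1⟩
    have hs := htp.support_finite hinv h₀.nonneg (Ioo_subset_Icc_self htT)
    rw [HasFiniteIntegral]
    refine lt_of_le_of_lt (b := (∫⁻ x, ({0}ᶜ : Set ℝ).indicator (1 : ℝ → ℝ≥0∞) (ρ n t x))
      + ∫⁻ x, ‖weightedVel (ρ n) (u n) t x‖ₑ ^ 2) ?_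
      (ENNReal.add_lt_top.2 ⟨hs.lt_top, h1.trans_lt ENNReal.ofReal_lt_top⟩)
    have h2m : AEMeasurable (fun x => ‖weightedVel (ρ n) (u n) t x‖ₑ ^ 2) volume :=
      h2.enorm.pow_const 2
    rw [← lintegral_add_right' _ h2m]
    refine lintegral_mono fun x => ?_
    by_cases hx : ρ n t x = 0
    · simp [weightedVel, hx]
    · rw [indicator_of_mem (by simpa using hx)]
      exact ENNReal_le_one_add_sq _) (hsh n)
  exact ⟨G, D,
    { toTransport := htp
      M0 := hM0
      bdd := hM
      inv := hinv
      Dm := hDm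
      Dfin := ne_top_of_le_ne_top (dqConst_ne_top ENNReal.ofReal_ne_top hβ hC hk) hDi
      dq := hdq
      wmem := hw
      vel := hb1
      visc := hb2
      Dle := hDi
      mom := hmom }⟩

/-- The divergence-free vector fields `∇ P_j + ℓ e_j` built from a radial profile `a`, where
`P_j = -2 z_j a(|z|²)` and `ℓ = 6 a + 4 |z|² a'`. -/
def solField (a : ℝ → ℝ) (j : Fin 3) (z : E3) : E3 :=
  (4 * a (‖z‖ ^ 2) + 4 * (‖z‖ ^ 2 * deriv a (‖z‖ ^ 2))) • basisVec j
    - (4 * (z j * deriv a (‖z‖ ^ 2))) • z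

/-- The scalar potential `P_j` of `solField`. -/
def solPot (a : ℝ → ℝ) (j : Fin 3) (z : E3) : ℝ := -2 * (z j * a (‖z‖ ^ 2))

/-- The scalar kernel `ℓ` of `solField`. -/
def solKer (a : ℝ → ℝ) (z : E3) : ℝ := 6 * a (‖z‖ ^ 2) + 4 * (‖z‖ ^ 2 * deriv a (‖z‖ ^ 2))

lemma contDiff_deriv_of_smooth {a : ℝ → ℝ} (ha : ContDiff ℝ ∞ a) : ContDiff ℝ ∞ (deriv a) :=
  (contDiff_infty_iff_deriv.1 ha).2

lemma contDiff_coord (j : Fin 3) : ContDiff ℝ ∞ fun z : E3 => z j :=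
  (EuclideanSpace.proj (𝕜 := ℝ) j).contDiff

lemma solField_contDiff {a : ℝ → ℝ} (ha : ContDiff ℝ ∞ a) (j : Fin 3) :
    ContDiff ℝ ∞ (solField a j) := by
  have h1 := ha.comp (contDiff_norm_sq ℝ (E := E3))
  have h2 := (contDiff_deriv_of_smooth ha).comp (contDiff_norm_sq ℝ (E := E3))
  exact (((contDiff_const.mul h1).add (contDiff_const.mul ((contDiff_norm_sq ℝ).mul h2))).smul
    contDiff_const).sub ((contDiff_const.mul ((contDiff_coord j).mul h2)).smul contDiff_id)

lemma solPot_contDiff {a : ℝ → ℝ} (ha : ContDiff ℝ ∞ a) (j : Fin 3) :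
    ContDiff ℝ ∞ (solPot a j) :=
  contDiff_const.mul ((contDiff_coord j).mul (ha.comp (contDiff_norm_sq ℝ (E := E3))))

lemma deriv_eq_zero_of_eventually {a : ℝ → ℝ} {R : ℝ} (hR : ∀ q, R ≤ q → a q = 0) {q : ℝ}
    (hq : R < q) : deriv a q = 0 := by
  have : a =ᶠ[𝓝 q] fun _ => 0 := (lt_mem_nhds hq).mono fun p hp => hR p hp.le
  rw [this.deriv_eq, deriv_const]

lemma hasCompactSupport_of_radial {F : Type*} [NormedAddCommGroup F] {g : E3 → F} {R : ℝ}
    (h : ∀ z, R < ‖z‖ ^ 2 → g z = 0) : HasCompactSupport g := by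
  refine HasCompactSupport.intro (isCompact_closedBall (0 : E3) (|R| + 1)) fun z hz => h z ?_
  rw [mem_closedBall_zero_iff, not_le] at hz
  have := le_abs_self R
  have := abs_nonneg R
  nlinarith

lemma solField_compact {a : ℝ → ℝ} {R : ℝ} (hR : ∀ q, R ≤ q → a q = 0) (j : Fin 3) :
    HasCompactSupport (solField a j) :=
  hasCompactSupport_of_radial (R := R) fun z hz => by
    simp [solField, hR _ hz.le, deriv_eq_zero_of_eventually hR hz]

lemma solPot_compact {a : ℝ → ℝ} {R : ℝ} (hR : ∀ q, R ≤ q → a q = 0) (j : Fin 3) :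
    HasCompactSupport (solPot a j) :=
  hasCompactSupport_of_radial (R := R) fun z hz => by simp [solPot, hR _ hz.le]

lemma hasFDerivAt_radial {a : ℝ → ℝ} (ha : ContDiff ℝ ∞ a) (z : E3) :
    HasFDerivAt (fun z : E3 => a (‖z‖ ^ 2)) (deriv a (‖z‖ ^ 2) • (2 • innerSL ℝ z)) z :=
  HasDerivAt.comp_hasFDerivAt (f := fun z : E3 => ‖z‖ ^ 2) z
    (ha.differentiable (by simp) _).hasDerivAt (hasStrictFDerivAt_norm_sq z).hasFDerivAt

lemma hasFDerivAt_coord (j : Fin 3) (z : E3) :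
    HasFDerivAt (fun z : E3 => z j) (EuclideanSpace.proj (𝕜 := ℝ) j) z :=
  (EuclideanSpace.proj (𝕜 := ℝ) j).hasFDerivAt

lemma solPot_fderiv {a : ℝ → ℝ} (ha : ContDiff ℝ ∞ a) (j : Fin 3) (z V : E3) :
    fderiv ℝ (solPot a j) z V
      = -2 * (V j * a (‖z‖ ^ 2)) - 4 * (z j * (deriv a (‖z‖ ^ 2) * inner ℝ z V)) := by
  have h := (((hasFDerivAt_coord j z).mul (hasFDerivAt_radial ha z)).const_mul (-2))
  have h' : HasFDerivAt (solPot a j) _ z := h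
  rw [h'.fderiv]
  simp
  ring

lemma inner_basisVec (z : E3) (j : Fin 3) : inner ℝ z (basisVec j) = z j := by
  simp [basisVec, EuclideanSpace.inner_single_right]

lemma basisVec_apply (i j : Fin 3) : basisVec i j = if j = i then 1 else 0 := by
  simp [basisVec]

lemma solField_div {a : ℝ → ℝ} (ha : ContDiff ℝ ∞ a) (j : Fin 3) (z : E3) :
    divx (solField a j) z = 0 := by
  have h1 := hasFDerivAt_radial ha z
  have h2 := hasFDerivAt_radial (contDiff_deriv_of_smooth ha) z
  have hq := (hasStrictFDerivAt_norm_sq z).hasFDerivAt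
  have h3 := (((h1.const_mul 4).add ((hq.mul h2).const_mul 4)).smul_const (basisVec j)).sub
    ((((hasFDerivAt_coord j z).mul h2).const_mul 4).smul (hasFDerivAt_id z))
  have h' : HasFDerivAt (solField a j) _ z := h3
  have hn : ‖z‖ ^ 2 = z 0 ^ 2 + z 1 ^ 2 + z 2 ^ 2 := by
    rw [EuclideanSpace.norm_sq_eq, Fin.sum_univ_three]
    simp
  rw [divx, h'.fderiv]
  fin_cases j <;>
  · simp [Fin.sum_univ_three, inner_basisVec, basisVec_apply]
    generalize deriv (deriv a) (‖z‖ ^ 2) = a2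
    generalize deriv a (‖z‖ ^ 2) = a1
    rw [hn]
    ring

lemma sum_smul_solField {a : ℝ → ℝ} (ha : ContDiff ℝ ∞ a) (z m V : E3) :
    ∑ j, V j * inner ℝ m (solField a j z)
      = ∑ i, m i * fderiv ℝ (solPot a i) z V + solKer a z * inner ℝ m V := by
  simp only [solPot_fderiv ha, solField, solKer, inner_sub_right, inner_smul_right, inner_basisVec]
  have e1 : inner ℝ m V = ∑ i, m i * V i := by
    simp [PiLp.inner_apply, mul_comm]
  have e2 : inner ℝ z V = ∑ i, z i * V i := by
    simp [PiLp.inner_apply, mul_comm]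
  have e3 : inner ℝ m z = ∑ i, m i * z i := by
    simp [PiLp.inner_apply, mul_comm]
  rw [e1, e2, e3]
  simp only [Fin.sum_univ_three]
  ring

/-- The profile `q^{-3/2}` cut off near the origin. -/
def baseProfile (q : ℝ) : ℝ := Real.smoothTransition (2 * q - 1) * q ^ (-(3 / 2) : ℝ)

lemma baseProfile_of_le {q : ℝ} (hq : q ≤ 1 / 2) : baseProfile q = 0 := by
  rw [baseProfile, Real.smoothTransition.zero_of_nonpos (by linarith), zero_mul]

lemma baseProfile_of_ge {q : ℝ} (hq : 1 ≤ q) : baseProfile q = q ^ (-(3 / 2) : ℝ) := by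
  rw [baseProfile, Real.smoothTransition.one_of_one_le (by linarith), one_mul]

lemma baseProfile_contDiff : ContDiff ℝ ∞ baseProfile := by
  rw [contDiff_iff_contDiffAt]
  intro q
  by_cases hq : q < 1 / 2
  · have : baseProfile =ᶠ[𝓝 q] fun _ => 0 := (gt_mem_nhds hq).mono fun p hp =>
      baseProfile_of_le (le_of_lt hp)
    exact contDiffAt_const.congr_of_eventuallyEq this
  · have hq0 : q ≠ 0 := by linarith
    have h1 : ContDiff ℝ ∞ fun q : ℝ => Real.smoothTransition (2 * q - 1) :=
      Real.smoothTransition.contDiff.comp ((contDiff_const.mul contDiff_id).sub contDiff_const)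
    exact h1.contDiffAt.mul (Real.contDiffAt_rpow_const_of_ne hq0)

/-- The radial kernel of the base profile. -/
def baseKer (q : ℝ) : ℝ := 6 * baseProfile q + 4 * (q * deriv baseProfile q)

lemma baseKer_continuous : Continuous baseKer := by
  have h1 := baseProfile_contDiff.continuous
  have h2 := (contDiff_deriv_of_smooth baseProfile_contDiff).continuous
  unfold baseKer
  fun_prop

lemma baseKer_eq {q : ℝ} (hq : 0 < q) :
    baseKer q = 8 * (q ^ (-(1 / 2) : ℝ) * deriv Real.smoothTransition (2 * q - 1)) := by
  have h1 : HasDerivAt (fun q : ℝ => Real.smoothTransition (2 * q - 1))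
      (deriv Real.smoothTransition (2 * q - 1) * 2) q := by
    have h := ((Real.smoothTransition.contDiff (n := 1)).differentiable (by simp)
      (2 * q - 1)).hasDerivAt
    have hi : HasDerivAt (fun q : ℝ => 2 * q - 1) 2 q := by
      simpa using ((hasDerivAt_id q).const_mul 2).sub_const 1
    exact h.comp q hi
  have h2 : HasDerivAt baseProfile _ q := h1.mul (Real.hasDerivAt_rpow_const (p := -(3 / 2))
    (Or.inl hq.ne'))
  rw [baseKer, h2.deriv, baseProfile]
  have e1 : q * q ^ (-(3 / 2) - 1 : ℝ) = q ^ (-(3 / 2) : ℝ) := by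
    rw [← Real.rpow_one_add' hq.le (by norm_num)]
    norm_num
  have e2 : q * q ^ (-(3 / 2) : ℝ) = q ^ (-(1 / 2) : ℝ) := by
    rw [← Real.rpow_one_add' hq.le (by norm_num)]
    norm_num
  rw [← e2]
  linear_combination (-6 * Real.smoothTransition (2 * q - 1)) * e1

lemma baseKer_nonneg (q : ℝ) : 0 ≤ baseKer q := by
  by_cases hq : 0 < q
  · rw [baseKer_eq hq]
    have := Real.smoothTransition.monotone.deriv_nonneg (x := 2 * q - 1)
    positivity
  · have h1 : baseProfile =ᶠ[𝓝 q] fun _ => 0 := (gt_mem_nhds (by linarith : q < 1 / 2)).mono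
      fun p hp => baseProfile_of_le (le_of_lt hp)
    rw [baseKer, h1.deriv_eq, h1.eq_of_nhds]
    simp

lemma baseKer_of_ge {q : ℝ} (hq : 1 ≤ q) : baseKer q = 0 := by
  have h : ∀ q ∈ Ioi (1:ℝ), baseKer q = 0 := by
    intro q hq
    rw [baseKer_eq (by linarith [mem_Ioi.1 hq])]
    have : Real.smoothTransition =ᶠ[𝓝 (2 * q - 1)] fun _ => 1 :=
      (lt_mem_nhds (by linarith [mem_Ioi.1 hq] : 1 < 2 * q - 1)).mono fun p hp =>
        Real.smoothTransition.one_of_one_le (le_of_lt hp)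
    rw [this.deriv_eq]
    simp
  have hcl : IsClosed {q | baseKer q = 0} := isClosed_eq baseKer_continuous continuous_const
  have := hcl.closure_subset_iff.2 (fun q hq => h q hq : Ioi (1:ℝ) ⊆ {q | baseKer q = 0})
  rw [closure_Ioi] at this
  exact this hq

lemma exists_baseKer_pos : ∃ q, 0 < q ∧ 0 < baseKer q := by
  obtain ⟨c, hc, hd⟩ := exists_deriv_eq_slope Real.smoothTransition (zero_lt_one' ℝ)
    Real.smoothTransition.continuous.continuousOn
    ((Real.smoothTransition.contDiff (n := 1)).differentiable (by simp)).differentiableOn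
  rw [Real.smoothTransition.one, Real.smoothTransition.zero] at hd
  refine ⟨(c + 1) / 2, by linarith [hc.1], ?_⟩
  rw [baseKer_eq (by linarith [hc.1]), show 2 * ((c + 1) / 2) - 1 = c by ring, hd]
  have := hc.1
  positivity

/-- The rescaled kernel. -/
def scaledKer (δ : ℝ) (z : E3) : ℝ := (δ ^ 3)⁻¹ * baseKer (‖z‖ ^ 2 * (δ ^ 2)⁻¹)

/-- The mass of `scaledKer`. -/
def kerMass : ℝ := ∫ z : E3, baseKer (‖z‖ ^ 2)

lemma baseKer_radial_compact : HasCompactSupport fun z : E3 => baseKer (‖z‖ ^ 2) :=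
  hasCompactSupport_of_radial (R := 1) fun _ hz => baseKer_of_ge hz.le

lemma baseKer_radial_continuous : Continuous fun z : E3 => baseKer (‖z‖ ^ 2) :=
  baseKer_continuous.comp (by fun_prop)

lemma kerMass_pos : 0 < kerMass := by
  obtain ⟨q, hq, hk⟩ := exists_baseKer_pos
  refine baseKer_radial_continuous.integral_pos_of_hasCompactSupport_nonneg_nonzero
    baseKer_radial_compact (fun z => baseKer_nonneg _) (x := Real.sqrt q • basisVec 0) ?_
  have : ‖Real.sqrt q • basisVec 0‖ ^ 2 = q := by
    rw [norm_smul, mul_pow, Real.norm_of_nonneg (Real.sqrt_nonneg _), Real.sq_sqrt hq.le]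
    simp [basisVec]
  rw [this]
  exact hk.ne'

lemma exists_baseKer_bound : ∃ B : ℝ, 0 < B ∧ ∀ q, 0 ≤ q → baseKer q ≤ B := by
  obtain ⟨B, hB⟩ := baseKer_radial_continuous.bounded_above_of_compact_support
    baseKer_radial_compact
  refine ⟨|B| + 1, by positivity, fun q hq => ?_⟩
  have h := hB (Real.sqrt q • basisVec 0)
  have : ‖Real.sqrt q • basisVec 0‖ ^ 2 = q := by
    rw [norm_smul, mul_pow, Real.norm_of_nonneg (Real.sqrt_nonneg _), Real.sq_sqrt hq]
    simp [basisVec]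
  rw [this, Real.norm_of_nonneg (baseKer_nonneg _)] at h
  linarith [le_abs_self B]

variable {δ : ℝ}

lemma scaledKer_nonneg (hδ : 0 < δ) (z : E3) : 0 ≤ scaledKer δ z := by
  have := baseKer_nonneg (‖z‖ ^ 2 * (δ ^ 2)⁻¹)
  unfold scaledKer
  positivity

lemma scaledKer_eq_zero (hδ : 0 < δ) {z : E3} (hz : δ ≤ ‖z‖) : scaledKer δ z = 0 := by
  rw [scaledKer, baseKer_of_ge, mul_zero]
  rw [← div_eq_mul_inv, one_le_div (by positivity)]
  gcongr

lemma scaledKer_continuous (δ : ℝ) : Continuous (scaledKer δ) :=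
  continuous_const.mul (baseKer_continuous.comp (by fun_prop))

lemma scaledKer_neg (δ : ℝ) (z : E3) : scaledKer δ (-z) = scaledKer δ z := by
  simp [scaledKer]

lemma scaledKer_eq (hδ : 0 < δ) (z : E3) :
    scaledKer δ z = (δ ^ 3)⁻¹ * baseKer (‖δ⁻¹ • z‖ ^ 2) := by
  rw [scaledKer, norm_smul, mul_pow, norm_inv, Real.norm_of_nonneg hδ.le, inv_pow, mul_comm (‖z‖ ^ 2)]

lemma integral_scaledKer (hδ : 0 < δ) : ∫ z, scaledKer δ z = kerMass := by
  simp_rw [scaledKer_eq hδ]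
  rw [integral_const_mul, Measure.integral_comp_inv_smul_of_nonneg _ (fun z => baseKer (‖z‖ ^ 2)) hδ.le]
  simp only [finrank_euclideanSpace, Fintype.card_fin, smul_eq_mul]
  rw [← mul_assoc, inv_mul_cancel₀ (by positivity), one_mul, kerMass]

/-- The profile whose kernel is a difference of two rescaled kernels. -/
def diffProfile (δ L q : ℝ) : ℝ :=
  (δ ^ 3)⁻¹ * baseProfile (q * (δ ^ 2)⁻¹) - (L ^ 3)⁻¹ * baseProfile (q * (L ^ 2)⁻¹)

lemma diffProfile_contDiff (δ L : ℝ) : ContDiff ℝ ∞ (diffProfile δ L) :=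
  (contDiff_const.mul (baseProfile_contDiff.comp (contDiff_id.mul contDiff_const))).sub
    (contDiff_const.mul (baseProfile_contDiff.comp (contDiff_id.mul contDiff_const)))

lemma scaled_profile (hδ : 0 < δ) {q : ℝ} (hq : δ ^ 2 ≤ q) :
    (δ ^ 3)⁻¹ * baseProfile (q * (δ ^ 2)⁻¹) = q ^ (-(3 / 2) : ℝ) := by
  have h2 : 0 < δ ^ 2 := by positivity
  have hq0 : 0 < q := h2.trans_le hq
  rw [baseProfile_of_ge (by rw [← div_eq_mul_inv, one_le_div h2]; exact hq),
    Real.mul_rpow hq0.le (by positivity), Real.inv_rpow h2.le, Real.rpow_neg h2.le, inv_inv,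
    ← Real.rpow_natCast δ 2, ← Real.rpow_mul hδ.le, ← Real.rpow_natCast δ 3]
  norm_num
  field_simp

lemma diffProfile_of_ge {L : ℝ} (hδ : 0 < δ) (hL : 0 < L) {q : ℝ} (hq : δ ^ 2 + L ^ 2 ≤ q) :
    diffProfile δ L q = 0 := by
  rw [diffProfile, scaled_profile hδ (by nlinarith), scaled_profile hL (by nlinarith), sub_self]

lemma solKer_diffProfile (δ L : ℝ) (z : E3) :
    solKer (diffProfile δ L) z = scaledKer δ z - scaledKer L z := by
  have hd : ∀ p : ℝ, ∀ q, HasDerivAt (fun q => (p ^ 3)⁻¹ * baseProfile (q * (p ^ 2)⁻¹))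
      ((p ^ 3)⁻¹ * (deriv baseProfile (q * (p ^ 2)⁻¹) * (p ^ 2)⁻¹)) q := by
    intro p q
    refine HasDerivAt.const_mul _ ?_
    have h := (baseProfile_contDiff.differentiable (by simp) (q * (p ^ 2)⁻¹)).hasDerivAt
    exact h.comp q ((hasDerivAt_id q).mul_const _ |>.congr_deriv (one_mul _))
  have h := (hd δ (‖z‖ ^ 2)).sub (hd L (‖z‖ ^ 2))
  have h' : HasDerivAt (diffProfile δ L) _ (‖z‖ ^ 2) := h
  rw [solKer, h'.deriv, diffProfile, scaledKer, scaledKer, baseKer, baseKer]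
  ring

/-- The bound for the increments in time of the momentum tested against a solenoidal field. -/
def momConst (N Q F E : ℝ≥0∞) (M μ h : ℝ) : ℝ≥0∞ :=
  N * (E * ENNReal.ofReal h)
    + (ENNReal.ofReal M * F + 3 * (ENNReal.ofReal μ * E) ^ (1 / 2 : ℝ))
      * (ENNReal.ofReal h ^ (1 / 2 : ℝ) * Q)

/-- The density of the forces tested against `φ`. -/
def forceDens (μ : ℝ) (f : ℝ → E3 → E3) (ρ : ℝ → E3 → ℝ) (u : ℝ → E3 → E3)
    (G : Fin 3 → ℝ → E3 → E3) (φ : E3 → E3) (z : ℝ × E3) : ℝ :=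
  ρ z.1 z.2 * inner ℝ (u z.1 z.2) (fderiv ℝ φ z.2 (u z.1 z.2))
    + ρ z.1 z.2 * inner ℝ (f z.1 z.2) (φ z.2)
    - μ * ∑ j, inner ℝ (G j z.1 z.2) (partialx φ j z.2)

lemma le_half_of_sq_le {a b : ℝ≥0∞} (h : a ^ 2 ≤ b) : a ≤ b ^ (1 / 2 : ℝ) := by
  rw [← half_pow_two b] at h
  exact (ENNReal.pow_le_pow_left_iff two_ne_zero).1 h

lemma enorm_inner_le {F : Type*} [NormedAddCommGroup F] [InnerProductSpace ℝ F] (x y : F) :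
    ‖inner ℝ x y‖ₑ ≤ ‖x‖ₑ * ‖y‖ₑ := by
  rw [← ofReal_norm, ← ofReal_norm, ← ofReal_norm, ← ENNReal.ofReal_mul (norm_nonneg _)]
  exact ENNReal.ofReal_le_ofReal (norm_inner_le_norm _ _)

lemma ae_shift {T h : ℝ} (hh : 0 < h) {P : ℝ → Prop}
    (hP : ∀ᵐ t ∂(volume.restrict (Ioo 0 T)), P t) :
    ∀ᵐ t ∂(volume.restrict (Ioo 0 (T - h))), P t ∧ P (t + h) := by
  rw [ae_restrict_iff' measurableSet_Ioo] at hP ⊢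
  have h2 := (measurePreserving_add_right (volume : Measure ℝ) h).quasiMeasurePreserving.ae hP
  filter_upwards [hP, h2] with t h1 h2 ht
  exact ⟨h1 ⟨ht.1, by linarith [ht.2]⟩, h2 ⟨by linarith [ht.1], by linarith [ht.2]⟩⟩

namespace RegSol

variable {T M : ℝ} {E Dt : ℝ≥0∞} {μ : ℝ} {f : ℝ → E3 → E3} {ρ₀ : E3 → ℝ} {m₀ : E3 → E3}
  {ρ : ℝ → E3 → ℝ} {u : ℝ → E3 → E3} {G : Fin 3 → ℝ → E3 → E3} {D : ℝ → ℝ≥0∞}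

lemma visc_all (h : RegSol T M E Dt μ f ρ₀ m₀ ρ u G D) {t : ℝ} (ht : t < T) :
    ENNReal.ofReal μ * ∑ j, ∫⁻ z, ‖G j z.1 z.2‖ₑ ^ 2 ∂(slab t) ≤ E := by
  have h1 : ∀ᵐ t' ∂(volume.restrict (Ioo (max t 0) T)),
      ENNReal.ofReal μ * ∑ j, ∫⁻ z, ‖G j z.1 z.2‖ₑ ^ 2 ∂(slab t') ≤ E :=
    ae_restrict_of_ae_restrict_of_subset (Ioo_subset_Ioo_left (le_max_right _ _)) h.visc
  have hne : (ae (volume.restrict (Ioo (max t 0) T))).NeBot := by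
    rw [ae_neBot, Ne, Measure.restrict_eq_zero, Real.volume_Ioo, ENNReal.ofReal_eq_zero, not_le,
      sub_pos]
    exact max_lt ht h.pos
  obtain ⟨t', h2, h3⟩ := (h1.and (ae_restrict_mem measurableSet_Ioo)).exists
  refine le_trans ?_ h2
  gcongr with j
  exact slab_mono ((le_max_left _ _).trans h3.1.le)

variable {φ : E3 → E3}

lemma forceDens_aesm (h : RegSol T M E Dt μ f ρ₀ m₀ ρ u G D)
    (hf : MemLp (Function.uncurry f) 2 (slab T)) (hφ : ContDiff ℝ ∞ φ) :
    AEStronglyMeasurable (forceDens μ f ρ u G φ) (slab T) := by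
  have hd : Continuous (fderiv ℝ φ) := hφ.continuous_fderiv (by simp)
  have h1 : AEStronglyMeasurable (fun z : ℝ × E3 => fderiv ℝ φ z.2 (u z.1 z.2)) (slab T) :=
    aesm_clm_apply
      (hd.comp continuous_snd).aestronglyMeasurable h.um
  have h2 : AEStronglyMeasurable (fun z : ℝ × E3 => φ z.2) (slab T) :=
    (hφ.continuous.comp continuous_snd).aestronglyMeasurable
  have h3 : ∀ j, AEStronglyMeasurable (fun z : ℝ × E3 => partialx φ j z.2) (slab T) := fun j =>
    ((hd.clm_apply continuous_const).comp continuous_snd).aestronglyMeasurable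
  exact ((h.ρm.mul (h.um.inner h1)).add (h.ρm.mul (hf.1.inner h2))).sub
    (aestronglyMeasurable_const.mul (Finset.aestronglyMeasurable_fun_sum _ fun j _ =>
      (h.gradMem j).1.inner (h3 j)))

lemma enorm_forceDens_le (h : RegSol T M E Dt μ f ρ₀ m₀ ρ u G D) {N : ℝ≥0∞}
    (hN : ∀ x, ‖fderiv ℝ φ x‖ₑ ≤ N) :
    ∀ᵐ z ∂(slab T), ‖forceDens μ f ρ u G φ z‖ₑ
      ≤ N * ‖weightedVel ρ u z.1 z.2‖ₑ ^ 2
        + ENNReal.ofReal M * (‖f z.1 z.2‖ₑ * ‖φ z.2‖ₑ)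
        + ENNReal.ofReal |μ| * ∑ j, ‖G j z.1 z.2‖ₑ * ‖partialx φ j z.2‖ₑ := by
  filter_upwards [h.slab_mem] with z hz
  have e : ρ z.1 z.2 * inner ℝ (u z.1 z.2) (fderiv ℝ φ z.2 (u z.1 z.2))
      = inner ℝ (weightedVel ρ u z.1 z.2) (fderiv ℝ φ z.2 (weightedVel ρ u z.1 z.2)) := by
    rw [weightedVel, map_smul, inner_smul_left, inner_smul_right, ← mul_assoc]
    simp [Real.mul_self_sqrt hz.1]
  rw [forceDens, e]
  refine (enorm_sub_le).trans (add_le_add ((enorm_add_le _ _).trans (add_le_add ?_ ?_)) ?_)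
  · refine (enorm_inner_le _ _).trans ?_
    calc _ ≤ ‖weightedVel ρ u z.1 z.2‖ₑ * (‖fderiv ℝ φ z.2‖ₑ * ‖weightedVel ρ u z.1 z.2‖ₑ) := by
          gcongr
          exact ContinuousLinearMap.le_opENorm _ _
      _ ≤ ‖weightedVel ρ u z.1 z.2‖ₑ * (N * ‖weightedVel ρ u z.1 z.2‖ₑ) := by
          gcongr
          exact hN _
      _ = _ := by ring
  · rw [enorm_mul]
    refine mul_le_mul' ?_ (enorm_inner_le _ _)
    rw [Real.enorm_eq_ofReal hz.1]
    exact ENNReal.ofReal_le_ofReal hz.2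
  · rw [enorm_mul, Real.enorm_eq_ofReal_abs]
    gcongr
    refine (enorm_sum_le _ _).trans ?_
    gcongr
    exact enorm_inner_le _ _

lemma lintegral_forceDens_le (h : RegSol T M E Dt μ f ρ₀ m₀ ρ u G D)
    (hf : MemLp (Function.uncurry f) 2 (slab T)) (hφ : ContDiff ℝ ∞ φ) {N : ℝ≥0∞}
    (hN : ∀ x, ‖fderiv ℝ φ x‖ₑ ≤ N) {ν : Measure (ℝ × E3)} (hν : ν ≤ slab T) {W F Φ g : ℝ≥0∞}
    (hW : ∫⁻ z, ‖weightedVel ρ u z.1 z.2‖ₑ ^ 2 ∂ν ≤ W)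
    (hF : ∫⁻ z, ‖f z.1 z.2‖ₑ ^ 2 ∂ν ≤ F ^ 2)
    (hΦ : ∫⁻ z, ‖φ z.2‖ₑ ^ 2 ∂ν ≤ Φ ^ 2) (hΦ' : ∀ j, ∫⁻ z, ‖partialx φ j z.2‖ₑ ^ 2 ∂ν ≤ Φ ^ 2)
    (hg : ∀ j, ∫⁻ z, ‖G j z.1 z.2‖ₑ ^ 2 ∂ν ≤ g ^ 2) :
    ∫⁻ z, ‖forceDens μ f ρ u G φ z‖ₑ ∂ν
      ≤ N * W + ENNReal.ofReal M * (F * Φ) + ENNReal.ofReal |μ| * (3 * (g * Φ)) := by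
  have hd : Continuous (fderiv ℝ φ) := hφ.continuous_fderiv (by simp)
  have hwm : AEMeasurable (fun z : ℝ × E3 => ‖weightedVel ρ u z.1 z.2‖ₑ ^ 2) ν :=
    (h.wmem.1.mono_measure hν).enorm.pow_const 2
  have hfm : AEMeasurable (fun z : ℝ × E3 => ‖f z.1 z.2‖ₑ) ν := (hf.1.mono_measure hν).enorm
  have hφm : AEMeasurable (fun z : ℝ × E3 => ‖φ z.2‖ₑ) ν :=
    (hφ.continuous.comp continuous_snd).aestronglyMeasurable.enorm
  have hpm : ∀ j, AEMeasurable (fun z : ℝ × E3 => ‖partialx φ j z.2‖ₑ) ν := fun j =>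
    ((hd.clm_apply continuous_const).comp continuous_snd).aestronglyMeasurable.enorm
  have hGm : ∀ j, AEMeasurable (fun z : ℝ × E3 => ‖G j z.1 z.2‖ₑ) ν := fun j =>
    ((h.gradMem j).1.mono_measure hν).enorm
  have m1 : AEMeasurable (fun z : ℝ × E3 => N * ‖weightedVel ρ u z.1 z.2‖ₑ ^ 2) ν :=
    hwm.const_mul _
  have m2 : AEMeasurable (fun z : ℝ × E3 => N * ‖weightedVel ρ u z.1 z.2‖ₑ ^ 2
      + ENNReal.ofReal M * (‖f z.1 z.2‖ₑ * ‖φ z.2‖ₑ)) ν := m1.add ((hfm.mul hφm).const_mul _)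
  refine (lintegral_mono_ae (ae_mono hν (h.enorm_forceDens_le hN))).trans ?_
  have m3 : ∀ j, AEMeasurable (fun z : ℝ × E3 => ‖G j z.1 z.2‖ₑ * ‖partialx φ j z.2‖ₑ) ν :=
    fun j => (hGm j).mul (hpm j)
  rw [lintegral_add_left' m2, lintegral_add_left' m1, lintegral_const_mul'' _ hwm,
    lintegral_const_mul' _ _ ENNReal.ofReal_ne_top, lintegral_const_mul' _ _ ENNReal.ofReal_ne_top,
    lintegral_finsetSum' _ fun j _ => m3 j]
  gcongr
  · exact lintegral_mul_le_sqrt ν hfm hφm hF hΦ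
  · calc ∑ j : Fin 3, ∫⁻ z, ‖G j z.1 z.2‖ₑ * ‖partialx φ j z.2‖ₑ ∂ν ≤ ∑ j : Fin 3, g * Φ :=
          Finset.sum_le_sum fun j _ => lintegral_mul_le_sqrt ν (hGm j) (hpm j) (hg j) (hΦ' j)
      _ = _ := by simp

lemma lintegral_prod_time {a b : ℝ} {F : E3 → ℝ≥0∞} (hF : AEMeasurable F) :
    ∫⁻ z : ℝ × E3, F z.2 ∂((volume.restrict (Ioo a b)).prod volume)
      = ENNReal.ofReal (b - a) * ∫⁻ x, F x := by
  rw [lintegral_prod _ hF.comp_snd]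
  simp [mul_comm]

lemma lintegral_w_le (h : RegSol T M E Dt μ f ρ₀ m₀ ρ u G D) {a b : ℝ} (ha : 0 ≤ a) (hb : b ≤ T) :
    ∫⁻ z, ‖weightedVel ρ u z.1 z.2‖ₑ ^ 2 ∂((volume.restrict (Ioo a b)).prod volume)
      ≤ E * ENNReal.ofReal (b - a) := by
  have hsub : Ioo a b ⊆ Ioo 0 T := Ioo_subset_Ioo ha hb
  have hν : (volume.restrict (Ioo a b)).prod (volume : Measure E3) ≤ slab T :=
    Measure.prod_mono (Measure.restrict_mono hsub le_rfl) le_rfl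
  have hwm : AEMeasurable (fun z : ℝ × E3 => ‖weightedVel ρ u z.1 z.2‖ₑ ^ 2)
    ((volume.restrict (Ioo a b)).prod volume) := (h.wmem.1.mono_measure hν).enorm.pow_const 2
  rw [lintegral_prod _ hwm]
  calc _ ≤ ∫⁻ t in Ioo a b, E :=
        lintegral_mono_ae (ae_restrict_of_ae_restrict_of_subset hsub h.vel)
    _ = _ := by simp

lemma forceDens_integrable (h : RegSol T M E Dt μ f ρ₀ m₀ ρ u G D) (hE : E ≠ ⊤)
    (hf : MemLp (Function.uncurry f) 2 (slab T)) (hφ : ContDiff ℝ ∞ φ) (hφc : HasCompactSupport φ) :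
    Integrable (forceDens μ f ρ u G φ) (slab T) := by
  have hd : Continuous (fderiv ℝ φ) := hφ.continuous_fderiv (by simp)
  obtain ⟨N, hN⟩ := hd.bounded_above_of_compact_support (hφc.fderiv ℝ)
  have hsq : ∀ {F : E3 → E3}, Continuous F → HasCompactSupport F → ∫⁻ x, ‖F x‖ₑ ^ 2 ≠ ⊤ := by
    intro F hF hFc
    rw [← eLpNorm_two_sq]
    exact (ENNReal.pow_lt_top (hF.memLp_of_hasCompactSupport hFc).2).ne
  have hpc : ∀ j, Continuous (partialx φ j) := fun j => hd.clm_apply continuous_const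
  have hps : ∀ j, HasCompactSupport (partialx φ j) := fun j => hφc.fderiv_apply ℝ _
  set S := (∫⁻ x, ‖φ x‖ₑ ^ 2) + ∑ j, ∫⁻ x, ‖partialx φ j x‖ₑ ^ 2 with hS
  have hSt : S ≠ ⊤ := ENNReal.add_ne_top.2 ⟨hsq hφ.continuous hφc,
    ENNReal.sum_ne_top.2 fun j _ => hsq (hpc j) (hps j)⟩
  have hG2 : ∀ j, ∫⁻ z, ‖G j z.1 z.2‖ₑ ^ 2 ∂(slab T) ≠ ⊤ := fun j => by
    have := eLpNorm_two_sq (slab T) (Function.uncurry (G j))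
    simp only [Function.uncurry] at this
    rw [← this]
    exact (ENNReal.pow_lt_top (h.gradMem j).2).ne
  have hf2 : ∫⁻ z, ‖f z.1 z.2‖ₑ ^ 2 ∂(slab T) = eLpNorm (Function.uncurry f) 2 (slab T) ^ 2 :=
    (eLpNorm_two_sq (slab T) (Function.uncurry f)).symm
  refine ⟨h.forceDens_aesm hf hφ, ?_⟩
  rw [HasFiniteIntegral]
  refine (h.lintegral_forceDens_le hf hφ (N := ENNReal.ofReal N) (fun x => ?_) le_rfl
    (h.lintegral_w_le le_rfl le_rfl) hf2.le (Φ := (ENNReal.ofReal (T - 0) * S) ^ (1 / 2 : ℝ)) ?_ ?_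
    (g := (∑ j, ∫⁻ z, ‖G j z.1 z.2‖ₑ ^ 2 ∂(slab T)) ^ (1 / 2 : ℝ)) ?_).trans_lt ?_
  · rw [← ofReal_norm]
    exact ENNReal.ofReal_le_ofReal (hN x)
  · rw [half_pow_two, slab, lintegral_prod_time (F := fun x => ‖φ x‖ₑ ^ 2)
      (hφ.continuous.aestronglyMeasurable.enorm.pow_const 2)]
    gcongr
    exact le_self_add
  · intro j
    rw [half_pow_two, slab, lintegral_prod_time (F := fun x => ‖partialx φ j x‖ₑ ^ 2)
      ((hpc j).aestronglyMeasurable.enorm.pow_const 2)]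
    gcongr
    exact (Finset.single_le_sum (f := fun j => ∫⁻ x, ‖partialx φ j x‖ₑ ^ 2)
      (fun _ _ => zero_le) (Finset.mem_univ j)).trans le_add_self
  · intro j
    rw [half_pow_two]
    exact Finset.single_le_sum (f := fun j => ∫⁻ z, ‖G j z.1 z.2‖ₑ ^ 2 ∂(slab T))
      (fun _ _ => zero_le) (Finset.mem_univ j)
  · have h1 : (ENNReal.ofReal (T - 0) * S) ^ (1 / 2 : ℝ) ≠ ⊤ :=
      ENNReal.rpow_ne_top_of_nonneg (by norm_num) (by finiteness)
    have h2 : (∑ j, ∫⁻ z, ‖G j z.1 z.2‖ₑ ^ 2 ∂(slab T)) ^ (1 / 2 : ℝ) ≠ ⊤ :=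
      ENNReal.rpow_ne_top_of_nonneg (by norm_num) (ENNReal.sum_ne_top.2 fun j _ => hG2 j)
    have h3 := hf.2.ne
    finiteness

/-- The momentum tested against a solenoidal field has a representative that is
Hölder continuous in time. -/
lemma exists_momentum (h : RegSol T M E Dt μ f ρ₀ m₀ ρ u G D) (hE : E ≠ ⊤) (hμ : 0 ≤ μ)
    (hf : MemLp (Function.uncurry f) 2 (slab T)) (hφ : ContDiff ℝ ∞ φ) (hφc : HasCompactSupport φ)
    (hdiv : ∀ x, divx φ x = 0) {N Q : ℝ≥0∞} (hN : ∀ x, ‖fderiv ℝ φ x‖ₑ ≤ N)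
    (hQ : ∫⁻ x, ‖φ x‖ₑ ^ 2 ≤ Q ^ 2) (hQ' : ∀ j, ∫⁻ x, ‖partialx φ j x‖ₑ ^ 2 ≤ Q ^ 2) :
    ∃ m : ℝ → ℝ, (∀ᵐ t ∂(volume.restrict (Ioo 0 T)),
        ∫ x, inner ℝ (ρ t x • u t x) (φ x) = m t) ∧
      ∀ t t', 0 < t → t ≤ t' → t' < T →
        ‖m t' - m t‖ₑ ≤ momConst N Q (eLpNorm (Function.uncurry f) 2 (slab T)) E M μ (t' - t) := by
  have hFi := h.forceDens_integrable hE hf hφ hφc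
  have hg : IntegrableOn (fun t => ∫ x, forceDens μ f ρ u G φ (t, x)) (Ioo 0 T) :=
    hFi.integral_prod_left
  have hφm : AEStronglyMeasurable (fun z : ℝ × E3 => φ z.2) (slab T) :=
    (hφ.continuous.comp continuous_snd).aestronglyMeasurable
  have hfl := h.flux_integrable
  obtain ⟨C, hC⟩ := hφ.continuous.bounded_above_of_compact_support hφc
  have hmi : Integrable (fun z : ℝ × E3 => inner ℝ (ρ z.1 z.2 • u z.1 z.2) (φ z.2)) (slab T) := by
    refine (hfl.norm.mul_const C).mono' (hfl.1.inner hφm) (Eventually.of_forall fun z => ?_)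
    exact (norm_inner_le_norm _ _).trans (by gcongr; exact hC _)
  have hM : IntegrableOn (fun t => ∫ x, inner ℝ (ρ t x • u t x) (φ x)) (Ioo 0 T) :=
    hmi.integral_prod_left
  set m : ℝ → ℝ := fun t => (∫ x, inner ℝ (m₀ x) (φ x))
    + ∫ τ in (0:ℝ)..t, ∫ x, forceDens μ f ρ u G φ (τ, x) with hm
  refine ⟨m, ?_, ?_⟩
  · refine ae_eq_primitive h.pos hM hg _ ?_
    intro θ hθ hθc hθs
    have hmom := h.mom (fun t x => θ t • φ x) (isTest_smul hθ hθc hθs hφ hφc) (fun t x => by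
      have hh : DifferentiableAt ℝ φ x := hφ.differentiable (by simp) x
      have : fderiv ℝ (fun x => θ t • φ x) x = θ t • fderiv ℝ φ x := fderiv_fun_const_smul hh _
      have hd := hdiv x
      simp only [divx] at hd ⊢
      rw [this]
      simp [← Finset.mul_sum, hd])
    have hd1 : ∀ z : ℝ × E3, deriv (fun s => θ s • φ z.2) z.1 = deriv θ z.1 • φ z.2 := fun z =>
      deriv_smul_const ((hθ.differentiable (by simp)) _) _
    have hd2 : ∀ z : ℝ × E3, fderiv ℝ (fun x => θ z.1 • φ x) z.2 = θ z.1 • fderiv ℝ φ z.2 :=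
      fun z => by
        have hh : DifferentiableAt ℝ φ z.2 := hφ.differentiable (by simp) z.2
        exact fderiv_fun_const_smul hh _
    have hd3 : ∀ (z : ℝ × E3) j, partialx (fun x => θ z.1 • φ x) j z.2
        = θ z.1 • partialx φ j z.2 := fun z j => by
      simp only [partialx, hd2 z]
      rfl
    simp only [hd1, hd2, hd3] at hmom
    obtain ⟨Cθ, hCθ⟩ := hθ.continuous.bounded_above_of_compact_support hθc
    have hdθ : Continuous (deriv θ) := hθ.continuous_deriv (by simp)
    obtain ⟨Cd, hCd⟩ := hdθ.bounded_above_of_compact_support hθc.deriv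
    have j1 : Integrable (fun z : ℝ × E3 => deriv θ z.1 * inner ℝ (ρ z.1 z.2 • u z.1 z.2) (φ z.2))
        (slab T) := hmi.bdd_mul (hdθ.comp continuous_fst).aestronglyMeasurable
      (Eventually.of_forall fun z => hCd z.1)
    have j2 : Integrable (fun z : ℝ × E3 => θ z.1 * forceDens μ f ρ u G φ z) (slab T) :=
      hFi.bdd_mul (hθ.continuous.comp continuous_fst).aestronglyMeasurable
        (Eventually.of_forall fun z => hCθ z.1)
    have hG1 : ∀ j, Integrable (fun z : ℝ × E3 => inner ℝ (G j z.1 z.2) (partialx φ j z.2)) (slab T) := by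
      intro j
      have hd : Continuous (fderiv ℝ φ) := hφ.continuous_fderiv (by simp)
      have hpc : Continuous (partialx φ j) := hd.clm_apply continuous_const
      have hps : HasCompactSupport (partialx φ j) := hφc.fderiv_apply ℝ _
      have hp2 : MemLp (fun z : ℝ × E3 => partialx φ j z.2) 2 (slab T) :=
        (hpc.memLp_of_hasCompactSupport hps).comp_snd _
      refine ((h.gradMem j).norm.integrable_mul hp2.norm).mono'
        ((h.gradMem j).1.inner hp2.1) (Eventually.of_forall fun z => ?_)
      exact norm_inner_le_norm _ _
    have j3 : Integrable (fun z : ℝ × E3 => θ z.1 * (μ * ∑ j, inner ℝ (G j z.1 z.2)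
        (partialx φ j z.2))) (slab T) :=
      ((integrable_finsetSum _ fun j _ => hG1 j).const_mul μ).bdd_mul
        (hθ.continuous.comp continuous_fst).aestronglyMeasurable
        (Eventually.of_forall fun z => hCθ z.1)
    have e1 : ∫ t in Ioo 0 T, deriv θ t * ∫ x, inner ℝ (ρ t x • u t x) (φ x)
        = ∫ z, deriv θ z.1 * inner ℝ (ρ z.1 z.2 • u z.1 z.2) (φ z.2) ∂(slab T) := by
      rw [integral_slab j1]
      simp only [integral_const_mul]
    have e2 : ∫ t in Ioo 0 T, θ t * ∫ x, forceDens μ f ρ u G φ (t, x)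
        = ∫ z, θ z.1 * forceDens μ f ρ u G φ z ∂(slab T) := by
      rw [integral_slab j2]
      simp only [integral_const_mul]
    have e3 : θ 0 * ∫ x, inner ℝ (m₀ x) (φ x) = ∫ x, inner ℝ (m₀ x) (θ 0 • φ x) := by
      rw [← integral_const_mul]
      simp only [inner_smul_right]
    have e4 : ∫ z, μ * ∑ j, inner ℝ (G j z.1 z.2) (θ z.1 • partialx φ j z.2) ∂(slab T)
        = ∫ z, θ z.1 * (μ * ∑ j, inner ℝ (G j z.1 z.2) (partialx φ j z.2)) ∂(slab T) := by
      refine integral_congr_ae (Eventually.of_forall fun z => ?_)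
      simp only [inner_smul_right, ← Finset.mul_sum]
      ring
    have e5 : (fun z : ℝ × E3 => ρ z.1 z.2 * inner ℝ (u z.1 z.2) (deriv θ z.1 • φ z.2)
        + ρ z.1 z.2 * inner ℝ (u z.1 z.2) ((θ z.1 • fderiv ℝ φ z.2) (u z.1 z.2))
        + ρ z.1 z.2 * inner ℝ (f z.1 z.2) (θ z.1 • φ z.2))
        = fun z => deriv θ z.1 * inner ℝ (ρ z.1 z.2 • u z.1 z.2) (φ z.2)
          + (θ z.1 * forceDens μ f ρ u G φ z
            + θ z.1 * (μ * ∑ j, inner ℝ (G j z.1 z.2) (partialx φ j z.2))) := by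
      funext z
      simp only [forceDens, inner_smul_right, inner_smul_left, smul_apply, RCLike.conj_to_real]
      ring
    have j23 : Integrable (fun z : ℝ × E3 => θ z.1 * forceDens μ f ρ u G φ z
            + θ z.1 * (μ * ∑ j, inner ℝ (G j z.1 z.2) (partialx φ j z.2))) (slab T) := j2.add j3
    rw [e5, e4, integral_add j1 j23, integral_add j2 j3] at hmom
    rw [e1, e2, e3]
    linarith
  · intro t t' ht htt ht'
    have hsub : Ioo t t' ⊆ Ioo 0 T := Ioo_subset_Ioo ht.le ht'.le
    have hν : (volume.restrict (Ioo t t')).prod (volume : Measure E3) ≤ slab T :=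
      Measure.prod_mono (Measure.restrict_mono hsub le_rfl) le_rfl
    have hν' : (volume.restrict (Ioo t t')).prod (volume : Measure E3) ≤ slab t' :=
      Measure.prod_mono (Measure.restrict_mono (Ioo_subset_Ioo_left ht.le) le_rfl) le_rfl
    have hii : ∀ s, 0 ≤ s → s ≤ T → IntervalIntegrable
        (fun τ => ∫ x, forceDens μ f ρ u G φ (τ, x)) volume 0 s := fun s hs hs' => by
      rw [intervalIntegrable_iff_integrableOn_Ioo_of_le hs]
      exact hg.mono_set (Ioo_subset_Ioo_right hs')
    have e : m t' - m t = ∫ τ in Ioo t t', ∫ x, forceDens μ f ρ u G φ (τ, x) := by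
      rw [hm]
      simp only [add_sub_add_left_eq_sub]
      rw [intervalIntegral.integral_interval_sub_left (hii t' (by linarith) ht'.le)
        (hii t ht.le (by linarith)), intervalIntegral.integral_of_le htt, integral_Ioc_eq_integral_Ioo]
    rw [e]
    have hFi' := hFi.mono_measure hν
    rw [← integral_prod (fun z => forceDens μ f ρ u G φ z) hFi']
    refine (enorm_integral_le_lintegral_enorm _).trans ?_
    have hf2 : ∫⁻ z, ‖f z.1 z.2‖ₑ ^ 2 ∂((volume.restrict (Ioo t t')).prod volume)
        ≤ eLpNorm (Function.uncurry f) 2 (slab T) ^ 2 := by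
      rw [eLpNorm_two_sq]
      exact lintegral_mono' hν le_rfl
    have hd : Continuous (fderiv ℝ φ) := hφ.continuous_fderiv (by simp)
    set S := ∑ j, ∫⁻ z, ‖G j z.1 z.2‖ₑ ^ 2 ∂(slab t') with hS
    have hb := h.lintegral_forceDens_le hf hφ hN hν (h.lintegral_w_le ht.le ht'.le) hf2
      (Φ := ENNReal.ofReal (t' - t) ^ (1 / 2 : ℝ) * Q) (by
        rw [mul_pow, half_pow_two, lintegral_prod_time (F := fun x => ‖φ x‖ₑ ^ 2)
          (hφ.continuous.aestronglyMeasurable.enorm.pow_const 2)]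
        gcongr) (fun j => by
        rw [mul_pow, half_pow_two, lintegral_prod_time (F := fun x => ‖partialx φ j x‖ₑ ^ 2)
          ((hd.clm_apply continuous_const).aestronglyMeasurable.enorm.pow_const 2)]
        gcongr
        exact hQ' j) (g := S ^ (1 / 2 : ℝ)) (fun j => by
        rw [half_pow_two]
        exact (lintegral_mono' hν' le_rfl).trans
          (Finset.single_le_sum (f := fun j => ∫⁻ z, ‖G j z.1 z.2‖ₑ ^ 2 ∂(slab t'))
            (fun _ _ => zero_le) (Finset.mem_univ j)))
    refine hb.trans ?_
    rw [abs_of_nonneg hμ, momConst, add_mul, ← add_assoc]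
    refine add_le_add (add_le_add le_rfl (le_of_eq (by ring))) ?_
    have hμS : ENNReal.ofReal μ * S ^ (1 / 2 : ℝ) ≤ (ENNReal.ofReal μ * E) ^ (1 / 2 : ℝ) := by
      refine le_half_of_sq_le ?_
      rw [mul_pow, half_pow_two, pow_two, mul_assoc]
      gcongr
      exact h.visc_all ht'
    calc _ = 3 * (ENNReal.ofReal μ * S ^ (1 / 2 : ℝ))
          * (ENNReal.ofReal (t' - t) ^ (1 / 2 : ℝ) * Q) := by ring
      _ ≤ _ := by gcongr

end RegSol

lemma lintegral_shear {Φ : E3 × E3 → ℝ≥0∞} (hΦ : AEMeasurable Φ (volume.prod volume)) :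
    ∫⁻ z, Φ z ∂(volume.prod volume) = ∫⁻ ζ : E3, ∫⁻ y : E3, Φ (ζ + y, y) := by
  have hp := measurePreserving_add_prod (volume : Measure E3) (volume : Measure E3)
  have h1 : ∫⁻ z, Φ z ∂(volume.prod volume)
      = ∫⁻ z : E3 × E3, Φ (z.1 + z.2, z.2) ∂(volume.prod volume) := by
    conv_lhs => rw [← hp.map_eq]
    exact lintegral_map' (by rw [hp.map_eq]; exact hΦ) hp.measurable.aemeasurable
  have hm : AEMeasurable (fun z : E3 × E3 => Φ (z.1 + z.2, z.2)) (volume.prod volume) :=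
    hΦ.comp_quasiMeasurePreserving hp.quasiMeasurePreserving
  rw [h1, lintegral_prod _ hm]

lemma lintegral_kernel_le {k : E3 → ℝ≥0∞} (hk : Measurable k) {Ψ : E3 × E3 → ℝ≥0∞}
    (hΨ : AEMeasurable Ψ (volume.prod volume)) {c : ℝ≥0∞}
    (hc : ∀ ζ, k ζ ≠ 0 → ∫⁻ y, Ψ (ζ + y, y) ≤ c) :
    ∫⁻ z, k (z.1 - z.2) * Ψ z ∂(volume.prod volume) ≤ (∫⁻ ζ, k ζ) * c := by
  have hm : AEMeasurable (fun z : E3 × E3 => k (z.1 - z.2) * Ψ z) (volume.prod volume) :=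
    (hk.comp (measurable_fst.sub measurable_snd)).aemeasurable.mul hΨ
  rw [lintegral_shear hm, ← lintegral_mul_const _ hk]
  refine lintegral_mono_ae ?_
  have hs : ∀ᵐ ζ : E3, AEMeasurable fun y => Ψ (ζ + y, y) := by
    have hp := measurePreserving_add_prod (volume : Measure E3) (volume : Measure E3)
    have h2 := (hΨ.comp_quasiMeasurePreserving
      hp.quasiMeasurePreserving).aestronglyMeasurable.prodMk_left
    exact h2.mono fun ζ h => h.aemeasurable
  filter_upwards [hs] with ζ hζ
  simp only [add_sub_cancel_right]
  rw [lintegral_const_mul'' _ hζ]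
  by_cases h0 : k ζ = 0
  · simp [h0]
  · gcongr
    exact hc ζ h0

lemma lintegral_kernel_snd {k : E3 → ℝ≥0∞} (hk : Measurable k) {F : E3 → ℝ≥0∞}
    (hF : AEMeasurable F) :
    ∫⁻ z : E3 × E3, k (z.1 - z.2) * F z.2 ∂(volume.prod volume) = (∫⁻ ζ, k ζ) * ∫⁻ y, F y := by
  have hm : AEMeasurable (fun z : E3 × E3 => k (z.1 - z.2) * F z.2) (volume.prod volume) :=
    (hk.comp (measurable_fst.sub measurable_snd)).aemeasurable.mul hF.comp_snd
  rw [lintegral_shear hm, ← lintegral_mul_const _ hk]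
  refine lintegral_congr fun ζ => ?_
  simp only [add_sub_cancel_right]
  rw [lintegral_const_mul'' _ hF]

lemma integrable_kernel_bilin {m v : E3 → E3} (hm : Integrable m) (hv : Integrable v)
    {F : E3 × E3 → ℝ} (hF : AEStronglyMeasurable F (volume.prod volume)) {C : ℝ}
    (hC : ∀ z, ‖F z‖ ≤ C * (‖m z.1‖ * ‖v z.2‖)) : Integrable F (volume.prod volume) :=
  ((hm.norm.mul_prod hv.norm).const_mul C).mono' hF (Eventually.of_forall hC)

/-- Testing the momentum against solenoidal fields controls a bilinear form. -/
lemma bilinear_bound {a : ℝ → ℝ} (ha : ContDiff ℝ ∞ a) {R : ℝ} (hR : ∀ q, R ≤ q → a q = 0)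
    {m v : E3 → E3} (hm : Integrable m) (hv : Integrable v) {B : ℝ≥0∞}
    (hB : ∀ j y, ‖∫ x, inner ℝ (m x) (solField a j (x - y))‖ₑ ≤ B)
    (hdiv : ∀ i x, ∫ y, fderiv ℝ (solPot a i) (x - y) (v y) = 0) :
    ‖∫ z : E3 × E3, solKer a (z.1 - z.2) * inner ℝ (m z.1) (v z.2) ∂(volume.prod volume)‖ₑ
      ≤ 3 * (B * ∫⁻ y, ‖v y‖ₑ) := by
  have hfc : ∀ j, Continuous (solField a j) := fun j => (solField_contDiff ha j).continuous
  have hpc : ∀ j, Continuous (fderiv ℝ (solPot a j)) := fun j =>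
    (solPot_contDiff ha j).continuous_fderiv (by simp)
  have hsub : Continuous fun z : E3 × E3 => z.1 - z.2 := continuous_fst.sub continuous_snd
  have hm1 : AEStronglyMeasurable (fun z : E3 × E3 => m z.1) (volume.prod volume) := hm.1.comp_fst
  have hv2 : AEStronglyMeasurable (fun z : E3 × E3 => v z.2) (volume.prod volume) := hv.1.comp_snd
  have i1 : ∀ j, Integrable (fun z : E3 × E3 => v z.2 j * inner ℝ (m z.1) (solField a j (z.1 - z.2)))
      (volume.prod volume) := fun j => by
    obtain ⟨C, hC⟩ := (hfc j).bounded_above_of_compact_support (solField_compact hR j)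
    refine integrable_kernel_bilin hm hv (C := C) ((aesm_apply hv2 j).mul
      (hm1.inner ((hfc j).comp hsub).aestronglyMeasurable)) fun z => ?_
    rw [norm_mul]
    calc ‖v z.2 j‖ * ‖inner ℝ (m z.1) (solField a j (z.1 - z.2))‖
        ≤ ‖v z.2‖ * (‖m z.1‖ * C) := by
          gcongr
          · exact PiLp.norm_apply_le _ _
          · exact (norm_inner_le_norm _ _).trans (by gcongr; exact hC _)
      _ = _ := by ring
  have i2 : ∀ i, Integrable (fun z : E3 × E3 => m z.1 i * fderiv ℝ (solPot a i) (z.1 - z.2) (v z.2))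
      (volume.prod volume) := fun i => by
    obtain ⟨C, hC⟩ := (hpc i).bounded_above_of_compact_support ((solPot_compact hR i).fderiv ℝ)
    have hd : AEStronglyMeasurable (fun z : E3 × E3 => fderiv ℝ (solPot a i) (z.1 - z.2) (v z.2))
        (volume.prod volume) :=
      aesm_clm_apply
        ((hpc i).comp hsub).aestronglyMeasurable hv2
    refine integrable_kernel_bilin hm hv (C := C) ((aesm_apply hm1 i).mul hd) fun z => ?_
    rw [norm_mul]
    calc ‖m z.1 i‖ * ‖fderiv ℝ (solPot a i) (z.1 - z.2) (v z.2)‖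
        ≤ ‖m z.1‖ * (C * ‖v z.2‖) := by
          gcongr
          · exact PiLp.norm_apply_le _ _
          · exact (ContinuousLinearMap.le_opNorm _ _).trans (by gcongr; exact hC _)
      _ = _ := by ring
  have e1 : ∀ z : E3 × E3, solKer a (z.1 - z.2) * inner ℝ (m z.1) (v z.2)
      = (∑ j, v z.2 j * inner ℝ (m z.1) (solField a j (z.1 - z.2)))
        - ∑ i, m z.1 i * fderiv ℝ (solPot a i) (z.1 - z.2) (v z.2) := fun z => by
    rw [sum_smul_solField ha]
    ring
  simp_rw [e1]
  rw [integral_sub (integrable_finsetSum _ fun j _ => i1 j) (integrable_finsetSum _ fun j _ => i2 j),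
    integral_finsetSum _ fun j _ => i1 j, integral_finsetSum _ fun j _ => i2 j]
  have z2 : ∀ i, ∫ z : E3 × E3, m z.1 i * fderiv ℝ (solPot a i) (z.1 - z.2) (v z.2)
      ∂(volume.prod volume) = 0 := fun i => by
    rw [integral_prod _ (i2 i)]
    simp only [integral_const_mul, hdiv, mul_zero, integral_zero]
  rw [Finset.sum_eq_zero fun i _ => z2 i, sub_zero]
  refine (enorm_sum_le _ _).trans ?_
  calc ∑ j, ‖∫ z : E3 × E3, v z.2 j * inner ℝ (m z.1) (solField a j (z.1 - z.2))
        ∂(volume.prod volume)‖ₑ ≤ ∑ j : Fin 3, B * ∫⁻ y, ‖v y‖ₑ := by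
        refine Finset.sum_le_sum fun j _ => ?_
        rw [integral_prod_symm _ (i1 j)]
        refine (enorm_integral_le_lintegral_enorm _).trans ?_
        rw [← lintegral_const_mul'' _ hv.1.enorm]
        refine lintegral_mono fun y => ?_
        simp only [integral_const_mul]
        rw [enorm_mul, mul_comm]
        refine mul_le_mul' (hB j y) ?_
        rw [← ofReal_norm, ← ofReal_norm]
        exact ENNReal.ofReal_le_ofReal (PiLp.norm_apply_le _ _)
    _ = _ := by simp

lemma continuous_integral_inner {m Φ : E3 → E3} (hm : Integrable m) (hΦ : Continuous Φ)
    (hΦc : HasCompactSupport Φ) : Continuous fun y => ∫ x, inner ℝ (m x) (Φ (x - y)) := by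
  obtain ⟨C, hC⟩ := hΦ.bounded_above_of_compact_support hΦc
  refine continuous_of_dominated (bound := fun x => ‖m x‖ * C) (fun y => ?_) (fun y => ?_)
    (hm.norm.mul_const C) (Eventually.of_forall fun x => ?_)
  · exact hm.1.inner (hΦ.comp (continuous_id.sub continuous_const)).aestronglyMeasurable
  · exact Eventually.of_forall fun x => (norm_inner_le_norm _ _).trans (by gcongr; exact hC _)
  · fun_prop

lemma continuous_integral_apply {v : E3 → E3} {Φ : E3 → E3 →L[ℝ] ℝ} (hv : Integrable v)
    (hΦ : Continuous Φ) (hΦc : HasCompactSupport Φ) : Continuous fun x => ∫ y, Φ (x - y) (v y) := by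
  obtain ⟨C, hC⟩ := hΦ.bounded_above_of_compact_support hΦc
  refine continuous_of_dominated (bound := fun y => C * ‖v y‖) (fun x => ?_) (fun x => ?_)
    (hv.norm.const_mul C) (Eventually.of_forall fun y => ?_)
  · exact aesm_clm_apply
      (hΦ.comp (continuous_const.sub continuous_id)).aestronglyMeasurable hv.1
  · exact Eventually.of_forall fun y =>
      (ContinuousLinearMap.le_opNorm _ _).trans (by gcongr; exact hC _)
  · fun_prop

/-- Translates of a function with square integrable difference quotients, tested against a weight
with large values. -/
lemma lintegral_weight_diff_le {g : E3 → E3} (hg : MemLp g 2) {D : ℝ≥0∞}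
    (hD : ∀ i, DiffQuot (fun x => g x i) D) {q : E3 → ℝ≥0∞} (hq : AEMeasurable q) (ζ : E3) :
    ∫⁻ y, q y * ‖g (ζ + y) - g y‖ₑ ^ 2
      ≤ 12 * sobConst * D * (∫⁻ y, q y ^ (3 / 2 : ℝ)) ^ (2 / 3 : ℝ) := by
  set Q := (∫⁻ y, q y ^ (3 / 2 : ℝ)) ^ (2 / 3 : ℝ) with hQ
  have hgi : ∀ i, MemLp (fun x => g x i) 2 := fun i =>
    ⟨aesm_apply hg.1 i, (eLpNorm_mono fun x => PiLp.norm_apply_le _ _).trans_lt hg.2⟩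
  have hgs : ∀ i, AEStronglyMeasurable fun y => g (ζ + y) i := fun i =>
    (aesm_apply hg.1 i).comp_quasiMeasurePreserving
      (measurePreserving_add_left volume ζ).quasiMeasurePreserving
  have hdm : ∀ i, AEStronglyMeasurable fun y => g (ζ + y) i - g y i := fun i =>
    (hgs i).sub (aesm_apply hg.1 i)
  have hm : ∀ i, AEMeasurable fun y => q y * ‖g (ζ + y) i - g y i‖ₑ ^ 2 := fun i =>
    hq.mul ((hdm i).enorm.pow_const 2)
  have e : ∀ y, q y * ‖g (ζ + y) - g y‖ₑ ^ 2 = ∑ i, q y * ‖g (ζ + y) i - g y i‖ₑ ^ 2 := fun y => by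
    rw [enorm_sq_eq_sum, Finset.mul_sum]
    rfl
  simp_rw [e]
  rw [lintegral_finsetSum' _ fun i _ => hm i]
  have hone : ∀ i, ∫⁻ y, q y * ‖g (ζ + y) i - g y i‖ₑ ^ 2 ≤ 4 * sobConst * D * Q := by
    intro i
    have hconj : (3 / 2 : ℝ).HolderConjugate 3 := by
      rw [Real.holderConjugate_iff]; norm_num
    have h1 := ENNReal.lintegral_mul_le_Lp_mul_Lq volume hconj hq ((hdm i).enorm.pow_const 2)
    have h2 : (∫⁻ y, (‖g (ζ + y) i - g y i‖ₑ ^ 2) ^ (3:ℝ)) ^ (1 / 3 : ℝ)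
        = eLpNorm (fun y => g (ζ + y) i - g y i) 6 volume ^ 2 := by
      rw [eLpNorm_eq_lintegral_rpow_enorm_toReal (by norm_num) (by norm_num),
        ← ENNReal.rpow_natCast, ← ENNReal.rpow_mul]
      simp only [ENNReal.toReal_ofNat, ← ENNReal.rpow_natCast, ← ENNReal.rpow_mul]
      norm_num
    have h3 : eLpNorm (fun y => g (ζ + y) i - g y i) 6 volume
        ≤ 2 * eLpNorm (fun y => g y i) 6 volume := by
      refine (eLpNorm_sub_le (hgs i) (aesm_apply hg.1 i) one_le_six).trans ?_
      have : eLpNorm (fun y => g (ζ + y) i) 6 volume = eLpNorm (fun y => g y i) 6 volume :=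
        eLpNorm_comp_measurePreserving (g := fun y => g y i) (aesm_apply hg.1 i)
          (measurePreserving_add_left volume ζ)
      rw [this, two_mul]
    calc ∫⁻ y, q y * ‖g (ζ + y) i - g y i‖ₑ ^ 2
        ≤ (∫⁻ y, q y ^ (3 / 2 : ℝ)) ^ (1 / (3 / 2) : ℝ)
          * eLpNorm (fun y => g (ζ + y) i - g y i) 6 volume ^ 2 := by rw [← h2]; exact h1
      _ ≤ Q * (2 * eLpNorm (fun y => g y i) 6 volume) ^ 2 := by
          gcongr
          rw [hQ]
          norm_num
      _ = Q * (4 * eLpNorm (fun y => g y i) 6 volume ^ 2) := by ring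
      _ ≤ Q * (4 * (sobConst * D)) := by gcongr; exact (hD i).sobolev (hgi i)
      _ = _ := by ring
  calc _ ≤ ∑ i : Fin 3, 4 * sobConst * D * Q := Finset.sum_le_sum fun i _ => hone i
    _ = _ := by simp; ring

lemma lintegral_diff_le {g : E3 → E3} (hg : AEStronglyMeasurable g) {D : ℝ≥0∞}
    (hD : ∀ i, DiffQuot (fun x => g x i) D) (ζ : E3) :
    ∫⁻ y, ‖g (ζ + y) - g y‖ₑ ^ 2 ≤ ‖ζ‖ₑ ^ 2 * (3 * D) := by
  have hgs : ∀ i, AEStronglyMeasurable fun y => g (ζ + y) i := fun i =>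
    (aesm_apply hg i).comp_quasiMeasurePreserving
      (measurePreserving_add_left volume ζ).quasiMeasurePreserving
  have hm : ∀ i, AEMeasurable fun y => ‖g (ζ + y) i - g y i‖ₑ ^ 2 := fun i =>
    ((hgs i).sub (aesm_apply hg i)).enorm.pow_const 2
  have e : ∀ y, ‖g (ζ + y) - g y‖ₑ ^ 2 = ∑ i, ‖g (ζ + y) i - g y i‖ₑ ^ 2 := fun y => by
    rw [enorm_sq_eq_sum]
    rfl
  simp_rw [e]
  rw [lintegral_finsetSum' _ fun i _ => hm i]
  calc _ ≤ ∑ i : Fin 3, ‖ζ‖ₑ ^ 2 * D := Finset.sum_le_sum fun i _ => by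
        have := hD i (-ζ)
        simpa [add_comm] using this
    _ = _ := by simp; ring

/-- The part of a weight above the level `K` is small in `L^{3/2}`. -/
lemma lintegral_tail_le {q : E3 → ℝ≥0∞} {K : ℝ≥0∞} (hK : K ≠ 0) (hK' : K ≠ ⊤) :
    (∫⁻ y, (if K < q y then q y else 0) ^ (3 / 2 : ℝ)) ^ (2 / 3 : ℝ)
      ≤ (K ^ (-(1 / 2) : ℝ) * ∫⁻ y, q y ^ 2) ^ (2 / 3 : ℝ) := by
  gcongr
  rw [← lintegral_const_mul' _ _ (ENNReal.rpow_ne_top_of_ne_zero hK hK')]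
  refine lintegral_mono fun y => ?_
  split_ifs with h
  · by_cases hq : q y = ⊤
    · rw [hq]
      have : K ^ (-(1 / 2) : ℝ) ≠ 0 := by
        rw [Ne, ENNReal.rpow_eq_zero_iff]
        simp [hK, hK']
      rw [ENNReal.top_rpow_of_pos (by norm_num), ENNReal.top_pow two_ne_zero, ENNReal.mul_top this]
    · have hq0 : q y ≠ 0 := (bot_le.trans_lt h).ne'
      calc q y ^ (3 / 2 : ℝ) = q y ^ (-(1 / 2) : ℝ) * q y ^ 2 := by
            rw [← ENNReal.rpow_natCast, ← ENNReal.rpow_add _ _ hq0 hq]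
            norm_num
        _ ≤ K ^ (-(1 / 2) : ℝ) * q y ^ 2 := by
            rw [ENNReal.rpow_neg, ENNReal.rpow_neg]
            gcongr
  · simp

/-! ### Bilinear forms with a convolution kernel -/

/-- The form `∬ k(x - y) p(x) · q(y) dx dy`. -/
def kerForm (k : E3 → ℝ) (p q : E3 → E3) : ℝ :=
  ∫ z : E3 × E3, k (z.1 - z.2) * inner ℝ (p z.1) (q z.2) ∂(volume.prod volume)

section kerForm

variable {k : E3 → ℝ} {p p' q q' : E3 → E3}

lemma kerForm_integrable (hk : Continuous k) {C : ℝ} (hC : ∀ z, ‖k z‖ ≤ C) (hp : Integrable p)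
    (hq : Integrable q) : Integrable (fun z : E3 × E3 => k (z.1 - z.2) * inner ℝ (p z.1) (q z.2))
      (volume.prod volume) := by
  refine integrable_kernel_bilin hp hq (C := C) ?_ fun z => ?_
  · exact (hk.comp (continuous_fst.sub continuous_snd)).aestronglyMeasurable.mul
      (hp.1.comp_fst.inner hq.1.comp_snd)
  · rw [norm_mul]
    have h1 := hC (z.1 - z.2)
    exact mul_le_mul h1 (norm_inner_le_norm (𝕜 := ℝ) (p z.1) (q z.2)) (norm_nonneg _)
      ((norm_nonneg _).trans h1)

lemma kerForm_add_left (hk : Continuous k) {C : ℝ} (hC : ∀ z, ‖k z‖ ≤ C) (hp : Integrable p)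
    (hp' : Integrable p') (hq : Integrable q) :
    kerForm k (fun x => p x + p' x) q = kerForm k p q + kerForm k p' q := by
  rw [kerForm, kerForm, kerForm, ← integral_add (kerForm_integrable hk hC hp hq)
    (kerForm_integrable hk hC hp' hq)]
  simp only [inner_add_left, mul_add]

lemma kerForm_add_right (hk : Continuous k) {C : ℝ} (hC : ∀ z, ‖k z‖ ≤ C) (hp : Integrable p)
    (hq : Integrable q) (hq' : Integrable q') :
    kerForm k p (fun x => q x + q' x) = kerForm k p q + kerForm k p q' := by
  rw [kerForm, kerForm, kerForm, ← integral_add (kerForm_integrable hk hC hp hq)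
    (kerForm_integrable hk hC hp hq')]
  simp only [inner_add_right, mul_add]

lemma enorm_kerForm_le {C : ℝ} (hC : ∀ z, ‖k z‖ ≤ C) (hp : Integrable p) (hq : Integrable q) :
    ‖kerForm k p q‖ₑ ≤ ENNReal.ofReal C * ((∫⁻ x, ‖p x‖ₑ) * ∫⁻ y, ‖q y‖ₑ) := by
  refine (enorm_integral_le_lintegral_enorm _).trans ?_
  rw [← lintegral_prod_mul hp.1.enorm hq.1.enorm, ← lintegral_const_mul' _ _ ENNReal.ofReal_ne_top]
  refine lintegral_mono fun z => ?_
  rw [enorm_mul]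
  refine mul_le_mul' ?_ (enorm_inner_le _ _)
  rw [← ofReal_norm]
  exact ENNReal.ofReal_le_ofReal (hC _)

lemma kerForm_sub {k' : E3 → ℝ} (hk : Continuous k) {C : ℝ} (hC : ∀ z, ‖k z‖ ≤ C)
    (hk' : Continuous k') {C' : ℝ} (hC' : ∀ z, ‖k' z‖ ≤ C') (hp : Integrable p) (hq : Integrable q) :
    kerForm (fun z => k z - k' z) p q = kerForm k p q - kerForm k' p q := by
  rw [kerForm, kerForm, kerForm, ← integral_sub (kerForm_integrable hk hC hp hq)
    (kerForm_integrable hk' hC' hp hq)]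
  simp only [sub_mul]

end kerForm

lemma integrable_smul_of_sq {a : E3 → ℝ} {v : E3 → E3} (ha : AEStronglyMeasurable a)
    (hv : AEStronglyMeasurable v) {A V : ℝ≥0∞} (hA : A ≠ ⊤) (hV : V ≠ ⊤)
    (h1 : ∫⁻ x, ‖a x‖ₑ ^ 2 ≤ A ^ 2) (h2 : ∫⁻ x, ‖v x‖ₑ ^ 2 ≤ V ^ 2) :
    Integrable (fun x => a x • v x) ∧ ∫⁻ x, ‖a x • v x‖ₑ ≤ A * V := by
  have h : ∫⁻ x, ‖a x • v x‖ₑ ≤ A * V := by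
    simp only [enorm_smul]
    exact lintegral_mul_le_sqrt _ ha.enorm hv.enorm h1 h2
  exact ⟨⟨ha.smul hv, h.trans_lt (by finiteness)⟩, h⟩

lemma lintegral_sub_sq_le {F : Type*} [NormedAddCommGroup F] {v v' : E3 → F}
    (hv : AEStronglyMeasurable v) (hv' : AEStronglyMeasurable v') {V : ℝ≥0∞}
    (h : ∫⁻ x, ‖v x‖ₑ ^ 2 ≤ V ^ 2) (h' : ∫⁻ x, ‖v' x‖ₑ ^ 2 ≤ V ^ 2) :
    ∫⁻ x, ‖v' x - v x‖ₑ ^ 2 ≤ (2 * V) ^ 2 := by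
  rw [← eLpNorm_two_sq] at h h' ⊢
  have h1 := (ENNReal.pow_le_pow_left_iff two_ne_zero).1 h
  have h2 := (ENNReal.pow_le_pow_left_iff two_ne_zero).1 h'
  gcongr
  refine (eLpNorm_sub_le hv' hv one_le_two).trans ?_
  rw [two_mul]
  gcongr

/-- Bounds for the density root `s` and the weighted velocity `w` at a fixed time. -/
structure SliceData (b : ℝ) (S R W : ℝ≥0∞) (s : E3 → ℝ) (w : E3 → E3) : Prop where
  sm : AEStronglyMeasurable s
  wm : AEStronglyMeasurable w
  s0 : ∀ᵐ x, s x ∈ Icc 0 b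
  s2 : ∫⁻ x, ‖s x‖ₑ ^ 2 ≤ S ^ 2
  r2 : ∫⁻ x, ‖(s x)⁻¹‖ₑ ^ 2 ≤ R ^ 2
  w2 : ∫⁻ x, ‖w x‖ₑ ^ 2 ≤ W ^ 2
  vac : ∀ x, s x = 0 → w x = 0

lemma SliceData.rm {b : ℝ} {S R W : ℝ≥0∞} {s : E3 → ℝ} {w : E3 → E3} (h : SliceData b S R W s w) :
    AEStronglyMeasurable fun x => (s x)⁻¹ := h.sm.aemeasurable.inv.aestronglyMeasurable

/-- Pointwise symmetrisation. -/
lemma symm_pointwise {F : Type*} [NormedAddCommGroup F] [InnerProductSpace ℝ F] {s1 s2 : ℝ}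
    {g1 g2 : F} (h1 : 0 ≤ s1) (h2 : 0 ≤ s2) (hg1 : s1 = 0 → g1 = 0) (hg2 : s2 = 0 → g2 = 0) :
    ‖g1‖ ^ 2 + ‖g2‖ ^ 2 ≤ s1 * s2⁻¹ * inner ℝ g1 g2 + s2 * s1⁻¹ * inner ℝ g2 g1
      + ((1 + s1 * s2⁻¹) * ‖g1 - g2‖ ^ 2 + (1 + s2 * s1⁻¹) * ‖g2 - g1‖ ^ 2) := by
  have hc : inner ℝ g2 g1 = inner ℝ g1 g2 := real_inner_comm _ _
  have hn : ‖g2 - g1‖ = ‖g1 - g2‖ := norm_sub_rev _ _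
  rw [hc, hn]
  rcases h1.eq_or_lt with e1 | p1
  · have hz := hg1 e1.symm
    subst hz
    simp [← e1]
  rcases h2.eq_or_lt with e2 | p2
  · have hz := hg2 e2.symm
    subst hz
    simp [← e2]
  have hS : 2 ≤ s1 * s2⁻¹ + s2 * s1⁻¹ := by
    have : s1 * s2⁻¹ + s2 * s1⁻¹ - 2 = (s1 - s2) ^ 2 / (s1 * s2) := by field_simp; ring
    have h3 : 0 ≤ (s1 - s2) ^ 2 / (s1 * s2) := by positivity
    linarith
  set S := s1 * s2⁻¹ + s2 * s1⁻¹ with hSd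
  have hns : ‖g1 - g2‖ ^ 2 = ‖g1‖ ^ 2 - 2 * inner ℝ g1 g2 + ‖g2‖ ^ 2 := norm_sub_sq_real _ _
  have e : s1 * s2⁻¹ * inner ℝ g1 g2 + s2 * s1⁻¹ * inner ℝ g1 g2
      + ((1 + s1 * s2⁻¹) * ‖g1 - g2‖ ^ 2 + (1 + s2 * s1⁻¹) * ‖g1 - g2‖ ^ 2)
      = S * inner ℝ g1 g2 + (2 + S) * ‖g1 - g2‖ ^ 2 := by rw [hSd]; ring
  rw [e]
  have h5 : inner ℝ g1 g2 = (‖g1‖ ^ 2 + ‖g2‖ ^ 2 - ‖g1 - g2‖ ^ 2) / 2 := by linarith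
  rw [h5]
  have h6 : 0 ≤ ‖g1 - g2‖ ^ 2 := by positivity
  have h7 : 0 ≤ ‖g1‖ ^ 2 + ‖g2‖ ^ 2 := by positivity
  nlinarith

lemma inv_sub_pointwise {s s' : ℝ} (h : 0 ≤ s) (h' : 0 ≤ s') (hv : s = 0 ↔ s' = 0) {K : ℝ}
    (hK : 0 ≤ K) :
    |s'⁻¹ - s⁻¹| ≤ K ^ 2 * |s' - s| + ((if K < s⁻¹ then s⁻¹ else 0) + if K < s'⁻¹ then s'⁻¹ else 0) := by
  rcases h.eq_or_lt with e | p
  · have e' := hv.1 e.symm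
    simp [← e, e']
  have p' : 0 < s' := lt_of_le_of_ne h' fun e => p.ne' (hv.2 e.symm)
  have i := inv_pos.2 p
  have i' := inv_pos.2 p'
  have hnn : 0 ≤ K ^ 2 * |s' - s| := by positivity
  split_ifs with h1 h2 h2
  · rw [abs_le]; constructor <;> linarith
  · rw [abs_le]; constructor <;> linarith
  · rw [abs_le]; constructor <;> linarith
  · push Not at h1 h2
    have : s'⁻¹ - s⁻¹ = s⁻¹ * s'⁻¹ * (s - s') := by field_simp
    rw [this, abs_mul, abs_of_pos (by positivity), abs_sub_comm s s']
    have : s⁻¹ * s'⁻¹ ≤ K ^ 2 := by nlinarith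
    nlinarith [abs_nonneg (s' - s)]

lemma lintegral_inv_sub_sq_le {s s' : E3 → ℝ} (hs : AEStronglyMeasurable s)
    (hs' : AEStronglyMeasurable s') (h0 : ∀ᵐ x, 0 ≤ s x) (h0' : ∀ᵐ x, 0 ≤ s' x)
    (hv : ∀ᵐ x, s x = 0 ↔ s' x = 0) {K : ℝ} (hK : 0 ≤ K) {a τ : ℝ≥0∞}
    (ha : ∫⁻ x, ‖s' x - s x‖ₑ ^ 2 ≤ a ^ 2)
    (hτ : ∫⁻ x, ‖if K < (s x)⁻¹ then (s x)⁻¹ else 0‖ₑ ^ 2 ≤ τ ^ 2)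
    (hτ' : ∫⁻ x, ‖if K < (s' x)⁻¹ then (s' x)⁻¹ else 0‖ₑ ^ 2 ≤ τ ^ 2) :
    ∫⁻ x, ‖(s' x)⁻¹ - (s x)⁻¹‖ₑ ^ 2 ≤ (ENNReal.ofReal K ^ 2 * a + 2 * τ) ^ 2 := by
  have hmeas : Measurable fun r : ℝ => if K < r⁻¹ then r⁻¹ else 0 :=
    Measurable.ite (measurableSet_lt measurable_const measurable_inv) measurable_inv measurable_const
  have hm : AEStronglyMeasurable fun x => if K < (s x)⁻¹ then (s x)⁻¹ else 0 :=
    (hmeas.comp_aemeasurable hs.aemeasurable).aestronglyMeasurable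
  have hm' : AEStronglyMeasurable fun x => if K < (s' x)⁻¹ then (s' x)⁻¹ else 0 :=
    (hmeas.comp_aemeasurable hs'.aemeasurable).aestronglyMeasurable
  have hd : AEStronglyMeasurable fun x => K ^ 2 * |s' x - s x| := by
    have := (hs'.sub hs).norm.const_mul (K ^ 2)
    exact this
  rw [← eLpNorm_two_sq] at ha hτ hτ' ⊢
  have ha2 := (ENNReal.pow_le_pow_left_iff two_ne_zero).1 ha
  have hτ2 := (ENNReal.pow_le_pow_left_iff two_ne_zero).1 hτ
  have hτ2' := (ENNReal.pow_le_pow_left_iff two_ne_zero).1 hτ'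
  gcongr
  calc eLpNorm (fun x => (s' x)⁻¹ - (s x)⁻¹) 2 volume
      ≤ eLpNorm ((fun x => K ^ 2 * |s' x - s x|) + ((fun x => if K < (s x)⁻¹ then (s x)⁻¹ else 0)
        + fun x => if K < (s' x)⁻¹ then (s' x)⁻¹ else 0)) 2 volume := by
        refine eLpNorm_mono_ae_real ?_
        filter_upwards [h0, h0', hv] with x h1 h2 h3
        exact inv_sub_pointwise h1 h2 h3 hK
    _ ≤ eLpNorm (fun x => K ^ 2 * |s' x - s x|) 2 volume
        + (eLpNorm (fun x => if K < (s x)⁻¹ then (s x)⁻¹ else 0) 2 volume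
          + eLpNorm (fun x => if K < (s' x)⁻¹ then (s' x)⁻¹ else 0) 2 volume) :=
        (eLpNorm_add_le hd (hm.add hm') one_le_two).trans
          (add_le_add le_rfl (eLpNorm_add_le hm hm' one_le_two))
    _ ≤ ENNReal.ofReal K ^ 2 * a + 2 * τ := by
        rw [two_mul]
        gcongr
        have e : (fun x => K ^ 2 * |s' x - s x|) = (K ^ 2) • fun x => ‖s' x - s x‖ := by
          funext x; simp [Real.norm_eq_abs]
        rw [e, eLpNorm_const_smul, eLpNorm_norm]
        rw [Real.enorm_eq_ofReal (by positivity), ENNReal.ofReal_pow hK]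
        gcongr

section main

variable {b : ℝ} {S R W : ℝ≥0∞} {s s' : E3 → ℝ} {w w' : E3 → E3} {k : E3 → ℝ}

lemma kernel_lower (h : SliceData b S R W s w) {g : E3 → E3} (hgm : AEStronglyMeasurable g)
    (hg2 : ∫⁻ x, ‖g x‖ₑ ^ 2 ≤ (2 * W) ^ 2) (hgv : ∀ᵐ x, s x = 0 → g x = 0)
    (hS : S ≠ ⊤) (hR : R ≠ ⊤) (hW : W ≠ ⊤)
    (hk : Continuous k) {C : ℝ} (hC : ∀ z, ‖k z‖ ≤ C) (hk0 : ∀ z, 0 ≤ k z)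
    (hke : ∀ z, k (-z) = k z) (hkf : ∫⁻ z, ‖k z‖ₑ ≠ ⊤) :
    (∫⁻ z, ‖k z‖ₑ) * ∫⁻ x, ‖g x‖ₑ ^ 2
      ≤ ‖kerForm k (fun x => s x • g x) (fun x => (s x)⁻¹ • g x)‖ₑ
        + ∫⁻ z : E3 × E3, ‖k (z.1 - z.2)‖ₑ * ((1 + ‖s z.1‖ₑ * ‖(s z.2)⁻¹‖ₑ)
          * ‖g z.1 - g z.2‖ₑ ^ 2) ∂(volume.prod volume) := by
  set P : E3 × E3 → ℝ≥0∞ := fun z => ‖k (z.1 - z.2)‖ₑ * ((1 + ‖s z.1‖ₑ * ‖(s z.2)⁻¹‖ₑ)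
          * ‖g z.1 - g z.2‖ₑ ^ 2) with hP
  by_cases hPt : ∫⁻ z, P z ∂(volume.prod volume) = ⊤
  · rw [hPt]; simp
  have hsg := integrable_smul_of_sq h.sm hgm hS (by finiteness : (2 * W) ≠ ⊤) h.s2 hg2
  have hrg := integrable_smul_of_sq h.rm hgm hR (by finiteness : (2 * W) ≠ ⊤) h.r2 hg2
  obtain ⟨p1, hp1⟩ : ∃ p1 : E3 → E3, p1 = fun x => s x • g x := ⟨_, rfl⟩
  obtain ⟨q1, hq1⟩ : ∃ q1 : E3 → E3, q1 = fun x => (s x)⁻¹ • g x := ⟨_, rfl⟩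
  rw [← hp1, ← hq1]
  rw [← hp1] at hsg
  rw [← hq1] at hrg
  obtain ⟨F, hF⟩ : ∃ F : E3 × E3 → ℝ, F = fun z => k (z.1 - z.2) * inner ℝ (p1 z.1) (q1 z.2) :=
    ⟨_, rfl⟩
  have hFi : Integrable F (volume.prod volume) := by
    rw [hF]
    exact kerForm_integrable hk hC hsg.1 hrg.1
  obtain ⟨p, hp⟩ : ∃ p : E3 × E3 → ℝ, p = fun z => k (z.1 - z.2) * ((1 + |s z.1| * |(s z.2)⁻¹|)
    * ‖g z.1 - g z.2‖ ^ 2) := ⟨_, rfl⟩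
  have hkm : AEStronglyMeasurable (fun z : E3 × E3 => k (z.1 - z.2)) (volume.prod volume) :=
    (hk.comp (continuous_fst.sub continuous_snd)).aestronglyMeasurable
  have hpm : AEStronglyMeasurable p (volume.prod volume) := by
    have h1 : AEStronglyMeasurable (fun z : E3 × E3 => |s z.1|) (volume.prod volume) :=
      h.sm.norm.comp_fst
    have h2 : AEStronglyMeasurable (fun z : E3 × E3 => |(s z.2)⁻¹|) (volume.prod volume) :=
      h.rm.norm.comp_snd
    have h3 : AEStronglyMeasurable (fun z : E3 × E3 => ‖g z.1 - g z.2‖) (volume.prod volume) :=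
      (hgm.comp_fst.sub hgm.comp_snd).norm
    rw [hp]
    exact hkm.mul ((aestronglyMeasurable_const.add (h1.mul h2)).mul (h3.pow 2))
  have hp0 : ∀ z, 0 ≤ p z := fun z => by
    rw [hp]
    exact mul_nonneg (hk0 _) (by positivity)
  have hpP : ∀ z, ENNReal.ofReal (p z) = P z := fun z => by
    rw [hp, hP]
    simp only
    rw [ENNReal.ofReal_mul (hk0 _), ENNReal.ofReal_mul (by positivity),
      ENNReal.ofReal_add zero_le_one (by positivity), ENNReal.ofReal_mul (abs_nonneg _),
      ENNReal.ofReal_one, ENNReal.ofReal_pow (norm_nonneg _), ofReal_norm,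
      Real.enorm_eq_ofReal (hk0 _), Real.enorm_eq_ofReal_abs, Real.enorm_eq_ofReal_abs]
  have hpi : Integrable p (volume.prod volume) := by
    refine ⟨hpm, ?_⟩
    rw [hasFiniteIntegral_iff_ofReal (Eventually.of_forall hp0)]
    simp_rw [hpP]
    exact lt_top_iff_ne_top.2 hPt
  obtain ⟨H, hH⟩ : ∃ H : E3 × E3 → ℝ, H = fun z => k (z.1 - z.2) * ‖g z.2‖ ^ 2 := ⟨_, rfl⟩
  have hH0 : ∀ z, 0 ≤ H z := fun z => by
    rw [hH]
    exact mul_nonneg (hk0 _) (by positivity)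
  have hHl : ∫⁻ z, ENNReal.ofReal (H z) ∂(volume.prod volume)
      = (∫⁻ z, ‖k z‖ₑ) * ∫⁻ x, ‖g x‖ₑ ^ 2 := by
    rw [← lintegral_kernel_snd hk.enorm.measurable (hgm.enorm.pow_const 2)]
    refine lintegral_congr fun z => ?_
    rw [hH]
    simp only
    rw [ENNReal.ofReal_mul (hk0 _), ENNReal.ofReal_pow (norm_nonneg _), ofReal_norm,
      Real.enorm_eq_ofReal (hk0 _)]
  have hg2t : ∫⁻ x, ‖g x‖ₑ ^ 2 ≠ ⊤ := ne_top_of_le_ne_top (by finiteness) hg2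
  have hHi : Integrable H (volume.prod volume) := by
    refine ⟨by rw [hH]; exact hkm.mul (hgm.comp_snd.norm.pow 2), ?_⟩
    rw [hasFiniteIntegral_iff_ofReal (Eventually.of_forall hH0), hHl]
    exact ENNReal.mul_lt_top hkf.lt_top hg2t.lt_top
  have hsw : ∀ Φ : E3 × E3 → ℝ, Integrable Φ (volume.prod volume) →
      Integrable (fun z => Φ z.swap) (volume.prod volume) := fun Φ hΦ => hΦ.swap
  have hpt : ∀ᵐ z ∂((volume : Measure E3).prod (volume : Measure E3)),
      H z + H z.swap ≤ (F z + F z.swap) + (p z + p z.swap) := by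
    have h0 : ∀ᵐ x, 0 ≤ s x ∧ (s x = 0 → g x = 0) := by
      filter_upwards [h.s0, hgv] with x h1 h2 using ⟨h1.1, h2⟩
    have h1 : ∀ᵐ z ∂((volume : Measure E3).prod (volume : Measure E3)),
        0 ≤ s z.1 ∧ (s z.1 = 0 → g z.1 = 0) :=
      Measure.quasiMeasurePreserving_fst.ae h0
    have h2 : ∀ᵐ z ∂((volume : Measure E3).prod (volume : Measure E3)),
        0 ≤ s z.2 ∧ (s z.2 = 0 → g z.2 = 0) :=
      Measure.quasiMeasurePreserving_snd.ae h0
    filter_upwards [h1, h2] with z h1 h2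
    have key := mul_le_mul_of_nonneg_left (symm_pointwise h1.1 h2.1 h1.2 h2.2) (hk0 (z.1 - z.2))
    have hks : k (z.2 - z.1) = k (z.1 - z.2) := by rw [← hke, neg_sub]
    simp only [hH, hF, hp, hp1, hq1, Prod.fst_swap, Prod.snd_swap, hks, inner_smul_left, inner_smul_right,
      abs_of_nonneg h1.1, abs_of_nonneg h2.1, abs_of_nonneg (inv_nonneg.2 h1.1),
      abs_of_nonneg (inv_nonneg.2 h2.1), RCLike.conj_to_real]
    linarith
  have hint := integral_mono_ae (hHi.add (hsw _ hHi)) (((hFi.add (hsw _ hFi))).add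
    (hpi.add (hsw _ hpi))) hpt
  rw [integral_add' hHi (hsw _ hHi), integral_add' (hFi.add (hsw _ hFi)) (hpi.add (hsw _ hpi)),
    integral_add' hFi (hsw _ hFi), integral_add' hpi (hsw _ hpi), integral_prod_swap,
    integral_prod_swap, integral_prod_swap] at hint
  have hfin : ∫ z, H z ∂(volume.prod volume)
      ≤ kerForm k p1 q1 + ∫ z, p z ∂(volume.prod volume) := by
    have : kerForm k p1 q1 = ∫ z, F z ∂(volume.prod volume) := by rw [hF, kerForm]
    rw [this]
    linarith
  rw [← hHl, ← ofReal_integral_eq_lintegral_ofReal hHi (Eventually.of_forall hH0)]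
  refine (ENNReal.ofReal_le_ofReal hfin).trans (ENNReal.ofReal_add_le.trans (add_le_add ?_ ?_))
  · rw [Real.enorm_eq_ofReal_abs]
    exact ENNReal.ofReal_le_ofReal (le_abs_self _)
  · rw [ofReal_integral_eq_lintegral_ofReal hpi (Eventually.of_forall hp0)]
    simp_rw [hpP]
    exact le_rfl

lemma kernel_error (h : SliceData b S R W s w) {g : E3 → E3} (hg : MemLp g 2) {D : ℝ≥0∞}
    (hD : ∀ i, DiffQuot (fun x => g x i) D) (hk : Continuous k) {δ : ℝ}
    (hkδ : ∀ z, δ ≤ ‖z‖ → k z = 0) {K : ℝ≥0∞} (hK : K ≠ 0) (hK' : K ≠ ⊤) :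
    ∫⁻ z : E3 × E3, ‖k (z.1 - z.2)‖ₑ * ((1 + ‖s z.1‖ₑ * ‖(s z.2)⁻¹‖ₑ)
          * ‖g z.1 - g z.2‖ₑ ^ 2) ∂(volume.prod volume)
      ≤ (∫⁻ z, ‖k z‖ₑ) * (ENNReal.ofReal δ ^ 2 * (3 * D) + ENNReal.ofReal b
        * (K * (ENNReal.ofReal δ ^ 2 * (3 * D))
          + 12 * sobConst * D * (K ^ (-(1 / 2) : ℝ) * R ^ 2) ^ (2 / 3 : ℝ))) := by
  have hgd : AEMeasurable (fun z : E3 × E3 => ‖g z.1 - g z.2‖ₑ ^ 2) (volume.prod volume) :=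
    (hg.1.comp_fst.sub hg.1.comp_snd).enorm.pow_const 2
  have hsm1 : AEMeasurable (fun z : E3 × E3 => ‖s z.1‖ₑ) (volume.prod volume) :=
    h.sm.comp_fst.enorm
  have hrm2 : AEMeasurable (fun z : E3 × E3 => ‖(s z.2)⁻¹‖ₑ) (volume.prod volume) :=
    h.rm.comp_snd.enorm
  refine lintegral_kernel_le hk.enorm.measurable
    ((aemeasurable_const.add (hsm1.mul hrm2)).mul hgd) fun ζ hζ => ?_
  have hζδ : ‖ζ‖ₑ ≤ ENNReal.ofReal δ := by
    rw [← ofReal_norm]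
    refine ENNReal.ofReal_le_ofReal ?_
    by_contra hcon
    exact hζ (by rw [hkδ ζ (le_of_lt (not_le.1 hcon)), enorm_zero])
  have hdm : AEMeasurable fun y => ‖g (ζ + y) - g y‖ₑ ^ 2 :=
    ((hg.1.comp_quasiMeasurePreserving
      (measurePreserving_add_left volume ζ).quasiMeasurePreserving).sub hg.1).enorm.pow_const 2
  have hsζ : ∀ᵐ y, s (ζ + y) ∈ Icc 0 b :=
    (measurePreserving_add_left volume ζ).quasiMeasurePreserving.ae h.s0
  have hD1 : ∫⁻ y, ‖g (ζ + y) - g y‖ₑ ^ 2 ≤ ENNReal.ofReal δ ^ 2 * (3 * D) :=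
    (lintegral_diff_le hg.1 hD ζ).trans (by gcongr)
  set q : E3 → ℝ≥0∞ := fun y => ‖(s y)⁻¹‖ₑ with hq
  have hqm : AEMeasurable q := h.rm.enorm
  have htm : AEMeasurable fun y => if K < q y then q y else 0 := by
    have : Measurable fun r : ℝ≥0∞ => if K < r then r else 0 :=
      Measurable.ite measurableSet_Ioi measurable_id measurable_const
    exact this.comp_aemeasurable hqm
  have hT1 := (lintegral_weight_diff_le hg hD htm ζ).trans
    (mul_le_mul' le_rfl (lintegral_tail_le (q := q) hK hK'))
  have htm2 : AEMeasurable fun y => (if K < q y then q y else 0) * ‖g (ζ + y) - g y‖ₑ ^ 2 :=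
    htm.mul hdm
  calc ∫⁻ y, (1 + ‖s (ζ + y)‖ₑ * ‖(s y)⁻¹‖ₑ) * ‖g (ζ + y) - g y‖ₑ ^ 2
      ≤ ∫⁻ y, (‖g (ζ + y) - g y‖ₑ ^ 2 + ENNReal.ofReal b * (K * ‖g (ζ + y) - g y‖ₑ ^ 2
        + (if K < q y then q y else 0) * ‖g (ζ + y) - g y‖ₑ ^ 2)) := by
        refine lintegral_mono_ae (hsζ.mono fun y hy => ?_)
        have h1 : ‖s (ζ + y)‖ₑ ≤ ENNReal.ofReal b := by
          rw [Real.enorm_eq_ofReal hy.1]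
          exact ENNReal.ofReal_le_ofReal hy.2
        have h2 : q y ≤ K + if K < q y then q y else 0 := by
          split_ifs with hlt
          · exact le_add_self
          · simpa using hlt
        calc (1 + ‖s (ζ + y)‖ₑ * q y) * ‖g (ζ + y) - g y‖ₑ ^ 2
            ≤ (1 + ENNReal.ofReal b * (K + if K < q y then q y else 0))
              * ‖g (ζ + y) - g y‖ₑ ^ 2 := by gcongr
          _ = _ := by ring
    _ = (∫⁻ y, ‖g (ζ + y) - g y‖ₑ ^ 2) + ENNReal.ofReal b * (K * (∫⁻ y, ‖g (ζ + y) - g y‖ₑ ^ 2)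
        + ∫⁻ y, (if K < q y then q y else 0) * ‖g (ζ + y) - g y‖ₑ ^ 2) := by
        rw [lintegral_add_left' hdm, lintegral_const_mul' _ _ ENNReal.ofReal_ne_top,
          lintegral_add_right' _ htm2, lintegral_const_mul' _ _ hK']
    _ ≤ _ := by
        have hr2 : ∫⁻ y, q y ^ 2 ≤ R ^ 2 := h.r2
        gcongr
        refine hT1.trans ?_
        gcongr

end main

lemma lintegral_scaledKer {δ : ℝ} (hδ : 0 < δ) : ∫⁻ z, ‖scaledKer δ z‖ₑ = ENNReal.ofReal kerMass := by
  have hi : Integrable (scaledKer δ) := by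
    by_contra hcon
    have := integral_scaledKer hδ
    rw [integral_undef hcon] at this
    exact kerMass_pos.ne this
  rw [← integral_scaledKer hδ, ofReal_integral_eq_lintegral_ofReal hi
    (Eventually.of_forall (scaledKer_nonneg hδ))]
  exact lintegral_congr fun z => Real.enorm_eq_ofReal (scaledKer_nonneg hδ z)

lemma scaledKer_bound {Bk : ℝ} (hBk : ∀ q, 0 ≤ q → baseKer q ≤ Bk) {δ : ℝ} (hδ : 0 < δ) (z : E3) :
    ‖scaledKer δ z‖ ≤ Bk * (δ ^ 3)⁻¹ := by
  rw [Real.norm_of_nonneg (scaledKer_nonneg hδ z), scaledKer, mul_comm]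
  gcongr
  exact hBk _ (by positivity)

/-- The bound for the square of the increment of the weighted velocity: the part independent
of the difference quotients. -/
def lowerConst (S R W B a c : ℝ≥0∞) (Bk δ L : ℝ) : ℝ≥0∞ :=
  3 * (B * (2 * (R * W))) + ENNReal.ofReal (Bk * (L ^ 3)⁻¹) * (2 * (S * W) * (2 * (R * W)))
    + ENNReal.ofReal (Bk * (δ ^ 3)⁻¹) * (2 * (S * W) * (c * W) + a * W * (R * (2 * W)))

/-- The coefficient of the difference quotients. -/
def errorCoeff (b : ℝ) (R K : ℝ≥0∞) (δ : ℝ) : ℝ≥0∞ :=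
  ENNReal.ofReal kerMass * (ENNReal.ofReal δ ^ 2 * 3 + ENNReal.ofReal b
        * (K * (ENNReal.ofReal δ ^ 2 * 3)
          + 12 * sobConst * (K ^ (-(1 / 2) : ℝ) * R ^ 2) ^ (2 / 3 : ℝ)))

lemma lintegral_sub_le_two {m m' : E3 → E3} {c : ℝ≥0∞} (hm : AEStronglyMeasurable m)
    (h : ∫⁻ x, ‖m x‖ₑ ≤ c) (h' : ∫⁻ x, ‖m' x‖ₑ ≤ c) : ∫⁻ x, ‖m' x - m x‖ₑ ≤ 2 * c := by
  calc ∫⁻ x, ‖m' x - m x‖ₑ ≤ ∫⁻ x, (‖m' x‖ₑ + ‖m x‖ₑ) := lintegral_mono fun x => enorm_sub_le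
    _ = (∫⁻ x, ‖m' x‖ₑ) + ∫⁻ x, ‖m x‖ₑ := lintegral_add_right' _ hm.enorm
    _ ≤ _ := by rw [two_mul]; gcongr

/-- The increment of the weighted velocity between two times, controlled by the increments of the
momentum and of the density. -/
theorem static_estimate {b : ℝ} {S R W : ℝ≥0∞} {s s' : E3 → ℝ} {w w' : E3 → E3}
    (h : SliceData b S R W s w) (h' : SliceData b S R W s' w') (hv : ∀ᵐ x, s x = 0 ↔ s' x = 0)
    (hS : S ≠ ⊤) (hR : R ≠ ⊤) (hW : W ≠ ⊤) {a c D B : ℝ≥0∞} (ha : a ≠ ⊤) (hc : c ≠ ⊤)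
    (has : ∫⁻ x, ‖s' x - s x‖ₑ ^ 2 ≤ a ^ 2) (hcs : ∫⁻ x, ‖(s' x)⁻¹ - (s x)⁻¹‖ₑ ^ 2 ≤ c ^ 2)
    (hD : ∀ i, DiffQuot (fun x => w' x i - w x i) D) {δ L : ℝ} (hδ : 0 < δ) (hL : 0 < L)
    (hB : ∀ j y, ‖∫ x, inner ℝ (s' x • w' x - s x • w x)
      (solField (diffProfile δ L) j (x - y))‖ₑ ≤ B)
    (hdiv : ∀ i x, ∫ y, fderiv ℝ (solPot (diffProfile δ L) i) (x - y)
      ((s' y)⁻¹ • w' y - (s y)⁻¹ • w y) = 0)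
    {Bk : ℝ} (hBk : ∀ q, 0 ≤ q → baseKer q ≤ Bk) {K : ℝ≥0∞} (hK : K ≠ 0) (hK' : K ≠ ⊤) :
    ENNReal.ofReal kerMass * ∫⁻ x, ‖w' x - w x‖ₑ ^ 2
      ≤ lowerConst S R W B a c Bk δ L + errorCoeff b R K δ * D := by
  obtain ⟨g, hg⟩ : ∃ g : E3 → E3, g = fun x => w' x - w x := ⟨_, rfl⟩
  have hgm : AEStronglyMeasurable g := by rw [hg]; exact h'.wm.sub h.wm
  have hg2 : ∫⁻ x, ‖g x‖ₑ ^ 2 ≤ (2 * W) ^ 2 := by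
    rw [hg]; exact lintegral_sub_sq_le h.wm h'.wm h.w2 h'.w2
  have h2W : 2 * W ≠ ⊤ := by finiteness
  have hgv : ∀ᵐ x, s x = 0 → g x = 0 := hv.mono fun x hx h0 => by
    rw [hg]
    simp [h.vac x h0, h'.vac x (hx.1 h0)]
  have hgL : MemLp g 2 := by
    refine ⟨hgm, ?_⟩
    have := eLpNorm_two_sq volume g
    by_contra hcon
    rw [not_lt_top_iff] at hcon
    rw [hcon] at this
    rw [← this] at hg2
    simp at hg2
    exact h2W hg2
  have hgD : ∀ i, DiffQuot (fun x => g x i) D := fun i => by rw [hg]; exact hD i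
  have hsm : AEStronglyMeasurable fun x => s' x - s x := h'.sm.sub h.sm
  have hrm : AEStronglyMeasurable fun x => (s' x)⁻¹ - (s x)⁻¹ := h'.rm.sub h.rm
  have i1 := integrable_smul_of_sq h.sm h.wm hS hW h.s2 h.w2
  have i1' := integrable_smul_of_sq h'.sm h'.wm hS hW h'.s2 h'.w2
  have i2 := integrable_smul_of_sq h.rm h.wm hR hW h.r2 h.w2
  have i2' := integrable_smul_of_sq h'.rm h'.wm hR hW h'.r2 h'.w2
  have i3 := integrable_smul_of_sq h.sm hgm hS h2W h.s2 hg2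
  have i4 := integrable_smul_of_sq h.rm hgm hR h2W h.r2 hg2
  have i5 := integrable_smul_of_sq hsm h'.wm ha hW has h'.w2
  have i6 := integrable_smul_of_sq hrm h'.wm hc hW hcs h'.w2
  obtain ⟨m, hm⟩ : ∃ m : E3 → E3, m = fun x => s' x • w' x - s x • w x := ⟨_, rfl⟩
  obtain ⟨v, hvd⟩ : ∃ v : E3 → E3, v = fun x => (s' x)⁻¹ • w' x - (s x)⁻¹ • w x := ⟨_, rfl⟩
  have hmi : Integrable m := by rw [hm]; exact i1'.1.sub i1.1
  have hvi : Integrable v := by rw [hvd]; exact i2'.1.sub i2.1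
  have hm1 : ∫⁻ x, ‖m x‖ₑ ≤ 2 * (S * W) := by
    rw [hm]; exact lintegral_sub_le_two i1.1.1 i1.2 i1'.2
  have hv1 : ∫⁻ x, ‖v x‖ₑ ≤ 2 * (R * W) := by
    rw [hvd]; exact lintegral_sub_le_two i2.1.1 i2.2 i2'.2
  have em : m = fun x => s x • g x + (s' x - s x) • w' x := by
    rw [hm, hg]; funext x; module
  have ev : v = fun x => (s x)⁻¹ • g x + ((s' x)⁻¹ - (s x)⁻¹) • w' x := by
    rw [hvd, hg]; funext x; module
  have ck := scaledKer_continuous δ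
  have cL := scaledKer_continuous L
  have bk := scaledKer_bound hBk hδ
  have bL := scaledKer_bound hBk hL
  have hlow := kernel_lower h hgm hg2 hgv hS hR hW ck bk (scaledKer_nonneg hδ) (scaledKer_neg δ)
    (by rw [lintegral_scaledKer hδ]; exact ENNReal.ofReal_ne_top)
  have herr := kernel_error h hgL hgD ck (δ := δ) (fun z hz => scaledKer_eq_zero hδ hz) hK hK'
  rw [lintegral_scaledKer hδ] at hlow herr
  have hY : ‖kerForm (scaledKer δ) m v‖ₑ
      ≤ 3 * (B * (2 * (R * W))) + ENNReal.ofReal (Bk * (L ^ 3)⁻¹) * (2 * (S * W) * (2 * (R * W))) := by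
    have h1 := bilinear_bound (diffProfile_contDiff δ L) (fun q hq => diffProfile_of_ge hδ hL hq)
      hmi hvi (B := B) (by rw [hm]; exact hB) (by rw [hvd]; exact hdiv)
    have h2 := kerForm_sub ck bk cL bL hmi hvi
    have h3 : kerForm (fun z => scaledKer δ z - scaledKer L z) m v
        = ∫ z : E3 × E3, solKer (diffProfile δ L) (z.1 - z.2) * inner ℝ (m z.1) (v z.2)
          ∂(volume.prod volume) := by
      simp only [solKer_diffProfile, kerForm]
    have h4 : kerForm (scaledKer δ) m v = kerForm (fun z => scaledKer δ z - scaledKer L z) m v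
        + kerForm (scaledKer L) m v := by rw [h2]; ring
    rw [h4]
    refine (enorm_add_le _ _).trans (add_le_add ?_ ?_)
    · rw [h3]
      refine h1.trans ?_
      gcongr
    · refine (enorm_kerForm_le bL hmi hvi).trans ?_
      gcongr
  have hX : ‖kerForm (scaledKer δ) (fun x => s x • g x) (fun x => (s x)⁻¹ • g x)‖ₑ
      ≤ lowerConst S R W B a c Bk δ L := by
    have e1 : kerForm (scaledKer δ) m v = kerForm (scaledKer δ) m (fun x => (s x)⁻¹ • g x)
        + kerForm (scaledKer δ) m (fun x => ((s' x)⁻¹ - (s x)⁻¹) • w' x) := by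
      conv_lhs => rw [ev]
      exact kerForm_add_right ck bk hmi i4.1 i6.1
    have e2 : kerForm (scaledKer δ) m (fun x => (s x)⁻¹ • g x)
        = kerForm (scaledKer δ) (fun x => s x • g x) (fun x => (s x)⁻¹ • g x)
          + kerForm (scaledKer δ) (fun x => (s' x - s x) • w' x) (fun x => (s x)⁻¹ • g x) := by
      conv_lhs => rw [em]
      exact kerForm_add_left ck bk i3.1 i5.1 i4.1
    have e3 : kerForm (scaledKer δ) (fun x => s x • g x) (fun x => (s x)⁻¹ • g x)
        = kerForm (scaledKer δ) m v
          - (kerForm (scaledKer δ) m (fun x => ((s' x)⁻¹ - (s x)⁻¹) • w' x)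
            + kerForm (scaledKer δ) (fun x => (s' x - s x) • w' x) (fun x => (s x)⁻¹ • g x)) := by
      rw [e1, e2]; ring
    rw [e3, lowerConst]
    refine enorm_sub_le.trans (add_le_add hY ((enorm_add_le _ _).trans ?_))
    rw [mul_add]
    refine add_le_add ((enorm_kerForm_le bk hmi i6.1).trans ?_)
      ((enorm_kerForm_le bk i5.1 i4.1).trans ?_)
    · have := i6.2
      gcongr
    · have h1 := i5.2
      have h2 := i4.2
      gcongr
  have hfin := hlow.trans (add_le_add hX herr)
  have e : ∀ x, w' x - w x = g x := fun x => by rw [hg]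
  simp_rw [e]
  refine hfin.trans (le_of_eq ?_)
  rw [errorCoeff]
  ring

lemma DiffQuot.sub {f f' : E3 → ℝ} {d d' : ℝ≥0∞} (h : DiffQuot f d) (h' : DiffQuot f' d')
    (hm : AEStronglyMeasurable f) : DiffQuot (fun x => f' x - f x) (2 * (d + d')) := by
  intro z
  have hd : AEMeasurable fun x => ‖f (x - z) - f x‖ₑ ^ 2 :=
    ((hm.comp_quasiMeasurePreserving
      (measurePreserving_sub_right volume z).quasiMeasurePreserving).sub hm).enorm.pow_const 2
  calc ∫⁻ x, ‖f' (x - z) - f (x - z) - (f' x - f x)‖ₑ ^ 2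
      ≤ ∫⁻ x, 2 * (‖f' (x - z) - f' x‖ₑ ^ 2 + ‖f (x - z) - f x‖ₑ ^ 2) := by
        refine lintegral_mono fun x => ?_
        have e : f' (x - z) - f (x - z) - (f' x - f x)
            = (f' (x - z) - f' x) - (f (x - z) - f x) := by ring
        rw [e]
        exact enorm_sub_sq_le _ _
    _ = 2 * ((∫⁻ x, ‖f' (x - z) - f' x‖ₑ ^ 2) + ∫⁻ x, ‖f (x - z) - f x‖ₑ ^ 2) := by
        rw [lintegral_const_mul' _ _ (by simp), lintegral_add_right' _ hd]
    _ ≤ 2 * (‖z‖ₑ ^ 2 * d' + ‖z‖ₑ ^ 2 * d) := by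
        gcongr
        · exact h' z
        · exact h z
    _ = _ := by ring

/-- Uniform bounds for the test fields. -/
lemma exists_field_bounds {a : ℝ → ℝ} (ha : ContDiff ℝ ∞ a) {R : ℝ} (hR : ∀ q, R ≤ q → a q = 0) :
    ∃ N Q : ℝ≥0∞, N ≠ ⊤ ∧ Q ≠ ⊤ ∧ ∀ j, (∀ x, ‖fderiv ℝ (solField a j) x‖ₑ ≤ N) ∧
      (∫⁻ x, ‖solField a j x‖ₑ ^ 2 ≤ Q ^ 2) ∧
      ∀ i, ∫⁻ x, ‖partialx (solField a j) i x‖ₑ ^ 2 ≤ Q ^ 2 := by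
  have hd : ∀ j, Continuous (fderiv ℝ (solField a j)) := fun j =>
    (solField_contDiff ha j).continuous_fderiv (by simp)
  have hc := fun j => solField_compact hR j
  choose N hN using fun j => (hd j).bounded_above_of_compact_support ((hc j).fderiv ℝ)
  have hsq : ∀ {F : E3 → E3}, Continuous F → HasCompactSupport F → ∫⁻ x, ‖F x‖ₑ ^ 2 ≠ ⊤ := by
    intro F hF hFc
    rw [← eLpNorm_two_sq]
    exact (ENNReal.pow_lt_top (hF.memLp_of_hasCompactSupport hFc).2).ne
  set A : ℝ≥0∞ := ∑ j, ∫⁻ x, ‖solField a j x‖ₑ ^ 2 with hA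
  set P : ℝ≥0∞ := ∑ j, ∑ i, ∫⁻ x, ‖partialx (solField a j) i x‖ₑ ^ 2 with hP
  have hAt : A ≠ ⊤ := ENNReal.sum_ne_top.2 fun j _ =>
    hsq (solField_contDiff ha j).continuous (hc j)
  have hPt : P ≠ ⊤ := ENNReal.sum_ne_top.2 fun j _ => ENNReal.sum_ne_top.2 fun i _ =>
    hsq ((hd j).clm_apply continuous_const) ((hc j).fderiv_apply ℝ _)
  refine ⟨∑ j, ENNReal.ofReal (N j), (A + P) ^ (1 / 2 : ℝ),
    ENNReal.sum_ne_top.2 fun j _ => ENNReal.ofReal_ne_top,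
    ENNReal.rpow_ne_top_of_nonneg (by norm_num) (by finiteness), fun j => ⟨fun x => ?_, ?_, fun i => ?_⟩⟩
  · rw [← ofReal_norm]
    exact (ENNReal.ofReal_le_ofReal (hN j x)).trans
      (Finset.single_le_sum (f := fun j => ENNReal.ofReal (N j)) (fun _ _ => zero_le)
        (Finset.mem_univ j))
  · rw [half_pow_two]
    exact (Finset.single_le_sum (f := fun j => ∫⁻ x, ‖solField a j x‖ₑ ^ 2) (fun _ _ => zero_le)
      (Finset.mem_univ j)).trans le_self_add
  · rw [half_pow_two]
    refine le_trans ?_ le_add_self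
    exact (Finset.single_le_sum (f := fun i => ∫⁻ x, ‖partialx (solField a j) i x‖ₑ ^ 2)
      (fun _ _ => zero_le) (Finset.mem_univ i)).trans
      (Finset.single_le_sum (f := fun j => ∑ i, ∫⁻ x, ‖partialx (solField a j) i x‖ₑ ^ 2)
        (fun _ _ => zero_le) (Finset.mem_univ j))

/-- The `L²` norm of `√ρ₀`. -/
def rootNorm (ρ₀ : E3 → ℝ) : ℝ≥0∞ := (∫⁻ x, ‖Real.sqrt (ρ₀ x)‖ₑ ^ 2) ^ (1 / 2 : ℝ)

/-- The `L²` norm of `1/√ρ₀` outside the vacuum. -/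
def invNorm (ρ₀ : E3 → ℝ) : ℝ≥0∞ := (∫⁻ x, ‖(Real.sqrt (ρ₀ x))⁻¹‖ₑ ^ 2) ^ (1 / 2 : ℝ)

/-- The `L²` norm of the part of `1/√ρ₀` above the level `K`. -/
def invTail (ρ₀ : E3 → ℝ) (K : ℝ) : ℝ≥0∞ :=
  (∫⁻ x, ‖if K < (Real.sqrt (ρ₀ x))⁻¹ then (Real.sqrt (ρ₀ x))⁻¹ else 0‖ₑ ^ 2) ^ (1 / 2 : ℝ)

lemma enorm_inv_sqrt_sq (r : ℝ) : ‖(Real.sqrt r)⁻¹‖ₑ ^ 2 = ENNReal.ofReal r⁻¹ := by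
  rw [Real.enorm_eq_ofReal (by positivity), ← ENNReal.ofReal_pow (by positivity), inv_pow]
  rcases le_total 0 r with h | h
  · rw [Real.sq_sqrt h]
  · rw [Real.sqrt_eq_zero_of_nonpos h, ENNReal.ofReal_of_nonpos (inv_nonpos.2 h)]
    simp

namespace RegSol

variable {T M : ℝ} {E Dt : ℝ≥0∞} {μ : ℝ} {f : ℝ → E3 → E3} {ρ₀ : E3 → ℝ} {m₀ : E3 → E3}
  {ρ : ℝ → E3 → ℝ} {u : ℝ → E3 → E3} {G : Fin 3 → ℝ → E3 → E3} {D : ℝ → ℝ≥0∞}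

lemma rootNorm_ne_top (h : RegSol T M E Dt μ f ρ₀ m₀ ρ u G D) : rootNorm ρ₀ ≠ ⊤ := by
  refine ENNReal.rpow_ne_top_of_nonneg (by norm_num) ?_
  have h1 := h.sqrt_memLp (t := 0) ⟨le_rfl, h.pos.le⟩
  rw [← h.lintegral_conserved (F := fun r => ‖Real.sqrt r‖ₑ ^ 2)
    (Real.continuous_sqrt.measurable.enorm.pow_const 2) (by simp) (t := 0) ⟨le_rfl, h.pos.le⟩,
    ← eLpNorm_two_sq]
  exact (ENNReal.pow_lt_top h1.2).ne

lemma invNorm_ne_top (h : RegSol T M E Dt μ f ρ₀ m₀ ρ u G D) : invNorm ρ₀ ≠ ⊤ := by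
  refine ENNReal.rpow_ne_top_of_nonneg (by norm_num) ?_
  simp_rw [enorm_inv_sqrt_sq]
  exact h.inv

lemma invTail_eq (h : RegSol T M E Dt μ f ρ₀ m₀ ρ u G D) (K : ℝ) {t : ℝ} (ht : t ∈ Icc 0 T) :
    ∫⁻ x, ‖if K < (Real.sqrt (ρ t x))⁻¹ then (Real.sqrt (ρ t x))⁻¹ else 0‖ₑ ^ 2
      = invTail ρ₀ K ^ 2 := by
  have hm : Measurable fun r : ℝ => if K < (Real.sqrt r)⁻¹ then (Real.sqrt r)⁻¹ else 0 := by
    have : Measurable fun r : ℝ => (Real.sqrt r)⁻¹ := Real.continuous_sqrt.measurable.inv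
    exact Measurable.ite (measurableSet_lt measurable_const this) this measurable_const
  rw [invTail, half_pow_two, h.lintegral_conserved (F := fun r =>
    ‖if K < (Real.sqrt r)⁻¹ then (Real.sqrt r)⁻¹ else 0‖ₑ ^ 2) (hm.enorm.pow_const 2) (by simp) ht]

lemma invTail_tendsto (h : RegSol T M E Dt μ f ρ₀ m₀ ρ u G D) :
    Tendsto (fun n : ℕ => invTail ρ₀ n) atTop (𝓝 0) := by
  have hm : AEMeasurable fun x => (Real.sqrt (ρ₀ x))⁻¹ :=
    (Real.continuous_sqrt.measurable.comp_aemeasurable h.integrable_initial.1.aemeasurable).inv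
  have hmeas : ∀ K : ℝ, Measurable fun r : ℝ => if K < r then r else 0 := fun K =>
    Measurable.ite measurableSet_Ioi measurable_id measurable_const
  have h0 : Tendsto (fun n : ℕ => ∫⁻ x, ‖if (n:ℝ) < (Real.sqrt (ρ₀ x))⁻¹
      then (Real.sqrt (ρ₀ x))⁻¹ else 0‖ₑ ^ 2) atTop (𝓝 (∫⁻ x : E3, 0)) := by
    refine tendsto_lintegral_of_dominated_convergence' (fun x => ‖(Real.sqrt (ρ₀ x))⁻¹‖ₑ ^ 2)
      (fun n => ((hmeas n).comp_aemeasurable hm).enorm.pow_const 2)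
      (fun n => Eventually.of_forall fun x => ?_) (by simp_rw [enorm_inv_sqrt_sq]; exact h.inv)
      (Eventually.of_forall fun x => ?_)
    · simp only
      split_ifs <;> simp
    · refine tendsto_const_nhds.congr' ?_
      filter_upwards [eventually_ge_atTop ⌈(Real.sqrt (ρ₀ x))⁻¹⌉₊] with n hn
      have : ¬ ((n:ℝ) < (Real.sqrt (ρ₀ x))⁻¹) := not_lt.2 (Nat.ceil_le.1 hn)
      simp [this]
  have h1 := (h0.congr fun n => rfl).ennrpow_const (1 / 2 : ℝ)
  simpa [invTail] using h1

lemma sliceData (h : RegSol T M E Dt μ f ρ₀ m₀ ρ u G D) :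
    ∀ᵐ t ∂(volume.restrict (Ioo 0 T)), SliceData (Real.sqrt M) (rootNorm ρ₀) (invNorm ρ₀)
      (E ^ (1 / 2 : ℝ)) (fun x => Real.sqrt (ρ t x)) (weightedVel ρ u t) := by
  filter_upwards [h.vel, h.wmem.1.prodMk_left, ae_restrict_mem measurableSet_Ioo] with t h1 h2 htT
  have ht := Ioo_subset_Icc_self htT
  refine ⟨(h.sqrt_memLp ht).1, h2, ?_, ?_, ?_, ?_, fun x hx => by simp [weightedVel, hx]⟩
  · filter_upwards [h.mem ht] with x hx
    exact ⟨Real.sqrt_nonneg _, Real.sqrt_le_sqrt hx.2⟩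
  · rw [rootNorm, half_pow_two, h.lintegral_conserved (F := fun r => ‖Real.sqrt r‖ₑ ^ 2)
      (Real.continuous_sqrt.measurable.enorm.pow_const 2) (by simp) ht]
  · rw [invNorm, half_pow_two, h.lintegral_conserved (F := fun r => ‖(Real.sqrt r)⁻¹‖ₑ ^ 2)
      (Real.continuous_sqrt.measurable.inv.enorm.pow_const 2) (by simp) ht]
  · rwa [half_pow_two]

lemma sqrt_smul_weightedVel {t : ℝ} {x : E3} (hx : 0 ≤ ρ t x) :
    Real.sqrt (ρ t x) • weightedVel ρ u t x = ρ t x • u t x := by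
  rw [weightedVel, smul_smul, Real.mul_self_sqrt hx]

lemma momentum_increment (h : RegSol T M E Dt μ f ρ₀ m₀ ρ u G D) (hE : E ≠ ⊤) (hμ : 0 ≤ μ)
    (hf : MemLp (Function.uncurry f) 2 (slab T)) {a : ℝ → ℝ} (ha : ContDiff ℝ ∞ a) {R : ℝ}
    (hR : ∀ q, R ≤ q → a q = 0) {N Q : ℝ≥0∞}
    (hNQ : ∀ j, (∀ x, ‖fderiv ℝ (solField a j) x‖ₑ ≤ N) ∧
      (∫⁻ x, ‖solField a j x‖ₑ ^ 2 ≤ Q ^ 2) ∧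
      ∀ i, ∫⁻ x, ‖partialx (solField a j) i x‖ₑ ^ 2 ≤ Q ^ 2) {η : ℝ} (hη : 0 < η) :
    ∀ᵐ t ∂(volume.restrict (Ioo 0 (T - η))), ∀ j y,
      ‖∫ x, inner ℝ (Real.sqrt (ρ (t + η) x) • weightedVel ρ u (t + η) x
        - Real.sqrt (ρ t x) • weightedVel ρ u t x) (solField a j (x - y))‖ₑ
      ≤ momConst N Q (eLpNorm (Function.uncurry f) 2 (slab T)) E M μ η := by
  set C := momConst N Q (eLpNorm (Function.uncurry f) 2 (slab T)) E M μ η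
  set P : Fin 3 → E3 → ℝ → ℝ := fun j y t =>
    ∫ x, inner ℝ (ρ t x • u t x) (solField a j (x - y)) with hP
  have hcs : ∀ j, Continuous (solField a j) := fun j => (solField_contDiff ha j).continuous
  have hcc := fun j => solField_compact hR j
  have hone : ∀ j y, ∀ᵐ t ∂(volume.restrict (Ioo 0 (T - η))),
      ‖P j y (t + η) - P j y t‖ₑ ≤ C := by
    intro j y
    have hfd : ∀ x, fderiv ℝ (fun x => solField a j (x - y)) x = fderiv ℝ (solField a j) (x - y) :=
      fun x => fderiv_comp_sub y
    have hpd : ∀ i x, partialx (fun x => solField a j (x - y)) i x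
        = partialx (solField a j) i (x - y) := fun i x => by
      simp only [partialx, hfd]
    obtain ⟨m, hm1, hm2⟩ := h.exists_momentum hE hμ hf (φ := fun x => solField a j (x - y))
      ((solField_contDiff ha j).comp (contDiff_id.sub contDiff_const))
      ((hcc j).comp_homeomorph (Homeomorph.subRight y)) (fun x => by
        have := solField_div ha j (x - y)
        simp only [divx] at this ⊢
        rw [hfd]
        exact this) (N := N) (Q := Q) (fun x => by rw [hfd]; exact (hNQ j).1 _)
      (by
        rw [lintegral_sub_right_eq_self (fun x => ‖solField a j x‖ₑ ^ 2) y]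
        exact (hNQ j).2.1) (fun i => by
        simp_rw [hpd]
        rw [lintegral_sub_right_eq_self (fun x => ‖partialx (solField a j) i x‖ₑ ^ 2) y]
        exact (hNQ j).2.2 i)
    filter_upwards [ae_shift hη hm1, ae_restrict_mem measurableSet_Ioo] with t h1 htT
    simp only [hP]
    rw [h1.1, h1.2]
    have := hm2 t (t + η) htT.1 (by linarith) (by linarith [htT.2])
    simpa using this
  have hall : ∀ᵐ t ∂(volume.restrict (Ioo 0 (T - η))), ∀ (j : Fin 3) (n : ℕ),
      ‖P j (TopologicalSpace.denseSeq E3 n) (t + η) - P j (TopologicalSpace.denseSeq E3 n) t‖ₑ ≤ C := by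
    rw [ae_all_iff]
    intro j
    rw [ae_all_iff]
    intro n
    exact hone j _
  have hfl : ∀ᵐ t ∂(volume.restrict (Ioo 0 T)), Integrable (fun x => ρ t x • u t x) ∧
      ∀ᵐ x, 0 ≤ ρ t x := by
    filter_upwards [h.flux_integrable.prod_right_ae, ae_restrict_mem measurableSet_Ioo] with t h1 h2
    exact ⟨h1, (h.mem (Ioo_subset_Icc_self h2)).mono fun x hx => hx.1⟩
  filter_upwards [hall, ae_shift hη hfl] with t h1 h2 j y
  obtain ⟨⟨i1, p1⟩, i2, p2⟩ := h2
  have hc1 := continuous_integral_inner i1 (hcs j) (hcc j)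
  have hc2 := continuous_integral_inner i2 (hcs j) (hcc j)
  have hy : ‖P j y (t + η) - P j y t‖ₑ ≤ C :=
    (TopologicalSpace.denseRange_denseSeq E3).induction_on (p := fun y =>
      ‖P j y (t + η) - P j y t‖ₑ ≤ C) y
      (isClosed_le (hc2.sub hc1).enorm continuous_const) (fun n => h1 j n)
  refine le_trans (le_of_eq ?_) hy
  obtain ⟨B, hB⟩ := (hcs j).bounded_above_of_compact_support (hcc j)
  have hint : ∀ {m : E3 → E3}, Integrable m →
      Integrable fun x => (inner ℝ (m x) (solField a j (x - y)) : ℝ) := fun {m} hm => by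
    refine (hm.norm.mul_const B).mono' (hm.1.inner
      ((hcs j).comp (continuous_id.sub continuous_const)).aestronglyMeasurable)
      (Eventually.of_forall fun x => ?_)
    exact (norm_inner_le_norm _ _).trans (by gcongr; exact hB _)
  simp only [hP]
  rw [← integral_sub (hint i2) (hint i1)]
  congr 1
  refine integral_congr_ae ?_
  filter_upwards [p1, p2] with x q1 q2
  rw [sqrt_smul_weightedVel q1, sqrt_smul_weightedVel q2, inner_sub_left]

lemma innerVel_solenoidal (h : RegSol T M E Dt μ f ρ₀ m₀ ρ u G D) (hE : E ≠ ⊤) {a : ℝ → ℝ}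
    (ha : ContDiff ℝ ∞ a) {R : ℝ} (hR : ∀ q, R ≤ q → a q = 0) :
    ∀ᵐ t ∂(volume.restrict (Ioo 0 T)), Integrable (innerVel ρ u t) ∧
      ∀ i x, ∫ y, fderiv ℝ (solPot a i) (x - y) (innerVel ρ u t y) = 0 := by
  have hpc : ∀ j, Continuous (fderiv ℝ (solPot a j)) := fun j =>
    (solPot_contDiff ha j).continuous_fderiv (by simp)
  have hpcs := fun j => (solPot_compact hR j).fderiv ℝ
  have hall : ∀ᵐ t ∂(volume.restrict (Ioo 0 T)), ∀ (i : Fin 3) (n : ℕ),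
      ∫ y, fderiv ℝ (solPot a i) (TopologicalSpace.denseSeq E3 n - y) (innerVel ρ u t y) = 0 := by
    rw [ae_all_iff]
    intro i
    rw [ae_all_iff]
    intro n
    set x := TopologicalSpace.denseSeq E3 n
    have hd := h.innerVel_div (ζ := fun y => solPot a i (x - y))
      ((solPot_contDiff ha i).comp (contDiff_const.sub contDiff_id))
      ((solPot_compact hR i).comp_homeomorph (Homeomorph.subLeft x))
    filter_upwards [hd] with t ht
    simp_rw [fderiv_comp_const_sub (solPot_contDiff ha i), integral_neg] at ht
    linarith
  filter_upwards [hall, h.sliceData] with t h1 hs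
  have hi : Integrable (innerVel ρ u t) :=
    (integrable_smul_of_sq hs.rm hs.wm h.invNorm_ne_top
      (ENNReal.rpow_ne_top_of_nonneg (by norm_num) hE) hs.r2 hs.w2).1
  refine ⟨hi, fun i x => ?_⟩
  exact (TopologicalSpace.denseRange_denseSeq E3).induction_on (p := fun x =>
    ∫ y, fderiv ℝ (solPot a i) (x - y) (innerVel ρ u t y) = 0) x
    (isClosed_eq (continuous_integral_apply hi (hpc i) (hpcs i)) continuous_const) (fun n => h1 i n)

/-- The increment in time of the weighted velocity. -/
lemma increment (h : RegSol T M E Dt μ f ρ₀ m₀ ρ u G D) (hE : E ≠ ⊤) (hDt : Dt ≠ ⊤) (hμ : 0 ≤ μ)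
    (hf : MemLp (Function.uncurry f) 2 (slab T)) {δ L : ℝ} (hδ : 0 < δ) (hL : 0 < L) {N Q : ℝ≥0∞}
    (hNQ : ∀ j, (∀ x, ‖fderiv ℝ (solField (diffProfile δ L) j) x‖ₑ ≤ N) ∧
      (∫⁻ x, ‖solField (diffProfile δ L) j x‖ₑ ^ 2 ≤ Q ^ 2) ∧
      ∀ i, ∫⁻ x, ‖partialx (solField (diffProfile δ L) j) i x‖ₑ ^ 2 ≤ Q ^ 2)
    {Bk : ℝ} (hBk : ∀ q, 0 ≤ q → baseKer q ≤ Bk) {K : ℝ≥0∞} (hK : K ≠ 0) (hK' : K ≠ ⊤)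
    {K₁ : ℝ} (hK₁ : 0 ≤ K₁) (hKt : invTail ρ₀ K₁ ≠ ⊤) {η : ℝ} (hη : 0 < η) :
    ∀ᵐ t ∂(volume.restrict (Ioo 0 (T - η))),
      ENNReal.ofReal kerMass * ∫⁻ x, ‖weightedVel ρ u (t + η) x - weightedVel ρ u t x‖ₑ ^ 2
        ≤ lowerConst (rootNorm ρ₀) (invNorm ρ₀) (E ^ (1 / 2 : ℝ))
            (momConst N Q (eLpNorm (Function.uncurry f) 2 (slab T)) E M μ η)
            ((9 * ENNReal.ofReal η * Dt) ^ (1 / 2 : ℝ))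
            (ENNReal.ofReal K₁ ^ 2 * (9 * ENNReal.ofReal η * Dt) ^ (1 / 2 : ℝ)
              + 2 * invTail ρ₀ K₁) Bk δ L
          + errorCoeff (Real.sqrt M) (invNorm ρ₀) K δ * (2 * (D t + D (t + η))) := by
  have hR := fun q (hq : δ ^ 2 + L ^ 2 ≤ q) => diffProfile_of_ge hδ hL hq
  have ha := diffProfile_contDiff δ L
  filter_upwards [h.momentum_increment hE hμ hf ha hR hNQ hη,
    ae_shift hη (h.innerVel_solenoidal hE ha hR), ae_shift hη h.sliceData, ae_shift hη h.dq,
    ae_restrict_mem measurableSet_Ioo] with t h1 h2 h3 h4 htT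
  have ht : t ∈ Icc 0 T := ⟨htT.1.le, by linarith [htT.2]⟩
  have ht' : t + η ∈ Icc 0 T := ⟨by linarith [htT.1], by linarith [htT.2]⟩
  have ha2 : (9 * ENNReal.ofReal η * Dt) ^ (1 / 2 : ℝ) ≠ ⊤ :=
    ENNReal.rpow_ne_top_of_nonneg (by norm_num) (by finiteness)
  have has : ∫⁻ x, ‖Real.sqrt (ρ (t + η) x) - Real.sqrt (ρ t x)‖ₑ ^ 2
      ≤ ((9 * ENNReal.ofReal η * Dt) ^ (1 / 2 : ℝ)) ^ 2 := by
    rw [half_pow_two]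
    refine (h.sqrt_diff_sq ht.1 (by linarith) ht'.2).trans ?_
    rw [add_sub_cancel_left]
    gcongr
    exact (lintegral_mono_set (Ioo_subset_Ioo ht.1 ht'.2)).trans h.Dle
  have hvac : ∀ᵐ x, Real.sqrt (ρ t x) = 0 ↔ Real.sqrt (ρ (t + η) x) = 0 := by
    filter_upwards [h.vacuum ht, h.vacuum ht', h.mem ht, h.mem ht'] with x v1 v2 p1 p2
    rw [Real.sqrt_eq_zero p1.1, Real.sqrt_eq_zero p2.1, v1, v2]
  have hcs := lintegral_inv_sub_sq_le h3.1.sm h3.2.sm (h3.1.s0.mono fun x hx => hx.1)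
    (h3.2.s0.mono fun x hx => hx.1) hvac hK₁ has (h.invTail_eq K₁ ht).le (h.invTail_eq K₁ ht').le
  refine static_estimate h3.1 h3.2 hvac h.rootNorm_ne_top h.invNorm_ne_top
    (ENNReal.rpow_ne_top_of_nonneg (by norm_num) hE) ha2 (by finiteness) has hcs
    (fun i => (h4.1 i).sub (h4.2 i) (aesm_apply h3.1.wm i)) hδ hL h1 (fun i x => ?_) hBk hK hK'
  have hpc : Continuous (fderiv ℝ (solPot (diffProfile δ L) i)) :=
    (solPot_contDiff ha i).continuous_fderiv (by simp)
  obtain ⟨C, hC⟩ := hpc.bounded_above_of_compact_support ((solPot_compact hR i).fderiv ℝ)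
  have hint : ∀ {v : E3 → E3}, Integrable v →
      Integrable fun y => fderiv ℝ (solPot (diffProfile δ L) i) (x - y) (v y) := fun {v} hv => by
    refine (hv.norm.const_mul C).mono' ?_ (Eventually.of_forall fun y =>
      (ContinuousLinearMap.le_opNorm _ _).trans (by gcongr; exact hC _))
    exact aesm_clm_apply
      (hpc.comp (continuous_const.sub continuous_id)).aestronglyMeasurable hv.1
  have e := integral_sub (hint h2.2.1) (hint h2.1.1)
  rw [h2.2.2 i x, h2.1.2 i x, sub_zero] at e
  rw [← e]
  refine integral_congr_ae (Eventually.of_forall fun y => ?_)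
  simp only [innerVel, map_sub]

end RegSol

lemma ENNReal_tendsto_const_mul_zero {ι : Type*} {l : Filter ι} {a : ι → ℝ≥0∞} {c : ℝ≥0∞}
    (hc : c ≠ ⊤) (h : Tendsto a l (𝓝 0)) : Tendsto (fun x => c * a x) l (𝓝 0) := by
  simpa using ENNReal.Tendsto.const_mul h (Or.inr hc)

lemma ENNReal_tendsto_add_zero {ι : Type*} {l : Filter ι} {a b : ι → ℝ≥0∞}
    (ha : Tendsto a l (𝓝 0)) (hb : Tendsto b l (𝓝 0)) :
    Tendsto (fun x => a x + b x) l (𝓝 0) := by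
  simpa using ha.add hb

lemma tendsto_ofReal_zero : Tendsto ENNReal.ofReal (𝓝[>] 0) (𝓝 0) := by
  simpa using (ENNReal.continuous_ofReal.tendsto 0).mono_left nhdsWithin_le_nhds

lemma ENNReal_tendsto_rpow_zero {ι : Type*} {l : Filter ι} {a : ι → ℝ≥0∞} {p : ℝ} (hp : 0 < p)
    (ha : Tendsto a l (𝓝 0)) : Tendsto (fun x => a x ^ p) l (𝓝 0) := by
  simpa [hp] using ha.ennrpow_const p

lemma momConst_tendsto {N Q F E : ℝ≥0∞} (hN : N ≠ ⊤) (hQ : Q ≠ ⊤) (hF : F ≠ ⊤) (hE : E ≠ ⊤)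
    (M μ : ℝ) : Tendsto (momConst N Q F E M μ) (𝓝[>] 0) (𝓝 0) := by
  have h1 := ENNReal_tendsto_const_mul_zero (ENNReal.mul_ne_top hN hE) tendsto_ofReal_zero
  have h2 := ENNReal_tendsto_const_mul_zero (c := (ENNReal.ofReal M * F
    + 3 * (ENNReal.ofReal μ * E) ^ (1 / 2 : ℝ)) * Q)
    (ENNReal.mul_ne_top (ENNReal.add_ne_top.2 ⟨by finiteness, ENNReal.mul_ne_top (by simp)
      (ENNReal.rpow_ne_top_of_nonneg (by norm_num) (by finiteness))⟩) hQ)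
    (ENNReal_tendsto_rpow_zero (p := 1 / 2) (by norm_num) tendsto_ofReal_zero)
  refine (ENNReal_tendsto_add_zero h1 h2).congr fun h => ?_
  rw [momConst]
  ring

lemma momConst_mono {N Q F E : ℝ≥0∞} {M μ μ' h : ℝ} (hμ : μ ≤ μ') :
    momConst N Q F E M μ h ≤ momConst N Q F E M μ' h := by
  unfold momConst
  gcongr

/-- The coefficient of the difference quotients can be made small. -/
lemma exists_errorCoeff_le (b : ℝ) {R C : ℝ≥0∞} (hR : R ≠ ⊤) (hC : C ≠ ⊤) {ε : ℝ≥0∞} (hε : ε ≠ 0) :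
    ∃ (K : ℝ≥0∞) (δ : ℝ), K ≠ 0 ∧ K ≠ ⊤ ∧ 0 < δ ∧ errorCoeff b R K δ * C ≤ ε := by
  set κ := ENNReal.ofReal kerMass
  have hκ : κ ≠ ⊤ := ENNReal.ofReal_ne_top
  have h1 : Tendsto (fun n : ℕ => κ * ENNReal.ofReal b * (12 * sobConst) * C
      * (R ^ 2 * ((n : ℝ≥0∞)) ^ (-(1 / 2) : ℝ)) ^ (2 / 3 : ℝ)) atTop (𝓝 0) := by
    refine ENNReal_tendsto_const_mul_zero ?_ (ENNReal_tendsto_rpow_zero (by norm_num)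
      (ENNReal_tendsto_const_mul_zero (by finiteness) ?_))
    · have := sobConst_ne_top
      finiteness
    · simpa using (ENNReal.tendsto_nat_nhds_top).ennrpow_const (-(1 / 2) : ℝ)
  obtain ⟨n, hn1, hn2⟩ := (((tendsto_order.1 h1).2 (ε / 2) (ENNReal.half_pos hε)).and
    (eventually_ge_atTop 1)).exists
  have h2 : Tendsto (fun δ : ℝ => κ * (3 + ENNReal.ofReal b * (n * 3)) * C * ENNReal.ofReal δ ^ 2)
      (𝓝[>] 0) (𝓝 0) := by
    refine ENNReal_tendsto_const_mul_zero (by finiteness) ?_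
    refine (ENNReal_tendsto_rpow_zero (p := 2) (by norm_num) tendsto_ofReal_zero).congr fun δ => ?_
    exact ENNReal.rpow_two _
  obtain ⟨δ, hd1, hd2⟩ := (((tendsto_order.1 h2).2 (ε / 2) (ENNReal.half_pos hε)).and
    self_mem_nhdsWithin).exists
  refine ⟨n, δ, by simpa using (by omega : n ≠ 0), by simp, hd2, ?_⟩
  calc errorCoeff b R n δ * C
      = κ * (3 + ENNReal.ofReal b * (n * 3)) * C * ENNReal.ofReal δ ^ 2
        + κ * ENNReal.ofReal b * (12 * sobConst) * C
          * (R ^ 2 * ((n : ℝ≥0∞)) ^ (-(1 / 2) : ℝ)) ^ (2 / 3 : ℝ) := by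
        rw [errorCoeff, mul_comm (R ^ 2)]
        ring
    _ ≤ ε / 2 + ε / 2 := add_le_add hd1.le hn1.le
    _ = ε := ENNReal.add_halves ε

lemma lintegral_shift_le {D : ℝ → ℝ≥0∞} (hD : Measurable D) (T : ℝ) {η : ℝ} (hη : 0 < η) :
    ∫⁻ t in Ioo 0 (T - η), D (t + η) ≤ ∫⁻ t in Ioo 0 T, D t := by
  have h := (measurePreserving_add_right volume η).setLIntegral_comp_preimage
    (s := Ioo η T) measurableSet_Ioo hD
  rw [preimage_add_const_Ioo, sub_self] at h
  rw [h]
  exact lintegral_mono_set (Ioo_subset_Ioo_left hη.le)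

/-- The increments in time of the weighted velocities are uniformly small. -/
theorem RegSol.uniform_increment {T M : ℝ} {E Dt : ℝ≥0∞} {f : ℝ → E3 → E3} {ρ₀ : E3 → ℝ}
    {m₀ : E3 → E3} {μ : ℕ → ℝ} {ρ : ℕ → ℝ → E3 → ℝ} {u : ℕ → ℝ → E3 → E3}
    {G : ℕ → Fin 3 → ℝ → E3 → E3} {D : ℕ → ℝ → ℝ≥0∞}
    (h : ∀ n, RegSol T M E Dt (μ n) f ρ₀ m₀ (ρ n) (u n) (G n) (D n)) (hE : E ≠ ⊤) (hDt : Dt ≠ ⊤)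
    (hμ : ∀ n, 0 ≤ μ n) {b : ℝ} (hb : ∀ n, μ n ≤ b)
    (hf : MemLp (Function.uncurry f) 2 (slab T)) {ε : ℝ≥0∞} (hε : ε ≠ 0) :
    ∃ η₀ > 0, ∀ n η, 0 < η → η < η₀ →
      ∫⁻ t in Ioo 0 (T - η), ∫⁻ x, ‖weightedVel (ρ n) (u n) (t + η) x
        - weightedVel (ρ n) (u n) t x‖ₑ ^ 2 ≤ ε := by
  set κ := ENNReal.ofReal kerMass with hκd
  have hκ0 : κ ≠ 0 := by simpa [hκd] using kerMass_pos
  have hκ : κ ≠ ⊤ := ENNReal.ofReal_ne_top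
  have hε3 : 0 < κ * ε / 3 := ENNReal.div_pos (mul_ne_zero hκ0 hε) (by simp)
  have hR := (h 0).invNorm_ne_top
  have hS := (h 0).rootNorm_ne_top
  set R := invNorm ρ₀
  set S := rootNorm ρ₀
  set W := E ^ (1 / 2 : ℝ) with hWd
  have hW : W ≠ ⊤ := ENNReal.rpow_ne_top_of_nonneg (by norm_num) hE
  set F := eLpNorm (Function.uncurry f) 2 (slab T)
  have hF : F ≠ ⊤ := hf.2.ne
  set τ := ENNReal.ofReal T
  have hτ : τ ≠ ⊤ := ENNReal.ofReal_ne_top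
  obtain ⟨Bk, hBk0, hBk⟩ := exists_baseKer_bound
  obtain ⟨K, δ, hK, hK', hδ, herr⟩ := exists_errorCoeff_le (Real.sqrt M) hR
    (C := 2 * (Dt + Dt)) (by finiteness) hε3.ne'
  set d := ENNReal.ofReal (Bk * (δ ^ 3)⁻¹)
  have hL : Tendsto (fun n : ℕ => τ * (2 * (S * W) * (2 * (R * W)))
        * ENNReal.ofReal (Bk * (((n : ℝ) + 1) ^ 3)⁻¹)
      + τ * (d * (2 * (S * W) * W) * 2) * invTail ρ₀ n) atTop (𝓝 0) := by
    refine ENNReal_tendsto_add_zero (ENNReal_tendsto_const_mul_zero (by finiteness) ?_)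
      (ENNReal_tendsto_const_mul_zero (by finiteness) (h 0).invTail_tendsto)
    have h1 : Tendsto (fun n : ℕ => Bk * (((n : ℝ) + 1) ^ 3)⁻¹) atTop (𝓝 0) := by
      have := ((Transport.tendsto_inv_succ.pow 3).const_mul Bk)
      simpa using this
    simpa using ENNReal.tendsto_ofReal h1
  obtain ⟨k, hk1, hk2⟩ := (((tendsto_order.1 hL).2 _ hε3).and (eventually_ge_atTop 0)).exists
  have hkt : invTail ρ₀ k ≠ ⊤ := by
    refine ne_top_of_le_ne_top hR (ENNReal.rpow_le_rpow (lintegral_mono fun x => ?_) (by norm_num))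
    split_ifs <;> simp
  set L : ℝ := (k : ℝ) + 1
  have hLpos : 0 < L := by positivity
  obtain ⟨N, Q, hN, hQ, hNQ⟩ := exists_field_bounds (diffProfile_contDiff δ L)
    (fun q hq => diffProfile_of_ge hδ hLpos hq)
  have ha0 : Tendsto (fun η => (9 * ENNReal.ofReal η * Dt) ^ (1 / 2 : ℝ)) (𝓝[>] 0) (𝓝 0) := by
    refine ENNReal_tendsto_rpow_zero (by norm_num) ?_
    refine (ENNReal_tendsto_const_mul_zero (c := 9 * Dt) (by finiteness)
      tendsto_ofReal_zero).congr fun η => by ring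
  have hη : Tendsto (fun η => τ * (6 * (R * W)) * momConst N Q F E M b η
      + τ * (d * (2 * (S * W) * (ENNReal.ofReal k ^ 2 * W) + W * (R * (2 * W))))
        * (9 * ENNReal.ofReal η * Dt) ^ (1 / 2 : ℝ)) (𝓝[>] 0) (𝓝 0) :=
    ENNReal_tendsto_add_zero (ENNReal_tendsto_const_mul_zero (by finiteness)
      (momConst_tendsto hN hQ hF hE M b)) (ENNReal_tendsto_const_mul_zero (by finiteness) ha0)
  obtain ⟨η₀, hη₀, hη₁⟩ := mem_nhdsGT_iff_exists_Ioo_subset.1 ((tendsto_order.1 hη).2 _ hε3)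
  refine ⟨η₀, hη₀, fun n η hη0 hηlt => ?_⟩
  have hsmall := le_of_lt (mem_ofPred.1 (hη₁ ⟨hη0, hηlt⟩))
  have hinc := (h n).increment hE hDt (hμ n) hf hδ hLpos hNQ hBk hK hK' (Nat.cast_nonneg k) hkt hη0
  set a := (9 * ENNReal.ofReal η * Dt) ^ (1 / 2 : ℝ)
  set I := fun t => ∫⁻ x, ‖weightedVel (ρ n) (u n) (t + η) x - weightedVel (ρ n) (u n) t x‖ₑ ^ 2
  have hLC := lintegral_mono_ae hinc
  rw [lintegral_const_mul' _ _ hκ, lintegral_add_left measurable_const, lintegral_const,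
    lintegral_const_mul _ (by have := (h n).Dm; fun_prop),
    lintegral_const_mul _ (by have := (h n).Dm; fun_prop), lintegral_add_left (h n).Dm,
    Measure.restrict_apply_univ, Real.volume_Ioo, sub_zero] at hLC
  have hD1 : ∫⁻ t in Ioo 0 (T - η), D n t ≤ Dt :=
    (lintegral_mono_set (Ioo_subset_Ioo_right (by linarith))).trans (h n).Dle
  have hD2 : ∫⁻ t in Ioo 0 (T - η), D n (t + η) ≤ Dt :=
    (lintegral_shift_le (h n).Dm T hη0).trans (h n).Dle
  have hτ' : ENNReal.ofReal (T - η) ≤ τ := ENNReal.ofReal_le_ofReal (by linarith)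
  have hfin : κ * ∫⁻ t in Ioo 0 (T - η), I t ≤ κ * ε := by
    calc _ ≤ _ := hLC
      _ ≤ lowerConst S R W (momConst N Q F E M b η) a (ENNReal.ofReal k ^ 2 * a + 2 * invTail ρ₀ k)
            Bk δ L * τ + errorCoeff (Real.sqrt M) R K δ * (2 * (Dt + Dt)) := by
          gcongr
          unfold lowerConst
          gcongr
          exact momConst_mono (hb n)
      _ = (τ * (6 * (R * W)) * momConst N Q F E M b η
            + τ * (d * (2 * (S * W) * (ENNReal.ofReal k ^ 2 * W) + W * (R * (2 * W)))) * a)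
          + (τ * (2 * (S * W) * (2 * (R * W))) * ENNReal.ofReal (Bk * (L ^ 3)⁻¹)
            + τ * (d * (2 * (S * W) * W) * 2) * invTail ρ₀ k)
          + errorCoeff (Real.sqrt M) R K δ * (2 * (Dt + Dt)) := by
          rw [lowerConst]
          ring
      _ ≤ κ * ε / 3 + κ * ε / 3 + κ * ε / 3 := add_le_add (add_le_add hsmall hk1.le) herr
      _ = κ * ε := ENNReal.add_thirds _
  exact (ENNReal.mul_le_mul_iff_right hκ0 hκ).1 hfin

/-- Bounded sequences of a separable Hilbert space have weakly convergent subsequences. -/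
lemma exists_weak_subseq {H : Type*} [NormedAddCommGroup H] [InnerProductSpace ℝ H]
    [CompleteSpace H] [TopologicalSpace.SeparableSpace H] {x : ℕ → H} {C : ℝ} (hx : ∀ n, ‖x n‖ ≤ C) :
    ∃ s : ℕ → ℕ, StrictMono s ∧ ∃ y : H, ∀ z : H,
      Tendsto (fun n => (inner ℝ z (x (s n)) : ℝ)) atTop (𝓝 (inner ℝ z y)) := by
  set Λ : ℕ → WeakDual ℝ H := fun n => StrongDual.toWeakDual (InnerProductSpace.toDual ℝ H (x n))
  obtain ⟨l, -, s, hs, hl⟩ := WeakDual.isSeqCompact_closedBall (𝕜 := ℝ) (E := H) 0 C (x := Λ)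
    (fun n => by
      rw [mem_preimage, mem_closedBall_zero_iff]
      simpa [Λ] using hx n)
  refine ⟨s, hs, (InnerProductSpace.toDual ℝ H).symm (WeakDual.toStrongDual l), fun z => ?_⟩
  have h1 := (WeakDual.eval_continuous z).continuousAt.tendsto.comp hl
  refine (h1.congr fun n => ?_).trans (le_of_eq ?_)
  · simp [Λ, real_inner_comm]
  · rw [real_inner_comm, InnerProductSpace.toDual_symm_apply]
    rfl

section Kolmogorov

set_option linter.unusedSectionVars false

variable {Z : Type*} [NormedAddCommGroup Z] [NormedSpace ℝ Z] [FiniteDimensional ℝ Z]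
  [SecondCountableTopology Z] [MeasurableSpace Z] [BorelSpace Z] (ν : Measure Z)
  [ν.IsAddHaarMeasure]

/-- The integral over the ball of radius `r` around `z`. -/
def ballSum (r : ℝ) (f : Z → E3) (z : Z) : E3 := ∫ ζ in Metric.ball (0 : Z) r, f (z + ζ) ∂ν

variable {ν}

lemma aesm_add {f : Z → E3} (hf : AEStronglyMeasurable f ν) (S : Set Z) :
    AEStronglyMeasurable (fun p : Z × Z => f (p.1 + p.2)) (ν.prod (ν.restrict S)) := by
  have h := hf.comp_quasiMeasurePreserving (Measure.quasiMeasurePreserving_fst.comp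
    (measurePreserving_add_prod ν ν).quasiMeasurePreserving)
  exact h.mono_ac (Measure.AbsolutelyContinuous.rfl.prod Measure.absolutelyContinuous_restrict)

lemma shift_memLp {f : Z → E3} (hf : MemLp f 2 ν) (z : Z) : MemLp (fun ζ => f (z + ζ)) 2 ν :=
  hf.comp_measurePreserving (measurePreserving_add_left ν z)

lemma integrableOn_shift {f : Z → E3} (hf : MemLp f 2 ν) (z : Z) (r : ℝ) :
    IntegrableOn (fun ζ => f (z + ζ)) (Metric.ball 0 r) ν := by
  have : Fact (ν (Metric.ball (0 : Z) r) < ⊤) := ⟨measure_ball_lt_top⟩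
  exact ((shift_memLp hf z).restrict _).integrable (by norm_num)

lemma ballSum_sub {f g : Z → E3} (hf : MemLp f 2 ν) (hg : MemLp g 2 ν) (r : ℝ) (z : Z) :
    ballSum ν r (fun y => f y - g y) z = ballSum ν r f z - ballSum ν r g z :=
  integral_sub (integrableOn_shift hf z r) (integrableOn_shift hg z r)

lemma ballSum_eq (r : ℝ) (f : Z → E3) (z : Z) :
    ballSum ν r f z = ∫ y in Metric.ball z r, f y ∂ν := by
  have h := (measurePreserving_add_left ν z).setIntegral_preimage_emb
    (MeasurableEquiv.addLeft z).measurableEmbedding f (Metric.ball z r)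
  rw [← h, ballSum]
  congr 2
  ext ζ
  simp

lemma enorm_setIntegral_sq_le {f : Z → E3} {S : Set Z} (hf : AEStronglyMeasurable f (ν.restrict S)) :
    ‖∫ y in S, f y ∂ν‖ₑ ^ 2 ≤ ν S * ∫⁻ y in S, ‖f y‖ₑ ^ 2 ∂ν := by
  have h := lintegral_mul_sq_le (ν.restrict S) (f := fun _ => 1) aemeasurable_const hf.enorm
  simp only [one_mul, one_pow, lintegral_one, Measure.restrict_apply_univ] at h
  exact (pow_le_pow_left' (enorm_integral_le_lintegral_enorm _) 2).trans h

lemma ballSum_sq_le {f : Z → E3} (hf : MemLp f 2 ν) (r : ℝ) (z : Z) :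
    ‖ballSum ν r f z‖ₑ ^ 2 ≤ ν (Metric.ball 0 r) * eLpNorm f 2 ν ^ 2 := by
  refine (enorm_setIntegral_sq_le (shift_memLp hf z).1.restrict).trans ?_
  gcongr
  rw [eLpNorm_two_sq, ← lintegral_add_left_eq_self (fun y => ‖f y‖ₑ ^ 2) z]
  exact setLIntegral_le_lintegral _ _

/-- A function is controlled by its translates and its local averages. -/
lemma lintegral_sq_le_ballSum {f : Z → E3} (hf : MemLp f 2 ν) (r : ℝ) {B : Set Z}
    (hB : MeasurableSet B) (hsupp : ∀ᵐ z ∂ν, z ∉ B → f z = 0) {ε : ℝ≥0∞}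
    (htr : ∀ ζ, ‖ζ‖ < r → ∫⁻ z, ‖f (z + ζ) - f z‖ₑ ^ 2 ∂ν ≤ ε) :
    ν (Metric.ball 0 r) ^ 2 * ∫⁻ z, ‖f z‖ₑ ^ 2 ∂ν
      ≤ 2 * (ν (Metric.ball 0 r) ^ 2 * ε + ∫⁻ z in B, ‖ballSum ν r f z‖ₑ ^ 2 ∂ν) := by
  set S := Metric.ball (0 : Z) r
  have hS : ν S ≠ ⊤ := measure_ball_lt_top.ne
  have hm := aesm_add hf.1 S
  have hm' : AEMeasurable (fun p : Z × Z => ‖f (p.1 + p.2) - f p.1‖ₑ ^ 2)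
      (ν.prod (ν.restrict S)) := (hm.sub hf.1.comp_fst).enorm.pow_const 2
  have hpt : ∀ z, ν S ^ 2 * ‖f z‖ₑ ^ 2
      ≤ 2 * (ν S * (∫⁻ ζ in S, ‖f (z + ζ) - f z‖ₑ ^ 2 ∂ν) + ‖ballSum ν r f z‖ₑ ^ 2) := by
    intro z
    have hc : IntegrableOn (fun _ => f z) S ν := integrableOn_const hS
    have e : (ν S).toReal • f z = ballSum ν r f z - ∫ ζ in S, (f (z + ζ) - f z) ∂ν := by
      rw [integral_sub (integrableOn_shift hf z r) hc, ballSum, setIntegral_const]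
      simp [Measure.real, S]
    have e2 : ν S * ‖f z‖ₑ = ‖(ν S).toReal • f z‖ₑ := by
      rw [enorm_smul, Real.enorm_eq_ofReal ENNReal.toReal_nonneg, ENNReal.ofReal_toReal hS]
    rw [← mul_pow, e2, e, add_comm]
    refine (enorm_sub_sq_le _ _).trans ?_
    gcongr
    exact enorm_setIntegral_sq_le ((shift_memLp hf z).1.sub aestronglyMeasurable_const).restrict
  have hres : ∫⁻ z, ‖f z‖ₑ ^ 2 ∂ν = ∫⁻ z in B, ‖f z‖ₑ ^ 2 ∂ν := by
    rw [← lintegral_indicator hB]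
    refine lintegral_congr_ae (hsupp.mono fun z hz => ?_)
    by_cases h : z ∈ B
    · simp [h]
    · simp [h, hz h]
  have hI : AEMeasurable (fun z => ∫⁻ ζ in S, ‖f (z + ζ) - f z‖ₑ ^ 2 ∂ν) ν :=
    hm'.lintegral_prod_right'
  rw [hres, ← lintegral_const_mul' _ _ (by finiteness)]
  calc ∫⁻ z in B, ν S ^ 2 * ‖f z‖ₑ ^ 2 ∂ν
      ≤ ∫⁻ z in B, 2 * (ν S * (∫⁻ ζ in S, ‖f (z + ζ) - f z‖ₑ ^ 2 ∂ν)
          + ‖ballSum ν r f z‖ₑ ^ 2) ∂ν := lintegral_mono fun z => hpt z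
    _ = 2 * (ν S * (∫⁻ z in B, ∫⁻ ζ in S, ‖f (z + ζ) - f z‖ₑ ^ 2 ∂ν ∂ν)
          + ∫⁻ z in B, ‖ballSum ν r f z‖ₑ ^ 2 ∂ν) := by
        rw [lintegral_const_mul' _ _ (by simp), lintegral_add_left' (hI.restrict.const_mul _),
          lintegral_const_mul' _ _ hS]
    _ ≤ _ := by
        rw [pow_two, mul_assoc]
        gcongr
        calc ∫⁻ z in B, ∫⁻ ζ in S, ‖f (z + ζ) - f z‖ₑ ^ 2 ∂ν ∂ν
            ≤ ∫⁻ z, ∫⁻ ζ in S, ‖f (z + ζ) - f z‖ₑ ^ 2 ∂ν ∂ν := setLIntegral_le_lintegral _ _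
          _ = ∫⁻ ζ in S, ∫⁻ z, ‖f (z + ζ) - f z‖ₑ ^ 2 ∂ν ∂ν := lintegral_lintegral_swap hm'
          _ ≤ ∫⁻ ζ in S, ε ∂ν := setLIntegral_mono measurable_const fun ζ hζ =>
              htr ζ (mem_ball_zero_iff.1 hζ)
          _ = ν S * ε := by rw [setLIntegral_const, mul_comm]

lemma ballSum_aesm {f : Z → E3} (hf : MemLp f 2 ν) (r : ℝ) :
    AEStronglyMeasurable (ballSum ν r f) ν :=
  (aesm_add hf.1 (Metric.ball 0 r)).integral_prod_right'

/-- **Kolmogorov's compactness criterion** in `L²` for functions supported in a fixed set of finite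
measure. -/
theorem exists_strong_subseq {W : ℕ → Z → E3} (hW : ∀ n, MemLp (W n) 2 ν) {C : ℝ≥0∞} (hC : C ≠ ⊤)
    (hb : ∀ n, eLpNorm (W n) 2 ν ≤ C) {B : Set Z} (hBm : MeasurableSet B) (hB : ν B ≠ ⊤)
    (hsupp : ∀ n, ∀ᵐ z ∂ν, z ∉ B → W n z = 0)
    (htr : ∀ ε : ℝ≥0∞, ε ≠ 0 → ∃ r > 0, ∀ n ζ, ‖ζ‖ < r →
      ∫⁻ z, ‖W n (z + ζ) - W n z‖ₑ ^ 2 ∂ν ≤ ε) :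
    ∃ s : ℕ → ℕ, StrictMono s ∧ ∃ U : Z → E3, MemLp U 2 ν ∧
      Tendsto (fun n => eLpNorm (W (s n) - U) 2 ν) atTop (𝓝 0) := by
  have hbd : ∀ n, ‖(hW n).toLp (W n)‖ ≤ C.toReal := fun n => by
    rw [Lp.norm_toLp]
    exact ENNReal.toReal_mono hC (hb n)
  have : Fact ((2 : ℝ≥0∞) ≠ ⊤) := ⟨by simp⟩
  obtain ⟨s, hs, Y, hY⟩ := exists_weak_subseq hbd
  have hlim : ∀ r z, Tendsto (fun n => ‖ballSum ν r (W (s n)) z - ballSum ν r Y z‖ₑ ^ 2)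
      atTop (𝓝 0) := by
    intro r z
    have hi : ∀ i, Tendsto (fun n => ‖(ballSum ν r (W (s n)) z - ballSum ν r Y z) i‖ₑ ^ 2)
        atTop (𝓝 0) := by
      intro i
      have h1 := hY (indicatorConstLp 2 (measurableSet_ball (x := z) (ε := r))
        measure_ball_lt_top.ne (basisVec i))
      have hv : ∀ v : E3, inner ℝ (basisVec i) v = v i := fun v => by
        rw [real_inner_comm, inner_basisVec]
      simp only [L2.inner_indicatorConstLp_eq_inner_setIntegral, hv] at h1
      have h2 : ∀ n, (∫ y in Metric.ball z r, (hW (s n)).toLp (W (s n)) y ∂ν) = ballSum ν r (W (s n)) z := by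
        intro n
        rw [ballSum_eq]
        exact integral_congr_ae (ae_restrict_of_ae (hW (s n)).coeFn_toLp)
      simp_rw [h2, ← ballSum_eq] at h1
      have h3 := (h1.sub_const (ballSum ν r Y z i)).enorm
      rw [sub_self, enorm_zero] at h3
      have h4 := ENNReal_tendsto_rpow_zero (p := 2) (by norm_num) h3
      simpa using h4
    simp_rw [enorm_sq_eq_sum]
    simpa using tendsto_finsetSum Finset.univ fun i _ => hi i
  have hcs : CauchySeq fun n => (hW (s n)).toLp (W (s n)) := by
    rw [EMetric.cauchySeq_iff]
    intro ε hε
    obtain ⟨ε', hε'0, hε'⟩ : ∃ ε' : ℝ≥0∞, ε' ≠ 0 ∧ 2 * (4 * ε' + ε') < ε ^ 2 := by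
      have h1 : Tendsto (fun a : ℝ≥0∞ => 10 * a) (𝓝[>] 0) (𝓝 0) :=
        ENNReal_tendsto_const_mul_zero (by simp) (tendsto_id.mono_left nhdsWithin_le_nhds)
      obtain ⟨a, ha, ha0⟩ := (((tendsto_order.1 h1).2 _ (ENNReal.pow_pos hε 2)).and
        self_mem_nhdsWithin).exists
      refine ⟨a, (mem_Ioi.1 ha0).ne', lt_of_eq_of_lt ?_ ha⟩
      ring
    obtain ⟨r, hr, htr'⟩ := htr ε' hε'0
    set V := ν (Metric.ball (0 : Z) r)
    have hV0 : V ≠ 0 := (Metric.measure_ball_pos ν 0 hr).ne'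
    have hV : V ≠ ⊤ := measure_ball_lt_top.ne
    have hVe : V ^ 2 * ε' / 4 ≠ 0 := (ENNReal.div_pos
      (mul_ne_zero (pow_ne_zero 2 hV0) hε'0) (by simp)).ne'
    have hdct : Tendsto (fun n => ∫⁻ z in B, ‖ballSum ν r (W (s n)) z - ballSum ν r Y z‖ₑ ^ 2 ∂ν)
        atTop (𝓝 (∫⁻ z in B, 0 ∂ν)) := by
      refine tendsto_lintegral_of_dominated_convergence'
        (fun _ => 2 * (V * C ^ 2 + V * eLpNorm Y 2 ν ^ 2))
        (fun n => ((ballSum_aesm (hW (s n)) r).sub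
          (ballSum_aesm (Lp.memLp Y) r)).restrict.enorm.pow_const 2)
        (fun n => Eventually.of_forall fun z => ?_) ?_
        (Eventually.of_forall fun z => hlim r z)
      · refine (enorm_sub_sq_le _ _).trans (mul_le_mul_right ?_ 2)
        refine add_le_add ?_ ?_
        · exact (ballSum_sq_le (hW (s n)) r z).trans (by gcongr; exact hb _)
        · exact ballSum_sq_le (Lp.memLp Y) r z
      · rw [setLIntegral_const]
        have := (Lp.memLp Y).2.ne
        finiteness
    rw [lintegral_zero] at hdct
    obtain ⟨N, hN⟩ := eventually_atTop.1 ((tendsto_order.1 hdct).2 _ (pos_iff_ne_zero.2 hVe))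
    refine ⟨N, fun m hm n hn => ?_⟩
    rw [Lp.edist_toLp_toLp]
    have hsub : MemLp (fun z => W (s m) z - W (s n) z) 2 ν := (hW (s m)).sub (hW (s n))
    have key := lintegral_sq_le_ballSum hsub r hBm (ε := 4 * ε')
      (by
        filter_upwards [hsupp (s m), hsupp (s n)] with z h1 h2 hz
        rw [h1 hz, h2 hz, sub_zero])
      (fun ζ hζ => by
        have hmeas : AEMeasurable (fun z => ‖W (s m) (z + ζ) - W (s m) z‖ₑ ^ 2) ν :=
          (((hW (s m)).1.comp_measurePreserving (measurePreserving_add_right ν ζ)).sub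
            (hW (s m)).1).enorm.pow_const 2
        calc ∫⁻ z, ‖W (s m) (z + ζ) - W (s n) (z + ζ) - (W (s m) z - W (s n) z)‖ₑ ^ 2 ∂ν
            ≤ ∫⁻ z, 2 * (‖W (s m) (z + ζ) - W (s m) z‖ₑ ^ 2
                + ‖W (s n) (z + ζ) - W (s n) z‖ₑ ^ 2) ∂ν := by
              refine lintegral_mono fun z => ?_
              rw [sub_sub_sub_comm]
              exact enorm_sub_sq_le _ _
          _ ≤ 2 * (ε' + ε') := by
              rw [lintegral_const_mul' _ _ (by simp), lintegral_add_left' hmeas]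
              gcongr
              · exact htr' _ ζ hζ
              · exact htr' _ ζ hζ
          _ = 4 * ε' := by ring)
    have hAB : ∫⁻ z in B, ‖ballSum ν r (fun z => W (s m) z - W (s n) z) z‖ₑ ^ 2 ∂ν
        ≤ V ^ 2 * ε' := by
      have hmeas : AEMeasurable (fun z => ‖ballSum ν r (W (s m)) z - ballSum ν r Y z‖ₑ ^ 2)
          (ν.restrict B) := ((ballSum_aesm (hW (s m)) r).sub
            (ballSum_aesm (Lp.memLp Y) r)).restrict.enorm.pow_const 2
      calc _ ≤ ∫⁻ z in B, 2 * (‖ballSum ν r (W (s m)) z - ballSum ν r Y z‖ₑ ^ 2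
                + ‖ballSum ν r (W (s n)) z - ballSum ν r Y z‖ₑ ^ 2) ∂ν := by
            refine lintegral_mono fun z => ?_
            rw [ballSum_sub (hW (s m)) (hW (s n)),
              ← sub_sub_sub_cancel_right _ _ (ballSum ν r Y z)]
            exact enorm_sub_sq_le _ _
        _ ≤ 2 * (V ^ 2 * ε' / 4 + V ^ 2 * ε' / 4) := by
            rw [lintegral_const_mul' _ _ (by simp), lintegral_add_left' hmeas]
            gcongr
            · exact (hN m hm).le
            · exact (hN n hn).le
        _ = V ^ 2 * ε' := by
            rw [← two_mul, ← mul_assoc, show (2 * 2 : ℝ≥0∞) = 4 by norm_num,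
              ENNReal.mul_div_cancel (by simp) (by simp)]
    have hfin : ∫⁻ z, ‖W (s m) z - W (s n) z‖ₑ ^ 2 ∂ν ≤ 2 * (4 * ε' + ε') := by
      refine (ENNReal.mul_le_mul_iff_right (pow_ne_zero 2 hV0) (ENNReal.pow_ne_top hV)).1
        (key.trans ?_)
      calc _ ≤ 2 * (V ^ 2 * (4 * ε') + V ^ 2 * ε') := by gcongr
        _ = _ := by ring
    refine (ENNReal.pow_lt_pow_left_iff two_ne_zero).1 ?_
    rw [eLpNorm_two_sq]
    exact hfin.trans_lt hε'
  obtain ⟨U, hU⟩ := cauchySeq_tendsto_of_complete hcs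
  refine ⟨s, hs, U, Lp.memLp U, ?_⟩
  have h1 := (tendsto_iff_edist_tendsto_0).1 hU
  refine h1.congr fun n => ?_
  rw [Lp.edist_def]
  exact eLpNorm_congr_ae ((hW (s n)).coeFn_toLp.sub (EventuallyEq.refl _ _))

end Kolmogorov

instance isAddHaarMeasure_volume_time_space :
    (volume : Measure (ℝ × E3)).IsAddHaarMeasure :=
  inferInstanceAs ((volume : Measure ℝ).prod (volume : Measure E3)).IsAddHaarMeasure

/-- The extension by zero to all times. -/
def zeroExt (T : ℝ) (w : ℝ → E3 → E3) : ℝ × E3 → E3 :=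
  (Ioo 0 T ×ˢ univ).indicator (Function.uncurry w)

lemma slab_eq_restrict (T : ℝ) : slab T = (volume : Measure (ℝ × E3)).restrict (Ioo 0 T ×ˢ univ) := by
  rw [slab, Measure.volume_eq_prod, ← Measure.prod_restrict, Measure.restrict_univ]

lemma zeroExt_of_mem {T : ℝ} {w : ℝ → E3 → E3} {t : ℝ} (ht : t ∈ Ioo 0 T) (x : E3) :
    zeroExt T w (t, x) = w t x :=
  indicator_of_mem (s := Ioo 0 T ×ˢ univ) (a := (t, x)) ⟨ht, mem_univ _⟩ _

lemma zeroExt_of_notMem {T : ℝ} {w : ℝ → E3 → E3} {t : ℝ} (ht : t ∉ Ioo 0 T) (x : E3) :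
    zeroExt T w (t, x) = 0 :=
  indicator_of_notMem (s := Ioo 0 T ×ˢ univ) (a := (t, x)) (fun h => ht h.1) _

lemma zeroExt_memLp {T : ℝ} {w : ℝ → E3 → E3} (hw : MemLp (Function.uncurry w) 2 (slab T)) :
    MemLp (zeroExt T w) 2 volume := by
  rw [slab_eq_restrict] at hw
  exact (memLp_indicator_iff_restrict (measurableSet_Ioo.prod MeasurableSet.univ)).2 hw

/-- The part of space outside the vacuum. -/
def bulk (ρ₀ : E3 → ℝ) : Set E3 := toMeasurable volume {x | ρ₀ x ≠ 0}

lemma measurableSet_bulk (ρ₀ : E3 → ℝ) : MeasurableSet (bulk ρ₀) := measurableSet_toMeasurable _ _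

lemma ae_mem_bulk {ρ₀ : E3 → ℝ} (h : AEMeasurable ρ₀) : ∀ᵐ x, x ∈ bulk ρ₀ ↔ ρ₀ x ≠ 0 := by
  have hn : NullMeasurableSet {x | ρ₀ x ≠ 0} :=
    h.nullMeasurableSet_preimage (measurableSet_singleton (0 : ℝ)).compl
  exact (hn.toMeasurable_ae_eq).mem_iff

namespace RegTransport

variable {T M : ℝ} {ρ₀ : E3 → ℝ} {ρ : ℝ → E3 → ℝ} {u : ℝ → E3 → E3}
  {G : Fin 3 → ℝ → E3 → E3} {D : ℝ → ℝ≥0∞}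

lemma volume_bulk (h : RegTransport T M ρ₀ ρ u G D) : volume (bulk ρ₀) ≠ ⊤ := by
  have h0 := h.support_finite h.inv (h.bdd.mono fun x hx => hx.1) (t := 0) ⟨le_rfl, h.pos.le⟩
  rw [h.lintegral_conserved (F := ({0}ᶜ : Set ℝ).indicator (1 : ℝ → ℝ≥0∞))
    (measurable_one.indicator (measurableSet_singleton 0).compl) (by simp)
    ⟨le_rfl, h.pos.le⟩] at h0
  rw [bulk, measure_toMeasurable]
  have hn : NullMeasurableSet {x | ρ₀ x ≠ 0} :=
    h.integrable_initial.1.aemeasurable.nullMeasurableSet_preimage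
      (measurableSet_singleton (0 : ℝ)).compl
  rw [← lintegral_indicator_one₀ hn]
  exact h0

lemma ae_vacuum (h : RegTransport T M ρ₀ ρ u G D) :
    ∀ᵐ z ∂(slab T), z.2 ∈ bulk ρ₀ ↔ ρ z.1 z.2 ≠ 0 := by
  classical
  have hf : AEStronglyMeasurable (fun z : ℝ × E3 => if ρ z.1 z.2 = 0 then (0 : ℝ) else 1) (slab T) :=
    (Measurable.comp_aemeasurable (g := fun r : ℝ => if r = 0 then (0 : ℝ) else 1)
      (Measurable.ite (measurableSet_singleton (0 : ℝ)) measurable_const measurable_const)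
      h.ρm.aemeasurable).aestronglyMeasurable
  have hg : AEStronglyMeasurable (fun z : ℝ × E3 => if z.2 ∈ bulk ρ₀ then (1 : ℝ) else 0) (slab T) :=
    (Measurable.ite (measurable_snd (measurableSet_bulk ρ₀)) measurable_const
      measurable_const).aestronglyMeasurable
  have hs : ∀ᵐ t ∂(volume.restrict (Ioo 0 T)), ∀ᵐ x, (if ρ t x = 0 then (0 : ℝ) else 1)
      = if x ∈ bulk ρ₀ then (1 : ℝ) else 0 := by
    filter_upwards [ae_restrict_mem measurableSet_Ioo] with t ht
    filter_upwards [h.vacuum (Ioo_subset_Icc_self ht),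
      ae_mem_bulk h.integrable_initial.1.aemeasurable] with x h1 h2
    by_cases hx : ρ₀ x = 0
    · rw [if_pos (h1.2 hx), if_neg (by simp [h2, hx])]
    · rw [if_neg (fun h3 => hx (h1.1 h3)), if_pos (h2.2 hx)]
  filter_upwards [slab_ae_le hf hg (hs.mono fun t ht => ht.mono fun x hx => hx.le),
    slab_ae_le hg hf (hs.mono fun t ht => ht.mono fun x hx => hx.ge)] with z h1 h2
  by_cases hz : ρ z.1 z.2 = 0
  · rw [if_pos hz] at h1 h2
    refine ⟨fun hb => ?_, fun hb => absurd hz hb⟩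
    rw [if_pos hb] at h2
    norm_num at h2
  · rw [if_neg hz] at h1 h2
    refine ⟨fun _ => hz, fun _ => ?_⟩
    by_contra hb
    rw [if_neg hb] at h1
    norm_num at h1

end RegTransport

namespace RegSol

variable {T M : ℝ} {E Dt : ℝ≥0∞} {μ : ℝ} {f : ℝ → E3 → E3} {ρ₀ : E3 → ℝ} {m₀ : E3 → E3}
  {ρ : ℝ → E3 → ℝ} {u : ℝ → E3 → E3} {G : Fin 3 → ℝ → E3 → E3} {D : ℝ → ℝ≥0∞}

lemma translate_space (h : RegSol T M E Dt μ f ρ₀ m₀ ρ u G D) (x : E3) :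
    ∫⁻ z, ‖zeroExt T (weightedVel ρ u) (z + (0, x)) - zeroExt T (weightedVel ρ u) z‖ₑ ^ 2
      ≤ 3 * ‖x‖ₑ ^ 2 * Dt := by
  set w := weightedVel ρ u
  have hw := zeroExt_memLp h.wmem
  have hm : AEMeasurable (fun z => ‖zeroExt T w (z + (0, x)) - zeroExt T w z‖ₑ ^ 2)
      (volume.prod volume) :=
    ((hw.1.comp_measurePreserving (measurePreserving_add_right volume (0, x))).sub
      hw.1).enorm.pow_const 2
  rw [Measure.volume_eq_prod, lintegral_prod _ hm]
  have hle : ∀ᵐ t : ℝ, ∫⁻ y, ‖zeroExt T w ((t, y) + (0, x)) - zeroExt T w (t, y)‖ₑ ^ 2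
      ≤ (Ioo 0 T).indicator (fun t => 3 * ‖x‖ₑ ^ 2 * D t) t := by
    have hgood : ∀ᵐ t : ℝ, t ∈ Ioo 0 T → AEStronglyMeasurable (w t) ∧
        ∀ i, DiffQuot (fun x => w t x i) (D t) := by
      rw [← ae_restrict_iff' measurableSet_Ioo]
      filter_upwards [h.wmem.1.prodMk_left, h.dq] with t h1 h2
      exact ⟨h1, h2⟩
    filter_upwards [hgood] with t ht
    simp only [Prod.mk_add_mk, add_zero]
    by_cases htT : t ∈ Ioo 0 T
    · rw [indicator_of_mem htT]
      simp only [zeroExt_of_mem htT]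
      obtain ⟨h1, h2⟩ := ht htT
      have hs : ∀ i ∈ (Finset.univ : Finset (Fin 3)),
          AEMeasurable fun y => ‖(w t (y + x) - w t y) i‖ₑ ^ 2 := fun i _ =>
        (aesm_apply ((h1.comp_measurePreserving (measurePreserving_add_right volume x)).sub h1)
          i).enorm.pow_const 2
      simp_rw [enorm_sq_eq_sum (_ - _)]
      rw [lintegral_finsetSum' _ hs]
      have hi : ∀ i, ∫⁻ y, ‖(w t (y + x) - w t y) i‖ₑ ^ 2 ≤ ‖x‖ₑ ^ 2 * D t := fun i => by
        simpa using h2 i (-x)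
      refine (Finset.sum_le_sum fun i _ => hi i).trans (le_of_eq ?_)
      simp [mul_assoc]
    · simp [zeroExt_of_notMem htT]
  refine (lintegral_mono_ae hle).trans ?_
  rw [lintegral_indicator measurableSet_Ioo, lintegral_const_mul _ h.Dm]
  gcongr
  exact h.Dle

lemma translate_time (h : RegSol T M E Dt μ f ρ₀ m₀ ρ u G D) {η : ℝ} (hη : 0 < η) :
    ∫⁻ z, ‖zeroExt T (weightedVel ρ u) (z + (η, 0)) - zeroExt T (weightedVel ρ u) z‖ₑ ^ 2
      ≤ (∫⁻ t in Ioo 0 (T - η), ∫⁻ x, ‖weightedVel ρ u (t + η) x - weightedVel ρ u t x‖ₑ ^ 2)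
        + 2 * (E * ENNReal.ofReal η) := by
  set w := weightedVel ρ u
  have hw := zeroExt_memLp h.wmem
  have hm : AEMeasurable (fun z => ‖zeroExt T w (z + (η, 0)) - zeroExt T w z‖ₑ ^ 2)
      (volume.prod volume) :=
    ((hw.1.comp_measurePreserving (measurePreserving_add_right volume (η, 0))).sub
      hw.1).enorm.pow_const 2
  rw [Measure.volume_eq_prod, lintegral_prod _ hm]
  have hv : ∀ᵐ t : ℝ, t ∈ Ioo 0 T → ∫⁻ x, ‖w t x‖ₑ ^ 2 ≤ E := by
    rw [← ae_restrict_iff' measurableSet_Ioo]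
    exact h.vel
  have hle : ∀ᵐ t : ℝ, ∫⁻ y, ‖zeroExt T w ((t, y) + (η, 0)) - zeroExt T w (t, y)‖ₑ ^ 2
      ≤ (Ioo 0 (T - η)).indicator (fun t => ∫⁻ x, ‖w (t + η) x - w t x‖ₑ ^ 2) t
        + ((Ioc (-η) 0).indicator (fun _ => E) t + (Ico (T - η) T).indicator (fun _ => E) t) := by
    filter_upwards [hv, (measurePreserving_add_right volume η).quasiMeasurePreserving.ae hv]
      with t h1 h2
    simp only [Prod.mk_add_mk, add_zero]
    rcases le_or_gt t 0 with ht | ht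
    · have hn : t ∉ Ioo 0 T := fun hh => absurd hh.1 (not_lt.2 ht)
      simp only [zeroExt_of_notMem hn, sub_zero]
      by_cases ht' : t + η ∈ Ioo 0 T
      · simp only [zeroExt_of_mem ht']
        refine le_trans (h2 ht') (le_trans ?_ le_add_self)
        rw [indicator_of_mem (show t ∈ Ioc (-η) 0 from ⟨by linarith [ht'.1], ht⟩)]
        exact le_self_add
      · simp [zeroExt_of_notMem ht']
    · rcases lt_or_ge t (T - η) with ht2 | ht2
      · have m1 : t ∈ Ioo 0 T := ⟨ht, by linarith⟩
        have m2 : t + η ∈ Ioo 0 T := ⟨by linarith, by linarith⟩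
        simp only [zeroExt_of_mem m1, zeroExt_of_mem m2]
        rw [indicator_of_mem (show t ∈ Ioo 0 (T - η) from ⟨ht, ht2⟩)]
        exact le_self_add
      · have hn : t + η ∉ Ioo 0 T := fun hh => by linarith [hh.2]
        simp only [zeroExt_of_notMem hn, zero_sub, enorm_neg]
        by_cases ht' : t ∈ Ioo 0 T
        · simp only [zeroExt_of_mem ht']
          refine le_trans (h1 ht') (le_trans ?_ le_add_self)
          rw [indicator_of_mem (show t ∈ Ico (T - η) T from ⟨ht2, ht'.2⟩)]
          exact le_add_self
        · simp [zeroExt_of_notMem ht']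
  refine (lintegral_mono_ae hle).trans ?_
  rw [lintegral_add_right _ (by measurability), lintegral_add_right _ (by measurability),
    lintegral_indicator measurableSet_Ioo, lintegral_indicator measurableSet_Ioc,
    lintegral_indicator measurableSet_Ico, setLIntegral_const, setLIntegral_const,
    Real.volume_Ioc, Real.volume_Ico]
  refine le_of_eq ?_
  rw [sub_neg_eq_add, zero_add, sub_sub_cancel, two_mul]

/-- Translations of the weighted velocity. -/
lemma translate_le (h : RegSol T M E Dt μ f ρ₀ m₀ ρ u G D) {ε : ℝ≥0∞} {η₀ : ℝ}
    (hinc : ∀ η, 0 < η → η < η₀ → ∫⁻ t in Ioo 0 (T - η), ∫⁻ x,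
      ‖weightedVel ρ u (t + η) x - weightedVel ρ u t x‖ₑ ^ 2 ≤ ε) {ζ : ℝ × E3} {r : ℝ}
    (hζ : ‖ζ‖ < r) (hr : r ≤ η₀) :
    ∫⁻ z, ‖zeroExt T (weightedVel ρ u) (z + ζ) - zeroExt T (weightedVel ρ u) z‖ₑ ^ 2
      ≤ 2 * (ε + 2 * (E * ENNReal.ofReal r) + 3 * ENNReal.ofReal r ^ 2 * Dt) := by
  set W := zeroExt T (weightedVel ρ u)
  have hw : MemLp W 2 volume := zeroExt_memLp h.wmem
  obtain ⟨η, x⟩ := ζ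
  have hη : |η| < r := by
    have := norm_fst_le (η, x)
    rw [Real.norm_eq_abs] at this
    exact this.trans_lt hζ
  have hx : ‖x‖ₑ ≤ ENNReal.ofReal r := by
    rw [← ofReal_norm]
    exact ENNReal.ofReal_le_ofReal ((norm_snd_le (η, x)).trans hζ.le)
  have hpos : ∀ η', 0 < η' → η' < r → ∫⁻ z, ‖W (z + (η', 0)) - W z‖ₑ ^ 2
      ≤ ε + 2 * (E * ENNReal.ofReal r) := fun η' h1 h2 => by
    refine (h.translate_time h1).trans ?_
    gcongr
    exact hinc η' h1 (h2.trans_le hr)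
  have htime : ∫⁻ z, ‖W (z + (η, 0)) - W z‖ₑ ^ 2 ≤ ε + 2 * (E * ENNReal.ofReal r) := by
    rcases lt_trichotomy η 0 with hn | hn | hn
    · rw [← lintegral_add_right_eq_self (fun z => ‖W (z + (η, 0)) - W z‖ₑ ^ 2) (-η, 0)]
      refine le_trans (le_of_eq ?_) (hpos (-η) (by linarith) (by rwa [abs_of_neg hn] at hη))
      refine lintegral_congr fun z => ?_
      rw [add_assoc, show ((-η, 0) : ℝ × E3) + (η, 0) = 0 by ext <;> simp, add_zero, ← enorm_neg,
        neg_sub]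
    · subst hn
      simp [← Prod.zero_eq_mk]
    · exact hpos η hn (by rwa [abs_of_pos hn] at hη)
  have hm : AEMeasurable (fun z => ‖W (z + (0, x)) - W z‖ₑ ^ 2) :=
    ((hw.1.comp_measurePreserving (measurePreserving_add_right volume (0, x))).sub
      hw.1).enorm.pow_const 2
  calc ∫⁻ z, ‖W (z + (η, x)) - W z‖ₑ ^ 2
      ≤ ∫⁻ z, 2 * (‖W (z + (0, x) + (η, 0)) - W (z + (0, x))‖ₑ ^ 2
          + ‖W (z + (0, x)) - W z‖ₑ ^ 2) := by
        refine lintegral_mono fun z => ?_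
        have e : W (z + (η, x)) - W z = (W (z + (0, x) + (η, 0)) - W (z + (0, x)))
            + (W (z + (0, x)) - W z) := by
          rw [sub_add_sub_cancel, add_assoc,
            show ((0, x) : ℝ × E3) + (η, 0) = (η, x) by ext <;> simp]
        rw [e]
        exact enorm_add_sq_le _ _
    _ ≤ 2 * ((ε + 2 * (E * ENNReal.ofReal r)) + 3 * ENNReal.ofReal r ^ 2 * Dt) := by
        rw [lintegral_const_mul' _ _ (by simp), lintegral_add_right' _ hm,
          lintegral_add_right_eq_self (fun z => ‖W (z + (η, 0)) - W z‖ₑ ^ 2)]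
        gcongr
        refine (h.translate_space x).trans ?_
        gcongr

/-- Strong convergence of a subsequence of the weighted velocities. -/
theorem exists_strong_limit {μ : ℕ → ℝ} {ρ : ℕ → ℝ → E3 → ℝ} {u : ℕ → ℝ → E3 → E3}
    {G : ℕ → Fin 3 → ℝ → E3 → E3} {D : ℕ → ℝ → ℝ≥0∞}
    (h : ∀ n, RegSol T M E Dt (μ n) f ρ₀ m₀ (ρ n) (u n) (G n) (D n)) (hE : E ≠ ⊤) (hDt : Dt ≠ ⊤)
    (hμ : ∀ n, 0 ≤ μ n) {b : ℝ} (hb : ∀ n, μ n ≤ b)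
    (hf : MemLp (Function.uncurry f) 2 (slab T)) :
    ∃ s : ℕ → ℕ, StrictMono s ∧ ∃ U : ℝ × E3 → E3, MemLp U 2 (slab T) ∧
      Tendsto (fun n => eLpNorm (Function.uncurry (weightedVel (ρ (s n)) (u (s n))) - U) 2 (slab T))
        atTop (𝓝 0) := by
  set W : ℕ → ℝ × E3 → E3 := fun n => zeroExt T (weightedVel (ρ n) (u n))
  have hset : MeasurableSet (Ioo 0 T ×ˢ (univ : Set E3)) := measurableSet_Ioo.prod MeasurableSet.univ
  suffices key : ∃ s : ℕ → ℕ, StrictMono s ∧ ∃ U : ℝ × E3 → E3, MemLp U 2 volume ∧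
      Tendsto (fun n => eLpNorm (W (s n) - U) 2 volume) atTop (𝓝 0) by
    obtain ⟨s, hs, U, hU, hlim⟩ := key
    refine ⟨s, hs, U, ?_, ?_⟩
    · rw [slab_eq_restrict]
      exact hU.restrict _
    · refine tendsto_of_tendsto_of_tendsto_of_le_of_le tendsto_const_nhds hlim (fun _ => zero_le)
        (fun n => ?_)
      rw [slab_eq_restrict]
      refine le_trans (le_of_eq (eLpNorm_congr_ae ?_)) (eLpNorm_restrict_le _ 2 volume
        (Ioo 0 T ×ˢ univ))
      filter_upwards [ae_restrict_mem hset] with z hz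
      simp only [Pi.sub_apply, W, zeroExt, indicator_of_mem hz]
  refine exists_strong_subseq (ν := (volume : Measure (ℝ × E3))) (W := W)
    (C := (E * ENNReal.ofReal T) ^ (1 / 2 : ℝ)) (B := Ioo 0 T ×ˢ bulk ρ₀)
    (fun n => zeroExt_memLp (h n).wmem)
    (ENNReal.rpow_ne_top_of_nonneg (by norm_num) (by finiteness)) (fun n => ?_)
    (measurableSet_Ioo.prod (measurableSet_bulk ρ₀)) ?_ (fun n => ?_) (fun ε hε => ?_)
  · refine (ENNReal.pow_le_pow_left_iff two_ne_zero).1 ?_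
    rw [half_pow_two]
    have e : eLpNorm (W n) 2 volume
        = eLpNorm (Function.uncurry (weightedVel (ρ n) (u n))) 2 (slab T) := by
      rw [slab_eq_restrict]
      exact eLpNorm_indicator_eq_eLpNorm_restrict hset
    rw [e, eLpNorm_two_sq, lintegral_slab ((h n).wmem.1.enorm.pow_const 2)]
    refine (lintegral_mono_ae (h n).vel).trans (le_of_eq ?_)
    rw [setLIntegral_const, Real.volume_Ioo, sub_zero]
  · rw [Measure.volume_eq_prod, Measure.prod_prod, Real.volume_Ioo]
    exact ENNReal.mul_ne_top ENNReal.ofReal_ne_top (h 0).volume_bulk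
  · have hv := (h n).ae_vacuum
    rw [slab_eq_restrict, ae_restrict_iff' hset] at hv
    filter_upwards [hv] with z h1 h2
    by_cases hz : z ∈ Ioo 0 T ×ˢ (univ : Set E3)
    · have h3 : ρ n z.1 z.2 = 0 := by
        by_contra h4
        exact h2 ⟨hz.1, (h1 hz).2 h4⟩
      simp only [W, zeroExt, indicator_of_mem hz, Function.uncurry, weightedVel, h3,
        Real.sqrt_zero, zero_smul]
    · simp only [W, zeroExt, indicator_of_notMem hz]
  · obtain ⟨η₀, hη₀, hinc⟩ := RegSol.uniform_increment h hE hDt hμ hb hf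
      (ε := ε / 4) (ENNReal.div_pos hε (by simp)).ne'
    have ht : Tendsto (fun r => 4 * E * ENNReal.ofReal r + 6 * Dt * ENNReal.ofReal r ^ (2 : ℝ))
        (𝓝[>] 0) (𝓝 0) := ENNReal_tendsto_add_zero
      (ENNReal_tendsto_const_mul_zero (by finiteness) tendsto_ofReal_zero)
      (ENNReal_tendsto_const_mul_zero (by finiteness)
        (ENNReal_tendsto_rpow_zero (by norm_num) tendsto_ofReal_zero))
    obtain ⟨r, hr1, hr2⟩ := (((tendsto_order.1 ht).2 (ε / 2) (ENNReal.half_pos hε)).and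
      (Ioo_mem_nhdsGT hη₀)).exists
    refine ⟨r, hr2.1, fun n ζ hζ => ((h n).translate_le (hinc n) hζ hr2.2.le).trans ?_⟩
    rw [ENNReal.rpow_two] at hr1
    calc 2 * (ε / 4 + 2 * (E * ENNReal.ofReal r) + 3 * ENNReal.ofReal r ^ 2 * Dt)
        = 2 * (ε / 4) + (4 * E * ENNReal.ofReal r + 6 * Dt * ENNReal.ofReal r ^ 2) := by ring
      _ ≤ ε / 2 + ε / 2 := by
          refine add_le_add (le_of_eq ?_) hr1.le
          rw [show (4 : ℝ≥0∞) = 2 * 2 by norm_num, ENNReal.div_eq_inv_mul, ENNReal.div_eq_inv_mul,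
            ENNReal.mul_inv (by simp) (by simp), ← mul_assoc, ← mul_assoc,
            ENNReal.mul_inv_cancel (by simp) (by simp), one_mul]
      _ = ε := ENNReal.add_halves ε

end RegSol

section WeakLimit

variable {α : Type*} [MeasurableSpace α] {ν : Measure α}

/-- Weak convergence in `L²` of bounded functions implies weak-* convergence in `L^∞`. -/
lemma tendsto_integral_of_weak {a : ℕ → α → ℝ} {Y : α → ℝ} {M : ℝ}
    (ham : ∀ n, AEStronglyMeasurable (a n) ν) (hY : AEStronglyMeasurable Y ν)
    (ha : ∀ n, ∀ᵐ z ∂ν, ‖a n z‖ ≤ M) (hYM : ∀ᵐ z ∂ν, ‖Y z‖ ≤ M)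
    (hw : ∀ g : α → ℝ, MemLp g 2 ν →
      Tendsto (fun n => ∫ z, a n z * g z ∂ν) atTop (𝓝 (∫ z, Y z * g z ∂ν)))
    {g : α → ℝ} (hg : Integrable g ν) :
    Tendsto (fun n => ∫ z, a n z * g z ∂ν) atTop (𝓝 (∫ z, Y z * g z ∂ν)) := by
  have hbound : ∀ {b h : α → ℝ}, AEStronglyMeasurable b ν → (∀ᵐ z ∂ν, ‖b z‖ ≤ M) →
      Integrable h ν → Integrable (fun z => b z * h z) ν ∧
      ‖∫ z, b z * h z ∂ν‖ ≤ M * ∫ z, ‖h z‖ ∂ν := by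
    intro b h hb hbM hh
    refine ⟨hh.bdd_mul hb hbM, ?_⟩
    rw [← integral_const_mul]
    refine norm_integral_le_of_norm_le (hh.norm.const_mul M) (hbM.mono fun z hz => ?_)
    rw [norm_mul]
    gcongr
  rw [Metric.tendsto_atTop]
  intro ε hε
  obtain ⟨δ, hδ, hδε⟩ : ∃ δ : ℝ, 0 < δ ∧ M * δ < ε / 3 := by
    refine ⟨ε / (3 * (|M| + 1)), by positivity, ?_⟩
    calc M * (ε / (3 * (|M| + 1))) ≤ |M| * (ε / (3 * (|M| + 1))) := by
          gcongr
          exact le_abs_self M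
      _ < (|M| + 1) * (ε / (3 * (|M| + 1))) := by
          gcongr
          linarith
      _ = ε / 3 := by
          have : |M| + 1 ≠ 0 := by positivity
          field_simp
  obtain ⟨k, hk1, hk2⟩ := (memLp_one_iff_integrable.2 hg).exists_simpleFunc_eLpNorm_sub_lt
    ENNReal.one_ne_top (ENNReal.ofReal_pos.2 hδ).ne'
  have hki : Integrable k ν := memLp_one_iff_integrable.1 hk2
  have hk3 : MemLp k 2 ν := (SimpleFunc.memLp_iff_integrable (by simp) (by simp)).2 hki
  have hsub : Integrable (fun z => g z - k z) ν := hg.sub hki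
  have hδ' : ∫ z, ‖g z - k z‖ ∂ν ≤ δ := by
    rw [integral_norm_eq_lintegral_enorm hsub.1]
    rw [eLpNorm_one_eq_lintegral_enorm] at hk1
    exact ENNReal.toReal_le_of_le_ofReal hδ.le hk1.le
  have hM0 : ∀ {b : α → ℝ}, AEStronglyMeasurable b ν → (∀ᵐ z ∂ν, ‖b z‖ ≤ M) →
      |(∫ z, b z * g z ∂ν) - ∫ z, b z * k z ∂ν| < ε / 3 := by
    intro b hb hbM
    rw [← integral_sub (hbound hb hbM hg).1 (hbound hb hbM hki).1]
    simp_rw [← mul_sub]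
    have h1 := (hbound hb hbM hsub).2
    rw [Real.norm_eq_abs] at h1
    refine h1.trans_lt ?_
    rcases le_total 0 M with h | h
    · exact (mul_le_mul_of_nonneg_left hδ' h).trans_lt hδε
    · exact (mul_nonpos_of_nonpos_of_nonneg h
        (integral_nonneg fun z => norm_nonneg _)).trans_lt (by positivity)
  obtain ⟨N, hN⟩ := Metric.tendsto_atTop.1 (hw k hk3) (ε / 3) (by positivity)
  refine ⟨N, fun n hn => ?_⟩
  have h1 := hM0 (ham n) (ha n)
  have h2 := hM0 hY hYM
  have h3 := hN n hn
  rw [Real.dist_eq] at h3 ⊢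
  rw [abs_lt] at h1 h2 h3 ⊢
  constructor <;> linarith [h1.1, h1.2, h2.1, h2.2, h3.1, h3.2]

/-- Nonnegative, uniformly bounded functions on a set of finite measure have weakly convergent
subsequences. -/
theorem exists_weak_limit [MeasurableSpace.CountablyGenerated α] [SigmaFinite ν] {a : ℕ → α → ℝ}
    {M : ℝ} {B : Set α} (hBm : MeasurableSet B) (hB : ν B ≠ ⊤)
    (ham : ∀ n, AEStronglyMeasurable (a n) ν) (hmem : ∀ n, ∀ᵐ z ∂ν, a n z ∈ Icc 0 M)
    (hsupp : ∀ n, ∀ᵐ z ∂ν, z ∉ B → a n z = 0) :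
    ∃ s : ℕ → ℕ, StrictMono s ∧ ∃ Y : α → ℝ, Measurable Y ∧ (∀ᵐ z ∂ν, Y z ∈ Icc 0 M) ∧
      (∀ᵐ z ∂ν, z ∉ B → Y z = 0) ∧ ∀ g : α → ℝ, Integrable g ν →
        Tendsto (fun n => ∫ z, a (s n) z * g z ∂ν) atTop (𝓝 (∫ z, Y z * g z ∂ν)) := by
  set H : α → ℝ := B.indicator fun _ => M
  have hH : MemLp H 2 ν := memLp_indicator_const 2 hBm M (Or.inr hB)
  have haH : ∀ n, ∀ᵐ z ∂ν, 0 ≤ a n z ∧ a n z ≤ H z := by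
    intro n
    filter_upwards [hmem n, hsupp n] with z h1 h2
    refine ⟨h1.1, ?_⟩
    by_cases hz : z ∈ B
    · simpa [H, hz] using h1.2
    · simp [H, hz, h2 hz]
  have haH' : ∀ n, ∀ᵐ z ∂ν, ‖a n z‖ ≤ H z := fun n => (haH n).mono fun z hz => by
    rw [Real.norm_eq_abs, abs_of_nonneg hz.1]
    exact hz.2
  have hL : ∀ n, MemLp (a n) 2 ν := fun n => hH.mono' (ham n) (haH' n)
  have : Fact ((2 : ℝ≥0∞) ≠ ⊤) := ⟨by simp⟩
  obtain ⟨s, hs, Y, hY⟩ := exists_weak_subseq (x := fun n => (hL n).toLp (a n))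
    (C := (eLpNorm H 2 ν).toReal) (fun n => by
      rw [Lp.norm_toLp]
      exact ENNReal.toReal_mono hH.2.ne (eLpNorm_mono_ae_real (haH' n)))
  have hweak : ∀ g : α → ℝ, MemLp g 2 ν →
      Tendsto (fun n => ∫ z, a (s n) z * g z ∂ν) atTop (𝓝 (∫ z, Y z * g z ∂ν)) := by
    intro g hg
    have h1 := hY (hg.toLp g)
    simp_rw [L2.inner_def] at h1
    have e1 : ∀ n, ∫ z, (inner ℝ (hg.toLp g z) ((hL (s n)).toLp (a (s n)) z) : ℝ) ∂ν
        = ∫ z, a (s n) z * g z ∂ν := fun n => by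
      refine integral_congr_ae ?_
      filter_upwards [hg.coeFn_toLp, (hL (s n)).coeFn_toLp] with z h2 h3
      simp [h2, h3]
    have e2 : ∫ z, (inner ℝ (hg.toLp g z) (Y z) : ℝ) ∂ν = ∫ z, Y z * g z ∂ν := by
      refine integral_congr_ae ?_
      filter_upwards [hg.coeFn_toLp] with z h2
      simp [h2]
    simpa only [e1, e2] using h1
  have hset : ∀ S, MeasurableSet S → ν S < ⊤ →
      Tendsto (fun n => ∫ z in S, a (s n) z ∂ν) atTop (𝓝 (∫ z in S, Y z ∂ν)) := by
    intro S hS hSf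
    have h1 := hweak (S.indicator fun _ => 1) (memLp_indicator_const 2 hS 1 (Or.inr hSf.ne))
    have e : ∀ b : α → ℝ, ∫ z, b z * S.indicator (fun _ => 1) z ∂ν = ∫ z in S, b z ∂ν := fun b => by
      rw [← integral_indicator hS]
      congr 1
      ext z
      by_cases hz : z ∈ S <;> simp [hz]
    simpa only [e] using h1
  have hint : ∀ {b : α → ℝ}, MemLp b 2 ν → ∀ S, ν S < ⊤ → IntegrableOn b S ν := by
    intro b hb S hSf
    have : Fact (ν S < ⊤) := ⟨hSf⟩
    exact (hb.restrict S).integrable (by norm_num)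
  have hY0 : 0 ≤ᵐ[ν] Y := ae_nonneg_of_forall_setIntegral_nonneg_of_sigmaFinite
    (fun S _ hSf => hint (Lp.memLp Y) S hSf) (fun S hS hSf => ge_of_tendsto' (hset S hS hSf)
      fun n => integral_nonneg_of_ae (ae_restrict_of_ae ((haH (s n)).mono fun z hz => hz.1)))
  have hYH : 0 ≤ᵐ[ν] fun z => H z - Y z := ae_nonneg_of_forall_setIntegral_nonneg_of_sigmaFinite
    (fun S _ hSf => (hint hH S hSf).sub (hint (Lp.memLp Y) S hSf)) (fun S hS hSf => by
      rw [integral_sub (hint hH S hSf) (hint (Lp.memLp Y) S hSf), sub_nonneg]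
      exact le_of_tendsto' (hset S hS hSf) fun n => integral_mono_ae (hint (hL (s n)) S hSf)
        (hint hH S hSf) (ae_restrict_of_ae ((haH (s n)).mono fun z hz => hz.2)))
  have hYM : ∀ᵐ z ∂ν, Y z ∈ Icc 0 M := by
    filter_upwards [hY0, hYH, hmem 0] with z h1 h2 h3
    have h2' : Y z ≤ H z := sub_nonneg.1 h2
    refine ⟨h1, h2'.trans ?_⟩
    by_cases hz : z ∈ B
    · simp [H, hz]
    · simpa [H, hz] using h3.1.trans h3.2
  refine ⟨s, hs, Y, (Lp.stronglyMeasurable Y).measurable, hYM, ?_, fun g hg => ?_⟩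
  · filter_upwards [hY0, hYH] with z h1 h2 hz
    have h2' : Y z ≤ H z := sub_nonneg.1 h2
    simp only [H, indicator_of_notMem hz] at h2'
    exact le_antisymm h2' h1
  · have hn : ∀ r : ℝ, r ∈ Icc 0 M → ‖r‖ ≤ M := fun r hr => by
      rw [Real.norm_eq_abs, abs_of_nonneg hr.1]
      exact hr.2
    exact tendsto_integral_of_weak (fun n => ham (s n)) (Lp.memLp Y).1
      (fun n => (hmem (s n)).mono fun z hz => hn _ hz) (hYM.mono fun z hz => hn _ hz) hweak hg

/-- A weak limit is positive where the reciprocals are positive and bounded in `L¹`. -/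
lemma measure_eq_zero_of_weak_limit {a : ℕ → α → ℝ} {N : Set α}
    (ham : ∀ n, AEStronglyMeasurable (a n) ν) (hpos : ∀ n, ∀ᵐ z ∂ν, z ∈ N → 0 < a n z)
    (hN : MeasurableSet N) (hint : ∀ n, IntegrableOn (a n) N ν)
    (hlim : Tendsto (fun n => ∫ z in N, a n z ∂ν) atTop (𝓝 0)) {C : ℝ≥0∞} (hC : C ≠ ⊤)
    (hinv : ∀ n, ∫⁻ z, ‖(Real.sqrt (a n z))⁻¹‖ₑ ^ 2 ∂ν ≤ C) : ν N = 0 := by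
  have hle : ∀ n, ν N ^ 2 ≤ C * ENNReal.ofReal (∫ z in N, a n z ∂ν) := by
    intro n
    have hp : ∀ᵐ z ∂(ν.restrict N), 0 < a n z := (ae_restrict_iff' hN).2 (hpos n)
    have hm : AEMeasurable (fun z => Real.sqrt (a n z)) (ν.restrict N) :=
      Real.continuous_sqrt.measurable.comp_aemeasurable (ham n).aemeasurable.restrict
    have h1 := lintegral_mul_sq_le (ν.restrict N) hm.inv.enorm hm.enorm
    have e1 : ∫⁻ z in N, ‖(Real.sqrt (a n z))⁻¹‖ₑ * ‖Real.sqrt (a n z)‖ₑ ∂ν = ν N := by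
      rw [← setLIntegral_one]
      refine lintegral_congr_ae (hp.mono fun z hz => ?_)
      simp only
      rw [← enorm_mul, inv_mul_cancel₀ (Real.sqrt_pos.2 hz).ne', enorm_one]
    have e2 : ∫⁻ z in N, ‖Real.sqrt (a n z)‖ₑ ^ 2 ∂ν = ENNReal.ofReal (∫ z in N, a n z ∂ν) := by
      rw [ofReal_integral_eq_lintegral_ofReal (hint n) (hp.mono fun z hz => hz.le)]
      refine lintegral_congr_ae (hp.mono fun z hz => ?_)
      simp only
      rw [Real.enorm_eq_ofReal (Real.sqrt_nonneg _), ← ENNReal.ofReal_pow (Real.sqrt_nonneg _),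
        Real.sq_sqrt hz.le]
    simp only [Pi.inv_apply] at h1
    rw [e1, e2] at h1
    refine h1.trans ?_
    gcongr
    exact (setLIntegral_le_lintegral _ _).trans (hinv n)
  have ht : Tendsto (fun n => C * ENNReal.ofReal (∫ z in N, a n z ∂ν)) atTop (𝓝 0) := by
    refine ENNReal_tendsto_const_mul_zero hC ?_
    simpa using ENNReal.tendsto_ofReal hlim
  have h0 : ν N ^ 2 ≤ 0 := ge_of_tendsto' ht hle
  exact pow_eq_zero_iff (two_ne_zero) |>.1 (le_antisymm h0 zero_le)

lemma ae_eq_zero_of_strong_limit {W : ℕ → α → E3} {U : α → E3} {B : Set α} (hB : MeasurableSet B)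
    (hU : AEStronglyMeasurable U ν) (hsupp : ∀ n, ∀ᵐ z ∂ν, z ∈ B → W n z = 0)
    (hlim : Tendsto (fun n => eLpNorm (W n - U) 2 ν) atTop (𝓝 0)) :
    ∀ᵐ z ∂ν, z ∈ B → U z = 0 := by
  have hle : ∀ n, eLpNorm U 2 (ν.restrict B) ≤ eLpNorm (W n - U) 2 ν := fun n => by
    refine le_trans (le_of_eq ?_) (eLpNorm_restrict_le _ 2 ν B)
    rw [← eLpNorm_neg U]
    refine eLpNorm_congr_ae ?_
    filter_upwards [(ae_restrict_iff' hB).2 (hsupp n)] with z hz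
    simp [hz]
  have h0 : eLpNorm U 2 (ν.restrict B) = 0 := le_antisymm (ge_of_tendsto' hlim hle) zero_le
  rw [eLpNorm_eq_zero_iff hU.restrict two_ne_zero] at h0
  exact (ae_restrict_iff' hB).1 h0

end WeakLimit

end

end InhomNS

theorem proposition3p6 (T : ℝ) (hT : 0 < T)
    (f : ℝ → InhomNS.E3 → InhomNS.E3)
    (hf : MemLp (Function.uncurry f) 2 (InhomNS.slab T))
    (ρ₀ : InhomNS.E3 → ℝ) (m₀ : InhomNS.E3 → InhomNS.E3)
    (h₀ : InhomNS.InitialData ρ₀ m₀)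
    (μ : ℕ → ℝ) (hμ : ∀ n, 0 < μ n) (hμ0 : Tendsto μ atTop (𝓝 0))
    (ρ : ℕ → ℝ → InhomNS.E3 → ℝ) (u : ℕ → ℝ → InhomNS.E3 → InhomNS.E3)
    (hsol : ∀ n, InhomNS.IsWeakSolution T (μ n) f ρ₀ m₀ (ρ n) (u n))
    (hK : InhomNS.RICKHw T fun n => InhomNS.weightedVel (ρ n) (u n)) :
    ∃ (s : ℕ → ℕ) (ρlim : ℝ → InhomNS.E3 → ℝ) (ulim : ℝ → InhomNS.E3 → InhomNS.E3),
      StrictMono s ∧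
      (∀ᵐ z ∂(InhomNS.slab T), 0 ≤ ρlim z.1 z.2) ∧
      InhomNS.WeakLpConv T (fun n => ρ (s n)) ρlim ∧
      MemLp (Function.uncurry (InhomNS.weightedVel ρlim ulim)) 2 (InhomNS.slab T) ∧
      Tendsto (fun n => eLpNorm
        (Function.uncurry (InhomNS.weightedVel (ρ (s n)) (u (s n)))
          - Function.uncurry (InhomNS.weightedVel ρlim ulim)) 2 (InhomNS.slab T))
        atTop (𝓝 0) := by
  obtain ⟨M, E, Dt, hE, hDt, hreg⟩ := InhomNS.exists_regSol hT hf h₀ hμ hsol hK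
  choose G D h using hreg
  obtain ⟨b, hb⟩ := hμ0.bddAbove_range
  obtain ⟨s₁, hs₁, U, hU, hUlim⟩ := InhomNS.RegSol.exists_strong_limit h hE hDt
    (fun n => (hμ n).le) (fun n => hb (mem_range_self n)) hf
  have hBm : MeasurableSet (Prod.snd ⁻¹' InhomNS.bulk ρ₀ : Set (ℝ × InhomNS.E3)) :=
    measurable_snd (InhomNS.measurableSet_bulk ρ₀)
  have hB : InhomNS.slab T (Prod.snd ⁻¹' InhomNS.bulk ρ₀) ≠ ⊤ := by
    rw [← univ_prod, InhomNS.slab, Measure.prod_prod, Measure.restrict_apply_univ,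
      Real.volume_Ioo]
    exact ENNReal.mul_ne_top ENNReal.ofReal_ne_top (h 0).volume_bulk
  have : SigmaFinite (InhomNS.slab T) := by
    unfold InhomNS.slab
    infer_instance
  have hvac := fun n => (h n).ae_vacuum
  obtain ⟨s₂, hs₂, Y, hYm, hYM, hYB, hYlim⟩ := InhomNS.exists_weak_limit (ν := InhomNS.slab T)
    (a := fun n => Function.uncurry (ρ (s₁ n))) hBm hB (fun n => (h (s₁ n)).ρm)
    (fun n => (h (s₁ n)).slab_mem) (fun n => (hvac (s₁ n)).mono fun z hz hzB => by
      by_contra h1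
      exact hzB (hz.2 h1))
  have hUlim' := hUlim.comp hs₂.tendsto_atTop
  have hU0 : ∀ᵐ z ∂(InhomNS.slab T), z ∈ (Prod.snd ⁻¹' InhomNS.bulk ρ₀)ᶜ → U z = 0 := by
    refine InhomNS.ae_eq_zero_of_strong_limit hBm.compl hU.1 (fun n => ?_) hUlim
    filter_upwards [hvac (s₁ n)] with z hz hzB
    have h1 : ρ (s₁ n) z.1 z.2 = 0 := by
      by_contra h2
      exact hzB (hz.2 h2)
    simp only [Function.uncurry, InhomNS.weightedVel, h1, Real.sqrt_zero, zero_smul]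
  have hN : InhomNS.slab T (Prod.snd ⁻¹' InhomNS.bulk ρ₀ ∩ {z | Y z ≤ 0}) = 0 := by
    set N : Set (ℝ × InhomNS.E3) := Prod.snd ⁻¹' InhomNS.bulk ρ₀ ∩ {z | Y z ≤ 0}
    have hNm : MeasurableSet N := hBm.inter (measurableSet_le hYm measurable_const)
    have hNt : InhomNS.slab T N ≠ ⊤ := ne_top_of_le_ne_top hB (measure_mono inter_subset_left)
    have hind : ∀ c : ℝ × InhomNS.E3 → ℝ, ∫ z, c z * N.indicator (fun _ => 1) z ∂(InhomNS.slab T)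
        = ∫ z in N, c z ∂(InhomNS.slab T) := fun c => by
      rw [← integral_indicator hNm]
      congr 1
      ext z
      by_cases hz : z ∈ N <;> simp [hz]
    have hlim := hYlim (N.indicator fun _ => 1)
      ((integrable_indicator_iff hNm).2 (integrableOn_const hNt))
    simp_rw [hind] at hlim
    have hz : ∫ z in N, Y z ∂(InhomNS.slab T) = 0 := by
      refine integral_eq_zero_of_ae ((ae_restrict_iff' hNm).2 (hYM.mono fun z h1 h2 => ?_))
      exact le_antisymm h2.2 h1.1
    rw [hz] at hlim
    refine InhomNS.measure_eq_zero_of_weak_limit (fun n => (h (s₁ (s₂ n))).ρm) (fun n => ?_) hNm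
      (fun n => ?_) hlim (ENNReal.mul_ne_top (h 0).inv (ENNReal.ofReal_ne_top (r := T)))
      (fun n => ?_)
    · filter_upwards [hvac (s₁ (s₂ n)), (h (s₁ (s₂ n))).slab_mem] with z h1 h2 h3
      exact lt_of_le_of_ne h2.1 (Ne.symm (h1.1 h3.1))
    · refine Measure.integrableOn_of_bounded (M := M) hNt (h (s₁ (s₂ n))).ρm
        (ae_restrict_of_ae ((h (s₁ (s₂ n))).slab_mem.mono fun z hz => ?_))
      rw [Real.norm_eq_abs]
      exact (abs_of_nonneg hz.1).trans_le hz.2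
    · have hn := h (s₁ (s₂ n))
      have hm : AEMeasurable (fun z => ‖(Real.sqrt (Function.uncurry (ρ (s₁ (s₂ n))) z))⁻¹‖ₑ ^ 2)
          (InhomNS.slab T) := (Real.continuous_sqrt.measurable.comp_aemeasurable
        hn.ρm.aemeasurable).inv.enorm.pow_const 2
      rw [InhomNS.lintegral_slab hm]
      refine le_trans (lintegral_mono_ae (g := fun _ => ∫⁻ x, ENNReal.ofReal (ρ₀ x)⁻¹) ?_) ?_
      · filter_upwards [ae_restrict_mem measurableSet_Ioo] with t ht
        have h1 := hn.lintegral_conserved (F := fun r => ‖(Real.sqrt r)⁻¹‖ₑ ^ 2)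
          (Real.continuous_sqrt.measurable.inv.enorm.pow_const 2) (by simp)
          (Ioo_subset_Icc_self ht)
        simp_rw [InhomNS.enorm_inv_sqrt_sq] at h1 ⊢
        exact h1.le
      · rw [setLIntegral_const, Real.volume_Ioo, sub_zero]
  have hYpos : ∀ᵐ z ∂(InhomNS.slab T), z.2 ∈ InhomNS.bulk ρ₀ → 0 < Y z := by
    filter_upwards [measure_eq_zero_iff_ae_notMem.1 hN] with z hz hzB
    by_contra h1
    exact hz ⟨hzB, not_lt.1 h1⟩
  set ρlim : ℝ → InhomNS.E3 → ℝ := fun t x => Y (t, x)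
  set ulim : ℝ → InhomNS.E3 → InhomNS.E3 := fun t x => (Real.sqrt (Y (t, x)))⁻¹ • U (t, x)
  have hw : Function.uncurry (InhomNS.weightedVel ρlim ulim) =ᵐ[InhomNS.slab T] U := by
    filter_upwards [hYpos, hU0] with z h1 h2
    by_cases hz : z.2 ∈ InhomNS.bulk ρ₀
    · have h3 : Real.sqrt (Y z) ≠ 0 := (Real.sqrt_pos.2 (h1 hz)).ne'
      exact smul_inv_smul₀ h3 (U z)
    · have h3 : U z = 0 := h2 hz
      simp only [Function.uncurry, InhomNS.weightedVel, ρlim, ulim, h3, smul_zero]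
  refine ⟨s₁ ∘ s₂, ρlim, ulim, hs₁.comp hs₂, hYM.mono fun z hz => hz.1, fun p q hpq => ⟨?_, ?_⟩,
    hU.ae_eq hw.symm, ?_⟩
  · refine (memLp_indicator_const (ENNReal.ofReal p) hBm M (Or.inr hB)).mono'
      hYm.aestronglyMeasurable ?_
    filter_upwards [hYM, hYB] with z h1 h2
    by_cases hz : z ∈ (Prod.snd ⁻¹' InhomNS.bulk ρ₀ : Set (ℝ × InhomNS.E3))
    · rw [indicator_of_mem hz, Real.norm_eq_abs]
      exact (abs_of_nonneg h1.1).trans_le h1.2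
    · rw [indicator_of_notMem hz]
      simp [Function.uncurry, ρlim, h2 hz]
  · intro g hg
    have hgB : Integrable ((Prod.snd ⁻¹' InhomNS.bulk ρ₀).indicator g) (InhomNS.slab T) := by
      rw [integrable_indicator_iff hBm]
      have : Fact (InhomNS.slab T (Prod.snd ⁻¹' InhomNS.bulk ρ₀) < ⊤) := ⟨hB.lt_top⟩
      exact (hg.restrict _).integrable (ENNReal.one_le_ofReal.2 hpq.symm.lt.le)
    have hc : ∀ {c : ℝ × InhomNS.E3 → ℝ},
        (∀ᵐ z ∂(InhomNS.slab T), z ∉ Prod.snd ⁻¹' InhomNS.bulk ρ₀ → c z = 0) →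
        ∫ z, c z * (Prod.snd ⁻¹' InhomNS.bulk ρ₀).indicator g z ∂(InhomNS.slab T)
          = ∫ z, c z * g z ∂(InhomNS.slab T) := fun {c} hc => by
      refine integral_congr_ae (hc.mono fun z hz => ?_)
      by_cases h1 : z ∈ (Prod.snd ⁻¹' InhomNS.bulk ρ₀ : Set (ℝ × InhomNS.E3))
      · simp only [indicator_of_mem h1]
      · simp only [hz h1, zero_mul]
    have h1 := hYlim _ hgB
    rw [hc hYB] at h1
    refine h1.congr fun n => ?_
    rw [hc]
    · rfl
    · filter_upwards [hvac (s₁ (s₂ n))] with z hz hzB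
      by_contra h2
      exact hzB (hz.2 h2)
  · refine hUlim'.congr fun n => ?_
    exact eLpNorm_congr_ae ((EventuallyEq.refl _ _).sub hw.symm)
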